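/- Let $S$ be a scheme. For a scheme $X$ let $\mathfrak{QCoh}(X)$ be the category of quasi-coherent $\mathcal O$-modules on the big fppf site $\mathrm{Sch}_X$; for $g\colon X'\to X$ the pullback $g^*$ is restriction along $\mathrm{Sch}_{X'}\to\mathrm{Sch}_X$. For a morphism $f\colon V\to U$ of $X$-schemes and $\mathcal M\in\mathfrak{QCoh}(X)$ write $\rho_f\colon\mathcal M(U)\otimes_{\mathcal O(U)}\mathcal O(V)\to\mathcal M(V)$, $m\otimes s\mapsto s\cdot m|_V$. All $\mathrm{can}$ are canonical isomorphisms of tensor products. **(1)** Let $h\colon T\to X$ be an affine morphism. For affine $U\in\mathrm{Sch}_X$ put $U_T=T\times_XU$. Suppose given functors $\mathcal F_U\colon\mathrm{Mod}_{\mathcal O(U_T)}\to\mathrm{Mod}_{\mathcal O(U)}$ for all affine $U\in \mathrm{Sch}_X$ and isomorphisms of functors $\theta_f\colon\mathcal F_U(-)\otimes_{\mathcal O(U)}\mathcal O(V)\to\mathcal F_V(-\otimes_{\mathcal O(U_T)}\mathcal O(V_T))$ for all morphisms $f\colon V\to U$ of affine $X$-schemes, such that $\mathcal F_U(\mathrm{can})\circ\theta_{\mathrm{Id}_U}=\mathrm{can}$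 for all $U$, and $\theta_{f\circ g}\circ\mathrm{can}=\mathcal F_{V'}(\mathrm{can})\circ\theta_g\circ(\theta_f\otimes\mathrm{Id})$ for all $g\colon V'\to V$, $f\colon V\to U$. Then there is a functor $\mathcal F_{T/X}\colon\mathfrak{QCoh}(T)\to\mathfrak{QCoh}(X)$ with identifications $\mathcal F_{T/X}(\mathcal M)(U)=\mathcal F_U(\mathcal M(U_T))$, natural in $\mathcal M$, for all affine $U\in \mathrm{Sch}_X$, under which the restriction map along $f\colon V\to U$ is the composite of $\mathrm{Id}\otimes1$, $\theta_f(\mathcal M(U_T))$ and $\mathcal F_V(\rho_{f'})$, where $f'\colon V_T\to U_T$ is the base change of $f$. **(2)** Let $\mathfrak{QCoh}\to\mathrm{Sch}_S$ have objects $(X,\mathcal M)$ with $\mathcal M\in\mathfrak{QCoh}(X)$, morphisms $(g,\varphi)\colon(X',\mathcal M')\to(X,\mathcal M)$ with $\varphi\colon\mathcal M'\to g^*\mathcal M$ linear, and composition $(g,\varphi)\circ(h,\psi)=(g\circ h,h^*(\varphi)\circ\psi)$. Let $\mathfrak{AffMor}\to\mathrm{Sch}_S$ have as objects the affine morphisms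 $T'\to T$ with $T\in\mathrm{Sch}_S$ and as morphisms the fibre product squares; the structure functor is $(T'\to T)\mapsto T$. For a substack $\mathfrak I\subseteq\mathfrak{AffMor}$ (a subcategory, not necessarily full, whose structure functor to $\mathrm{Sch}_S$ is an fppf stack), let $\mathfrak{QCoh}_{\mathfrak I}\to\mathrm{Sch}_S$ have objects $(h\colon T'\to T,\mathcal M)$ with $h\in\mathfrak I$ and $\mathcal M\in\mathfrak{QCoh}(T')$, and morphisms $(f,g,\varphi)\colon(h',\mathcal N)\to(h,\mathcal M)$ with $(f,g)\colon h'\to h$ a morphism of $\mathfrak I$ and $\varphi\colon\mathcal N\to g^*\mathcal M$ an isomorphism. Then $\mathfrak{QCoh}$ and $\mathfrak{QCoh}_{\mathfrak I}$ are fppf stacks over $\mathrm{Sch}_S$. **(3)** Let $\mathfrak I$ be such a substack. Suppose given, for every $h\colon U'\to U$ in $\mathfrak I$ with $U$ (hence $U'$) affine, a functor $\mathcal F_h\colon\mathrm{Mod}_{\mathcal O(U')}\to\mathrm{Mod}_{\mathcal O(U)}$, and, for every fibre product square $D$ from $h'\colon V'\to V$ to $h\colon U'\to U$ between such objects (the square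 need not be a morphism of $\mathfrak I$), an isomorphism of functors $\theta_D\colon\mathcal F_h(-)\otimes_{\mathcal O(U)}\mathcal O(V)\to\mathcal F_{h'}(-\otimes_{\mathcal O(U')}\mathcal O(V'))$, satisfying $\mathcal F_h(\mathrm{can})\circ\theta_D=\mathrm{can}$ for identity squares $D$ of $h$, and $\theta_{D_{f\circ g}}\circ\mathrm{can}=\mathcal F_{h''}(\mathrm{can})\circ\theta_{D_g}\circ(\theta_{D_f}\otimes\mathrm{Id})$ for composable squares. Then: (a) For every $h\colon T'\to T$ in $\mathfrak I$ there is a functor $\mathcal F_{T'/T}\colon\mathfrak{QCoh}(T')\to\mathfrak{QCoh}(T)$ with identifications, natural in $\mathcal M$, $\mathcal F_{T'/T}(\mathcal M)(U)=\mathcal F_k(\mathcal M(U'))$ for every fibre product square from an object $k\colon U'\to U$ of $\mathfrak I$ with $U$ affine to $h$, whose restriction maps are given, as in (1), by $\mathcal F_{k'}(\rho)\circ\theta_{n}\circ(\mathrm{Id}\otimes1)$ for squares $n\colon k'\to k$. (b) For every fibre product square $D=(f,g)$ from $h'\colon X'\to X$ to $h\colon T'\to T$ with $h,h'\in\mathfrak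 I$ there is an isomorphism of functors $\phi_D\colon\mathcal F_{X'/X}\circ g^*\to f^*\circ\mathcal F_{T'/T}$ which, for every fibre product square from an object $k\colon U'\to U$ of $\mathfrak I$ with $U$ affine to $h'$ (and hence, by composition with $D$, to $h$), is over $U$ the identification of both sides with $\mathcal F_k(\mathcal M(U'))$ from (a). (c) $(h\colon T'\to T,\mathcal M)\mapsto(T,\mathcal F_{T'/T}(\mathcal M))$ and $(f,g,\varphi)\mapsto(f,\phi_D(\mathcal M)\circ\mathcal F_{X'/X}(\varphi))$ define a functor $\mathfrak F\colon\mathfrak{QCoh}_{\mathfrak I}\to\mathfrak{QCoh}$ over $\mathrm{Sch}_S$ sending every morphism to a cartesian morphism. In particular $\mathfrak F$ is a morphism of fppf stacks. **(4)** Let $d\ge0$ be an integer and let $\mathfrak I$ be the full subcategory of $\mathfrak{AffMor}$ on the finite locally free morphisms of constant rank $d$. Then $\mathfrak I$ is an fppf stack. For $h\colon U'\to U$ in $\mathfrak I$ with $U$ affine let $\mathcal F_h=N_{\mathcal O(U')/\mathcal O(U)}$ be Ferrand's norm functor $M'\mapsto\Gamma^d_R(M')\otimes_{\Gamma^d_R(R')}R$,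 where $R=\mathcal O(U)$, $R'=\mathcal O(U')$, $\Gamma^d$ is the degree-$d$ part of the divided power algebra, and $\Gamma^d_R(R')\to R$ is the $R$-algebra homomorphism which, after every base change, sends $\gamma^d(r')$ to the norm of $r'$. Then there are isomorphisms $\theta_D$ given on generators by $$\gamma^{a_1}(m_1)\cdots\gamma^{a_k}(m_k)\otimes s\mapsto s\cdot\gamma^{a_1}(m_1\otimes1)\cdots\gamma^{a_k}(m_k\otimes1)\qquad\Bigl(\sum a_i=d\Bigr),$$ they satisfy the two compatibilities of (3), and (3) gives functors $N_{T'/T}\colon\mathfrak{QCoh}(T')\to\mathfrak{QCoh}(T)$ for all $T'\to T$ in $\mathfrak I$ and the norm morphism of stacks $N\colon\mathfrak{QCoh}^d_{\mathrm{flf}}=\mathfrak{QCoh}_{\mathfrak I}\to\mathfrak{QCoh}$. -/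

import Mathlib

open CategoryTheory Opposite Limits AlgebraicGeometry
open scoped ChangeOfRings TensorProduct

universe u v

namespace NormStack

noncomputable section

/-- The structure sheaf `O` on the category of all `X`-schemes. -/
abbrev structureSheaf (X : Scheme.{u}) : (Over X)ᵒᵖ ⥤ RingCat.{u} :=
  (Over.forget X).op ⋙ Scheme.Γ ⋙ forget₂ CommRingCat RingCat

/-- Presheaves of `O`-modules on the category of all `X`-schemes. -/
abbrev PreMod (X : Scheme.{u}) := PresheafOfModules.{u} (structureSheaf X)

/-- The big fppf topology on the category of `X`-schemes. -/
abbrev fppf (X : Scheme.{u}) : GrothendieckTopology (Over X) := Scheme.fppfTopology.{u}.over X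

/-- Restriction of finitely supported families of functions along `f : Z ⟶ Y`. -/
def resFin {X : Scheme.{u}} {K : Type u} {Y Z : Over X} (f : Z ⟶ Y)
    (a : K →₀ (structureSheaf X).obj (op Y)) : K →₀ (structureSheaf X).obj (op Z) :=
  a.mapRange ((structureSheaf X).map f.op).hom (map_zero _)

/-- Over the `X`-scheme `Z` there is an exact sequence of sheaves of modules
`⨁_J O|_Z → ⨁_K O|_Z → M|_Z → 0`, spelled out on sections: the second map is given by sections
`e k` of `M` over `Z`, the first by finitely supported families `r j` over `Z`; the composite is
zero, the `e k` generate `M|_Z` locally, and every relation between them is locally an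
`O`-linear combination of the `r j`. -/
def HasPresentationOver {X : Scheme.{u}} (M : PreMod X) (Z : Over X) : Prop :=
  ∃ (K J : Type u) (e : K → M.obj (op Z)) (r : J → K →₀ (structureSheaf X).obj (op Z)),
    (∀ j, ((r j).sum fun k a => a • e k) = 0) ∧
    (∀ (T : Over X) (t : T ⟶ Z) (m : M.obj (op T)), ∃ R ∈ fppf X T,
      ∀ (T' : Over X) (t' : T' ⟶ T), R t' →
        M.map t'.op m ∈ Submodule.span ((structureSheaf X).obj (op T'))
          (Set.range fun k => (M.map (t' ≫ t).op (e k) : M.obj (op T')))) ∧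
    (∀ (T : Over X) (t : T ⟶ Z) (a : K →₀ (structureSheaf X).obj (op T)),
      (a.sum fun k b => b • (M.map t.op (e k) : M.obj (op T))) = 0 → ∃ R ∈ fppf X T,
      ∀ (T' : Over X) (t' : T' ⟶ T), R t' →
        resFin t' a ∈
          Submodule.span ((structureSheaf X).obj (op T'))
            (Set.range fun j => resFin (t' ≫ t) (r j)))

/-- Quasi-coherent `O`-modules on the big fppf site of `X`: sheaves of `O`-modules which have a
presentation locally on every `X`-scheme. (Since over an affine, hence quasi-compact, scheme a
section of a direct sum of copies of `O` has finite support, it is harmless to demand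
finitely supported relations, after refining the cover.) -/
def IsQCoh {X : Scheme.{u}} : ObjectProperty (PreMod X) := fun M =>
  Presheaf.IsSheaf (fppf X) M.presheaf ∧
    ∀ Y : Over X, ∃ R ∈ fppf X Y, ∀ (Z : Over X) (z : Z ⟶ Y), R z → HasPresentationOver M Z

/-- The category of quasi-coherent `O`-modules on `X`. -/
abbrev QCoh (X : Scheme.{u}) := (IsQCoh (X := X)).FullSubcategory

/-- Restriction of presheaves of modules along `g : X' ⟶ X`: `(g^* M)(Y → X') = M(Y → X' → X)`. -/
def restrictPre {X' X : Scheme.{u}} (g : X' ⟶ X) : PreMod X ⥤ PreMod X' :=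
  PresheafOfModules.pushforward₀ (Over.map g) (structureSheaf X)

theorem hasPresentationOver_restrictPre {X' X : Scheme.{u}} (g : X' ⟶ X) (M : PreMod X)
    (Z : Over X') (h : HasPresentationOver M ((Over.map g).obj Z)) :
    HasPresentationOver ((restrictPre g).obj M) Z := by
  obtain ⟨K, J, e, r, h1, h2, h3⟩ := h
  refine ⟨K, J, e, r, h1, ?_, ?_⟩
  · intro T t m
    obtain ⟨Q, hQ, q⟩ := h2 ((Over.map g).obj T) ((Over.map g).map t) m
    refine ⟨Q.functorPullback (Over.map g), Functor.cover_lift _ (fppf X') (fppf X) hQ, ?_⟩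
    intro T' t' ht'
    have := q ((Over.map g).obj T') ((Over.map g).map t') ht'
    rw [← Functor.map_comp] at this
    exact this
  · intro T t a ha
    obtain ⟨Q, hQ, q⟩ := h3 ((Over.map g).obj T) ((Over.map g).map t) a ha
    refine ⟨Q.functorPullback (Over.map g), Functor.cover_lift _ (fppf X') (fppf X) hQ, ?_⟩
    intro T' t' ht'
    have := q ((Over.map g).obj T') ((Over.map g).map t') ht'
    rw [← Functor.map_comp] at this
    exact this

theorem isQCoh_restrictPre {X' X : Scheme.{u}} (g : X' ⟶ X) (M : PreMod X) (hM : IsQCoh M) :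
    IsQCoh ((restrictPre g).obj M) := by
  refine ⟨?_, fun Y => ?_⟩
  · exact Functor.op_comp_isSheaf (Over.map g) (fppf X') (fppf X) ⟨_, hM.1⟩
  · obtain ⟨R, hR, h⟩ := hM.2 ((Over.map g).obj Y)
    refine ⟨R.functorPullback (Over.map g), Functor.cover_lift _ (fppf X') (fppf X) hR, ?_⟩
    intro Z z hz
    exact hasPresentationOver_restrictPre g M Z (h _ _ hz)

/-- The pullback functor `g^*` on quasi-coherent modules. On the big site it is restriction. -/
def pull {X' X : Scheme.{u}} (g : X' ⟶ X) : QCoh X ⥤ QCoh X' :=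
  IsQCoh.lift (IsQCoh.ι ⋙ restrictPre g) fun M => isQCoh_restrictPre g M.obj M.property

/-- Restriction along the identity, on the level of functions. -/
theorem gamma_map_id (Y : Scheme.{u}) (r : Γ(Y, ⊤)) : (Scheme.Γ.map (𝟙 Y).op).hom r = r :=
  RingHom.congr_fun (congrArg CommRingCat.Hom.hom (Scheme.Γ.map_id (op Y))) r

theorem smul_congr_left {R : RingCat.{u}} (N : ModuleCat.{u} R) {r s : R} (h : r = s) (m : N) :
    r • m = s • m := by rw [h]

/-- The identification of `M` with `id^* M`. -/
def pullIdPre {X : Scheme.{u}} (M : PreMod X) : M ≅ (restrictPre (𝟙 X)).obj M where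
  hom := PresheafOfModules.homMk
    (Functor.whiskerRight (NatTrans.op (Over.mapId X).hom) M.presheaf)
    (fun Y r m => (M.map_smul ((Over.mapId X).hom.app Y.unop).op r m).trans
      (smul_congr_left (((restrictPre (𝟙 X)).obj M).obj Y) (gamma_map_id Y.unop.left r) _))
  inv := PresheafOfModules.homMk
    (Functor.whiskerRight (NatTrans.op (Over.mapId X).inv) M.presheaf)
    (fun Y r m => (M.map_smul ((Over.mapId X).inv.app Y.unop).op r m).trans
      (smul_congr_left (M.obj Y) (gamma_map_id Y.unop.left r) _))
  hom_inv_id := by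
    apply (PresheafOfModules.toPresheaf _).map_injective
    change Functor.whiskerRight (NatTrans.op (Over.mapId X).hom) M.presheaf ≫
      Functor.whiskerRight (NatTrans.op (Over.mapId X).inv) M.presheaf = 𝟙 _
    rw [← Functor.whiskerRight_comp, ← NatTrans.op_comp, Iso.inv_hom_id]
    exact Functor.whiskerRight_id' _
  inv_hom_id := by
    apply (PresheafOfModules.toPresheaf _).map_injective
    change Functor.whiskerRight (NatTrans.op (Over.mapId X).inv) M.presheaf ≫
      Functor.whiskerRight (NatTrans.op (Over.mapId X).hom) M.presheaf = 𝟙 _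
    rw [← Functor.whiskerRight_comp, ← NatTrans.op_comp, Iso.hom_inv_id]
    exact Functor.whiskerRight_id' _

/-- The identification of `f^* (g^* M)` with `(g ∘ f)^* M`. -/
def pullCompPre {X'' X' X : Scheme.{u}} (f : X'' ⟶ X') (g : X' ⟶ X) (M : PreMod X) :
    (restrictPre f).obj ((restrictPre g).obj M) ≅ (restrictPre (f ≫ g)).obj M where
  hom := PresheafOfModules.homMk
    (Functor.whiskerRight (NatTrans.op (Over.mapComp f g).hom) M.presheaf)
    (fun Y r m => (M.map_smul ((Over.mapComp f g).hom.app Y.unop).op r m).trans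
      (smul_congr_left (((restrictPre (f ≫ g)).obj M).obj Y) (gamma_map_id Y.unop.left r) _))
  inv := PresheafOfModules.homMk
    (Functor.whiskerRight (NatTrans.op (Over.mapComp f g).inv) M.presheaf)
    (fun Y r m => (M.map_smul ((Over.mapComp f g).inv.app Y.unop).op r m).trans
      (smul_congr_left (((restrictPre f).obj ((restrictPre g).obj M)).obj Y) (gamma_map_id Y.unop.left r) _))
  hom_inv_id := by
    apply (PresheafOfModules.toPresheaf _).map_injective
    change Functor.whiskerRight (NatTrans.op (Over.mapComp f g).hom) M.presheaf ≫
      Functor.whiskerRight (NatTrans.op (Over.mapComp f g).inv) M.presheaf = 𝟙 _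
    rw [← Functor.whiskerRight_comp, ← NatTrans.op_comp, Iso.inv_hom_id]
    exact Functor.whiskerRight_id' _
  inv_hom_id := by
    apply (PresheafOfModules.toPresheaf _).map_injective
    change Functor.whiskerRight (NatTrans.op (Over.mapComp f g).inv) M.presheaf ≫
      Functor.whiskerRight (NatTrans.op (Over.mapComp f g).hom) M.presheaf = 𝟙 _
    rw [← Functor.whiskerRight_comp, ← NatTrans.op_comp, Iso.hom_inv_id]
    exact Functor.whiskerRight_id' _

/-- The natural isomorphism between `id^*` and the identity. -/
def pullId (X : Scheme.{u}) : 𝟭 (QCoh X) ≅ pull (𝟙 X) :=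
  NatIso.ofComponents (fun M => IsQCoh.isoMk (pullIdPre M.obj)) (by
    intro M N φ
    apply IsQCoh.hom_ext
    apply (PresheafOfModules.toPresheaf _).map_injective
    ext Y x
    exact (PresheafOfModules.naturality_apply φ.hom ((Over.mapId X).hom.app Y.unop).op x).symm)

/-- The natural isomorphism between `f^* g^*` and `(g ∘ f)^*`. -/
def pullComp {X'' X' X : Scheme.{u}} (f : X'' ⟶ X') (g : X' ⟶ X) :
    pull g ⋙ pull f ≅ pull (f ≫ g) :=
  NatIso.ofComponents (fun M => IsQCoh.isoMk (pullCompPre f g M.obj)) (by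
    intro M N φ
    apply IsQCoh.hom_ext
    apply (PresheafOfModules.toPresheaf _).map_injective
    ext Y x
    exact (PresheafOfModules.naturality_apply φ.hom ((Over.mapComp f g).hom.app Y.unop).op x).symm)

/-- The identification of sections of `g^* M` and `g'^* M` for equal `g`, `g'`. -/
def congrOver {X' X : Scheme.{u}} {g g' : X' ⟶ X} (h : g = g') (T : Over X') :
    (Over.map g').obj T ⟶ (Over.map g).obj T :=
  Over.homMk (𝟙 T.left) (by subst h; simp)

/-- Restriction of sections, as a plain function. -/
@[irreducible] def res {X : Scheme.{u}} (M : QCoh X) {A B : Over X} (i : B ⟶ A) (x : M.obj.obj (op A)) :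
    M.obj.obj (op B) := M.obj.map i.op x

theorem res_res {X : Scheme.{u}} (M : QCoh X) {A B C : Over X} (f : B ⟶ A) (g : C ⟶ B)
    (x : M.obj.obj (op A)) : res M g (res M f x) = res M (g ≫ f) x := by
  unfold res
  exact (PresheafOfModules.map_comp_apply M.obj f.op g.op x).symm

theorem res_id {X : Scheme.{u}} (M : QCoh X) {A : Over X} (f : A ⟶ A) (h : f = 𝟙 A)
    (x : M.obj.obj (op A)) : res M f x = x := by
  subst h
  unfold res
  exact ConcreteCategory.congr_hom (M.obj.presheaf.map_id _) _

/-- A map `M ⟶ g^* N` on sections, as a plain function. -/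
@[irreducible] def fn {X' X : Scheme.{u}} {g : X' ⟶ X} {M : QCoh X'} {N : QCoh X} (φ : M ⟶ (pull g).obj N)
    (T : Over X') (x : M.obj.obj (op T)) : N.obj.obj (op ((Over.map g).obj T)) :=
  φ.hom.app (op T) x

theorem fn_res {X' X : Scheme.{u}} {g : X' ⟶ X} {M : QCoh X'} {N : QCoh X}
    (φ : M ⟶ (pull g).obj N) {A B : Over X'} (i : B ⟶ A) (x : M.obj.obj (op A)) :
    fn φ B (res M i x) = res N ((Over.map g).map i) (fn φ A x) := by
  unfold fn res
  exact PresheafOfModules.naturality_apply φ.hom i.op x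

theorem heq_of_fn {X' X : Scheme.{u}} {M : QCoh X'} {N : QCoh X} {g g' : X' ⟶ X} (h : g = g')
    (φ : M ⟶ (pull g).obj N) (ψ : M ⟶ (pull g').obj N)
    (e : ∀ (T : Over X') (x : M.obj.obj (op T)),
      res N (congrOver h T) (fn φ T x) = fn ψ T x) : HEq φ ψ := by
  subst h
  apply heq_of_eq
  apply IsQCoh.hom_ext
  apply (PresheafOfModules.toPresheaf _).map_injective
  ext T x
  have e := e T.unop x
  unfold fn at e
  refine Eq.trans ?_ e
  exact (res_id N (congrOver (rfl : g = g) T.unop) (by ext; rfl) _).symm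

/-- The canonical map `M ⟶ id^* M`. -/
def idMap {X : Scheme.{u}} (M : QCoh X) : M ⟶ (pull (𝟙 X)).obj M := (pullId X).hom.app M

/-- The composite `h^*(φ) ∘ ψ : L ⟶ (g ∘ h)^* N` of `ψ : L ⟶ h^* M` and `φ : M ⟶ g^* N`. -/
def compMap {X'' X' X : Scheme.{u}} {h : X'' ⟶ X'} {g : X' ⟶ X} {L : QCoh X''} {M : QCoh X'}
    {N : QCoh X} (ψ : L ⟶ (pull h).obj M) (φ : M ⟶ (pull g).obj N) : L ⟶ (pull (h ≫ g)).obj N :=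
  ψ ≫ (pull h).map φ ≫ (pullComp h g).hom.app N

theorem fn_idMap {X : Scheme.{u}} (M : QCoh X) (T : Over X) (x : M.obj.obj (op T)) :
    fn (idMap M) T x = res M ((Over.mapId X).hom.app T) x := by
  unfold fn res
  rfl

theorem fn_compMap {X'' X' X : Scheme.{u}} {h : X'' ⟶ X'} {g : X' ⟶ X} {L : QCoh X''}
    {M : QCoh X'} {N : QCoh X} (ψ : L ⟶ (pull h).obj M) (φ : M ⟶ (pull g).obj N)
    (T : Over X'') (x : L.obj.obj (op T)) :
    fn (compMap ψ φ) T x = res N ((Over.mapComp h g).hom.app T)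
      (fn φ ((Over.map h).obj T) (fn ψ T x)) := by
  unfold fn res
  rfl

theorem id_compMap {X' X : Scheme.{u}} {g : X' ⟶ X} {M : QCoh X'} {N : QCoh X}
    (φ : M ⟶ (pull g).obj N) : HEq (compMap (idMap M) φ) φ := by
  refine heq_of_fn (Category.id_comp g) _ _ fun T x => ?_
  refine (congrArg (res N _) ((fn_compMap (idMap M) φ T x).trans (congrArg (res N _)
    ((congrArg (fn φ _) (fn_idMap M T x)).trans (fn_res φ _ x))))).trans ?_
  refine (congrArg (res N _) (res_res N _ _ _)).trans ?_
  refine (res_res N _ _ _).trans (res_id N _ ?_ _)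
  ext
  change 𝟙 T.left ≫ 𝟙 T.left ≫ 𝟙 T.left = 𝟙 T.left
  simp

theorem compMap_id {X' X : Scheme.{u}} {g : X' ⟶ X} {M : QCoh X'} {N : QCoh X}
    (φ : M ⟶ (pull g).obj N) : HEq (compMap φ (idMap N)) φ := by
  refine heq_of_fn (Category.comp_id g) _ _ fun T x => ?_
  refine (congrArg (res N _) ((fn_compMap φ (idMap N) T x).trans (congrArg (res N _)
    (fn_idMap N _ _)))).trans ?_
  refine (congrArg (res N _) (res_res N _ _ _)).trans ?_
  refine (res_res N _ _ _).trans (res_id N _ ?_ _)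
  ext
  change 𝟙 T.left ≫ 𝟙 T.left ≫ 𝟙 T.left = 𝟙 T.left
  simp

theorem compMap_assoc {X₁ X₂ X₃ X₄ : Scheme.{u}} {f : X₁ ⟶ X₂} {g : X₂ ⟶ X₃} {h : X₃ ⟶ X₄}
    {M₁ : QCoh X₁} {M₂ : QCoh X₂} {M₃ : QCoh X₃} {M₄ : QCoh X₄} (φ : M₁ ⟶ (pull f).obj M₂)
    (ψ : M₂ ⟶ (pull g).obj M₃) (χ : M₃ ⟶ (pull h).obj M₄) :
    HEq (compMap (compMap φ ψ) χ) (compMap φ (compMap ψ χ)) := by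
  refine heq_of_fn (Category.assoc f g h) _ _ fun T x => ?_
  refine (congrArg (res M₄ _) ((fn_compMap (compMap φ ψ) χ T x).trans (congrArg (res M₄ _)
    ((congrArg (fn χ _) (fn_compMap φ ψ T x)).trans (fn_res χ _ _))))).trans ?_
  refine (congrArg (res M₄ _) (res_res M₄ _ _ _)).trans ?_
  refine (res_res M₄ _ _ _).trans ?_
  refine Eq.trans ?_ ((fn_compMap φ (compMap ψ χ) T x).trans (congrArg (res M₄ _)
    (fn_compMap ψ χ _ _))).symm
  refine Eq.trans ?_ (res_res M₄ _ _ _).symm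
  refine congrArg (fun i => res M₄ i _) ?_
  ext
  change 𝟙 T.left ≫ 𝟙 T.left ≫ 𝟙 T.left = 𝟙 T.left ≫ 𝟙 T.left
  simp

instance isIso_idMap {X : Scheme.{u}} (M : QCoh X) : IsIso (idMap M) := by
  unfold idMap
  infer_instance

instance isIso_compMap {X'' X' X : Scheme.{u}} {h : X'' ⟶ X'} {g : X' ⟶ X} {L : QCoh X''}
    {M : QCoh X'} {N : QCoh X} (ψ : L ⟶ (pull h).obj M) (φ : M ⟶ (pull g).obj N)
    [IsIso ψ] [IsIso φ] : IsIso (compMap ψ φ) := by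
  unfold compMap
  infer_instance

/-- The fibered category `QCoh` over the category of `S`-schemes: objects are pairs `(X, M)` with
`M` a quasi-coherent module on the big fppf site of `X`. -/
structure QCohTot (S : Scheme.{u}) where
  /-- the underlying `S`-scheme -/
  base : Over S
  /-- the quasi-coherent module -/
  mod : QCoh base.left

namespace QCohTot

variable {S : Scheme.{u}}

/-- Morphisms `(X', M') ⟶ (X, M)` are pairs `(g, φ)` with `φ : M' ⟶ g^* M`. -/
@[ext]
structure Hom (A B : QCohTot S) where
  /-- the morphism of `S`-schemes -/
  base : A.base ⟶ B.base
  /-- the linear map `M' ⟶ g^* M` -/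
  map : A.mod ⟶ (pull base.left).obj B.mod

/-- Composition is `(g, φ) ∘ (h, ψ) = (g ∘ h, h^*(φ) ∘ ψ)`. -/
instance : Category (QCohTot S) where
  Hom := Hom
  id A := ⟨𝟙 _, idMap A.mod⟩
  comp f g := ⟨f.base ≫ g.base, compMap f.map g.map⟩
  id_comp f := Hom.ext (Category.id_comp f.base) (id_compMap f.map)
  comp_id f := Hom.ext (Category.comp_id f.base) (compMap_id f.map)
  assoc f g h := Hom.ext (Category.assoc f.base g.base h.base) (compMap_assoc f.map g.map h.map)

/-- The structure functor to `S`-schemes. -/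
def proj (S : Scheme.{u}) : QCohTot S ⥤ Over S where
  obj A := A.base
  map f := f.base

end QCohTot

/-- Objects of the fibered category of affine morphisms: affine morphisms `T' ⟶ T` with `T` an
`S`-scheme (so that `T'` is an `S`-scheme through `T`). -/
structure AffMor (S : Scheme.{u}) where
  /-- the target `T` -/
  base : Over S
  /-- the source `T'` -/
  total : Scheme.{u}
  /-- the affine morphism -/
  hom : total ⟶ base.left
  affine : IsAffineHom hom

namespace AffMor

variable {S : Scheme.{u}}

/-- Morphisms of affine morphisms are fibre product squares
`g : X' ⟶ T'` over a morphism of `S`-schemes `f : X ⟶ T`. -/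
@[ext]
structure Hom (j h : AffMor S) where
  /-- the bottom map -/
  f : j.base ⟶ h.base
  /-- the top map -/
  g : j.total ⟶ h.total
  isPullback : IsPullback g j.hom h.hom f.left

instance : Category (AffMor S) where
  Hom := Hom
  id _ := ⟨𝟙 _, 𝟙 _, IsPullback.of_id_fst⟩
  comp a b := ⟨a.f ≫ b.f, a.g ≫ b.g, a.isPullback.paste_horiz b.isPullback⟩
  id_comp a := Hom.ext (Category.id_comp a.f) (Category.id_comp a.g)
  comp_id a := Hom.ext (Category.comp_id a.f) (Category.comp_id a.g)
  assoc a b c := Hom.ext (Category.assoc a.f b.f c.f) (Category.assoc a.g b.g c.g)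

/-- The structure functor, sending an affine morphism to its target. -/
def proj (S : Scheme.{u}) : AffMor S ⥤ Over S where
  obj h := h.base
  map a := a.f

end AffMor

/-- A (not necessarily full) subcategory of the category of affine morphisms. It is a substack if
its structure functor to `S`-schemes is a stack. (As all fibre product squares are cartesian
morphisms of the fibered category of affine morphisms, cartesian morphisms of the subcategory are
automatically cartesian in the category of all affine morphisms.) -/
structure Subcat (S : Scheme.{u}) where
  /-- which objects belong to the subcategory -/
  obj : AffMor S → Prop
  /-- which morphisms between its objects belong to the subcategory -/
  hom : ∀ {j h : AffMor S}, (j ⟶ h) → Prop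
  id_mem : ∀ h, obj h → hom (𝟙 h)
  comp_mem : ∀ {i j h : AffMor S} (a : i ⟶ j) (b : j ⟶ h), hom a → hom b → hom (a ≫ b)

variable {S : Scheme.{u}}

/-- The objects of a subcategory of the category of affine morphisms. -/
structure Subcat.Cat (I : Subcat S) where
  /-- the affine morphism -/
  val : AffMor S
  mem : I.obj val

/-- The morphisms of a subcategory of the category of affine morphisms. -/
@[ext]
structure Subcat.Hom {I : Subcat S} (j h : I.Cat) where
  /-- the fibre product square -/
  val : j.val ⟶ h.val
  mem : I.hom val

instance (I : Subcat S) : Category I.Cat where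
  Hom := Subcat.Hom
  id h := ⟨𝟙 h.val, I.id_mem _ h.mem⟩
  comp a b := ⟨a.val ≫ b.val, I.comp_mem _ _ a.mem b.mem⟩
  id_comp a := Subcat.Hom.ext (Category.id_comp a.val)
  comp_id a := Subcat.Hom.ext (Category.comp_id a.val)
  assoc a b c := Subcat.Hom.ext (Category.assoc a.val b.val c.val)

/-- The structure functor of a subcategory of the category of affine morphisms. -/
def Subcat.proj (I : Subcat S) : I.Cat ⥤ Over S where
  obj h := h.val.base
  map a := a.val.f

/-- Objects of `QCoh_I`: an object `h : T' ⟶ T` of `I` with a quasi-coherent module on `T'`. -/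
structure QCohI (I : Subcat S) where
  /-- the object of `I` -/
  arr : I.Cat
  /-- the quasi-coherent module on the source -/
  mod : QCoh arr.val.total

namespace QCohI

variable {I : Subcat S}

/-- Morphisms `(j, N) ⟶ (h, M)` of `QCoh_I` are triples `(f, g, φ)` where `(f, g) : j ⟶ h` is a
morphism of `I` and `φ : N ⟶ g^* M` is an isomorphism. -/
@[ext]
structure Hom (A B : QCohI I) where
  /-- the morphism of `I` -/
  arr : A.arr ⟶ B.arr
  /-- the linear map -/
  map : A.mod ⟶ (pull arr.val.g).obj B.mod
  isIso : IsIso map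

instance : Category (QCohI I) where
  Hom := Hom
  id A := ⟨𝟙 _, idMap A.mod, isIso_idMap _⟩
  comp a b := ⟨a.arr ≫ b.arr, compMap a.map b.map,
    have := a.isIso
    have := b.isIso
    isIso_compMap _ _⟩
  id_comp a := Hom.ext (Category.id_comp a.arr) (id_compMap a.map)
  comp_id a := Hom.ext (Category.comp_id a.arr) (compMap_id a.map)
  assoc a b c := Hom.ext (Category.assoc a.arr b.arr c.arr) (compMap_assoc a.map b.map c.map)

/-- The structure functor to `I`. -/
def toI (I : Subcat S) : QCohI I ⥤ I.Cat where
  obj A := A.arr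
  map a := a.arr

/-- The structure functor to `S`-schemes. -/
def proj (I : Subcat S) : QCohI I ⥤ Over S := toI I ⋙ I.proj

end QCohI

/-- Families of flat morphisms, locally of finite presentation, that are jointly surjective. -/
structure IsFppfCover {ι : Type u} {Y : Over S} {X : ι → Over S} (f : ∀ i, X i ⟶ Y) : Prop where
  flat : ∀ i, Flat (f i).left
  lfp : ∀ i, LocallyOfFinitePresentation (f i).left
  surj : ∀ y : Y.left, ∃ (i : ι) (x : (X i).left), (f i).left x = y

/-- Stacks over the category of `S`-schemes for the fppf topology, as fibered categories in which
morphisms and objects can be glued. "Strongly cartesian" is what is often called "cartesian":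
the universal property holds for all morphisms of the base.

`glue_hom`: for objects `y`, `y'` over `Y`, the presheaf of morphisms `y ⟶ y'` is a sheaf. A section
of it over `X i ⟶ Y` is given by a cartesian lift `c i : x i ⟶ y` and a morphism
`a i : x i ⟶ y'` over `f i`.

`glue_obj`: descent data are effective. A descent datum consists of objects `x i` over `X i` and,
over `X i ×_Y X j`, of an object `xx i j` with cartesian morphisms `a i j` to `x i` over the
first projection and `b i j` to `x j` over the second projection, that is, of an isomorphism between
the two restrictions; the cocycle condition over triple products is tested on morphisms into
the objects `xx i j`, `xx j k` and `xx i k`. -/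
structure IsStack {𝒳 : Type (u + 1)} [Category.{v} 𝒳] (p : 𝒳 ⥤ Over S) : Prop where
  fibered : p.IsFibered
  glue_hom : ∀ {ι : Type u} {Y : Over S} {X : ι → Over S} (f : ∀ i, X i ⟶ Y), IsFppfCover f →
    ∀ {y y' : 𝒳} {x : ι → 𝒳} (c : ∀ i, x i ⟶ y) (a : ∀ i, x i ⟶ y'),
      p.obj y = Y → p.obj y' = Y →
      (∀ i, p.IsStronglyCartesian (f i) (c i)) → (∀ i, p.IsHomLift (f i) (a i)) →
      (∀ (i j : ι) (z : 𝒳) (s : z ⟶ x i) (t : z ⟶ x j), s ≫ c i = t ≫ c j →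
        s ≫ a i = t ≫ a j) →
      ∃! b : y ⟶ y', p.IsHomLift (𝟙 Y) b ∧ ∀ i, c i ≫ b = a i
  glue_obj : ∀ {ι : Type u} {Y : Over S} {X : ι → Over S} (f : ∀ i, X i ⟶ Y), IsFppfCover f →
    ∀ {x : ι → 𝒳} {xx : ι → ι → 𝒳} (a : ∀ i j, xx i j ⟶ x i) (b : ∀ i j, xx i j ⟶ x j),
      (∀ i j, p.IsStronglyCartesian (pullback.fst (f i) (f j)) (a i j)) →
      (∀ i j, p.IsStronglyCartesian (pullback.snd (f i) (f j)) (b i j)) →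
      (∀ (i j k : ι) (z : 𝒳) (r : z ⟶ xx i j) (s : z ⟶ xx j k) (t : z ⟶ xx i k),
        r ≫ b i j = s ≫ a j k → r ≫ a i j = t ≫ a i k →
        p.map (s ≫ b j k) = p.map (t ≫ b i k) → s ≫ b j k = t ≫ b i k) →
      ∃ (y : 𝒳) (c : ∀ i, x i ⟶ y), p.obj y = Y ∧
        (∀ i, p.IsStronglyCartesian (f i) (c i)) ∧ ∀ i j, a i j ≫ c i = b i j ≫ c j

/-- The canonical isomorphism `R ⊗_R M ≅ M`. -/
def canId {R : Type u} [CommRing R] (f : R →+* R) (hf : f = RingHom.id R) :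
    ModuleCat.extendScalars.{u, u, u} f ≅ 𝟭 (ModuleCat.{u} R) :=
  eqToIso (by rw [hf]) ≪≫ ModuleCat.extendScalarsId R

/-- The canonical isomorphism `R₃ ⊗_{R₂} (R₂ ⊗_{R₁} M) ≅ R₃ ⊗_{R₁} M`. -/
def canComp {R₁ R₂ R₃ : Type u} [CommRing R₁] [CommRing R₂] [CommRing R₃] (f : R₁ →+* R₂)
    (g : R₂ →+* R₃) (k : R₁ →+* R₃) (hk : k = g.comp f) :
    ModuleCat.extendScalars.{u, u, u} f ⋙ ModuleCat.extendScalars.{u, u, u} g ≅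
      ModuleCat.extendScalars.{u, u, u} k :=
  (ModuleCat.extendScalarsComp f g).symm ≪≫ eqToIso (by rw [hk])

/-- Compatibility of a base change isomorphism `θ` along identities with the unit: the triangle
formed by `θ : R ⊗ F(-) ≅ F(R' ⊗ -)` and the canonical isomorphisms commutes. -/
def UnitCompat {R R' : Type u} [CommRing R] [CommRing R'] (F : ModuleCat.{u} R' ⥤ ModuleCat.{u} R)
    (f : R →+* R) (hf : f = RingHom.id R) (f' : R' →+* R') (hf' : f' = RingHom.id R')
    (θ : F ⋙ ModuleCat.extendScalars.{u, u, u} f ≅ ModuleCat.extendScalars.{u, u, u} f' ⋙ F) :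
    Prop :=
  ∀ M : ModuleCat.{u} R', θ.hom.app M ≫ F.map ((canId f' hf').hom.app M) =
    (canId f hf).hom.app (F.obj M)

/-- Compatibility of base change isomorphisms with composition (the cocycle condition):
`θ_k ∘ can = F₃(can) ∘ θ_g ∘ (R₃ ⊗ θ_f)` as maps
`R₃ ⊗_{R₂} (R₂ ⊗_{R₁} F₁(M)) ⟶ F₃(R₃' ⊗_{R₁'} M)`, where `k = g ∘ f`. -/
def CocycleCompat {R₁ R₂ R₃ R₁' R₂' R₃' : Type u} [CommRing R₁] [CommRing R₂] [CommRing R₃]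
    [CommRing R₁'] [CommRing R₂'] [CommRing R₃'] (F₁ : ModuleCat.{u} R₁' ⥤ ModuleCat.{u} R₁)
    (F₂ : ModuleCat.{u} R₂' ⥤ ModuleCat.{u} R₂) (F₃ : ModuleCat.{u} R₃' ⥤ ModuleCat.{u} R₃)
    (f : R₁ →+* R₂) (g : R₂ →+* R₃) (k : R₁ →+* R₃) (hk : k = g.comp f)
    (f' : R₁' →+* R₂') (g' : R₂' →+* R₃') (k' : R₁' →+* R₃') (hk' : k' = g'.comp f')
    (θf : F₁ ⋙ ModuleCat.extendScalars.{u, u, u} f ≅ ModuleCat.extendScalars.{u, u, u} f' ⋙ F₂)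
    (θg : F₂ ⋙ ModuleCat.extendScalars.{u, u, u} g ≅ ModuleCat.extendScalars.{u, u, u} g' ⋙ F₃)
    (θk : F₁ ⋙ ModuleCat.extendScalars.{u, u, u} k ≅ ModuleCat.extendScalars.{u, u, u} k' ⋙ F₃) :
    Prop :=
  ∀ M : ModuleCat.{u} R₁', (canComp f g k hk).hom.app (F₁.obj M) ≫ θk.hom.app M =
    (ModuleCat.extendScalars.{u, u, u} g).map (θf.hom.app M) ≫
      θg.hom.app ((ModuleCat.extendScalars.{u, u, u} f').obj M) ≫
        F₃.map ((canComp f' g' k' hk').hom.app M)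

/-- Sections of quasi-coherent modules over the `X`-scheme `f : Y ⟶ X`. -/
def evAt {Y X : Scheme.{u}} (f : Y ⟶ X) : QCoh X ⥤ ModuleCat.{u} Γ(Y, ⊤) :=
  IsQCoh.ι ⋙ PresheafOfModules.evaluation (structureSheaf X) (op (Over.mk f))

/-- The `O(Z)`-linear map `O(Z) ⊗_{O(Y)} M(Y) ⟶ M(Z)`, `s ⊗ m ↦ s • m|_Z`, for a morphism
`i : Z ⟶ Y` of `X`-schemes. -/
def rhoAt {Z Y X : Scheme.{u}} (M : QCoh X) (i : Z ⟶ Y) (f : Y ⟶ X) (f' : Z ⟶ X)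
    (w : i ≫ f = f') :
    (ModuleCat.extendScalars.{u, u, u} i.appTop.hom).obj ((evAt f).obj M) ⟶ (evAt f').obj M :=
  ((ModuleCat.extendRestrictScalarsAdj i.appTop.hom).homEquiv
    ((evAt f).obj M) ((evAt f').obj M)).symm
      (M.obj.map (Over.homMk i w : Over.mk f' ⟶ Over.mk f).op)

/-- Restriction of sections along a morphism `i : Z ⟶ Y` of `X`-schemes. -/
def resAt {Z Y X : Scheme.{u}} (M : QCoh X) (i : Z ⟶ Y) (f : Y ⟶ X) (f' : Z ⟶ X)
    (w : i ≫ f = f') (m : (evAt f).obj M) : (evAt f').obj M :=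
  M.obj.map (Over.homMk i w : Over.mk f' ⟶ Over.mk f).op m

theorem rhoAt_tmul {Z Y X : Scheme.{u}} (M : QCoh X) (i : Z ⟶ Y) (f : Y ⟶ X) (f' : Z ⟶ X)
    (w : i ≫ f = f') (s : Γ(Z, ⊤)) (m : (evAt f).obj M) :
    rhoAt M i f f' w (s ⊗ₜ[_, i.appTop.hom] m :
      (ModuleCat.extendScalars.{u, u, u} i.appTop.hom).obj ((evAt f).obj M)) =
      s • resAt M i f f' w m := rfl

/-- The sections of `g^* M` over `f : Z ⟶ Y` are those of `M` over `g ∘ f`. -/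
def evPull {Z Y X : Scheme.{u}} (f : Z ⟶ Y) (g : Y ⟶ X) : pull g ⋙ evAt f ≅ evAt (f ≫ g) :=
  Iso.refl _

theorem appTop_id (X : Scheme.{u}) : (𝟙 X : X ⟶ X).appTop.hom = RingHom.id Γ(X, ⊤) := by
  rw [Scheme.Hom.id_appTop]
  rfl

theorem appTop_comp {Z Y X : Scheme.{u}} (f : Z ⟶ Y) (g : Y ⟶ X) :
    (f ≫ g).appTop.hom = f.appTop.hom.comp g.appTop.hom := by
  rw [Scheme.Hom.comp_appTop]
  rfl

/-- Functors `F_U` from `O(T ×_X U)`-modules to `O(U)`-modules, one for each affine `X`-scheme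
`x : U ⟶ X`, where `h : T ⟶ X`. -/
abbrev LocalFunctors {T X : Scheme.{u}} (h : T ⟶ X) :=
  ∀ {U : Scheme.{u}} (x : U ⟶ X), IsAffine U →
    (ModuleCat.{u} Γ(pullback h x, ⊤) ⥤ ModuleCat.{u} Γ(U, ⊤))

/-- The map `T ×_X V ⟶ T ×_X U` induced by a map `f : V ⟶ U` of `X`-schemes. -/
def pullbackMap {T X V U : Scheme.{u}} (h : T ⟶ X) (x : U ⟶ X) (y : V ⟶ X) (f : V ⟶ U)
    (w : f ≫ x = y) : pullback h y ⟶ pullback h x :=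
  pullback.lift (pullback.fst h y) (pullback.snd h y ≫ f) (by simp [w, pullback.condition])

theorem pullbackMap_fst {T X V U : Scheme.{u}} (h : T ⟶ X) (x : U ⟶ X) (y : V ⟶ X) (f : V ⟶ U)
    (w : f ≫ x = y) : pullbackMap h x y f w ≫ pullback.fst h x = pullback.fst h y :=
  pullback.lift_fst _ _ _

theorem pullbackMap_snd {T X V U : Scheme.{u}} (h : T ⟶ X) (x : U ⟶ X) (y : V ⟶ X) (f : V ⟶ U)
    (w : f ≫ x = y) : pullbackMap h x y f w ≫ pullback.snd h x = pullback.snd h y ≫ f :=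
  pullback.lift_snd _ _ _

theorem pullbackMap_id {T X U : Scheme.{u}} (h : T ⟶ X) (x : U ⟶ X) :
    pullbackMap h x x (𝟙 U) (Category.id_comp x) = 𝟙 _ := by
  apply pullback.hom_ext <;> simp [pullbackMap_fst, pullbackMap_snd]

theorem pullbackMap_comp {T X W V U : Scheme.{u}} (h : T ⟶ X) (x : U ⟶ X) (y : V ⟶ X) (z : W ⟶ X)
    (f : V ⟶ U) (g : W ⟶ V) (w : f ≫ x = y) (w' : g ≫ y = z)
    (w'' : (g ≫ f) ≫ x = z) : pullbackMap h x z (g ≫ f) w'' =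
      pullbackMap h y z g w' ≫ pullbackMap h x y f w := by
  apply pullback.hom_ext
  · rw [Category.assoc, pullbackMap_fst, pullbackMap_fst, pullbackMap_fst]
  · rw [Category.assoc, pullbackMap_snd, pullbackMap_snd, ← Category.assoc,
      ← Category.assoc, pullbackMap_snd]

/-- Base change isomorphisms `θ_f : F_U(-) ⊗_{O(U)} O(V) ≅ F_V(- ⊗_{O(T ×_X U)} O(T ×_X V))`
for all morphisms `f : V ⟶ U` of affine `X`-schemes, compatible with identities and
composition. -/
structure LocalBaseChange {T X : Scheme.{u}} (h : T ⟶ X) (F : LocalFunctors h) where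
  /-- the base change isomorphisms -/
  θ : ∀ {V U : Scheme.{u}} (hV : IsAffine V) (hU : IsAffine U) (x : U ⟶ X) (y : V ⟶ X)
    (f : V ⟶ U) (w : f ≫ x = y),
    F x hU ⋙ ModuleCat.extendScalars.{u, u, u} f.appTop.hom ≅
      ModuleCat.extendScalars.{u, u, u} (pullbackMap h x y f w).appTop.hom ⋙ F y hV
  unit : ∀ {U : Scheme.{u}} (hU : IsAffine U) (x : U ⟶ X),
    UnitCompat (F x hU) (𝟙 U : U ⟶ U).appTop.hom (appTop_id U)
      (pullbackMap h x x (𝟙 U) (Category.id_comp x)).appTop.hom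
      (by rw [pullbackMap_id, appTop_id]) (θ hU hU x x (𝟙 U) (Category.id_comp x))
  cocycle : ∀ {W V U : Scheme.{u}} (hW : IsAffine W) (hV : IsAffine V) (hU : IsAffine U)
    (x : U ⟶ X) (y : V ⟶ X) (z : W ⟶ X) (f : V ⟶ U) (g : W ⟶ V) (w : f ≫ x = y)
    (w' : g ≫ y = z) (w'' : (g ≫ f) ≫ x = z),
    CocycleCompat (F x hU) (F y hV) (F z hW)
      f.appTop.hom g.appTop.hom (g ≫ f).appTop.hom (appTop_comp g f)
      (pullbackMap h x y f w).appTop.hom (pullbackMap h y z g w').appTop.hom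
      (pullbackMap h x z (g ≫ f) w'').appTop.hom
      (by rw [pullbackMap_comp h x y z f g w w' w'', appTop_comp])
      (θ hV hU x y f w) (θ hW hV y z g w') (θ hW hU x z (g ≫ f) w'')

/-- The functor `G : QCoh(T) ⥤ QCoh(X)` is given by the local data `F`, `θ`: there are
isomorphisms `G(M)(U) ≅ F_U(M(T ×_X U))`, natural in `M`, for all affine `X`-schemes `U`, under
which the restriction map `G(M)(U) ⟶ G(M)(V)` along `f : V ⟶ U` becomes the composite of
`F_U(M(T ×_X U)) ⟶ F_U(M(T ×_X U)) ⊗ O(V)`, `θ_f` and `F_V` of the canonical map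
`M(T ×_X U) ⊗ O(T ×_X V) ⟶ M(T ×_X V)`. (The last condition is expressed by the `O(V)`-linear
maps out of `G(M)(U) ⊗ O(V)` which correspond to the restriction maps.) -/
def IsAssembledFrom {T X : Scheme.{u}} (h : T ⟶ X) (F : LocalFunctors h)
    (B : LocalBaseChange h F) (G : QCoh T ⥤ QCoh X) : Prop :=
  ∃ e : ∀ {U : Scheme.{u}} (hU : IsAffine U) (x : U ⟶ X),
      G ⋙ evAt x ≅ evAt (pullback.fst h x) ⋙ F x hU,
    ∀ {V U : Scheme.{u}} (hV : IsAffine V) (hU : IsAffine U) (x : U ⟶ X) (y : V ⟶ X)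
      (f : V ⟶ U) (w : f ≫ x = y) (M : QCoh T),
      rhoAt (G.obj M) f x y w ≫ (e hV y).hom.app M =
        (ModuleCat.extendScalars.{u, u, u} f.appTop.hom).map ((e hU x).hom.app M) ≫
          (B.θ hV hU x y f w).hom.app ((evAt (pullback.fst h x)).obj M) ≫
            (F y hV).map (rhoAt M (pullbackMap h x y f w) (pullback.fst h x)
              (pullback.fst h y) (pullbackMap_fst h x y f w))

/-- The objects `U' ⟶ U` of a subcategory of affine morphisms for which `U` (hence also `U'`)
is affine. -/
structure Subcat.Aff (I : Subcat S) extends I.Cat where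
  isAffine : IsAffine val.base.left

/-- A functor `F_h` from `O(U')`-modules to `O(U)`-modules for every object `h : U' ⟶ U` of `I`
with `U` affine. -/
abbrev Subcat.Functors (I : Subcat S) :=
  ∀ h : I.Aff, ModuleCat.{u} Γ(h.val.total, ⊤) ⥤ ModuleCat.{u} Γ(h.val.base.left, ⊤)

/-- Base change isomorphisms `θ_D : F_h(-) ⊗_{O(U)} O(V) ≅ F_{h'}(- ⊗_{O(U')} O(V'))` for all fibre
product squares `D` (not only those belonging to `I`) from an object `h' : V' ⟶ V` to an object
`h : U' ⟶ U` of `I` with `U`, `V` affine, compatible with identity squares and with pasting of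
squares. -/
structure BaseChange (I : Subcat S) (F : I.Functors) where
  /-- the base change isomorphisms -/
  θ : ∀ {k h : I.Aff} (D : k.val ⟶ h.val),
    F h ⋙ ModuleCat.extendScalars.{u, u, u} D.f.left.appTop.hom ≅
      ModuleCat.extendScalars.{u, u, u} D.g.appTop.hom ⋙ F k
  unit : ∀ h : I.Aff,
    UnitCompat (F h) (AffMor.Hom.f (𝟙 h.val)).left.appTop.hom (appTop_id h.val.base.left)
      (AffMor.Hom.g (𝟙 h.val)).appTop.hom (appTop_id h.val.total) (θ (𝟙 h.val))
  cocycle : ∀ {l k h : I.Aff} (E : l.val ⟶ k.val) (D : k.val ⟶ h.val),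
    CocycleCompat (F h) (F k) (F l)
      D.f.left.appTop.hom E.f.left.appTop.hom (E ≫ D).f.left.appTop.hom
      (appTop_comp E.f.left D.f.left)
      D.g.appTop.hom E.g.appTop.hom (E ≫ D).g.appTop.hom (appTop_comp E.g D.g)
      (θ D) (θ E) (θ (E ≫ D))

/-- The object and morphism parts of the would-be functor `QCoh_I ⥤ QCoh` defined by functors
`Φ h : QCoh(T') ⥤ QCoh(T)` for `h : T' ⟶ T` in `I` and isomorphisms
`φ D : Φ h' ∘ g^* ≅ f^* ∘ Φ h` for fibre product squares `D = (f, g) : h' ⟶ h`: it sends `(h, M)` to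
`(T, Φ h (M))` and `(f, g, ψ) : (h', N) ⟶ (h, M)` to `(f, φ D (M) ∘ Φ h' (ψ))`. -/
def assembledPrefunctor {I : Subcat S}
    (Φ : ∀ h : I.Cat, QCoh h.val.total ⥤ QCoh h.val.base.left)
    (φ : ∀ {j h : I.Cat} (D : j.val ⟶ h.val), pull D.g ⋙ Φ j ≅ Φ h ⋙ pull D.f.left) :
    QCohI I ⥤q QCohTot S where
  obj A := ⟨A.arr.val.base, (Φ A.arr).obj A.mod⟩
  map {A B} a := ⟨a.arr.val.f, (Φ A.arr).map a.map ≫ (φ a.arr.val).hom.app B.mod⟩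

/-- The local functors `F` with the base change isomorphisms `B` assemble into functors
between categories of quasi-coherent modules and into a morphism of stacks `QCoh_I ⥤ QCoh`.

* There are functors `Φ h : QCoh(T') ⥤ QCoh(T)` for all `h : T' ⟶ T` in `I`, and for every fibre
  product square `m` from `k : U' ⟶ U` in `I` with `U` affine to `h` isomorphisms `e h k m` between
  `Φ h (M)(U)` and `F_k(M(U'))`, natural in `M`.
* For a further square `n : k' ⟶ k` with `k' : V' ⟶ V`, the restriction map
  `Φ h (M)(U) ⟶ Φ h (M)(V)` is the composite of the canonical map to `F_k(M(U')) ⊗ O(V)`,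
  of `θ_n` and of `F_{k'}` of the canonical map `M(U') ⊗ O(V') ⟶ M(V')`.
* There are isomorphisms of functors `φ D : Φ h' ∘ g^* ≅ f^* ∘ Φ h` for all fibre product squares
  `D = (f, g)` between objects `h'`, `h` of `I`. Over an affine `U` they are the identification of
  both sides with `F_k(M(U'))`, where `k : U' ⟶ U` is a base change of `h'`, hence of `h`. (If the
  two sides are computed by two different such base changes `k` and `k₁`, then by the formula for
  restriction maps this is the inverse of `F_k(ρ) ∘ θ` for the square `k ⟶ k₁` over the
  identity of `U`.)
* The assignment `(h, M) ↦ (T, Φ h (M))`, `(f, g, ψ) ↦ (f, φ D (M) ∘ Φ h' (ψ))` is a functor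
  over the category of `S`-schemes, and all morphisms in its image are cartesian, in particular it
  preserves cartesian morphisms. -/
def Assembles (I : Subcat S) (F : I.Functors) (B : BaseChange I F) : Prop :=
  ∃ (Φ : ∀ h : I.Cat, QCoh h.val.total ⥤ QCoh h.val.base.left)
    (e : ∀ (h : I.Cat) (k : I.Aff) (m : k.val ⟶ h.val),
      Φ h ⋙ evAt m.f.left ≅ evAt m.g ⋙ F k)
    (φ : ∀ {j h : I.Cat} (D : j.val ⟶ h.val), pull D.g ⋙ Φ j ≅ Φ h ⋙ pull D.f.left)
    (N : QCohI I ⥤ QCohTot S),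
    (∀ (h : I.Cat) (k' k : I.Aff) (n : k'.val ⟶ k.val) (m : k.val ⟶ h.val)
      (M : QCoh h.val.total),
      rhoAt ((Φ h).obj M) n.f.left m.f.left (n ≫ m).f.left rfl ≫ (e h k' (n ≫ m)).hom.app M =
        (ModuleCat.extendScalars.{u, u, u} n.f.left.appTop.hom).map ((e h k m).hom.app M) ≫
          (B.θ n).hom.app ((evAt m.g).obj M) ≫
            (F k').map (rhoAt M n.g m.g (n ≫ m).g rfl)) ∧
    (∀ (j h : I.Cat) (D : j.val ⟶ h.val) (k : I.Aff) (m : k.val ⟶ j.val)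
      (M : QCoh h.val.total),
      (evAt m.f.left).map ((φ D).hom.app M) ≫
          (evPull m.f.left D.f.left).hom.app ((Φ h).obj M) ≫ (e h k (m ≫ D)).hom.app M =
        (e j k m).hom.app ((pull D.g).obj M) ≫ (F k).map ((evPull m.g D.g).hom.app M)) ∧
    N.toPrefunctor = assembledPrefunctor Φ φ ∧
    N ⋙ QCohTot.proj S = QCohI.proj I ∧
    ∀ {A A' : QCohI I} (a : A ⟶ A'),
      (QCohTot.proj S).IsStronglyCartesian ((QCohTot.proj S).map (N.map a)) (N.map a)

/-- The determinant of an endomorphism of a finitely generated projective module: choose a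
complement which makes the module free of finite rank, and extend the endomorphism by the identity.
(The result is independent of the choices; the value is `1` if the module is not
finitely generated projective.) -/
def projDet {R P : Type u} [CommRing R] [AddCommGroup P] [Module R P] (φ : P →ₗ[R] P) : R :=
  open Classical in
  if h : ∃ (n : ℕ) (s : P →ₗ[R] (Fin n → R)) (q : (Fin n → R) →ₗ[R] P), q ∘ₗ s = LinearMap.id then
    LinearMap.det (h.choose_spec.choose ∘ₗ φ ∘ₗ h.choose_spec.choose_spec.choose +
      (LinearMap.id - h.choose_spec.choose ∘ₗ h.choose_spec.choose_spec.choose))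
  else 1

/-- The norm of an element of an `R`-algebra that is finitely generated projective as a module:
the determinant of multiplication by it. -/
def projNorm (R : Type u) {A : Type u} [CommRing R] [CommRing A] [Algebra R A] (x : A) : R :=
  projDet (LinearMap.mulLeft R x)

/-- The divided power algebra `Γ(M)` of an `R`-module `M`. -/
def Gam (R M : Type u) [CommRing R] [AddCommGroup M] [Module R M] : Type u :=
  DividedPowerAlgebra R M

instance (R M : Type u) [CommRing R] [AddCommGroup M] [Module R M] : CommRing (Gam R M) :=
  inferInstanceAs (CommRing (DividedPowerAlgebra R M))

instance (R M : Type u) [CommRing R] [AddCommGroup M] [Module R M] : Algebra R (Gam R M) :=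
  inferInstanceAs (Algebra R (DividedPowerAlgebra R M))

/-- The divided power `γ^n(m)` in `Γ(M)`. -/
def dp (R : Type u) {M : Type u} [CommRing R] [AddCommGroup M] [Module R M] (n : ℕ) (m : M) :
    Gam R M := DividedPowerAlgebra.dp R n m

/-- Functoriality of the divided power algebra. -/
def Gam.map {R M N : Type u} [CommRing R] [AddCommGroup M] [Module R M] [AddCommGroup N]
    [Module R N] (φ : M →ₗ[R] N) : Gam R M →ₐ[R] Gam R N := DividedPowerAlgebra.map R φ

theorem Gam.map_dp {R M N : Type u} [CommRing R] [AddCommGroup M] [Module R M] [AddCommGroup N]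
    [Module R N] (φ : M →ₗ[R] N) (n : ℕ) (m : M) : Gam.map φ (dp R n m) = dp R n (φ m) :=
  DividedPowerAlgebra.map_apply_dp R φ

theorem Gam.map_id {R M : Type u} [CommRing R] [AddCommGroup M] [Module R M] (x : Gam R M) :
    Gam.map (LinearMap.id : M →ₗ[R] M) x = x :=
  congrArg (fun k : DividedPowerAlgebra R M →ₐ[R] DividedPowerAlgebra R M => k x)
    DividedPowerAlgebra.map_id

theorem Gam.map_comp {R M N P : Type u} [CommRing R] [AddCommGroup M] [Module R M] [AddCommGroup N]
    [Module R N] [AddCommGroup P] [Module R P] (φ : M →ₗ[R] N) (ψ : N →ₗ[R] P) (x : Gam R M) :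
    Gam.map (ψ ∘ₗ φ) x = Gam.map ψ (Gam.map φ x) :=
  congrArg (fun k : DividedPowerAlgebra R M →ₐ[R] DividedPowerAlgebra R P => k x)
    (DividedPowerAlgebra.map_comp φ ψ)

/-- The submodule `Γ^d(M)` of the divided power algebra `Γ(M)` of an `R`-module `M`, spanned by
the products `γ^{a_1}(m_1) ⋯ γ^{a_k}(m_k)` with `a_1 + ⋯ + a_k = d`. -/
def gammaPart (R : Type u) [CommRing R] (d : ℕ) (M : Type u) [AddCommGroup M] [Module R M] :
    Submodule R (Gam R M) :=
  Submodule.span R {x | ∃ (k : ℕ) (a : Fin k → ℕ) (m : Fin k → M),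
    ∑ i, a i = d ∧ x = ∏ i, dp R (a i) (m i)}

/-- For an `R`-algebra `A` and an `A`-module `M`, the product `γ^a(r) · γ^b(m)` of an element
`γ^{a_1}(r_1) ⋯ γ^{a_k}(r_k)` of `Γ^d(A)` with an element `γ^{b_1}(m_1) ⋯ γ^{b_l}(m_l)` of `Γ^d(M)`,
for the `Γ^d(A)`-module structure on `Γ^d(M)` characterized by
`γ^d(r) · γ^d(m) = γ^d(r m)` (after all base changes). Comparing coefficients of `X^a Y^b` in
`γ^d(∑ X_i r_i) · γ^d(∑ Y_j m_j) = γ^d(∑ X_i Y_j r_i m_j)`, it is the sum of the products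
`∏_{i,j} γ^{c_ij}(r_i m_j)` over all matrices `c` with row sums `a` and column sums `b`. -/
def gammaMul (R : Type u) {A M : Type u} [CommRing R] [CommRing A] [AddCommGroup M] [Module R M]
    [Module A M] (d : ℕ) {k l : ℕ} (a : Fin k → ℕ) (r : Fin k → A) (b : Fin l → ℕ)
    (m : Fin l → M) : Gam R M :=
  ∑ c : Fin k → Fin l → Fin (d + 1) with
    (∀ i, ∑ j, (c i j : ℕ) = a i) ∧ ∀ j, ∑ i, (c i j : ℕ) = b j,
    ∏ i, ∏ j, dp R (c i j : ℕ) (r i • m j)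

/-- The image of `γ^{a_1}(r_1) ⋯ γ^{a_k}(r_k)` under the algebra homomorphism `π : Γ^d(A) → R`
with `π(γ^d(r)) = norm(r)` (after all base changes), for `A` locally free of rank `d` over `R`: the
coefficient of `X^a` in the norm of `∑ X_i r_i`. -/
def normCoeff (R : Type u) {A : Type u} [CommRing R] [CommRing A] [Algebra R A] {k : ℕ}
    (a : Fin k → ℕ) (r : Fin k → A) : R :=
  (projNorm (MvPolynomial (Fin k) R)
    (∑ i, (MvPolynomial.X i : MvPolynomial (Fin k) R) ⊗ₜ[R] r i :
      MvPolynomial (Fin k) R ⊗[R] A)).coeff (Finsupp.equivFunOnFinite.symm a)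

/-- The relations `x · y = π(x) y` between elements of `Γ^d(M)`, for generators `x` of `Γ^d(A)`
and `y` of `Γ^d(M)`. -/
def normRel (R : Type u) (A : Type u) [CommRing R] [CommRing A] [Algebra R A] (d : ℕ)
    (M : Type u) [AddCommGroup M] [Module R M] [Module A M] :
    Submodule R (Gam R M) :=
  Submodule.span R {x | ∃ (k l : ℕ) (a : Fin k → ℕ) (r : Fin k → A) (b : Fin l → ℕ)
    (m : Fin l → M), ∑ i, a i = d ∧ ∑ j, b j = d ∧
      x = gammaMul R d a r b m - normCoeff R a r • ∏ j, dp R (b j) (m j)}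

/-- Ferrand's norm `N_{A/R}(M) = Γ^d(M) ⊗_{Γ^d(A)} R` of an `A`-module `M`, for an `R`-algebra `A`
that is locally free of rank `d`. As `π : Γ^d(A) → R` is a surjective homomorphism of
`R`-algebras, the tensor product is the quotient of `Γ^d(M)` by the relations
`x · y = π(x) y`. -/
abbrev FerrandNorm (R : Type u) (A : Type u) [CommRing R] [CommRing A] [Algebra R A] (d : ℕ)
    (M : Type u) [AddCommGroup M] [Module R M] [Module A M] : Type u :=
  gammaPart R d M ⧸ (normRel R A d M).submoduleOf (gammaPart R d M)

section

variable {R : Type u} {A : Type u} [CommRing R] [CommRing A] [Algebra R A] {d : ℕ}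
variable {M : Type u} [AddCommGroup M] [Module R M] [Module A M]
variable {M' : Type u} [AddCommGroup M'] [Module R M'] [Module A M']
variable {M'' : Type u} [AddCommGroup M''] [Module R M''] [Module A M'']

theorem gammaPart_le_comap (φ : M →ₗ[R] M') :
    gammaPart R d M ≤ (gammaPart R d M').comap (Gam.map φ).toLinearMap := by
  refine Submodule.span_le.2 ?_
  rintro _ ⟨k, a, m, ha, rfl⟩
  refine Submodule.subset_span ⟨k, a, fun i => φ (m i), ha, ?_⟩
  simp [map_prod, Gam.map_dp]

theorem normRel_le_comap (φ : M →ₗ[R] M') (hφ : ∀ (r : A) (m : M), φ (r • m) = r • φ m) :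
    normRel R A d M ≤ (normRel R A d M').comap (Gam.map φ).toLinearMap := by
  refine Submodule.span_le.2 ?_
  rintro _ ⟨k, l, a, r, b, m, ha, hb, rfl⟩
  refine Submodule.subset_span ⟨k, l, a, r, b, fun i => φ (m i), ha, hb, ?_⟩
  simp [gammaMul, map_prod, map_sum, Gam.map_dp, hφ]

/-- Functoriality of the norm: `γ^{a_1}(m_1) ⋯ γ^{a_k}(m_k)` is sent to
`γ^{a_1}(φ(m_1)) ⋯ γ^{a_k}(φ(m_k))`. -/
def FerrandNorm.map (φ : M →ₗ[R] M') (hφ : ∀ (r : A) (m : M), φ (r • m) = r • φ m) :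
    FerrandNorm R A d M →ₗ[R] FerrandNorm R A d M' :=
  Submodule.mapQ _ _ ((Gam.map φ).toLinearMap.restrict (gammaPart_le_comap φ))
    fun _ hx => normRel_le_comap φ hφ hx

/-- The class of `γ^{a_1}(m_1) ⋯ γ^{a_k}(m_k)` in the norm of `M`. -/
def FerrandNorm.mk (A : Type u) [CommRing A] [Algebra R A] [Module A M] {k : ℕ} (a : Fin k → ℕ)
    (m : Fin k → M) (ha : ∑ i, a i = d) : FerrandNorm R A d M :=
  Submodule.Quotient.mk ⟨∏ i, dp R (a i) (m i),
    Submodule.subset_span ⟨k, a, m, ha, rfl⟩⟩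

theorem FerrandNorm.map_id :
    FerrandNorm.map (R := R) (A := A) (d := d) (LinearMap.id : M →ₗ[R] M) (fun _ _ => rfl) =
      LinearMap.id := by
  ext x
  obtain ⟨x, hx⟩ := x
  exact congrArg Submodule.Quotient.mk (Subtype.ext (Gam.map_id x))

theorem FerrandNorm.map_comp (φ : M →ₗ[R] M') (hφ : ∀ (r : A) (m : M), φ (r • m) = r • φ m)
    (ψ : M' →ₗ[R] M'') (hψ : ∀ (r : A) (m : M'), ψ (r • m) = r • ψ m) :
    FerrandNorm.map (A := A) (d := d) (ψ ∘ₗ φ) (fun r m => by simp [hφ, hψ]) =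
      FerrandNorm.map (d := d) ψ hψ ∘ₗ FerrandNorm.map φ hφ := by
  ext x
  obtain ⟨x, hx⟩ := x
  exact congrArg Submodule.Quotient.mk (Subtype.ext (Gam.map_comp φ ψ x))

end

/-- Ferrand's norm functor from `A`-modules to `R`-modules along a ring homomorphism `f : R → A`,
of degree `d`. -/
def ferrandFunctor (d : ℕ) {R A : Type u} [CommRing R] [CommRing A] (f : R →+* A) :
    ModuleCat.{u} A ⥤ ModuleCat.{u} R :=
  letI : Algebra R A := f.toAlgebra
  { obj := fun M =>
      letI : Module R M := Module.compHom M f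
      ModuleCat.of R (FerrandNorm R A d M)
    map := fun {M N} φ =>
      letI : Module R M := Module.compHom M f
      letI : Module R N := Module.compHom N f
      ModuleCat.ofHom (FerrandNorm.map
        { toFun := φ.hom
          map_add' := φ.hom.map_add
          map_smul' := fun r m => φ.hom.map_smul (f r) m } fun r m => φ.hom.map_smul r m)
    map_id := fun M => by
      let : Module R M := Module.compHom M f
      exact congrArg ModuleCat.ofHom (FerrandNorm.map_id (R := R) (A := A) (d := d) (M := M))
    map_comp := fun {M N P} φ ψ => by
      let : Module R M := Module.compHom M f
      let : Module R N := Module.compHom N f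
      let : Module R P := Module.compHom P f
      exact congrArg ModuleCat.ofHom (FerrandNorm.map_comp (R := R) (A := A) (d := d)
        { toFun := φ.hom
          map_add' := φ.hom.map_add
          map_smul' := fun r m => φ.hom.map_smul (f r) m } (fun r m => φ.hom.map_smul r m)
        { toFun := ψ.hom
          map_add' := ψ.hom.map_add
          map_smul' := fun r m => ψ.hom.map_smul (f r) m } (fun r m => ψ.hom.map_smul r m)) }

/-- The class of `γ^{a_1}(m_1) ⋯ γ^{a_k}(m_k)` in the norm of `M`. -/
def ferrandMk {d : ℕ} {R A : Type u} [CommRing R] [CommRing A] (f : R →+* A) (M : ModuleCat.{u} A)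
    {k : ℕ} (a : Fin k → ℕ) (m : Fin k → M) (ha : ∑ i, a i = d) : (ferrandFunctor d f).obj M :=
  letI : Algebra R A := f.toAlgebra
  letI : Module R M := Module.compHom M f
  FerrandNorm.mk (R := R) A a m ha

/-- The full subcategory of the category of affine morphisms on the finite locally free
morphisms of constant rank `d`. -/
def flf (S : Scheme.{u}) (d : ℕ) : Subcat S where
  obj h := IsFinite h.hom ∧ Flat h.hom ∧ LocallyOfFinitePresentation h.hom ∧
    ∀ t : h.base.left, h.hom.finrank t = d
  hom _ := True
  id_mem _ _ := trivial
  comp_mem _ _ _ _ := trivial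

/-- Ferrand's norm functors `N_{O(U')/O(U)}` for finite locally free `U' ⟶ U` of rank `d`
with `U` affine. -/
def ferrandFunctors (S : Scheme.{u}) (d : ℕ) : (flf S d).Functors :=
  fun h => ferrandFunctor d h.val.hom.appTop.hom

/-- The base change isomorphisms `θ` are the ones given by
`s ⊗ γ^{a_1}(m_1) ⋯ γ^{a_k}(m_k) ↦ s γ^{a_1}(1 ⊗ m_1) ⋯ γ^{a_k}(1 ⊗ m_k)`. -/
def IsFerrandBaseChange (S : Scheme.{u}) (d : ℕ)
    (B : BaseChange (flf S d) (ferrandFunctors S d)) : Prop :=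
  ∀ (k h : (flf S d).Aff) (D : k.val ⟶ h.val) (M : ModuleCat.{u} Γ(h.val.total, ⊤)) (n : ℕ)
    (a : Fin n → ℕ) (m : Fin n → M) (ha : ∑ i, a i = d) (s : Γ(k.val.base.left, ⊤)),
    (B.θ D).hom.app M
      (s ⊗ₜ[_, D.f.left.appTop.hom] ferrandMk h.val.hom.appTop.hom M a m ha :
        (ModuleCat.extendScalars.{u, u, u} D.f.left.appTop.hom).obj
          ((ferrandFunctors S d h).obj M)) =
      s • (ferrandMk k.val.hom.appTop.hom
        ((ModuleCat.extendScalars.{u, u, u} D.g.appTop.hom).obj M) a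
          (fun i => (1 : Γ(k.val.total, ⊤)) ⊗ₜ[_, D.g.appTop.hom] m i) ha :
        (ferrandFunctors S d k).obj ((ModuleCat.extendScalars.{u, u, u} D.g.appTop.hom).obj M))

end

end NormStack

/-!
A quasi-coherent module on the big fppf site of `X` is the same as a family of modules on the affine
schemes over `X` whose restriction maps are base changes. In one direction, a presentation over a
covering shows that sections over the members are base changes, and faithfully flat descent carries
this over to all affine schemes (`isBC_of_isQCoh`). In the other direction, such a family satisfies
the sheaf condition for finite affine coverings by the exactness of the Amitsur complex
(`FFFamily.exists_eq`) and thus for all coverings (`LocMod.Cartesian.isSheaf`). It extends uniquely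
to a sheaf on all schemes, whose sections are the compatible families of sections over affine
schemes; these form small modules, since a single affine covering determines them
(`LocMod.exists_extension`). The extension is quasi-coherent, with all sections as generators and
all relations between them (`isQCoh_of_isBC`).

Given local functors `F` with base change isomorphisms `θ`, the transition maps
`F(ρ) ∘ θ ∘ (Id ⊗ 1)` are base changes because `ρ` and `θ` are isomorphisms, and the two
compatibilities of `θ` say that these maps are unital and transitive. Hence the local functors
assemble to functors between quasi-coherent modules (`exists_assembly`, `exists_isAssembledFrom`,
`exists_assembled_functor`). Natural isomorphisms and the functoriality of the resulting morphism of
stacks can be checked on sections over a family of affine schemes which covers all schemes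
(`exists_natIso`, `assembles`). For a fibered subcategory `I` and `T' ⟶ T` in `I`, such a family is
given by the affine base changes of `T' ⟶ T` in `I`.

That quasi-coherent modules form a stack amounts to gluing linear maps and modules along fppf
coverings (`exists_descended_map`, `exists_descended_module`). The schemes over the members of a
covering are a family which covers all schemes, so that both follow from the extension of sheaves
described above. A stack of affine morphisms with modules on their sources is treated in the same
way, as the sources form a covering as well (`QCohTot.isStack`, `QCohI.isStack`).

For finite locally free morphisms, the functions on the given affine schemes form a sheaf of
algebras on the schemes over the members of a covering. Its extension is a quasi-coherent algebra, and the
spectra of its sections over the affine open subschemes of the base are glued to a scheme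
(`CartFam.exists_descent`). This scheme is finite locally free of the same rank, where finiteness is
obtained from universal closedness: affine universally closed morphisms are integral
(`IsFppfCov.finite_locally_free`, `isStack_flf`).

Finally, the norm functor has to commute with base change. The divided power algebra does, as maps
out of it are families of elements with the multiplication and addition rules of divided powers,
which are most easily extended to tensor products in terms of their generating series (`gamTensor`).
The relations which define the norm of `M` follow from the ones between generators of the algebra
and of `M` (`normRel_le`), because the coefficients of the norm and the products of divided powers
behave in the same way under linear substitutions (`normCoeff_sum`, `prod_dp_sum`). As generators
can be chosen before base change, the norm commutes with base change (`isBC_normSemi`), and the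
compatibilities of the isomorphisms hold because they hold on generators (`exists_ferrand_data`).
-/

namespace NormStack

noncomputable section

/-! ### Faithfully flat families and base change of modules -/

/-- A finite or infinite family of flat algebras `B k` over `A` which is jointly surjective on
prime spectra. -/
structure FFFamily {A : Type u} [CommRing A] {ι : Type u} (B : ι → Type u) [∀ k, CommRing (B k)]
    [∀ k, Algebra A (B k)] : Prop where
  flat : ∀ k, Module.Flat A (B k)
  surj : ∀ p : PrimeSpectrum A, ∃ k, ∃ q : PrimeSpectrum (B k),
    PrimeSpectrum.comap (algebraMap A (B k)) q = p

section FF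

variable {A : Type u} [CommRing A] {ι : Type u} {B : ι → Type u} [∀ k, CommRing (B k)]
  [∀ k, Algebra A (B k)]

/-- If `z ≠ 0`, the annihilator of `z` is contained in a maximal ideal, which lifts to some `B k`,
whereas `1 ⊗ z = 0` means by flatness that the annihilator generates the unit ideal of `B k`. -/
theorem FFFamily.eq_zero (hB : FFFamily (A := A) B) {Q : Type u} [AddCommGroup Q] [Module A Q]
    (z : Q) (hz : ∀ k, (1 : B k) ⊗ₜ[A] z = 0) : z = 0 := by
  by_contra hne
  let I : Ideal A := LinearMap.ker (LinearMap.toSpanSingleton A Q z)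
  have hI : I ≠ ⊤ := fun h => hne (by
    have : (1 : A) ∈ I := h ▸ Submodule.mem_top
    simpa [I, LinearMap.mem_ker] using this)
  obtain ⟨m, hm, hIm⟩ := Ideal.exists_le_maximal I hI
  obtain ⟨k, q, hq⟩ := hB.surj ⟨m, hm.isPrime⟩
  have := hB.flat k
  let j : (A ⧸ I) →ₗ[A] Q := Submodule.liftQ I (LinearMap.toSpanSingleton A Q z) le_rfl
  have hj : Function.Injective j := by
    rw [← LinearMap.ker_eq_bot]
    exact Submodule.ker_liftQ_eq_bot _ _ _ le_rfl
  have h1 : (1 : B k) ⊗ₜ[A] (Submodule.Quotient.mk (1 : A) : A ⧸ I) = 0 := by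
    apply Module.Flat.lTensor_preserves_injective_linearMap (M := B k) j hj
    rw [map_zero, LinearMap.lTensor_tmul]
    have e : j (Submodule.Quotient.mk (1 : A)) = z := by
      change LinearMap.toSpanSingleton A Q z 1 = z
      simp
    rw [e]
    exact hz k
  let c : B k ⊗[A] (A ⧸ I) →ₗ[A] (B k ⧸ I.map (algebraMap A (B k))) :=
    TensorProduct.lift (LinearMap.mk₂ A
      (fun b a => Ideal.Quotient.mk _ b * Ideal.quotientMap _ (algebraMap A (B k))
        Ideal.le_comap_map a)
      (by intros; simp [add_mul]) (by intros; simp [Algebra.smul_def, mul_assoc])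
      (by intros; simp [mul_add]) (by
        intro r b a
        rw [Algebra.smul_def r a, map_mul, Algebra.smul_def, mul_left_comm]
        rfl))
  have h2 := congrArg c h1
  rw [map_zero] at h2
  have h3 : (Ideal.Quotient.mk (I.map (algebraMap A (B k)))) 1 = 0 := by
    have : c ((1 : B k) ⊗ₜ[A] (Submodule.Quotient.mk (1 : A) : A ⧸ I)) =
      Ideal.Quotient.mk _ 1 * Ideal.quotientMap _ (algebraMap A (B k))
        Ideal.le_comap_map (Ideal.Quotient.mk I 1) := rfl
    rw [this] at h2
    simpa using h2
  rw [Ideal.Quotient.eq_zero_iff_mem] at h3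
  have h4 : I.map (algebraMap A (B k)) ≤ q.asIdeal := by
    rw [Ideal.map_le_iff_le_comap]
    refine hIm.trans (le_of_eq ?_)
    exact (congrArg PrimeSpectrum.asIdeal hq).symm
  exact q.isPrime.ne_top ((Ideal.eq_top_iff_one _).2 (h4 h3))

/-- A linear map is bijective if it is so after base change to a faithfully flat family. -/
theorem FFFamily.bijective (hB : FFFamily (A := A) B)
    {M N : Type u} [AddCommGroup M] [Module A M] [AddCommGroup N]
    [Module A N] (φ : M →ₗ[A] N) (h : ∀ k, Function.Bijective (φ.lTensor (B k))) :
    Function.Bijective φ := by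
  constructor
  · rw [injective_iff_map_eq_zero]
    intro z hz
    refine hB.eq_zero z fun k => (h k).1 ?_
    simp [hz]
  · intro n
    have : (Submodule.Quotient.mk n : N ⧸ LinearMap.range φ) = 0 := by
      refine hB.eq_zero _ fun k => ?_
      obtain ⟨y, hy⟩ := (h k).2 ((1 : B k) ⊗ₜ n)
      have := congrArg ((LinearMap.range φ).mkQ.lTensor (B k)) hy
      rw [← LinearMap.comp_apply, ← LinearMap.lTensor_comp,
        LinearMap.range_mkQ_comp, LinearMap.lTensor_zero, LinearMap.lTensor_tmul] at this
      exact this.symm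
    obtain ⟨m, hm⟩ := (Submodule.Quotient.mk_eq_zero _).1 this
    exact ⟨m, hm⟩

/-- Descent of elements along a finite faithfully flat family: the element `x` of `∏ i, N i` becomes
zero in the quotient by the image of `M`, as this holds after base change to each `B k`, where `x`
is the image of `x k`. -/
theorem FFFamily.exists_eq (hB : FFFamily (A := A) B) [Finite ι]
    {M : Type u} [AddCommGroup M] [Module A M] {N : ι → Type u}
    [∀ i, AddCommGroup (N i)] [∀ i, Module A (N i)] [∀ i, Module (B i) (N i)]
    [∀ i, IsScalarTower A (B i) (N i)] (σ : ∀ i, M →ₗ[A] N i) (hσ : ∀ i, IsBaseChange (B i) (σ i))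
    {N₂ : ι → ι → Type u} [∀ i j, AddCommGroup (N₂ i j)] [∀ i j, Module A (N₂ i j)]
    [∀ i j, Module (B i) (N₂ i j)] [∀ i j, IsScalarTower A (B i) (N₂ i j)]
    (p : ∀ i j, N i →ₗ[B i] N₂ i j) (q : ∀ i j, N j →ₗ[A] N₂ i j)
    (hq : ∀ i j, IsBaseChange (B i) (q i j))
    (hpq : ∀ i j m, p i j (σ i m) = q i j (σ j m)) (x : ∀ i, N i)
    (hx : ∀ i j, p i j (x i) = q i j (x j)) : ∃ m, ∀ i, σ i m = x i := by
  classical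
  have := Fintype.ofFinite ι
  let T' : M →ₗ[A] (∀ i, N i) := LinearMap.pi σ
  have key : (Submodule.Quotient.mk x : (∀ i, N i) ⧸ LinearMap.range T') = 0 := by
    refine hB.eq_zero _ fun k => ?_
    have hbc := IsBaseChange.pi (S := B k) (fun i => q k i) (fun i => hq k i)
    have : (1 : B k) ⊗ₜ[A] x = T'.lTensor (B k) ((hσ k).equiv.symm (x k)) := by
      apply hbc.equiv.injective
      obtain ⟨y, hy⟩ := (hσ k).equiv.surjective (x k)
      rw [← hy, LinearEquiv.symm_apply_apply, IsBaseChange.equiv_tmul, one_smul]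
      have e : ∀ y : B k ⊗[A] M, hbc.equiv (T'.lTensor (B k) y) =
          fun i => p k i ((hσ k).equiv y) := by
        intro y
        induction y with
        | zero => simp; rfl
        | add a b ha hb => rw [map_add, map_add, ha, hb]; ext i; simp
        | tmul b m =>
          rw [LinearMap.lTensor_tmul, IsBaseChange.equiv_tmul, IsBaseChange.equiv_tmul]
          ext i
          simp [T', hpq]
      rw [e, hy]
      ext i
      exact (hx k i).symm
    have h2 := congrArg ((LinearMap.range T').mkQ.lTensor (B k)) this
    rw [← LinearMap.comp_apply, ← LinearMap.lTensor_comp,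
        LinearMap.range_mkQ_comp, LinearMap.lTensor_zero, LinearMap.lTensor_tmul] at h2
    exact h2
  obtain ⟨m, hm⟩ := (Submodule.Quotient.mk_eq_zero _).1 key
  exact ⟨m, fun i => congrFun hm i⟩

end FF

/-- Let `E` be the equalizer of `p, q : N ⇉ P` and let `E'` be contained in the equalizer of
`p', q' : N' ⇉ P'`, where `N'` and `P'` arise from `N` and `P` by a flat base change. Then so does
`E'` from `E`. -/
theorem isBaseChange_of_equalizer {A B : Type u} [CommRing A] [CommRing B] [Algebra A B]
    [Module.Flat A B] {E N P E' N' P' : Type u} [AddCommGroup E] [AddCommGroup N] [AddCommGroup P]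
    [AddCommGroup E'] [AddCommGroup N'] [AddCommGroup P'] [Module A E] [Module A N] [Module A P]
    [Module A E'] [Module A N'] [Module A P'] [Module B E'] [Module B N'] [Module B P']
    [IsScalarTower A B E'] [IsScalarTower A B N'] [IsScalarTower A B P']
    (i : E →ₗ[A] N) (p q : N →ₗ[A] P) (hi : Function.Injective i)
    (hpq : ∀ x, p x = q x ↔ x ∈ LinearMap.range i)
    (i' : E' →ₗ[B] N') (p' q' : N' →ₗ[B] P') (hi' : Function.Injective i')
    (hpq' : ∀ x, p' (i' x) = q' (i' x)) (e : E →ₗ[A] E') (n : N →ₗ[A] N') (r : P →ₗ[A] P')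
    (hn : IsBaseChange B n) (hr : IsBaseChange B r) (hie : ∀ x, i' (e x) = n (i x))
    (hp : ∀ x, p' (n x) = r (p x)) (hq : ∀ x, q' (n x) = r (q x)) : IsBaseChange B e := by
  obtain ⟨el, hel⟩ : ∃ el : B ⊗[A] E →ₗ[B] E', ∀ b x, el (b ⊗ₜ x) = b • e x :=
    ⟨TensorProduct.AlgebraTensorModule.lift (LinearMap.toSpanSingleton B (E →ₗ[A] E') e),
      fun b x => rfl⟩
  have hie2 : ∀ x : B ⊗[A] E, i' (el x) = hn.equiv (i.lTensor B x) := by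
    intro x
    induction x with
    | zero => simp
    | add a b ha hb => simp only [map_add, ha, hb]
    | tmul b m => simp [IsBaseChange.equiv_tmul, hie, hel]
  have hp2 : ∀ x, p' (hn.equiv x) = hr.equiv (p.lTensor B x) := by
    intro x
    induction x with
    | zero => simp
    | add a b ha hb => simp only [map_add, ha, hb]
    | tmul b m => simp [IsBaseChange.equiv_tmul, hp]
  have hq2 : ∀ x, q' (hn.equiv x) = hr.equiv (q.lTensor B x) := by
    intro x
    induction x with
    | zero => simp
    | add a b ha hb => simp only [map_add, ha, hb]
    | tmul b m => simp [IsBaseChange.equiv_tmul, hq]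
  have hex : Function.Exact i (p - q) := by
    intro x
    rw [LinearMap.sub_apply, sub_eq_zero, hpq]
    rfl
  have hex2 := Module.Flat.lTensor_exact B hex
  have hbij : Function.Bijective el := by
    constructor
    · rw [injective_iff_map_eq_zero]
      intro x hx
      have := hie2 x
      rw [hx, map_zero] at this
      apply Module.Flat.lTensor_preserves_injective_linearMap (M := B) i hi
      rw [map_zero]
      apply hn.equiv.injective
      rw [← this, map_zero]
    · intro e'
      obtain ⟨y, hy⟩ := hn.equiv.surjective (i' e')
      obtain ⟨x, rfl⟩ := (hex2 y).1 (by
        rw [LinearMap.lTensor_sub, LinearMap.sub_apply, sub_eq_zero]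
        apply hr.equiv.injective
        rw [← hp2, ← hq2, hy, hpq'])
      exact ⟨x, hi' ((hie2 x).trans hy)⟩
  exact IsBaseChange.of_equiv (LinearEquiv.ofBijective el hbij) fun x =>
    (hel 1 x).trans (one_smul _ _)

/-- The semilinear map `σ : M → N` over the ring homomorphism `f : A → B` exhibits `N` as
`B ⊗[A] M`. -/
def IsBC {A B : Type u} [CommRing A] [CommRing B] (f : A →+* B) {M N : Type u} [AddCommGroup M]
    [Module A M] [AddCommGroup N] [Module B N] (σ : M →+ N) : Prop :=
  ∃ h : ∀ (r : A) (m : M), σ (r • m) = f r • σ m,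
    letI : Algebra A B := f.toAlgebra
    letI : Module A N := Module.compHom N f
    haveI : IsScalarTower A B N := ⟨fun a b n => mul_smul (f a) b n⟩
    IsBaseChange B ({ σ with map_smul' := h } : M →ₗ[A] N)

section IsBC

variable {A B C D : Type u} [CommRing A] [CommRing B] [CommRing C] [CommRing D]

/-- For algebras, `IsBC` is Mathlib's `IsBaseChange`; the two `A`-module structures on `N` agree. -/
theorem isBC_iff [Algebra A B] {M N : Type u} [AddCommGroup M] [Module A M] [AddCommGroup N]
    [Module B N] [Module A N] [IsScalarTower A B N] (σ : M →ₗ[A] N) :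
    IsBC (algebraMap A B) σ.toAddMonoidHom ↔ IsBaseChange B σ := by
  rename_i i1 i2 i3 i4 i5 i6 i7
  have hs : ∀ (r : A) (m : M), σ.toAddMonoidHom (r • m) = algebraMap A B r • σ.toAddMonoidHom m :=
    fun r m => (σ.map_smul r m).trans (algebraMap_smul B r (σ m)).symm
  obtain rfl : i6 = Module.compHom N (algebraMap A B) := by
    apply Module.ext'
    intro r n
    exact (algebraMap_smul B r n).symm
  have e : (algebraMap A B).toAlgebra = i1 := Algebra.algebra_ext _ _ fun r => rfl
  unfold IsBC
  constructor
  · rintro ⟨_, h⟩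
    convert! h
    exact e.symm
  · intro h
    refine ⟨hs, ?_⟩
    convert! h

theorem IsBC.smul {f : A →+* B} {M N : Type u} [AddCommGroup M]
    [Module A M] [AddCommGroup N] [Module B N] {σ : M →+ N} (h : IsBC f σ) (r : A) (m : M) :
    σ (r • m) = f r • σ m := h.1 r m

theorem IsBC.comp {f : A →+* B} {g : B →+* C} {M N P : Type u} [AddCommGroup M]
    [Module A M] [AddCommGroup N] [Module B N] [AddCommGroup P] [Module C P] {σ : M →+ N}
    {τ : N →+ P} (hσ : IsBC f σ) (hτ : IsBC g τ) : IsBC (g.comp f) (τ.comp σ) := by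
  let : Algebra A B := f.toAlgebra
  let : Algebra B C := g.toAlgebra
  let : Algebra A C := (g.comp f).toAlgebra
  let : Module A N := Module.compHom N f
  let : Module B P := Module.compHom P g
  let : Module A P := Module.compHom P (g.comp f)
  have : IsScalarTower A B N := ⟨fun a b n => mul_smul (f a) b n⟩
  have : IsScalarTower B C P := ⟨fun a b n => mul_smul (g a) b n⟩
  have : IsScalarTower A C P := ⟨fun a b n => mul_smul (g (f a)) b n⟩
  have : IsScalarTower A B P := ⟨fun a b n => by
    change g (f a * b) • n = g (f a) • g b • n
    rw [map_mul, mul_smul]⟩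
  have : IsScalarTower A B C := IsScalarTower.of_algebraMap_eq fun x => rfl
  obtain ⟨h1, h2⟩ := hσ
  obtain ⟨h3, h4⟩ := hτ
  exact (isBC_iff (A := A) (B := C) _).2 (IsBaseChange.comp h2 h4)

theorem IsBC.of_comp {f : A →+* B} {g : B →+* C} {M N P : Type u} [AddCommGroup M]
    [Module A M] [AddCommGroup N] [Module B N] [AddCommGroup P] [Module C P] {σ : M →+ N}
    {τ : N →+ P} (hσ : IsBC f σ) (h3 : ∀ r m, τ (r • m) = g r • τ m)
    (hc : IsBC (g.comp f) (τ.comp σ)) : IsBC g τ := by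
  let : Algebra A B := f.toAlgebra
  let : Algebra B C := g.toAlgebra
  let : Algebra A C := (g.comp f).toAlgebra
  let : Module A N := Module.compHom N f
  let : Module B P := Module.compHom P g
  let : Module A P := Module.compHom P (g.comp f)
  have : IsScalarTower A B N := ⟨fun a b n => mul_smul (f a) b n⟩
  have : IsScalarTower B C P := ⟨fun a b n => mul_smul (g a) b n⟩
  have : IsScalarTower A C P := ⟨fun a b n => mul_smul (g (f a)) b n⟩
  have : IsScalarTower A B P := ⟨fun a b n => by
    change g (f a * b) • n = g (f a) • g b • n
    rw [map_mul, mul_smul]⟩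
  have : IsScalarTower A B C := IsScalarTower.of_algebraMap_eq fun x => rfl
  obtain ⟨h1, h2⟩ := hσ
  let τ' : N →ₗ[B] P := { τ with map_smul' := h3 }
  refine (isBC_iff (A := B) (B := C) τ').2 (IsBaseChange.of_comp h2 ?_)
  exact (isBC_iff (A := A) (B := C) ((τ'.restrictScalars A) ∘ₗ
    ({ σ with map_smul' := h1 } : M →ₗ[A] N))).1 hc

/-- A semilinear bijection over a ring isomorphism is a base change. -/
theorem IsBC.of_bijective {f : A →+* B} (hf : Function.Bijective f) {M N : Type u}
    [AddCommGroup M] [Module A M] [AddCommGroup N] [Module B N] {σ : M →+ N}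
    (h : ∀ r m, σ (r • m) = f r • σ m) (hσ : Function.Bijective σ) : IsBC f σ := by
  let : Algebra A B := f.toAlgebra
  let : Module A N := Module.compHom N f
  have : IsScalarTower A B N := ⟨fun a b n => mul_smul (f a) b n⟩
  let σ' : M ≃ₗ[A] N := LinearEquiv.ofBijective ({ σ with map_smul' := h } : M →ₗ[A] N) hσ
  let e : A ≃ₗ[A] B := LinearEquiv.ofBijective (Algebra.linearMap A B) hf
  let E : B ⊗[A] M ≃ₗ[A] N := (TensorProduct.congr e.symm σ') ≪≫ₗ TensorProduct.lid A N
  have hE : ∀ b m, E (b ⊗ₜ m) = b • σ m := by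
    intro b m
    obtain ⟨a, rfl⟩ := e.surjective b
    change (e.symm (e a)) • σ m = _
    rw [e.symm_apply_apply]
    rfl
  refine (isBC_iff (A := A) (B := B) σ'.toLinearMap).2 (IsBaseChange.of_equiv
    { E with map_smul' := ?_ } ?_)
  · intro b x
    induction x with
    | zero => simp
    | add x y hx hy =>
      rw [smul_add]
      refine (map_add E _ _).trans ?_
      refine (congrArg₂ (· + ·) hx hy).trans ?_
      exact (smul_add b _ _).symm.trans (congrArg (b • ·) (map_add E x y).symm)
    | tmul c m =>
      change E ((b * c) ⊗ₜ m) = b • E (c ⊗ₜ m)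
      rw [hE, hE, mul_smul]
  · intro x
    exact (hE 1 x).trans (one_smul _ _)

theorem IsBC.bijective {f : A →+* B} (hf : Function.Bijective f) {M N : Type u}
    [AddCommGroup M] [Module A M] [AddCommGroup N] [Module B N] {σ : M →+ N}
    (h : IsBC f σ) : Function.Bijective σ := by
  let : Algebra A B := f.toAlgebra
  let : Module A N := Module.compHom N f
  have : IsScalarTower A B N := ⟨fun a b n => mul_smul (f a) b n⟩
  obtain ⟨h1, h2⟩ := h
  let e : A ≃ₗ[A] B := LinearEquiv.ofBijective (Algebra.linearMap A B) hf
  let E : M ≃ₗ[A] N := (TensorProduct.lid A M).symm ≪≫ₗ (TensorProduct.congr e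
    (LinearEquiv.refl A M)) ≪≫ₗ h2.equiv.restrictScalars A
  have : (E : M → N) = σ := by
    ext m
    change h2.equiv (f 1 ⊗ₜ m) = σ m
    rw [IsBaseChange.equiv_tmul, map_one, one_smul]
    rfl
  rw [← this]
  exact E.bijective

/-- Base change of a `C`-module along `C → D`, where `D = B ⊗[A] C`, is base change along
`A → B`. -/
theorem IsBC.of_isPushout {f : A →+* B} {c : A →+* C} {d : B →+* D} {e : C →+* D}
    (h : IsPushout (CommRingCat.ofHom f) (CommRingCat.ofHom c) (CommRingCat.ofHom d)
      (CommRingCat.ofHom e)) {M N : Type u} [AddCommGroup M] [i1 : Module C M] [AddCommGroup N]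
    [i2 : Module D N] {σ : M →+ N} (hσ : IsBC e σ) :
    letI : Module A M := Module.compHom M c
    letI : Module B N := Module.compHom N d
    IsBC f σ := by
  let : Algebra A B := f.toAlgebra
  let : Algebra A C := c.toAlgebra
  let : Algebra B D := d.toAlgebra
  let : Algebra C D := e.toAlgebra
  let : Algebra A D := (d.comp f).toAlgebra
  have hw : d.comp f = e.comp c := congrArg CommRingCat.Hom.hom h.w
  have : IsScalarTower A B D := IsScalarTower.of_algebraMap_eq fun x => rfl
  have : IsScalarTower A C D := IsScalarTower.of_algebraMap_eq fun x => RingHom.congr_fun hw x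
  have hp : Algebra.IsPushout A B C D := CommRingCat.isPushout_iff_isPushout.1 h
  let : Module A M := Module.compHom M c
  let : Module B N := Module.compHom N d
  let : Module C N := Module.compHom N e
  let : Module A N := Module.compHom N (d.comp f)
  have : IsScalarTower A C M := ⟨fun a b n => mul_smul (c a) b n⟩
  have : IsScalarTower A B N := ⟨fun a b n => by
    change d (f a * b) • n = d (f a) • d b • n
    rw [map_mul, mul_smul]⟩
  have : IsScalarTower C D N := ⟨fun a b n => mul_smul (e a) b n⟩
  have : IsScalarTower B D N := ⟨fun a b n => mul_smul (d a) b n⟩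
  have : IsScalarTower A C N := ⟨fun a b n => by
    change e (c a * b) • n = d (f a) • e b • n
    rw [map_mul, mul_smul]
    exact congrArg (· • e b • n) (RingHom.congr_fun hw a).symm⟩
  obtain ⟨h1, h2⟩ := hσ
  let σ' : M →ₗ[C] N := { σ with map_smul' := h1 }
  refine (isBC_iff (A := A) (B := B) (σ'.restrictScalars A)).2 (IsBaseChange.of_equiv
    ((Algebra.IsPushout.cancelBaseChange A B C D M).symm ≪≫ₗ h2.equiv.restrictScalars B) ?_)
  intro x
  change h2.equiv ((Algebra.IsPushout.cancelBaseChange A B C D M).symm (1 ⊗ₜ x)) = σ x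
  rw [Algebra.IsPushout.cancelBaseChange_symm_tmul, map_one, IsBaseChange.equiv_tmul, one_smul]
  rfl

end IsBC

/-! ### Coverings of schemes by affine schemes -/

section Covers

variable {X : Scheme.{u}}

theorem IsFppfCover.ofArrows_mem {ι : Type u} {W : Over X} {Z : ι → Over X} {f : ∀ i, Z i ⟶ W}
    (h : IsFppfCover f) : Sieve.ofArrows Z f ∈ fppf X W := by
  rw [GrothendieckTopology.mem_over_iff, Sieve.overEquiv_ofArrows]
  apply Precoverage.generate_mem_toGrothendieck
  unfold Scheme.fppfPrecoverage
  rw [Scheme.ofArrows_mem_precoverage_iff]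
  refine ⟨fun x => ?_, fun i => ⟨h.flat i, h.lfp i⟩⟩
  obtain ⟨i, z, hz⟩ := h.surj x
  exact ⟨i, z, hz⟩

/-- Families of affine open subschemes, each contained in one of the open images of a covering. -/
theorem exists_affine_refinement {W : Over X} {R : Sieve W} (hR : R ∈ fppf X W) (w : W.left) :
    ∃ (Z : Over X) (f : Z ⟶ W), IsAffine Z.left ∧ Flat f.left ∧
      LocallyOfFinitePresentation f.left ∧ R f ∧ w ∈ Set.range f.left := by
  have : Scheme.fppfPrecoverage.{u}.HasIsos :=
    ⟨fun f _ => f.singleton_mem_fppfPrecoverage⟩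
  rw [GrothendieckTopology.mem_over_iff,
    Precoverage.mem_toGrothendieck_iff_of_isStableUnderComposition] at hR
  obtain ⟨Q, hQ, hle⟩ := hR
  obtain ⟨Y, g, hg, y, hy⟩ :=
    (Presieve.mem_comap_jointlySurjectivePrecoverage_iff Scheme.forget).1 hQ.1 w
  obtain ⟨V, hV, hyV, -⟩ := exists_isAffineOpen_mem_and_subset (X := Y) (x := y) (U := ⊤) trivial
  obtain ⟨h1, h2⟩ := hQ.2 hg
  have : IsAffine V.toScheme := hV
  refine ⟨Over.mk ((V.ι ≫ g) ≫ W.hom), Over.homMk (V.ι ≫ g) rfl, hV, ?_, ?_, ?_, ?_⟩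
  · change Flat (V.ι ≫ g); infer_instance
  · change LocallyOfFinitePresentation (V.ι ≫ g); infer_instance
  · have := hle _ _ hg
    rw [Sieve.overEquiv_iff] at this
    exact R.downward_closed this (Over.homMk (V := Over.mk (g ≫ W.hom)) V.ι
      (Category.assoc _ _ _).symm : Over.mk ((V.ι ≫ g) ≫ W.hom) ⟶ _)
  · exact ⟨⟨y, hyV⟩, hy⟩

theorem exists_affine_cover {W : Over X} {R : Sieve W} (hR : R ∈ fppf X W) :
    ∃ (ι : Type u) (Z : ι → Over X) (f : ∀ i, Z i ⟶ W), (∀ i, IsAffine (Z i).left) ∧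
      IsFppfCover f ∧ ∀ i, R (f i) := by
  choose Z f h1 h2 h3 h4 h5 using exists_affine_refinement hR
  exact ⟨W.left, Z, f, h1, ⟨h2, h3, fun w => ⟨w, h5 w⟩⟩, h4⟩

/-- As flat morphisms locally of finite presentation are open, finitely many of the members
of a covering suffice. -/
theorem exists_finite_affine_cover {W : Over X} [IsAffine W.left] {R : Sieve W}
    (hR : R ∈ fppf X W) :
    ∃ (ι : Type u) (_ : Finite ι) (Z : ι → Over X) (f : ∀ i, Z i ⟶ W),
      (∀ i, IsAffine (Z i).left) ∧ IsFppfCover f ∧ ∀ i, R (f i) := by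
  choose Z f h1 h2 h3 h4 h5 using exists_affine_refinement hR
  obtain ⟨t, ht⟩ := isCompact_univ.elim_nhds_subcover (fun w => Set.range (f w).left) fun w _ =>
    have := h2 w
    have := h3 w
    (f w).left.isOpenMap.isOpen_range.mem_nhds (h5 w)
  refine ⟨t, inferInstance, fun i => Z i, fun i => f i, fun i => h1 i,
    ⟨fun i => h2 i, fun i => h3 i, fun w => ?_⟩, fun i => h4 i⟩
  obtain ⟨i, hi, x, hx⟩ := Set.mem_iUnion₂.1 (ht.2 (Set.mem_univ w))
  exact ⟨⟨i, hi⟩, x, hx⟩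

theorem IsFppfCover.faithfullyFlat {ι : Type u} {W : Over X} {Z : ι → Over X}
    {f : ∀ i, Z i ⟶ W} (h : IsFppfCover f) (hW : IsAffine W.left)
    (hZ : ∀ i, IsAffine (Z i).left) :
    letI (i : ι) : Algebra Γ(W.left, ⊤) Γ((Z i).left, ⊤) := (f i).left.appTop.hom.toAlgebra
    FFFamily (A := Γ(W.left, ⊤)) fun i => Γ((Z i).left, ⊤) := by
  let (i : ι) : Algebra Γ(W.left, ⊤) Γ((Z i).left, ⊤) := (f i).left.appTop.hom.toAlgebra
  refine ⟨fun i => ?_, fun p => ?_⟩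
  · have := h.flat i
    have := hZ i
    exact (f i).left.flat_appTop
  · obtain ⟨w, rfl⟩ : ∃ w, W.left.toSpecΓ w = p := W.left.toSpecΓ.surjective p
    obtain ⟨i, z, rfl⟩ := h.surj w
    refine ⟨i, (Z i).left.toSpecΓ z, ?_⟩
    have := congrArg (fun k : (Z i).left ⟶ _ => k z) (Scheme.toSpecΓ_naturality (f i).left)
    dsimp only at this
    rw [Scheme.Hom.comp_apply, Scheme.Hom.comp_apply] at this
    exact this.symm

/-- The fibre product of `A` and `B` over `W`. -/
def fp {W A B : Over X} (f : A ⟶ W) (g : B ⟶ W) : Over X :=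
  Over.mk (pullback.fst f.left g.left ≫ A.hom)

/-- The first projection. -/
def fp1 {W A B : Over X} (f : A ⟶ W) (g : B ⟶ W) : fp f g ⟶ A := Over.homMk (pullback.fst _ _) rfl

/-- The second projection. -/
def fp2 {W A B : Over X} (f : A ⟶ W) (g : B ⟶ W) : fp f g ⟶ B :=
  Over.homMk (pullback.snd _ _) (by
    change pullback.snd f.left g.left ≫ B.hom = pullback.fst f.left g.left ≫ A.hom
    rw [← Over.w g, ← Over.w f, pullback.condition_assoc])

theorem fp_w {W A B : Over X} (f : A ⟶ W) (g : B ⟶ W) : fp1 f g ≫ f = fp2 f g ≫ g := by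
  ext
  exact pullback.condition

theorem fp_isPullback {W A B : Over X} (f : A ⟶ W) (g : B ⟶ W) :
    IsPullback (fp1 f g).left (fp2 f g).left f.left g.left := IsPullback.of_hasPullback _ _

instance {W A B : Over X} (f : A ⟶ W) (g : B ⟶ W) [IsAffine W.left] [IsAffine A.left]
    [IsAffine B.left] : IsAffine (fp f g).left := by
  unfold fp
  dsimp
  infer_instance

/-- The morphism into the fibre product given by morphisms to the factors. -/
def fpLift {W A B C : Over X} {f : A ⟶ W} {g : B ⟶ W} (a : C ⟶ A) (b : C ⟶ B)
    (h : a ≫ f = b ≫ g) : C ⟶ fp f g :=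
  Over.homMk (pullback.lift a.left b.left (congrArg (·.left) h)) (by
    change pullback.lift a.left b.left _ ≫ pullback.fst f.left g.left ≫ A.hom = C.hom
    rw [pullback.lift_fst_assoc, Over.w])

theorem fpLift_1 {W A B C : Over X} {f : A ⟶ W} {g : B ⟶ W} (a : C ⟶ A) (b : C ⟶ B)
    (h : a ≫ f = b ≫ g) : fpLift a b h ≫ fp1 f g = a := by
  ext
  exact pullback.lift_fst _ _ _

theorem fpLift_2 {W A B C : Over X} {f : A ⟶ W} {g : B ⟶ W} (a : C ⟶ A) (b : C ⟶ B)
    (h : a ≫ f = b ≫ g) : fpLift a b h ≫ fp2 f g = b := by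
  ext
  exact pullback.lift_snd _ _ _

theorem IsFppfCover.base_change {ι : Type u} {W : Over X} {Z : ι → Over X} {f : ∀ i, Z i ⟶ W}
    (h : IsFppfCover f) {V : Over X} (g : V ⟶ W) : IsFppfCover fun i => fp1 g (f i) := by
  refine ⟨fun i => ?_, fun i => ?_, fun v => ?_⟩
  · have := h.flat i
    exact inferInstanceAs (Flat (pullback.fst g.left (f i).left))
  · have := h.lfp i
    exact inferInstanceAs (LocallyOfFinitePresentation (pullback.fst g.left (f i).left))
  · obtain ⟨i, z, hz⟩ := h.surj (g.left v)
    obtain ⟨t, ht, -⟩ := Scheme.Pullback.exists_preimage_pullback v z hz.symm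
    exact ⟨i, t, ht⟩

/-- The objects `π e` cover every `X`-scheme. -/
def Dense {E : Type*} (π : E → Over X) : Prop :=
  ∀ W : Over X, ∃ (ι : Type u) (e : ι → E) (f : ∀ i, π (e i) ⟶ W),
    Sieve.ofArrows (fun i => π (e i)) f ∈ fppf X W

/-- A sieve is covering if it contains all morphisms from the objects `π e` that belong to a
covering sieve. -/
theorem Dense.mem {E : Type*} {π : E → Over X} (hπ : Dense π) {W : Over X} {R S : Sieve W}
    (hR : R ∈ fppf X W) (h : ∀ e (f : π e ⟶ W), R f → S f) : S ∈ fppf X W := by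
  refine (fppf X).transitive hR S fun Z f hf => ?_
  obtain ⟨ι, e, g, hg⟩ := hπ Z
  refine (fppf X).superset_covering ?_ hg
  rw [Sieve.ofArrows, Sieve.generate_le_iff]
  rintro _ _ ⟨i⟩
  exact h _ _ (R.downward_closed hf _)

/-- The affine `X`-schemes. -/
abbrev AffOver (X : Scheme.{u}) := { A : Over X // IsAffine A.left }

theorem dense_aff (X : Scheme.{u}) : Dense (Subtype.val : AffOver X → Over X) := fun W => by
  obtain ⟨ι, Z, f, h1, h2, -⟩ := exists_affine_cover ((fppf X).top_mem W)
  exact ⟨ι, fun i => ⟨Z i, h1 i⟩, f, h2.ofArrows_mem⟩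

end Covers

theorem IsBC.of_isPushout' {A B C D : CommRingCat.{u}} {f : A ⟶ B} {c : A ⟶ C} {d : B ⟶ D}
    {e : C ⟶ D} (h : IsPushout f c d e) {M N : Type u} [AddCommGroup M] [Module C M]
    [AddCommGroup N] [Module D N] {σ : M →+ N} (hσ : IsBC e.hom σ) :
    letI : Module A M := Module.compHom M c.hom
    letI : Module B N := Module.compHom N d.hom
    IsBC f.hom σ :=
  IsBC.of_isPushout (f := f.hom) (c := c.hom) (d := d.hom) (e := e.hom) h hσ

/-! ### Modules on families of schemes -/

/-- A presheaf of `O`-modules on the full subcategory of `X`-schemes on the objects `π e`. -/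
structure LocMod {X : Scheme.{u}} {E : Type*} (π : E → Over X) where
  /-- the sections over `π e` -/
  obj : E → Type u
  [ab : ∀ e, AddCommGroup (obj e)]
  [mod : ∀ e, Module Γ((π e).left, ⊤) (obj e)]
  /-- the restriction maps -/
  res : ∀ {e e' : E}, (π e' ⟶ π e) → obj e →+ obj e'
  res_smul : ∀ {e e' : E} (f : π e' ⟶ π e) (r : Γ((π e).left, ⊤)) (m : obj e),
    res f (r • m) = f.left.appTop.hom r • res f m
  res_id : ∀ {e : E} (m : obj e), res (𝟙 (π e)) m = m
  res_comp : ∀ {e e' e'' : E} (f : π e' ⟶ π e) (g : π e'' ⟶ π e') (m : obj e),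
    res (g ≫ f) m = res g (res f m)

attribute [instance] LocMod.ab LocMod.mod

instance {X : Scheme.{u}} (P : LocMod (fun W : Over X => W)) (W : Over X) :
    Module Γ(W.left, ⊤) (P.obj W) := P.mod W

namespace LocMod

variable {X : Scheme.{u}} {E : Type*} {π : E → Over X}

/-- Restriction to a subfamily. -/
def comap (P : LocMod π) {E' : Type*} (j : E' → E) : LocMod (fun e => π (j e)) where
  obj e := P.obj (j e)
  res f := P.res f
  res_smul f r m := P.res_smul f r m
  res_id m := P.res_id m
  res_comp f g m := P.res_comp f g m

/-- Linear maps of presheaves of modules. -/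
@[ext]
structure Hom (P Q : LocMod π) where
  /-- the linear maps on sections -/
  app : ∀ e, P.obj e →ₗ[Γ((π e).left, ⊤)] Q.obj e
  nat : ∀ {e e' : E} (f : π e' ⟶ π e) (m : P.obj e), app e' (P.res f m) = Q.res f (app e m)

/-- The fppf sheaf condition, for coverings of the objects `π e` by objects of the same kind. -/
def IsSheaf (P : LocMod π) : Prop :=
  ∀ (e : E) (R : Sieve (π e)), R ∈ fppf X (π e) →
    ∀ x : ∀ (e' : E) (f : π e' ⟶ π e), R f → P.obj e',
      (∀ (e' e'' : E) (f : π e' ⟶ π e) (hf : R f) (g : π e'' ⟶ π e'),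
        P.res g (x e' f hf) = x e'' (g ≫ f) (R.downward_closed hf g)) →
      ∃! m : P.obj e, ∀ (e' : E) (f : π e' ⟶ π e) (hf : R f), P.res f m = x e' f hf

/-- All restriction maps are base changes. -/
def Cartesian (P : LocMod π) : Prop :=
  ∀ (e e' : E) (f : π e' ⟶ π e), IsBC f.left.appTop.hom (P.res f)

theorem IsSheaf.sep {P : LocMod π} (h : P.IsSheaf) {e : E} {R : Sieve (π e)} (hR : R ∈ fppf X (π e))
    {m m' : P.obj e} (hm : ∀ (e' : E) (f : π e' ⟶ π e), R f → P.res f m = P.res f m') : m = m' := by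
  obtain ⟨_, -, h2⟩ := h e R hR (fun e' f _ => P.res f m) fun e' e'' f _ g =>
    (P.res_comp f g m).symm
  exact (h2 m fun _ _ _ => rfl).trans (h2 m' fun e' f hf => (hm e' f hf).symm).symm

/-- The locus where two sections agree. -/
def eqSieve (P : LocMod (fun W : Over X => W)) {W : Over X} (m m' : P.obj W) : Sieve W where
  arrows Z f := P.res (e := W) (e' := Z) f m = P.res (e := W) (e' := Z) f m'
  downward_closed {Y Z f} hf g :=
    (P.res_comp (e := W) (e' := Y) (e'' := Z) f g m).trans
      ((congrArg _ hf).trans (P.res_comp (e := W) (e' := Y) (e'' := Z) f g m').symm)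

theorem IsSheaf.sep_dense {P : LocMod (fun W : Over X => W)} (h : P.IsSheaf) (hπ : Dense π)
    {W : Over X} {R : Sieve W} (hR : R ∈ fppf X W) {m m' : P.obj W}
    (hm : ∀ (e : E) (f : π e ⟶ W), R f →
      P.res (e := W) (e' := π e) f m = P.res (e := W) (e' := π e) f m') : m = m' :=
  h.sep (R := P.eqSieve m m') (hπ.mem hR hm) fun _ _ hf => hf

/-- Gluing of compatible families of sections over the objects of a dense family. -/
theorem IsSheaf.glue_dense {P : LocMod (fun W : Over X => W)} (h : P.IsSheaf) (hπ : Dense π)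
    {W : Over X} {R : Sieve W} (hR : R ∈ fppf X W)
    (x : ∀ (e : E) (f : π e ⟶ W), R f → P.obj (π e))
    (hx : ∀ (e e' : E) (f : π e ⟶ W) (hf : R f) (g : π e' ⟶ π e),
      P.res (e := π e) (e' := π e') g (x e f hf) = x e' (g ≫ f) (R.downward_closed hf g)) :
    ∃ m : P.obj W, ∀ (e : E) (f : π e ⟶ W) (hf : R f),
      P.res (e := W) (e' := π e) f m = x e f hf := by
  let S : Sieve W :=
    { arrows := fun Z g => ∃ (e : E) (a : Z ⟶ π e) (f : π e ⟶ W), R f ∧ a ≫ f = g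
      downward_closed := by
        rintro Y Z _ ⟨e, a, f, hf, rfl⟩ b
        exact ⟨e, b ≫ a, f, hf, Category.assoc _ _ _⟩ }
  have hS : S ∈ fppf X W := hπ.mem hR fun e f hf => ⟨e, 𝟙 _, f, hf, Category.id_comp _⟩
  have key : ∀ (Z : Over X) (e e' : E) (a : Z ⟶ π e) (a' : Z ⟶ π e') (f : π e ⟶ W)
      (f' : π e' ⟶ W) (hf : R f) (hf' : R f'), a ≫ f = a' ≫ f' →
      P.res (e := π e) (e' := Z) a (x e f hf) = P.res (e := π e') (e' := Z) a' (x e' f' hf') := by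
    intro Z e e' a a' f f' hf hf' haa
    refine h.sep_dense hπ ((fppf X).top_mem Z) fun e'' b _ => ?_
    refine (P.res_comp (e := π e) (e' := Z) (e'' := π e'') a b _).symm.trans ?_
    refine Eq.trans ?_ (P.res_comp (e := π e') (e' := Z) (e'' := π e'') a' b _)
    refine (hx _ _ _ hf _).trans (Eq.trans ?_ (hx _ _ _ hf' _).symm)
    congr 1
    rw [Category.assoc, Category.assoc, haa]
  choose e a f hf hw using fun (Z : Over X) (g : Z ⟶ W) (hg : S g) => hg
  obtain ⟨m, hm, -⟩ := h W S hS
    (fun Z g hg => P.res (e := π (e Z g hg)) (e' := Z) (a Z g hg) (x _ _ (hf Z g hg))) (by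
      intro Z Z' g hg b
      refine (P.res_comp (e := π (e Z g hg)) (e' := Z) (e'' := Z') _ b _).symm.trans ?_
      apply key
      exact (Category.assoc _ _ _).trans ((congrArg (b ≫ ·) (hw Z g hg)).trans (hw Z' _ _).symm))
  refine ⟨m, fun e' f' hf' => ?_⟩
  have hg : S f' := ⟨e', 𝟙 _, f', hf', Category.id_comp _⟩
  refine (hm _ f' hg).trans ?_
  refine Eq.trans ?_ (P.res_id (e := π e') (x e' f' hf'))
  apply key
  rw [hw]
  exact (Category.id_comp _).symm

theorem IsSheaf.comap_dense {P : LocMod (fun W : Over X => W)} (h : P.IsSheaf) (hπ : Dense π) :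
    (P.comap π).IsSheaf := by
  intro e R hR x hx
  obtain ⟨m, hm⟩ := h.glue_dense hπ hR x hx
  exact ⟨m, hm, fun m' hm' => h.sep_dense hπ hR fun e' f hf =>
    (hm' e' f hf).trans (hm e' f hf).symm⟩

/-- The descent of elements along faithfully flat maps shows that a cartesian presheaf of modules
on the affine `X`-schemes is an fppf sheaf. -/
theorem Cartesian.isSheaf {P : LocMod (Subtype.val : AffOver X → Over X)} (hP : P.Cartesian) :
    P.IsSheaf := by
  have sep : ∀ (W : AffOver X) {ι : Type u} {Z : ι → AffOver X} {f : ∀ i, (Z i).1 ⟶ W.1}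
      (_ : IsFppfCover f) (m m' : P.obj W), (∀ i, P.res (f i) m = P.res (f i) m') → m = m' := by
    intro W ι Z f hf m m' hm
    have ff := hf.faithfullyFlat W.2 fun i => (Z i).2
    rw [← sub_eq_zero]
    let (i : ι) : Algebra Γ(W.1.left, ⊤) Γ((Z i).1.left, ⊤) := (f i).left.appTop.hom.toAlgebra
    refine ff.eq_zero _ fun i => ?_
    obtain ⟨h1, h2⟩ := hP _ _ (f i)
    let : Module Γ(W.1.left, ⊤) (P.obj (Z i)) := Module.compHom _ (f i).left.appTop.hom
    have : IsScalarTower Γ(W.1.left, ⊤) Γ((Z i).1.left, ⊤) (P.obj (Z i)) :=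
      ⟨fun a b n => mul_smul ((f i).left.appTop.hom a) b n⟩
    apply h2.equiv.injective
    rw [IsBaseChange.equiv_tmul, map_zero, one_smul]
    change P.res (f i) (m - m') = 0
    rw [map_sub, hm, sub_self]
  intro W R hR x hx
  have hW := W.2
  obtain ⟨ι, hι, Z', f, hf, hRf⟩ : ∃ (ι : Type u) (_ : Finite ι) (Z : ι → AffOver X)
      (f : ∀ i, (Z i).1 ⟶ W.1), IsFppfCover f ∧ ∀ i, R (f i) := by
    obtain ⟨ι, hι, Z, f, hZ, hf, hRf⟩ := exists_finite_affine_cover hR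
    exact ⟨ι, hι, fun i => ⟨Z i, hZ i⟩, f, hf, hRf⟩
  let W₂ (i j : ι) : AffOver X := ⟨fp (f i) (f j),
    have := (Z' i).2
    have := (Z' j).2
    inferInstance⟩
  let p (i j : ι) : (W₂ i j).1 ⟶ (Z' i).1 := fp1 (f i) (f j)
  let q (i j : ι) : (W₂ i j).1 ⟶ (Z' j).1 := fp2 (f i) (f j)
  have hpq (i j : ι) : p i j ≫ f i = q i j ≫ f j := fp_w _ _
  have ff := hf.faithfullyFlat (Z := fun i => (Z' i).1) W.2 fun i => (Z' i).2
  obtain ⟨m, hm⟩ : ∃ m : P.obj W, ∀ i, P.res (e' := Z' i) (f i) m = x (Z' i) (f i) (hRf i) := by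
    let (i : ι) : Algebra Γ(W.1.left, ⊤) Γ((Z' i).1.left, ⊤) := (f i).left.appTop.hom.toAlgebra
    let (i : ι) : Module Γ(W.1.left, ⊤) (P.obj (Z' i)) := Module.compHom _ (f i).left.appTop.hom
    have (i : ι) : IsScalarTower Γ(W.1.left, ⊤) Γ((Z' i).1.left, ⊤) (P.obj (Z' i)) :=
      ⟨fun a b n => mul_smul ((f i).left.appTop.hom a) b n⟩
    let (i j : ι) : Module Γ((Z' i).1.left, ⊤) (P.obj (W₂ i j)) :=
      Module.compHom _ (p i j).left.appTop.hom
    let (i j : ι) : Module Γ(W.1.left, ⊤) (P.obj (W₂ i j)) :=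
      Module.compHom _ (f i).left.appTop.hom
    have (i j : ι) : IsScalarTower Γ(W.1.left, ⊤) Γ((Z' i).1.left, ⊤) (P.obj (W₂ i j)) :=
      ⟨fun a b n => mul_smul ((f i).left.appTop.hom a) b n⟩
    have (i : ι) := (Z' i).2
    have hpo (i j : ι) : IsPushout (f i).left.appTop (f j).left.appTop (p i j).left.appTop
        (q i j).left.appTop := isPushout_appTop_of_isPullback (fp_isPullback (f i) (f j))
    refine ff.exists_eq (N := fun i => P.obj (Z' i)) (N₂ := fun i j => P.obj (W₂ i j))
      (fun i => { P.res (e' := Z' i) (f i) with map_smul' := fun r m => P.res_smul (f i) r m })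
      (fun i => ?_)
      (fun i j => { P.res (p i j) with map_smul' := fun r m => P.res_smul (p i j) r m })
      (fun i j => { P.res (q i j) with map_smul' := fun r m => ?_ }) (fun i j => ?_)
      (fun i j m => ?_) (fun i => x (Z' i) (f i) (hRf i)) (fun i j => ?_)
    · exact (hP _ (Z' i) (f i)).2
    · refine (P.res_smul (q i j) _ m).trans ?_
      have := RingHom.congr_fun (congrArg CommRingCat.Hom.hom (hpo i j).w) r
      exact congrArg (· • P.res (q i j) m) this.symm
    · have h := IsBC.of_isPushout' (hpo i j) (M := P.obj (Z' j))
        (N := P.obj (W₂ i j)) (hP _ _ (q i j))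
      exact h.2
    · refine (P.res_comp (e' := Z' i) (f i) (p i j) m).symm.trans ?_
      refine Eq.trans ?_ (P.res_comp (e' := Z' j) (f j) (q i j) m)
      rw [hpq]
    · refine (hx _ _ _ (hRf i) (p i j)).trans (Eq.trans ?_ (hx _ _ _ (hRf j) (q i j)).symm)
      congr 1
      exact hpq i j
  refine ⟨m, fun V g hg => ?_, fun m' hm' => ?_⟩
  · have hV := V.2
    refine sep V (Z := fun i => ⟨fp g (f i), have := (Z' i).2; inferInstance⟩) (hf.base_change g) _ _ fun i => ?_
    let V' : AffOver X := ⟨fp g (f i), have := (Z' i).2; inferInstance⟩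
    refine (P.res_comp g (e'' := V') (fp1 g (f i)) m).symm.trans ?_
    refine Eq.trans ?_ (hx _ V' _ hg (fp1 g (f i))).symm
    have e := (congrArg (P.res (e := Z' i) (e' := V') (fp2 g (f i))) (hm i)).trans
      (hx (Z' i) V' (f i) (hRf i) (fp2 g (f i)))
    rw [← P.res_comp] at e
    convert! e using 2
    · rw [fp_w]
    · exact fp_w _ _
  · refine sep W (Z := Z') hf _ _ fun i => ?_
    exact (hm' _ _ (hRf i)).trans (hm i).symm

end LocMod

/-! ### Sheaves of modules and their restrictions to dense families -/

section PreModLoc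

variable {X : Scheme.{u}}

/-- A presheaf of `O`-modules, considered as a family of modules. -/
def toLoc (M : PreMod X) : LocMod (fun W : Over X => W) where
  obj W := M.obj (op W)
  ab W := inferInstanceAs (AddCommGroup (M.obj (op W)))
  mod W := inferInstanceAs (Module ((structureSheaf X).obj (op W)) (M.obj (op W)))
  res f := (M.presheaf.map (Quiver.Hom.op (V := Over X) f)).hom
  res_smul f r m := M.map_smul (Quiver.Hom.op (V := Over X) f) r m
  res_id m := ConcreteCategory.congr_hom (M.presheaf.map_id _) m
  res_comp f g m := ConcreteCategory.congr_hom (M.presheaf.map_comp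
    (Quiver.Hom.op (V := Over X) f) (Quiver.Hom.op (V := Over X) g)) m

namespace LocMod

/-- The presheaf of modules given by its restriction maps. -/
def toPre (P : LocMod (fun W : Over X => W)) : PreMod X :=
  let A : (Over X)ᵒᵖ ⥤ AddCommGrpCat.{u} :=
    { obj := fun W => AddCommGrpCat.of (P.obj W.unop)
      map := fun {V W} f => AddCommGrpCat.ofHom (P.res (e := V.unop) (e' := W.unop) f.unop)
      map_id := fun V => by
        ext m
        exact P.res_id (e := V.unop) m
      map_comp := fun {U V W} f g => by
        ext m
        exact P.res_comp (e := U.unop) (e' := V.unop) (e'' := W.unop) f.unop g.unop m }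
  let (W : (Over X)ᵒᵖ) : Module ((structureSheaf X).obj W) (A.obj W) := P.mod W.unop
  PresheafOfModules.ofPresheaf (R := structureSheaf X) A
    fun {V W} f r m => P.res_smul (e := V.unop) (e' := W.unop) f.unop r m

/-- The linear map of presheaves of modules given by its components. -/
def Hom.toPre {M N : PreMod X} (α : Hom (toLoc M) (toLoc N)) : M ⟶ N :=
  PresheafOfModules.homMk
    { app := fun W => AddCommGrpCat.ofHom (α.app W.unop).toAddMonoidHom
      naturality := fun V W f => by
        ext m
        exact α.nat (e := V.unop) (e' := W.unop) f.unop m }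
    fun W r m => (α.app W.unop).map_smul r m

end LocMod

/-- The sheaf condition for families of linear maps, which is stated for elements, agrees with the
one for presheaves of abelian groups, whose sections are tested on arbitrary groups. -/
theorem isSheaf_toLoc {M : PreMod X} :
    (toLoc M).IsSheaf ↔ Presheaf.IsSheaf (fppf X) M.presheaf := by
  constructor
  · intro h A W R hR x hx
    have h' := h W R hR
    choose m hm hm2 using fun a : A => h'
      (fun V f hf => (x (Y := V) f hf).hom a)
      (fun V V' f hf g => by
        have := hx (Y₁ := V) (Y₂ := V') (Z := V') g (𝟙 V') hf (R.downward_closed hf g)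
          (Category.id_comp _).symm
        have := ConcreteCategory.congr_hom this a
        refine this.trans ?_
        exact (toLoc M).res_id (e := V') _)
    refine ⟨AddCommGrpCat.ofHom
      { toFun := m
        map_zero' := ?_
        map_add' := fun a b => ?_ }, fun V f hf => ?_, fun y hy => ?_⟩
    · exact (hm2 0 0 fun V f hf => (map_zero ((toLoc M).res (e := W) (e' := V) f)).trans
        (map_zero (x (Y := V) f hf).hom).symm).symm
    · refine (hm2 (a + b) (m a + m b) fun V f hf => ?_).symm
      refine (map_add ((toLoc M).res (e := W) (e' := V) f) (m a) (m b)).trans ?_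
      exact (congrArg₂ (· + ·) (hm a V f hf) (hm b V f hf)).trans (map_add (x f hf).hom a b).symm
    · exact AddCommGrpCat.hom_ext (AddMonoidHom.ext fun a => hm a V f hf)
    · exact AddCommGrpCat.hom_ext (AddMonoidHom.ext fun a =>
        hm2 a _ fun V f hf => ConcreteCategory.congr_hom (hy f hf) a)
  · intro h W R hR x hx
    let j : ∀ (V : Over X), M.presheaf.obj (op V) →
        (AddCommGrpCat.of (ULift.{u} ℤ) ⟶ M.presheaf.obj (op V)) := fun V m =>
      AddCommGrpCat.ofHom ((zmultiplesHom (M.presheaf.obj (op V)) m).comp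
        AddEquiv.ulift.toAddMonoidHom)
    have j1 : ∀ V m, (j V m).hom ⟨1⟩ = m := fun V m => one_zsmul m
    have ext1 : ∀ (V : Over X) (a b : AddCommGrpCat.of (ULift.{u} ℤ) ⟶ M.presheaf.obj (op V)),
        a.hom ⟨1⟩ = b.hom ⟨1⟩ → a = b := by
      intro V a b hab
      refine AddCommGrpCat.hom_ext (AddMonoidHom.ext fun z => ?_)
      have hz : z = z.down • (⟨1⟩ : ULift.{u} ℤ) := ULift.ext _ _ (mul_one z.down).symm
      rw [hz]
      exact (map_zsmul a.hom _ _).trans ((congrArg _ hab).trans (map_zsmul b.hom _ _).symm)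
    obtain ⟨m, hm, hm2⟩ := h (AddCommGrpCat.of (ULift.{u} ℤ)) R hR
      (fun V f hf => j V (x V f hf)) (by
        intro V V' V'' g g' f f' hf hf' e
        apply ext1
        change (toLoc M).res (e := V) (e' := V'') g ((j V _).hom ⟨1⟩) =
          (toLoc M).res (e := V') (e' := V'') g' ((j V' _).hom ⟨1⟩)
        refine (congrArg _ (j1 V _)).trans (Eq.trans ?_ (congrArg _ (j1 V' _)).symm)
        refine (hx V V'' f hf g).trans (Eq.trans ?_ (hx V' V'' f' hf' g').symm)
        congr 1)
    refine ⟨m.hom ⟨1⟩, fun V f hf => ?_, fun m' hm' => ?_⟩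
    · exact (ConcreteCategory.congr_hom (hm f hf) ⟨1⟩).trans (j1 _ _)
    · refine (j1 W m').symm.trans (congrArg (fun k : AddCommGrpCat.of (ULift.{u} ℤ) ⟶
        M.presheaf.obj (op W) => k.hom ⟨1⟩) (hm2 (j W m') fun V f hf => ?_))
      apply ext1
      refine Eq.trans ?_ (j1 _ _).symm
      refine Eq.trans ?_ (hm' V f hf)
      exact congrArg ((toLoc M).res (e := W) (e' := V) f) (j1 _ _)

end PreModLoc

namespace LocMod

variable {X : Scheme.{u}} {E : Type*} {π : E → Over X}

/-- Compatible families of sections over all `π e` over `W`. -/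
def Fam (P : LocMod π) (W : Over X) : AddSubgroup (∀ (e : E) (_ : π e ⟶ W), P.obj e) where
  carrier := {x | ∀ (e e' : E) (f : π e ⟶ W) (g : π e' ⟶ π e), P.res g (x e f) = x e' (g ≫ f)}
  zero_mem' _ _ _ _ := map_zero _
  add_mem' hx hy e e' f g := (map_add _ _ _).trans (congrArg₂ (· + ·) (hx e e' f g) (hy e e' f g))
  neg_mem' hx e e' f g := (map_neg _ _).trans (congrArg (- ·) (hx e e' f g))

instance (P : LocMod π) (W : Over X) : Module Γ(W.left, ⊤) (P.Fam W) where
  smul r x := ⟨fun e f => f.left.appTop.hom r • x.1 e f, fun e e' f g => by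
    rw [P.res_smul, x.2]
    rfl⟩
  one_smul x := Subtype.ext (funext fun e => funext fun f =>
    (congrArg (· • x.1 e f) (map_one _)).trans (one_smul _ _))
  mul_smul r s x := Subtype.ext (funext fun e => funext fun f =>
    (congrArg (· • x.1 e f) (map_mul _ r s)).trans (mul_smul _ _ _))
  smul_zero r := Subtype.ext (funext fun e => funext fun f => smul_zero _)
  smul_add r x y := Subtype.ext (funext fun e => funext fun f => smul_add _ _ _)
  add_smul r s x := Subtype.ext (funext fun e => funext fun f =>
    (congrArg (· • x.1 e f) (map_add _ r s)).trans (add_smul _ _ _))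
  zero_smul x := Subtype.ext (funext fun e => funext fun f =>
    (congrArg (· • x.1 e f) (map_zero _)).trans (zero_smul _ _))

/-- Restriction of compatible families. -/
def famRes (P : LocMod π) {V W : Over X} (h : V ⟶ W) : P.Fam W →+ P.Fam V where
  toFun x := ⟨fun e f => x.1 e (f ≫ h), fun e e' f g => (x.2 e e' (f ≫ h) g).trans
    (congrArg (x.1 e') (Category.assoc g f h).symm)⟩
  map_zero' := rfl
  map_add' _ _ := rfl

theorem Fam.ext_cover {P : LocMod π} (hP : P.IsSheaf) {W : Over X} {R : Sieve W}
    (hR : R ∈ fppf X W) {x y : P.Fam W} (h : ∀ e (f : π e ⟶ W), R f → x.1 e f = y.1 e f) :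
    x = y := by
  refine Subtype.ext (funext fun e => funext fun f => ?_)
  refine hP.sep ((fppf X).pullback_stable f hR) fun e' g hg => ?_
  rw [x.2, y.2]
  exact h _ _ hg

theorem small_fam {P : LocMod π} (hP : P.IsSheaf) (hπ : Dense π) (W : Over X) :
    Small.{u} (P.Fam W) := by
  obtain ⟨ι, e, f, hf⟩ := hπ W
  refine small_of_injective (β := ∀ i, P.obj (e i)) (f := fun x i => x.1 (e i) (f i)) ?_
  intro x y hxy
  refine Fam.ext_cover hP hf ?_
  rintro e' g ⟨_, a, _, ⟨i⟩, hg⟩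
  have e2 : ∀ z : P.Fam W, z.1 e' g = P.res a (z.1 (e i) (f i)) := fun z => by
    rw [z.2, hg]
  rw [e2, e2]
  exact congrArg (P.res a) (congrFun hxy i)

/-- The right Kan extension of a sheaf on a dense family to all `X`-schemes. -/
def ext (P : LocMod π) [hs : ∀ W, Small.{u} (P.Fam W)] : LocMod (fun W : Over X => W) where
  obj W := Shrink.{u} (P.Fam W)
  ab W := inferInstanceAs (AddCommGroup (Shrink.{u} (P.Fam W)))
  mod W := inferInstanceAs (Module Γ(W.left, ⊤) (Shrink.{u} (P.Fam W)))
  res {W V} h := ((Shrink.linearEquiv Γ(V.left, ⊤) (P.Fam V)).symm.toLinearMap.toAddMonoidHom.comp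
    (P.famRes (W := W) (V := V) h)).comp
      (Shrink.linearEquiv Γ(W.left, ⊤) (P.Fam W)).toLinearMap.toAddMonoidHom
  res_smul {W V} h r m := by
    refine Eq.trans ?_ (map_smul (Shrink.linearEquiv Γ(V.left, ⊤) (P.Fam V)).symm _ _)
    refine congrArg (Shrink.linearEquiv Γ(V.left, ⊤) (P.Fam V)).symm ?_
    refine (congrArg (P.famRes (W := W) (V := V) h)
      (map_smul (Shrink.linearEquiv Γ(W.left, ⊤) (P.Fam W)) r m)).trans ?_
    rfl
  res_id {W} m := by
    refine Eq.trans ?_ ((Shrink.linearEquiv Γ(W.left, ⊤) (P.Fam W)).symm_apply_apply m)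
    refine congrArg (Shrink.linearEquiv Γ(W.left, ⊤) (P.Fam W)).symm ?_
    refine Subtype.ext (funext fun e => funext fun f => ?_)
    exact congrArg (((Shrink.linearEquiv Γ(W.left, ⊤) (P.Fam W)) m).1 e) (Category.comp_id f)
  res_comp {W V U} f g m := by
    refine congrArg (Shrink.linearEquiv Γ(U.left, ⊤) (P.Fam U)).symm ?_
    refine Eq.trans ?_ (congrArg (P.famRes (W := V) (V := U) g)
      ((Shrink.linearEquiv Γ(V.left, ⊤) (P.Fam V)).apply_symm_apply _).symm)
    refine Subtype.ext (funext fun e => funext fun h => ?_)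
    exact congrArg (((Shrink.linearEquiv Γ(W.left, ⊤) (P.Fam W)) m).1 e)
      (Category.assoc h g f).symm

/-- The value of a section of the extension on a morphism from one of the objects `π e`. -/
def extVal (P : LocMod π) [hs : ∀ W, Small.{u} (P.Fam W)] {W : Over X} (m : P.ext.obj W) {e : E}
    (f : π e ⟶ W) : P.obj e := (Shrink.linearEquiv Γ(W.left, ⊤) (P.Fam W) m).1 e f

section

variable {P : LocMod π} [hs : ∀ W, Small.{u} (P.Fam W)]

theorem extVal_res {V W : Over X} (h : V ⟶ W) (m : P.ext.obj W) {e : E} (f : π e ⟶ V) :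
    P.extVal (P.ext.res (e := W) (e' := V) h m) f = P.extVal m (f ≫ h) :=
  congrArg (fun x : P.Fam V => x.1 e f)
    ((Shrink.linearEquiv Γ(V.left, ⊤) (P.Fam V)).apply_symm_apply _)

theorem res_extVal {W : Over X} (m : P.ext.obj W) {e e' : E} (f : π e ⟶ W) (g : π e' ⟶ π e) :
    P.res g (P.extVal m f) = P.extVal m (g ≫ f) :=
  (Shrink.linearEquiv Γ(W.left, ⊤) (P.Fam W) m).2 e e' f g

theorem extVal_inj {W : Over X} {m m' : P.ext.obj W}
    (h : ∀ e (f : π e ⟶ W), P.extVal m f = P.extVal m' f) : m = m' :=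
  (Shrink.linearEquiv Γ(W.left, ⊤) (P.Fam W)).injective
    (Subtype.ext (funext fun e => funext fun f => h e f))

theorem exists_extVal {W : Over X} (x : ∀ e (_ : π e ⟶ W), P.obj e)
    (hx : ∀ (e e' : E) (f : π e ⟶ W) (g : π e' ⟶ π e), P.res g (x e f) = x e' (g ≫ f)) :
    ∃ m : P.ext.obj W, ∀ e (f : π e ⟶ W), P.extVal m f = x e f := by
  obtain ⟨m, hm⟩ := (Shrink.linearEquiv Γ(W.left, ⊤) (P.Fam W)).surjective ⟨x, hx⟩
  exact ⟨m, fun e f => congrArg (fun x : P.Fam W => x.1 e f) hm⟩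

/-- Sections of the extension are compatible families indexed by the morphisms `π e ⟶ W`. A matching
family is glued one morphism at a time, along the pulled back sieve. -/
theorem ext_isSheaf (hP : P.IsSheaf) : P.ext.IsSheaf := by
  intro W R hR x hx
  -- the value on `f : π e ⟶ W` is glued along the sieve `f^* R`
  have h1 : ∀ (e : E) (f : π e ⟶ W), ∃! m : P.obj e, ∀ (e' : E) (g : π e' ⟶ π e)
      (hg : (R.pullback f) g), P.res g m = P.extVal (x (π e') (g ≫ f) hg) (𝟙 _) := fun e f =>
    hP e (R.pullback f) ((fppf X).pullback_stable f hR)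
      (fun e' g hg => P.extVal (x (π e') (g ≫ f) hg) (𝟙 _)) (by
        intro e' e'' g hg k
        rw [res_extVal, Category.comp_id]
        have := hx (π e') (π e'') (g ≫ f) hg k
        have h2 : ∀ (q q' : π e'' ⟶ W) (hq : R q) (hq' : R q'), q = q' →
            P.extVal (x (π e'') q hq) (𝟙 _) = P.extVal (x (π e'') q' hq') (𝟙 _) := by
          rintro q _ hq hq' rfl
          rfl
        refine Eq.trans ?_ (h2 _ _ (R.downward_closed hg k) _ (Category.assoc k g f).symm)
        refine Eq.trans ?_ (congrArg (fun m => P.extVal m (𝟙 (π e''))) this)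
        refine Eq.trans ?_ (extVal_res (V := π e'') (W := π e') k _ _).symm
        exact congrArg (P.extVal (x (π e') (g ≫ f) hg)) (Category.id_comp k).symm)
  choose v hv hv2 using h1
  obtain ⟨m, hm⟩ := exists_extVal (P := P) (W := W) v (by
    intro e e' f g
    refine hv2 _ _ _ fun e'' k hk => ?_
    refine (P.res_comp g k (v e f)).symm.trans ?_
    have hk' : R ((k ≫ g) ≫ f) := by rw [Category.assoc]; exact hk
    refine (hv e f e'' (k ≫ g) hk').trans ?_
    congr 2)
  refine ⟨m, fun V f hf => ?_, fun m' hm' => ?_⟩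
  · refine extVal_inj fun e g => ?_
    refine (extVal_res (V := V) (W := W) f m g).trans ?_
    refine (hm _ _).trans ?_
    refine (hv2 _ _ _ fun e' k hk => ?_).symm
    refine (res_extVal (W := V) (x V f hf) g k).trans ?_
    have := hx V (π e') f hf (k ≫ g)
    have h2 : ∀ (q q' : π e' ⟶ W) (hq : R q) (hq' : R q'), q = q' →
        P.extVal (x (π e') q hq) (𝟙 _) = P.extVal (x (π e') q' hq') (𝟙 _) := by
      rintro q _ hq hq' rfl
      rfl
    refine Eq.trans ?_ (h2 _ _ (R.downward_closed hf _) _ (Category.assoc k g f))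
    refine Eq.trans ?_ (congrArg (fun m => P.extVal m (𝟙 (π e'))) this)
    refine Eq.trans ?_ (extVal_res (V := π e') (W := V) (k ≫ g) _ _).symm
    exact congrArg (P.extVal (x V f hf)) (Category.id_comp _).symm
  · refine extVal_inj fun e f => ?_
    rw [hm]
    refine hv2 _ _ _ fun e' g hg => ?_
    rw [res_extVal]
    refine Eq.trans ?_ (congrArg (fun m => P.extVal m (𝟙 (π e'))) (hm' (π e') (g ≫ f) hg))
    refine Eq.trans ?_ (extVal_res (V := π e') (W := W) (g ≫ f) _ _).symm
    exact congrArg (P.extVal m') (Category.id_comp _).symm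

end

theorem exists_ext_restrict (P : LocMod π) [hs : ∀ W, Small.{u} (P.Fam W)] :
    ∃ c : Hom (P.ext.comap π) P, ∀ e, Function.Bijective (c.app e) := by
  refine ⟨⟨fun e =>
    { toFun := fun m => P.extVal (W := π e) m (𝟙 _)
      map_add' := fun m m' => ?_
      map_smul' := fun r m => ?_ }, fun {e e'} f m => ?_⟩, fun e => ⟨fun m m' hm => ?_, fun m => ?_⟩⟩
  · exact congrArg (fun x : P.Fam (π e) => x.1 e (𝟙 _)) (map_add
      (Shrink.linearEquiv Γ((π e).left, ⊤) (P.Fam (π e))) m m')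
  · refine (congrArg (fun x : P.Fam (π e) => x.1 e (𝟙 _)) (map_smul
      (Shrink.linearEquiv Γ((π e).left, ⊤) (P.Fam (π e))) r m)).trans ?_
    exact congrArg (· • P.extVal (W := π e) m (𝟙 _)) (gamma_map_id (π e).left r)
  · refine (extVal_res (V := π e') (W := π e) f m (𝟙 (π e'))).trans ?_
    refine Eq.trans ?_ (res_extVal (W := π e) m (𝟙 (π e)) f).symm
    rw [Category.id_comp, Category.comp_id]
  · refine extVal_inj (W := π e) fun e' f => ?_
    have h : ∀ m : P.ext.obj (π e), P.extVal (W := π e) m f =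
        P.res f (P.extVal (W := π e) m (𝟙 _)) := fun m => by
      rw [res_extVal, Category.comp_id]
    exact (h m).trans ((congrArg (P.res f) hm).trans (h m').symm)
  · obtain ⟨x, hx⟩ := exists_extVal (P := P) (W := π e) (fun e' f => P.res f m)
      fun e' e'' f g => (P.res_comp f g m).symm
    exact ⟨x, (hx _ _).trans (P.res_id m)⟩

/-- A sheaf on a dense family of schemes is the restriction of a sheaf on all schemes. -/
theorem exists_extension {P : LocMod π} (hP : P.IsSheaf) (hπ : Dense π) :
    ∃ N : PreMod X, (toLoc N).IsSheaf ∧ ∃ c : Hom ((toLoc N).comap π) P,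
      ∀ e, Function.Bijective (c.app e) := by
  have hs := small_fam hP hπ
  exact ⟨P.ext.toPre, ext_isSheaf hP, exists_ext_restrict P⟩

theorem Hom.ext_dense {M N : LocMod (fun W : Over X => W)} (hN : N.IsSheaf) (hπ : Dense π)
    {α β : Hom M N} (h : ∀ (e : E) (m : M.obj (π e)), α.app (π e) m = β.app (π e) m) : α = β := by
  refine Hom.ext (funext fun W => LinearMap.ext fun m => ?_)
  refine hN.sep_dense hπ ((fppf X).top_mem W) fun e f _ => ?_
  refine (α.nat (e := W) (e' := π e) f m).symm.trans ?_
  exact (h e _).trans (β.nat (e := W) (e' := π e) f m)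

/-- Linear maps into a sheaf are determined by their values on a dense family. -/
theorem Hom.exists_extension {M N : LocMod (fun W : Over X => W)} (hN : N.IsSheaf) (hπ : Dense π)
    (α : Hom (M.comap π) (N.comap π)) :
    ∃ β : Hom M N, ∀ (e : E) (m : M.obj (π e)), β.app (π e) m = α.app e m := by
  have h1 : ∀ (W : Over X) (m : M.obj W), ∃ n : N.obj W, ∀ (e : E) (f : π e ⟶ W),
      N.res (e := W) (e' := π e) f n = α.app e (M.res (e := W) (e' := π e) f m) := by
    intro W m
    obtain ⟨n, hn⟩ := hN.glue_dense hπ ((fppf X).top_mem W)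
      (fun e f _ => α.app e (M.res (e := W) (e' := π e) f m)) (by
        intro e e' f _ g
        refine (α.nat g _).symm.trans (congrArg (α.app e') ?_)
        exact (M.res_comp (e := W) (e' := π e) (e'' := π e') f g m).symm)
    exact ⟨n, fun e f => hn e f trivial⟩
  choose v hv using h1
  have hv2 : ∀ (W : Over X) (m : M.obj W) (n : N.obj W), (∀ (e : E) (f : π e ⟶ W),
      N.res (e := W) (e' := π e) f n = α.app e (M.res (e := W) (e' := π e) f m)) → v W m = n :=
    fun W m n hn => hN.sep_dense hπ ((fppf X).top_mem W) fun e f _ =>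
      (hv W m e f).trans (hn e f).symm
  refine ⟨⟨fun W => { toFun := v W, map_add' := fun m m' => ?_, map_smul' := fun r m => ?_ },
    fun {W V} f m => ?_⟩, fun e m => ?_⟩
  · refine hv2 W _ _ fun e f => ?_
    rw [map_add, map_add, hv, hv]
    exact (map_add (α.app e) _ _).symm
  · refine hv2 W _ _ fun e f => ?_
    refine (N.res_smul (e := W) (e' := π e) f r _).trans ?_
    refine (congrArg (_ • ·) (hv W m e f)).trans ?_
    refine ((α.app e).map_smul _ _).symm.trans (congrArg (α.app e) ?_)
    exact (M.res_smul (e := W) (e' := π e) f r m).symm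
  · refine hv2 V _ _ fun e g => ?_
    refine (N.res_comp (e := W) (e' := V) (e'' := π e) f g _).symm.trans ?_
    refine (hv W m e (g ≫ f)).trans (congrArg (α.app e) ?_)
    exact M.res_comp (e := W) (e' := V) (e'' := π e) f g m
  · exact hv2 (π e) m _ fun e' f => (α.nat f m).symm

theorem Hom.bijective_of_dense {M N : LocMod (fun W : Over X => W)} (hM : M.IsSheaf)
    (hN : N.IsSheaf) (hπ : Dense π) (α : Hom M N)
    (h : ∀ e, Function.Bijective (α.app (π e))) (W : Over X) : Function.Bijective (α.app W) := by
  constructor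
  · intro m m' hm
    refine hM.sep_dense hπ ((fppf X).top_mem W) fun e f _ => (h e).1 ?_
    refine (α.nat (e := W) (e' := π e) f m).trans (Eq.trans ?_
      (α.nat (e := W) (e' := π e) f m').symm)
    rw [hm]
  · intro n
    choose v hv using fun (e : E) (f : π e ⟶ W) => (h e).2 (N.res (e := W) (e' := π e) f n)
    obtain ⟨m, hm⟩ := hM.glue_dense hπ ((fppf X).top_mem W) (fun e f _ => v e f) (by
      intro e e' f _ g
      refine (h e').1 ?_
      refine (α.nat (e := π e) (e' := π e') g _).trans ?_
      rw [hv, hv]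
      exact (N.res_comp (e := W) (e' := π e) (e'' := π e') f g n).symm)
    refine ⟨m, hN.sep_dense hπ ((fppf X).top_mem W) fun e f _ => ?_⟩
    refine (α.nat (e := W) (e' := π e) f m).symm.trans ?_
    rw [hm e f trivial, hv]

end LocMod

section

variable {X : Scheme.{u}}

theorem isIso_of_bijective {M N : PreMod X} (f : M ⟶ N)
    (h : ∀ W : Over X, Function.Bijective (f.app (op W))) : IsIso f := by
  have : IsIso ((PresheafOfModules.toPresheaf _).map f) := by
    rw [NatTrans.isIso_iff_isIso_app]
    intro W
    exact (ConcreteCategory.isIso_iff_bijective _).2 (h W.unop)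
  exact isIso_of_reflects_iso f (PresheafOfModules.toPresheaf _)

end

/-! ### Quasi-coherent modules are determined by base change on affine schemes -/

section Presentation

variable {X : Scheme.{u}}

theorem hasPresentationOver_iff {M : PreMod X} {Z : Over X} :
    HasPresentationOver M Z ↔ ∃ (K J : Type u) (e : K → (toLoc M).obj Z)
      (r : J → K →₀ Γ(Z.left, ⊤)),
      (∀ j, ((r j).sum fun k a => a • e k) = 0) ∧
      (∀ (T : Over X) (t : T ⟶ Z) (m : (toLoc M).obj T), ∃ R ∈ fppf X T,
        ∀ (T' : Over X) (t' : T' ⟶ T), R t' →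
          (toLoc M).res (e := T) (e' := T') t' m ∈ Submodule.span Γ(T'.left, ⊤)
            (Set.range fun k => (toLoc M).res (e := Z) (e' := T') (t' ≫ t) (e k))) ∧
      (∀ (T : Over X) (t : T ⟶ Z) (a : K →₀ Γ(T.left, ⊤)),
        (a.sum fun k b => b • (toLoc M).res (e := Z) (e' := T) t (e k)) = 0 → ∃ R ∈ fppf X T,
        ∀ (T' : Over X) (t' : T' ⟶ T), R t' →
          a.mapRange t'.left.appTop.hom (map_zero _) ∈ Submodule.span Γ(T'.left, ⊤)
            (Set.range fun j => (r j).mapRange (t' ≫ t).left.appTop.hom (map_zero _))) :=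
  Iff.rfl

namespace LocMod

variable {E : Type*} {π : E → Over X}

theorem Hom.bijective_of_local {P Q : LocMod π} (hP : P.IsSheaf) (hQ : Q.IsSheaf) (α : Hom P Q)
    (h1 : ∀ e (m : P.obj e), α.app e m = 0 → ∃ R ∈ fppf X (π e),
      ∀ e' (f : π e' ⟶ π e), R f → P.res f m = 0)
    (h2 : ∀ e (n : Q.obj e), ∃ R ∈ fppf X (π e),
      ∀ e' (f : π e' ⟶ π e), R f → ∃ m, α.app e' m = Q.res f n) (e : E) :
    Function.Bijective (α.app e) := by
  have inj : ∀ e, Function.Injective (α.app e) := by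
    intro e
    rw [injective_iff_map_eq_zero]
    intro m hm
    obtain ⟨R, hR, h⟩ := h1 e m hm
    exact hP.sep hR fun e' f hf => (h e' f hf).trans (map_zero _).symm
  refine ⟨inj e, fun n => ?_⟩
  obtain ⟨R, hR, h⟩ := h2 e n
  choose v hv using h
  obtain ⟨m, hm, -⟩ := hP e R hR v fun e' e'' f hf g => inj e'' (by
    rw [α.nat, hv, hv, Q.res_comp])
  refine ⟨m, hQ.sep hR fun e' f hf => ?_⟩
  rw [← α.nat, hm e' f hf, hv]

theorem isBC_of_isIso (P : LocMod π) {e e' : E} (f : π e' ⟶ π e) [IsIso f] :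
    IsBC f.left.appTop.hom (P.res f) := by
  refine IsBC.of_bijective ?_ (P.res_smul f) ?_
  · have : IsIso f.left := (Over.forget X).map_isIso f
    exact (ConcreteCategory.isIso_iff_bijective f.left.appTop).1
      (inferInstanceAs (IsIso (Scheme.Γ.map f.left.op)))
  · refine Function.bijective_iff_has_inverse.2 ⟨P.res (inv f), fun m => ?_, fun m => ?_⟩
    · rw [← P.res_comp, IsIso.inv_hom_id, P.res_id]
    · rw [← P.res_comp, IsIso.hom_inv_id, P.res_id]

theorem isBC_comp {P : LocMod π} {e e' e'' : E} {f : π e' ⟶ π e} {g : π e'' ⟶ π e'}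
    (hf : IsBC f.left.appTop.hom (P.res f)) (hg : IsBC g.left.appTop.hom (P.res g)) :
    IsBC (g ≫ f).left.appTop.hom (P.res (g ≫ f)) := by
  have h := hf.comp hg
  have e1 : (P.res g).comp (P.res f) = P.res (g ≫ f) :=
    AddMonoidHom.ext fun m => (P.res_comp f g m).symm
  rwa [e1, ← CommRingCat.hom_comp, ← Scheme.Hom.comp_appTop, ← Over.comp_left] at h

theorem isBC_of_comp {P : LocMod π} {e e' e'' : E} {f : π e' ⟶ π e} {g : π e'' ⟶ π e'}
    (hf : IsBC f.left.appTop.hom (P.res f))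
    (hg : IsBC (g ≫ f).left.appTop.hom (P.res (g ≫ f))) : IsBC g.left.appTop.hom (P.res g) := by
  refine hf.of_comp (P.res_smul g) ?_
  have e1 : (P.res g).comp (P.res f) = P.res (g ≫ f) :=
    AddMonoidHom.ext fun m => (P.res_comp f g m).symm
  rwa [e1, ← CommRingCat.hom_comp, ← Scheme.Hom.comp_appTop, ← Over.comp_left]

theorem Cartesian.of_hom {P Q : LocMod π} (hP : P.Cartesian) (α : Hom P Q)
    (h : ∀ e, Function.Bijective (α.app e)) : Q.Cartesian := by
  intro e e' f
  have h1 : ∀ e, IsBC (RingHom.id Γ((π e).left, ⊤)) (α.app e).toAddMonoidHom := fun e =>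
    IsBC.of_bijective Function.bijective_id (fun r m => (α.app e).map_smul r m) (h e)
  refine (h1 e).of_comp (g := f.left.appTop.hom) (Q.res_smul f) ?_
  have h2 := (hP _ _ f).comp (h1 e')
  have e1 : (Q.res f).comp (α.app e).toAddMonoidHom =
      (α.app e').toAddMonoidHom.comp (P.res f) :=
    AddMonoidHom.ext fun m => (α.nat f m).symm
  rw [e1]
  exact h2

end LocMod

/-- The functions on an `X`-scheme form an algebra over those on `X`. -/
instance gammaAlgebra (T : Over X) : Algebra Γ(X, ⊤) Γ(T.left, ⊤) := T.hom.appTop.hom.toAlgebra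

/-- Restriction of functions, as a linear map. -/
def gammaMap {T T' : Over X} (f : T' ⟶ T) : Γ(T.left, ⊤) →ₗ[Γ(X, ⊤)] Γ(T'.left, ⊤) :=
  { f.left.appTop.hom with
    map_smul' := fun r s => by
      change f.left.appTop.hom (T.hom.appTop.hom r * s) =
        T'.hom.appTop.hom r * f.left.appTop.hom s
      rw [map_mul, ← Over.w f, Scheme.Hom.comp_appTop]
      rfl }

theorem gammaMap_comp {T T' T'' : Over X} (f : T' ⟶ T) (g : T'' ⟶ T') :
    gammaMap (g ≫ f) = gammaMap g ∘ₗ gammaMap f := by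
  ext s
  change (g ≫ f).left.appTop.hom s = g.left.appTop.hom (f.left.appTop.hom s)
  rw [Over.comp_left, Scheme.Hom.comp_appTop]
  rfl

/-- The presheaf `T ↦ O(T) ⊗ N` on affine `X`-schemes given by an `O(X)`-module `N`. -/
def tensorMod (X : Scheme.{u}) (N : Type u) [AddCommGroup N] [Module Γ(X, ⊤) N] :
    LocMod (Subtype.val : AffOver X → Over X) where
  obj T := Γ(T.1.left, ⊤) ⊗[Γ(X, ⊤)] N
  res f := (LinearMap.rTensor N (gammaMap f)).toAddMonoidHom
  res_smul {T T'} f r m := by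
    induction m with
    | zero => rw [smul_zero, map_zero, smul_zero]
    | add x y hx hy => rw [smul_add, map_add, hx, hy, map_add, smul_add]
    | tmul s n => exact congrArg (· ⊗ₜ n) (map_mul f.left.appTop.hom r s)
  res_id {T} m := by
    have : gammaMap (𝟙 T.1) = LinearMap.id := LinearMap.ext fun s => gamma_map_id _ s
    rw [this, LinearMap.rTensor_id]
    rfl
  res_comp f g m := by
    rw [gammaMap_comp, LinearMap.rTensor_comp]
    rfl

theorem tensorMod_cartesian (X : Scheme.{u}) (N : Type u) [AddCommGroup N] [Module Γ(X, ⊤) N] :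
    (tensorMod X N).Cartesian := by
  intro T T' f
  let ι (T : AffOver X) : N →+ (tensorMod X N).obj T :=
    (TensorProduct.mk Γ(X, ⊤) Γ(T.1.left, ⊤) N 1).toAddMonoidHom
  have h' (T : AffOver X) : IsBC T.1.hom.appTop.hom
      (TensorProduct.mk Γ(X, ⊤) Γ(T.1.left, ⊤) N 1).toAddMonoidHom :=
    (isBC_iff (TensorProduct.mk Γ(X, ⊤) Γ(T.1.left, ⊤) N 1)).2
      (TensorProduct.isBaseChange Γ(X, ⊤) N Γ(T.1.left, ⊤))
  have h (T : AffOver X) : IsBC T.1.hom.appTop.hom (ι T) := h' T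
  refine (h T).of_comp (g := f.left.appTop.hom) ((tensorMod X N).res_smul f) ?_
  have e1 : ((tensorMod X N).res f).comp (ι T) = ι T' := by
    ext n
    exact congrArg (· ⊗ₜ n) (map_one f.left.appTop.hom)
  rw [e1, ← CommRingCat.hom_comp, ← Scheme.Hom.comp_appTop, Over.w]
  exact h T'

theorem isSheaf_restrictPre {X' : Scheme.{u}} (g : X' ⟶ X) {M : PreMod X}
    (hM : (toLoc M).IsSheaf) : (toLoc ((restrictPre g).obj M)).IsSheaf :=
  isSheaf_toLoc.2 (Functor.op_comp_isSheaf (Over.map g) (fppf X') (fppf X)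
    ⟨_, isSheaf_toLoc.1 hM⟩)

end Presentation

section Presentation

variable {X : Scheme.{u}}

/-- A sheaf with a presentation over `Z` is given on affine `Z`-schemes `T` by `O(T) ⊗ N`, where
`N` is the cokernel of the relations over `O(Z)`: the map from `O(T) ⊗ N` is locally bijective, and
both sides are sheaves. -/
theorem cartesian_of_presentation {M : PreMod X} (hM : (toLoc M).IsSheaf) (Z : Over X)
    (h : HasPresentationOver M Z) :
    ((toLoc ((restrictPre Z.hom).obj M)).comap
      (Subtype.val : AffOver Z.left → Over Z.left)).Cartesian := by
  obtain ⟨K, J, e, r, h1, h2, h3⟩ := hasPresentationOver_iff.1 h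
  let A := Γ(Z.left, ⊤)
  let L : Submodule A (K →₀ A) := Submodule.span A (Set.range r)
  let N := (K →₀ A) ⧸ L
  let ψ : N →ₗ[A] (toLoc M).obj Z := L.liftQ (Finsupp.linearCombination A e) (by
    rw [Submodule.span_le]
    rintro _ ⟨j, rfl⟩
    exact h1 j)
  let P := (toLoc ((restrictPre Z.hom).obj M)).comap (Subtype.val : AffOver Z.left → Over Z.left)
  have hP : P.IsSheaf := (isSheaf_restrictPre Z.hom hM).comap_dense (dense_aff _)
  let j (T : Over Z.left) : (Over.map Z.hom).obj T ⟶ Z := Over.homMk T.hom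
  have hj {T T' : Over Z.left} (f : T' ⟶ T) : (Over.map Z.hom).map f ≫ j T = j T' := by
    ext
    exact Over.w f
  let (T : AffOver Z.left) : Module A (P.obj T) := Module.compHom (P.obj T) T.1.hom.appTop.hom
  have (T : AffOver Z.left) : IsScalarTower A Γ(T.1.left, ⊤) (P.obj T) :=
    ⟨fun a b n => mul_smul (T.1.hom.appTop.hom a) b n⟩
  let σ (T : AffOver Z.left) : N →ₗ[A] P.obj T :=
    { toFun := fun n => (toLoc M).res (e := Z) (e' := (Over.map Z.hom).obj T.1) (j T.1) (ψ n)
      map_add' := fun n n' => by rw [map_add, map_add]; rfl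
      map_smul' := fun a n => by
        rw [map_smul]
        exact (toLoc M).res_smul (e := Z) (e' := (Over.map Z.hom).obj T.1) (j T.1) a (ψ n) }
  let a (T : AffOver Z.left) : Γ(T.1.left, ⊤) ⊗[A] N →ₗ[Γ(T.1.left, ⊤)] P.obj T :=
    TensorProduct.AlgebraTensorModule.lift
      (LinearMap.toSpanSingleton Γ(T.1.left, ⊤) (N →ₗ[A] P.obj T) (σ T))
  have ha (T : AffOver Z.left) (s : Γ(T.1.left, ⊤)) (n : N) : a T (s ⊗ₜ n) = s • σ T n := rfl
  have hσ {T T' : AffOver Z.left} (f : T'.1 ⟶ T.1) (n : N) : P.res f (σ T n) = σ T' n := by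
    refine ((toLoc M).res_comp (e := Z) (e' := (Over.map Z.hom).obj T.1)
      (e'' := (Over.map Z.hom).obj T'.1) (j T.1) ((Over.map Z.hom).map f) (ψ n)).symm.trans ?_
    rw [hj]
    rfl
  let α : LocMod.Hom (tensorMod Z.left N) P :=
    { app := a
      nat := fun {T T'} f m => by
        change Γ(T.1.left, ⊤) ⊗[A] N at m
        induction m with
        | zero => exact (congrArg (a T') (map_zero _)).trans ((map_zero (a T')).trans
            ((map_zero (P.res f)).symm.trans (congrArg (P.res f) (map_zero (a T)).symm)))
        | add x y hx hy =>
          refine (congrArg (a T') (map_add ((tensorMod Z.left N).res f) x y)).trans ?_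
          refine (map_add (a T') _ _).trans ((congrArg₂ (· + ·) hx hy).trans ?_)
          exact (map_add (P.res f) _ _).symm.trans (congrArg (P.res f) (map_add (a T) x y).symm)
        | tmul s n =>
          change f.left.appTop.hom s • σ T' n = P.res f (s • σ T n)
          rw [P.res_smul, hσ] }
  let q (T : AffOver Z.left) : (K →₀ Γ(T.1.left, ⊤)) →ₗ[Γ(T.1.left, ⊤)] Γ(T.1.left, ⊤) ⊗[A] N :=
    Finsupp.linearCombination Γ(T.1.left, ⊤) fun k => 1 ⊗ₜ L.mkQ (Finsupp.single k 1)
  have hq (T : AffOver Z.left) (k : K) (b : Γ(T.1.left, ⊤)) :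
      q T (Finsupp.single k b) = b ⊗ₜ L.mkQ (Finsupp.single k 1) := by
    simp [q, TensorProduct.smul_tmul']
  have hq1 (T : AffOver Z.left) (b : K →₀ Γ(T.1.left, ⊤)) :
      a T (q T b) = b.sum fun k s => s • σ T (L.mkQ (Finsupp.single k 1)) := by
    induction b using Finsupp.induction_linear with
    | zero => simp
    | add x y hx hy =>
      rw [map_add, map_add, hx, hy, Finsupp.sum_add_index']
      · intros; exact zero_smul _ _
      · intros; exact add_smul _ _ _
    | single k s =>
      rw [hq, ha, Finsupp.sum_single_index]
      exact zero_smul _ _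
  have hσ1 (T : AffOver Z.left) (k : K) : σ T (L.mkQ (Finsupp.single k 1)) =
      (toLoc M).res (e := Z) (e' := (Over.map Z.hom).obj T.1) (j T.1) (e k) := by
    refine congrArg ((toLoc M).res (e := Z) (e' := (Over.map Z.hom).obj T.1) (j T.1)) ?_
    refine (Finsupp.linearCombination_single A (1 : A) k).trans (one_smul _ _)
  have hq2 (T : AffOver Z.left) (c : K →₀ A) :
      q T (c.mapRange T.1.hom.appTop.hom (map_zero _)) = 1 ⊗ₜ L.mkQ c := by
    induction c using Finsupp.induction_linear with
    | zero => simp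
    | add x y hx hy =>
      rw [Finsupp.mapRange_add (map_add _), map_add, hx, hy, map_add, TensorProduct.tmul_add]
    | single k s =>
      rw [Finsupp.mapRange_single, hq]
      have e1 : (Finsupp.single k s : K →₀ A) = s • Finsupp.single k 1 := by simp
      rw [e1, map_smul, ← TensorProduct.smul_tmul]
      congr 1
      exact (mul_one _).symm
  have hq3 (T : AffOver Z.left) : Function.Surjective (q T) := by
    rw [← LinearMap.range_eq_top, eq_top_iff]
    rintro m -
    induction m with
    | zero => exact zero_mem _
    | add x y hx hy => exact add_mem hx hy
    | tmul s n =>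
      obtain ⟨c, rfl⟩ := L.mkQ_surjective n
      have := (LinearMap.range (q T)).smul_mem s ⟨_, hq2 T c⟩
      rwa [TensorProduct.smul_tmul', smul_eq_mul, mul_one] at this
  have hq4 {T T' : AffOver Z.left} (f : T'.1 ⟶ T.1) (b : K →₀ Γ(T.1.left, ⊤)) :
      (tensorMod Z.left N).res f (q T b) =
        q T' (b.mapRange f.left.appTop.hom (map_zero _)) := by
    induction b using Finsupp.induction_linear with
    | zero => simp; exact map_zero _
    | add x y hx hy =>
      rw [Finsupp.mapRange_add (map_add _), map_add (q T'), ← hx, ← hy, map_add (q T)]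
      exact map_add _ _ _
    | single k s =>
      rw [Finsupp.mapRange_single, hq, hq]
      rfl
  refine (tensorMod_cartesian Z.left N).of_hom α fun T => ?_
  refine α.bijective_of_local
    (tensorMod_cartesian Z.left N).isSheaf hP (fun T m hm => ?_)
    (fun T n => ?_) T
  · obtain ⟨b, rfl⟩ := hq3 T m
    obtain ⟨R, hR, hRb⟩ := h3 ((Over.map Z.hom).obj T.1) (j T.1) b (by
      refine Eq.trans ?_ ((hq1 T b).symm.trans hm)
      simp only [hσ1]
      rfl)
    refine ⟨R.functorPullback (Over.map Z.hom), Functor.cover_lift _ (fppf Z.left) (fppf X) hR,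
      fun T' f hf => (hq4 f b).trans ?_⟩
    have := hRb _ _ hf
    rw [hj] at this
    refine (Submodule.span_le (p := LinearMap.ker (q T'))).2 ?_ this
    rintro _ ⟨i, rfl⟩
    refine (hq2 T' (r i)).trans ?_
    have : L.mkQ (r i) = 0 := (Submodule.Quotient.mk_eq_zero L).2
      (Submodule.subset_span ⟨i, rfl⟩)
    rw [this, TensorProduct.tmul_zero]
  · obtain ⟨R, hR, hRn⟩ := h2 ((Over.map Z.hom).obj T.1) (j T.1) n
    refine ⟨R.functorPullback (Over.map Z.hom), Functor.cover_lift _ (fppf Z.left) (fppf X) hR,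
      fun T' f hf => ?_⟩
    have := hRn _ _ hf
    rw [hj] at this
    refine (Submodule.span_le (p := LinearMap.range (a T'))).2 ?_ this
    rintro _ ⟨k, rfl⟩
    refine ⟨1 ⊗ₜ L.mkQ (Finsupp.single k 1), ?_⟩
    rw [ha, one_smul, hσ1]

/-- The terminal object of the schemes over `Z` is `Z` itself, so that `cartesian_of_presentation`
applies to the sections over `Z`. -/
theorem isBC_of_presentation {M : PreMod X} (hM : (toLoc M).IsSheaf) {Z T : Over X}
    [hZ : IsAffine Z.left] [hT : IsAffine T.left] (h : HasPresentationOver M Z) (t : T ⟶ Z) :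
    IsBC t.left.appTop.hom ((toLoc M).res (e := Z) (e' := T) t) := by
  let Z₀ : AffOver Z.left := ⟨Over.mk (𝟙 Z.left), hZ⟩
  let T₀ : AffOver Z.left := ⟨Over.mk t.left, hT⟩
  let t₀ : T₀.1 ⟶ Z₀.1 := Over.homMk t.left (Category.comp_id _)
  have h1 := cartesian_of_presentation hM Z h _ _ t₀
  let i : (Over.map Z.hom).obj Z₀.1 ⟶ Z := Over.homMk (𝟙 Z.left) rfl
  let j : T ⟶ (Over.map Z.hom).obj T₀.1 := Over.homMk (𝟙 T.left)
    ((Category.id_comp _).trans (Over.w t))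
  have hi : IsIso i := by
    have : IsIso ((Over.forget X).map i) := inferInstanceAs (IsIso (𝟙 Z.left))
    exact isIso_of_reflects_iso i (Over.forget X)
  have hj : IsIso j := by
    have : IsIso ((Over.forget X).map j) := inferInstanceAs (IsIso (𝟙 T.left))
    exact isIso_of_reflects_iso j (Over.forget X)
  have h2 := LocMod.isBC_comp (P := toLoc M) (e := Z) (e' := (Over.map Z.hom).obj Z₀.1)
    (e'' := (Over.map Z.hom).obj T₀.1) (f := i) (g := (Over.map Z.hom).map t₀)
    (LocMod.isBC_of_isIso (toLoc M) (e := Z) (e' := (Over.map Z.hom).obj Z₀.1) i) h1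
  have h3 := LocMod.isBC_comp (P := toLoc M) (e := Z) (e' := (Over.map Z.hom).obj T₀.1) (e'' := T)
    (g := j) h2 (LocMod.isBC_of_isIso (toLoc M) (e := (Over.map Z.hom).obj T₀.1) (e' := T) j)
  have e : j ≫ (Over.map Z.hom).map t₀ ≫ i = t := by
    ext
    change 𝟙 T.left ≫ t.left ≫ 𝟙 Z.left = t.left
    rw [Category.id_comp, Category.comp_id]
  rwa [e] at h3

end Presentation

section Descent

variable {X : Scheme.{u}}

namespace LocMod

variable {P : LocMod (fun W : Over X => W)}

theorem IsSheaf.sep_cover (hP : P.IsSheaf) {W : Over X} {ι : Type u} {Z : ι → Over X}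
    {f : ∀ k, Z k ⟶ W} (hf : IsFppfCover f) {m m' : P.obj W}
    (hm : ∀ k, P.res (e := W) (e' := Z k) (f k) m = P.res (e := W) (e' := Z k) (f k) m') :
    m = m' := by
  refine hP.sep hf.ofArrows_mem ?_
  rintro T _ ⟨_, l, _, ⟨k⟩, rfl⟩
  refine (P.res_comp (e := W) (e' := Z k) (e'' := T) (f k) l m).trans (Eq.trans ?_
    (P.res_comp (e := W) (e' := Z k) (e'' := T) (f k) l m').symm)
  rw [hm]

theorem IsSheaf.glue_cover (hP : P.IsSheaf) {W : Over X} {ι : Type u} {Z : ι → Over X}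
    {f : ∀ k, Z k ⟶ W} (hf : IsFppfCover f) (x : ∀ k, P.obj (Z k))
    (hx : ∀ k l, P.res (e := Z k) (e' := fp (f k) (f l)) (fp1 (f k) (f l)) (x k) =
      P.res (e := Z l) (e' := fp (f k) (f l)) (fp2 (f k) (f l)) (x l)) :
    ∃ m, ∀ k, P.res (e := W) (e' := Z k) (f k) m = x k := by
  have h : ∀ (T : Over X) (t : T ⟶ W), Sieve.ofArrows Z f t → ∃ (i : ι) (l : T ⟶ Z i),
      l ≫ f i = t := by
    rintro T _ ⟨_, l, _, ⟨k⟩, rfl⟩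
    exact ⟨k, l, rfl⟩
  choose i l hl using h
  have key : ∀ (T : Over X) (k k' : ι) (a : T ⟶ Z k) (a' : T ⟶ Z k'), a ≫ f k = a' ≫ f k' →
      P.res (e := Z k) (e' := T) a (x k) = P.res (e := Z k') (e' := T) a' (x k') := by
    intro T k k' a a' e
    have := congrArg (P.res (e := fp (f k) (f k')) (e' := T) (fpLift a a' e)) (hx k k')
    rwa [← P.res_comp, ← P.res_comp, fpLift_1, fpLift_2] at this
  obtain ⟨m, hm, -⟩ := hP W (Sieve.ofArrows Z f) hf.ofArrows_mem
    (fun T t ht => P.res (e := Z (i T t ht)) (e' := T) (l T t ht) (x _)) (by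
      intro T T' t ht g
      rw [← P.res_comp]
      apply key
      rw [Category.assoc, hl, hl])
  refine ⟨m, fun k => ?_⟩
  have hk : Sieve.ofArrows Z f (f k) := ⟨_, 𝟙 _, _, ⟨k⟩, Category.id_comp _⟩
  refine (hm (Z k) (f k) hk).trans (Eq.trans ?_ (P.res_id (e := Z k) (x k)))
  apply key
  exact (hl _ _ _).trans (Category.id_comp _).symm

end LocMod

/-- Sections over `Y` are base changed correctly to the members of a covering of `Y`
if this is the case for the sections over these members: use the equalizer sequences. -/
theorem isBC_of_cover {P : LocMod (fun W : Over X => W)} (hP : P.IsSheaf) {Y : Over X}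
    [IsAffine Y.left] {ι : Type u} [Finite ι] {Z : ι → Over X} {f : ∀ i, Z i ⟶ Y}
    (hf : IsFppfCover f) (hZ : ∀ i, IsAffine (Z i).left)
    (h : ∀ (i : ι) (T : Over X) (t : T ⟶ Z i), IsAffine T.left →
      IsBC t.left.appTop.hom (P.res (e := Z i) (e' := T) t)) (i : ι) :
    IsBC (f i).left.appTop.hom (P.res (e := Y) (e' := Z i) (f i)) := by
  classical
  have := Fintype.ofFinite ι
  let A := Γ(Y.left, ⊤)
  let B := Γ((Z i).left, ⊤)
  let : Algebra A B := (f i).left.appTop.hom.toAlgebra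
  have : Module.Flat A B :=
    have := hf.flat i
    have := hZ i
    (f i).left.flat_appTop
  -- the double overlaps over `Y`, and everything base changed to `Z i`
  let Z₂ (k : ι × ι) : Over X := fp (f k.1) (f k.2)
  let g₂ (k : ι × ι) : Z₂ k ⟶ Y := fp1 (f k.1) (f k.2) ≫ f k.1
  let Z' (k : ι) : Over X := fp (f i) (f k)
  let Z₂' (k : ι × ι) : Over X := fp (f i) (g₂ k)
  let a (k : ι) : Z' k ⟶ Z i := fp1 (f i) (f k)
  let b (k : ι) : Z' k ⟶ Z k := fp2 (f i) (f k)
  let a₂ (k : ι × ι) : Z₂' k ⟶ Z i := fp1 (f i) (g₂ k)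
  let b₂ (k : ι × ι) : Z₂' k ⟶ Z₂ k := fp2 (f i) (g₂ k)
  let p (k : ι × ι) : Z₂ k ⟶ Z k.1 := fp1 (f k.1) (f k.2)
  let q (k : ι × ι) : Z₂ k ⟶ Z k.2 := fp2 (f k.1) (f k.2)
  have hpq (k : ι × ι) : p k ≫ f k.1 = q k ≫ f k.2 := fp_w _ _
  have hab (k : ι) : a k ≫ f i = b k ≫ f k := fp_w _ _
  have hab₂ (k : ι × ι) : a₂ k ≫ f i = b₂ k ≫ p k ≫ f k.1 := fp_w _ _
  let p' (k : ι × ι) : Z₂' k ⟶ Z' k.1 := fpLift (a₂ k) (b₂ k ≫ p k) (by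
    rw [hab₂, Category.assoc])
  let q' (k : ι × ι) : Z₂' k ⟶ Z' k.2 := fpLift (a₂ k) (b₂ k ≫ q k) (by
    rw [hab₂, hpq, Category.assoc])
  have hp1 (k : ι × ι) : p' k ≫ a k.1 = a₂ k := fpLift_1 _ _ _
  have hp2 (k : ι × ι) : p' k ≫ b k.1 = b₂ k ≫ p k := fpLift_2 _ _ _
  have hq1 (k : ι × ι) : q' k ≫ a k.2 = a₂ k := fpLift_1 _ _ _
  have hq2 (k : ι × ι) : q' k ≫ b k.2 = b₂ k ≫ q k := fpLift_2 _ _ _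
  let r {V W : Over X} (k : V ⟶ W) : P.obj W →+ P.obj V := P.res (e := W) (e' := V) k
  have rr {U V W : Over X} (k : V ⟶ W) (l : U ⟶ V) (m : P.obj W) : r l (r k m) = r (l ≫ k) m :=
    (P.res_comp (e := W) (e' := V) (e'' := U) k l m).symm
  have rs {V W : Over X} (k : V ⟶ W) (s : Γ(W.left, ⊤)) (m : P.obj W) :
      r k (s • m) = k.left.appTop.hom s • r k m := P.res_smul (e := W) (e' := V) k s m
  -- all modules are considered over `A`, respectively over `B`
  let (k : ι) : Module A (P.obj (Z k)) := Module.compHom _ (f k).left.appTop.hom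
  let (k : ι × ι) : Module A (P.obj (Z₂ k)) := Module.compHom _ (g₂ k).left.appTop.hom
  let (k : ι) : Module B (P.obj (Z' k)) := Module.compHom _ (a k).left.appTop.hom
  let (k : ι × ι) : Module B (P.obj (Z₂' k)) := Module.compHom _ (a₂ k).left.appTop.hom
  let (k : ι) : Module A (P.obj (Z' k)) := Module.compHom (P.obj (Z' k)) (algebraMap A B)
  let (k : ι × ι) : Module A (P.obj (Z₂' k)) := Module.compHom (P.obj (Z₂' k)) (algebraMap A B)
  have (k : ι) : IsScalarTower A B (P.obj (Z' k)) :=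
    ⟨fun x y n => mul_smul (algebraMap A B x) y n⟩
  have (k : ι × ι) : IsScalarTower A B (P.obj (Z₂' k)) :=
    ⟨fun x y n => mul_smul (algebraMap A B x) y n⟩
  have : IsScalarTower A B (P.obj (Z i)) := ⟨fun x y n => mul_smul (algebraMap A B x) y n⟩
  have comm {U V V' W : Over X} (k : V ⟶ W) (l : U ⟶ V) (k' : V' ⟶ W) (l' : U ⟶ V')
      (e : l ≫ k = l' ≫ k') (s : Γ(W.left, ⊤)) : l.left.appTop.hom (k.left.appTop.hom s) =
      l'.left.appTop.hom (k'.left.appTop.hom s) := by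
    have := congrArg (fun x : U ⟶ W => x.left.appTop.hom s) e
    simp only [Over.comp_left, Scheme.Hom.comp_appTop] at this
    exact this
  have hn (k : ι) : IsBC (f i).left.appTop.hom (r (b k)) :=
    IsBC.of_isPushout' (M := P.obj (Z k)) (N := P.obj (Z' k))
      (have := hZ k; have := hZ i; isPushout_appTop_of_isPullback (fp_isPullback (f i) (f k)))
      (h k (Z' k) (b k) (have := hZ k; have := hZ i; inferInstance))
  have hr (k : ι × ι) : IsBC (f i).left.appTop.hom (r (b₂ k)) := by
    have := hZ i
    have := hZ k.1
    have := hZ k.2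
    have : IsAffine (Z₂ k).left := inferInstanceAs (IsAffine (fp (f k.1) (f k.2)).left)
    have : IsAffine (Z₂' k).left := inferInstanceAs (IsAffine (fp (f i) (g₂ k)).left)
    refine IsBC.of_isPushout' (M := P.obj (Z₂ k)) (N := P.obj (Z₂' k))
      (isPushout_appTop_of_isPullback (fp_isPullback (f i) (g₂ k))) ?_
    exact LocMod.isBC_of_comp (P := P) (e := Z k.1) (e' := Z₂ k) (e'' := Z₂' k)
      (h k.1 _ (p k) inferInstance) (h k.1 _ (b₂ k ≫ p k) inferInstance)
  let n (k : ι) : P.obj (Z k) →ₗ[A] P.obj (Z' k) :=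
    { r (b k) with
      map_smul' := fun s x => (rs (b k) _ _).trans
        (congrArg (· • r (b k) x) (comm _ _ (f i) (a k) (hab k).symm s)) }
  let n₂ (k : ι × ι) : P.obj (Z₂ k) →ₗ[A] P.obj (Z₂' k) :=
    { r (b₂ k) with
      map_smul' := fun s x => (rs (b₂ k) _ _).trans
        (congrArg (· • r (b₂ k) x) (comm _ _ (f i) (a₂ k) (hab₂ k).symm s)) }
  have hn' (k : ι) : IsBaseChange B (n k) := (hn k).2
  have hr' (k : ι × ι) : IsBaseChange B (n₂ k) := (hr k).2
  have key := isBaseChange_of_equalizer (A := A) (B := B) (E := P.obj Y) (E' := P.obj (Z i))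
    (N := ∀ k, P.obj (Z k)) (P := ∀ k, P.obj (Z₂ k)) (N' := ∀ k, P.obj (Z' k))
    (P' := ∀ k, P.obj (Z₂' k))
    { toFun := fun m k => r (f k) m
      map_add' := fun m m' => funext fun k => map_add _ m m'
      map_smul' := fun s m => funext fun k => rs (f k) s m }
    { toFun := fun x k => r (p k) (x k.1)
      map_add' := fun m m' => funext fun k => map_add _ _ _
      map_smul' := fun s x => funext fun k => (rs (p k) _ _).trans
        (congrArg (· • r (p k) (x k.1)) (comm _ _ (g₂ k) (𝟙 _) (Category.id_comp _).symm s)) }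
    { toFun := fun x k => r (q k) (x k.2)
      map_add' := fun m m' => funext fun k => map_add _ _ _
      map_smul' := fun s x => funext fun k => (rs (q k) _ _).trans
        (congrArg (· • r (q k) (x k.2)) (comm _ _ (f k.1) (p k) (hpq k).symm s)) }
    ?_ ?_
    { toFun := fun m k => r (a k) m
      map_add' := fun m m' => funext fun k => map_add _ m m'
      map_smul' := fun s m => funext fun k => rs (a k) s m }
    { toFun := fun x k => r (p' k) (x k.1)
      map_add' := fun m m' => funext fun k => map_add _ _ _
      map_smul' := fun s x => funext fun k => (rs (p' k) _ _).trans
        (congrArg (· • r (p' k) (x k.1)) (comm _ _ (a₂ k) (𝟙 _) (by simp [hp1]) s)) }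
    { toFun := fun x k => r (q' k) (x k.2)
      map_add' := fun m m' => funext fun k => map_add _ _ _
      map_smul' := fun s x => funext fun k => (rs (q' k) _ _).trans
        (congrArg (· • r (q' k) (x k.2)) (comm _ _ (a₂ k) (𝟙 _) (by simp [hq1]) s)) }
    ?_ ?_
    { toFun := fun m => r (f i) m
      map_add' := fun m m' => map_add _ m m'
      map_smul' := fun s m => rs (f i) s m }
    _ _ (IsBaseChange.pi (S := B) n hn') (IsBaseChange.pi (S := B) n₂ hr') ?_ ?_ ?_
  · exact ⟨rs (f i), key⟩
  · exact fun m m' hm => hP.sep_cover hf fun k => congrFun hm k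
  · intro x
    constructor
    · intro hx
      obtain ⟨m, hm⟩ := hP.glue_cover hf x fun k l => congrFun hx (k, l)
      exact ⟨m, funext hm⟩
    · rintro ⟨m, rfl⟩
      funext k
      refine (rr (f k.1) (p k) m).trans (Eq.trans ?_ (rr (f k.2) (q k) m).symm)
      rw [hpq]
  · exact fun m m' hm => hP.sep_cover (hf.base_change (f i)) fun k => congrFun hm k
  · intro m
    funext k
    refine (rr (a k.1) (p' k) m).trans (Eq.trans ?_ (rr (a k.2) (q' k) m).symm)
    rw [hp1, hq1]
  · intro m
    funext k
    refine (rr (f i) (a k) m).trans (Eq.trans ?_ (rr (f k) (b k) m).symm)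
    rw [hab]
  · intro x
    funext k
    refine (rr (b k.1) (p' k) _).trans (Eq.trans ?_ (rr (p k) (b₂ k) _).symm)
    rw [hp2]
    rfl
  · intro x
    funext k
    refine (rr (b k.2) (q' k) _).trans (Eq.trans ?_ (rr (q k) (b₂ k) _).symm)
    rw [hq2]
    rfl

end Descent

section IsBC

variable {A B : Type u} [CommRing A] [CommRing B] {f : A →+* B} {M N : Type u} [AddCommGroup M]
  [Module A M] [AddCommGroup N] [Module B N] {σ : M →+ N}

/-- Being a base change can be tested after base change to a faithfully flat family. -/
theorem IsBC.of_family {ι : Type u} {C : ι → Type u} [∀ i, CommRing (C i)] {g : ∀ i, B →+* C i}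
    (hg : letI (i : ι) : Algebra B (C i) := (g i).toAlgebra; FFFamily (A := B) C)
    (h : ∀ (r : A) (m : M), σ (r • m) = f r • σ m) {P : ι → Type u} [∀ i, AddCommGroup (P i)]
    [∀ i, Module (C i) (P i)] {τ : ∀ i, N →+ P i} (h1 : ∀ i, IsBC (g i) (τ i))
    (h2 : ∀ i, IsBC ((g i).comp f) ((τ i).comp σ)) : IsBC f σ := by
  let : Algebra A B := f.toAlgebra
  let : Module A N := Module.compHom N f
  have : IsScalarTower A B N := ⟨fun a b n => mul_smul (f a) b n⟩
  let (i : ι) : Algebra B (C i) := (g i).toAlgebra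
  let (i : ι) : Module B (P i) := Module.compHom (P i) (g i)
  have (i : ι) : IsScalarTower B (C i) (P i) := ⟨fun a b n => mul_smul (g i a) b n⟩
  let σ' : M →ₗ[A] N := { σ with map_smul' := h }
  let φ : B ⊗[A] M →ₗ[B] N := TensorProduct.AlgebraTensorModule.lift
    (LinearMap.toSpanSingleton B (M →ₗ[A] N) σ')
  have hφ (b : B) (m : M) : φ (b ⊗ₜ m) = b • σ m := rfl
  have hM : IsBC f (TensorProduct.mk A B M 1).toAddMonoidHom :=
    (isBC_iff (TensorProduct.mk A B M 1)).2 (TensorProduct.isBaseChange A M B)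
  have hbij : Function.Bijective φ := by
    refine hg.bijective φ fun i => ?_
    obtain ⟨t1, t2⟩ := h1 i
    have h3 : IsBC (g i) ((τ i).comp φ.toAddMonoidHom) := by
      refine hM.of_comp (g := g i) (fun r m => ?_) ?_
      · exact (congrArg (τ i) (φ.map_smul r m)).trans (t1 r (φ m))
      · convert! h2 i
        ext m
        exact congrArg (τ i) ((hφ 1 m).trans (one_smul _ _))
    obtain ⟨s1, s2⟩ := h3
    have e : t2.equiv.toEquiv ∘ (φ.lTensor (C i)) = s2.equiv.toEquiv := by
      funext x
      induction x with
      | zero =>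
        change t2.equiv (φ.lTensor (C i) 0) = s2.equiv 0
        rw [map_zero, map_zero, map_zero]
      | add x y hx hy =>
        change t2.equiv (φ.lTensor (C i) (x + y)) = s2.equiv (x + y)
        rw [map_add, map_add, map_add]
        exact congrArg₂ (· + ·) hx hy
      | tmul c m => exact (t2.equiv_tmul c (φ m)).trans (s2.equiv_tmul c m).symm
    have : φ.lTensor (C i) = t2.equiv.toEquiv.symm ∘ s2.equiv.toEquiv := by
      rw [← e, ← Function.comp_assoc, Equiv.symm_comp_self, Function.id_comp]
    rw [this]
    exact t2.equiv.toEquiv.symm.bijective.comp s2.equiv.toEquiv.bijective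
  exact (isBC_iff σ').2 (IsBaseChange.of_equiv (LinearEquiv.ofBijective φ hbij)
    fun x => (hφ 1 x).trans (one_smul _ _))

theorem IsBC.mem_span (h : IsBC f σ) (n : N) : n ∈ Submodule.span B (Set.range σ) := by
  let : Algebra A B := f.toAlgebra
  let : Module A N := Module.compHom N f
  have : IsScalarTower A B N := ⟨fun a b n => mul_smul (f a) b n⟩
  obtain ⟨h1, h2⟩ := h
  obtain ⟨x, rfl⟩ := h2.equiv.surjective n
  induction x with
  | zero => rw [map_zero]; exact zero_mem _
  | add x y hx hy => rw [map_add]; exact add_mem hx hy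
  | tmul b m =>
    rw [IsBaseChange.equiv_tmul]
    exact Submodule.smul_mem _ _ (Submodule.subset_span ⟨m, rfl⟩)

/-- Relations between elements of `B ⊗ M` of the form `1 ⊗ m` come from relations in `M`. -/
theorem IsBC.relation (h : IsBC f σ) (a : M →₀ B) (ha : (a.sum fun m b => b • σ m) = 0) :
    a ∈ Submodule.span B (Set.range fun c : {c : M →₀ A // (c.sum fun m r => r • m) = 0} =>
      c.1.mapRange f (map_zero f)) := by
  let : Algebra A B := f.toAlgebra
  let : Module A N := Module.compHom N f
  have : IsScalarTower A B N := ⟨fun a b n => mul_smul (f a) b n⟩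
  obtain ⟨h1, h2⟩ := h
  let L := Submodule.span B (Set.range fun c : {c : M →₀ A // (c.sum fun m r => r • m) = 0} =>
      c.1.mapRange f (map_zero f))
  let Q := (M →₀ B) ⧸ L
  let s : M →ₗ[A] Q :=
    { toFun := fun m => L.mkQ (Finsupp.single m 1)
      map_add' := fun m m' => by
        rw [← map_add, ← sub_eq_zero, ← map_sub]
        refine (Submodule.Quotient.mk_eq_zero L).2 (Submodule.subset_span
          ⟨⟨Finsupp.single (m + m') 1 - (Finsupp.single m 1 + Finsupp.single m' 1), ?_⟩, ?_⟩)
        · change Finsupp.linearCombination A id _ = 0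
          simp
        · change Finsupp.mapRange.addMonoidHom f.toAddMonoidHom _ = _
          rw [map_sub, map_add]
          simp
      map_smul' := fun r m => by
        change _ = f r • L.mkQ (Finsupp.single m 1)
        rw [← map_smul, ← sub_eq_zero, ← map_sub]
        refine (Submodule.Quotient.mk_eq_zero L).2 (Submodule.subset_span
          ⟨⟨Finsupp.single (r • m) 1 - Finsupp.single m r, ?_⟩, ?_⟩)
        · change Finsupp.linearCombination A id _ = 0
          simp
        · change Finsupp.mapRange.addMonoidHom f.toAddMonoidHom _ = _
          rw [map_sub]
          simp }
  let S : B ⊗[A] M →ₗ[B] Q := TensorProduct.AlgebraTensorModule.lift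
    (LinearMap.toSpanSingleton B (M →ₗ[A] Q) s)
  have hS (b : B) (m : M) : S (b ⊗ₜ m) = b • L.mkQ (Finsupp.single m 1) := rfl
  have h3 : ∀ a : M →₀ B, h2.equiv (a.sum fun m b => b ⊗ₜ m) = a.sum fun m b => b • σ m := by
    intro a
    rw [map_finsuppSum]
    exact Finsupp.sum_congr fun m _ => h2.equiv_tmul _ _
  have h4 : (a.sum fun m b => b ⊗ₜ[A] m) = 0 := by
    apply h2.equiv.injective
    rw [h3, ha, map_zero]
  have h5 : S (a.sum fun m b => b ⊗ₜ[A] m) = L.mkQ a := by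
    rw [map_finsuppSum]
    conv_rhs => rw [← Finsupp.sum_single a, map_finsuppSum]
    refine Finsupp.sum_congr fun m _ => ?_
    rw [hS, ← map_smul]
    simp
  rw [h4, map_zero] at h5
  exact (Submodule.Quotient.mk_eq_zero L).1 h5.symm

theorem mem_span_image (h : ∀ (r : A) (m : M), σ (r • m) = f r • σ m) {s : Set M} {m : M}
    (hm : m ∈ Submodule.span A s) : σ m ∈ Submodule.span B (σ '' s) := by
  induction hm using Submodule.span_induction with
  | mem x hx => exact Submodule.subset_span ⟨x, hx, rfl⟩
  | zero => rw [map_zero]; exact zero_mem _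
  | add x y _ _ hx hy => rw [map_add]; exact add_mem hx hy
  | smul r x _ hx => rw [h]; exact Submodule.smul_mem _ _ hx

end IsBC

section Descent

variable {X : Scheme.{u}}

/-- Restrictions of quasi-coherent modules between affine schemes are base changes. A finite affine
covering over which there are presentations reduces this to modules with a presentation, by
faithfully flat descent on both schemes. -/
theorem isBC_of_isQCoh {M : PreMod X} (hM : IsQCoh M) {Y V : Over X} [IsAffine Y.left]
    [IsAffine V.left] (f : V ⟶ Y) :
    IsBC f.left.appTop.hom ((toLoc M).res (e := Y) (e' := V) f) := by
  have hS : (toLoc M).IsSheaf := isSheaf_toLoc.2 hM.1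
  obtain ⟨R, hR, hRp⟩ := hM.2 Y
  obtain ⟨ι, hι, Z, g, hZ, hg, hRg⟩ := exists_finite_affine_cover hR
  have h (i : ι) (T : Over X) (t : T ⟶ Z i) (hT : IsAffine T.left) :
      IsBC t.left.appTop.hom ((toLoc M).res (e := Z i) (e' := T) t) :=
    have := hZ i
    isBC_of_presentation hS (hRp _ _ (hRg i)) t
  have hV (i : ι) : IsAffine (fp f (g i)).left := have := hZ i; inferInstance
  have hgV := hg.base_change f
  have h' (i : ι) (T : Over X) (t : T ⟶ fp f (g i)) (hT : IsAffine T.left) :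
      IsBC t.left.appTop.hom ((toLoc M).res (e := fp f (g i)) (e' := T) t) :=
    LocMod.isBC_of_comp (P := toLoc M) (e := Z i) (e' := fp f (g i)) (e'' := T)
      (f := fp2 f (g i)) (h i _ _ (hV i)) (h i _ _ hT)
  refine IsBC.of_family (hgV.faithfullyFlat inferInstance hV)
    ((toLoc M).res_smul (e := Y) (e' := V) f)
    (P := fun i => (toLoc M).obj (fp f (g i)))
    (τ := fun i => (toLoc M).res (e := V) (e' := fp f (g i)) (fp1 f (g i)))
    (fun i => isBC_of_cover hS hgV hV h' i) (fun i => ?_)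
  have h1 := LocMod.isBC_comp (P := toLoc M) (e := Y) (e' := Z i) (e'' := fp f (g i))
    (g := fp2 f (g i)) (isBC_of_cover hS hg hZ h i) (h i _ _ (hV i))
  rw [← fp_w, Over.comp_left, Scheme.Hom.comp_appTop] at h1
  convert! h1
  ext m
  exact ((toLoc M).res_comp (e := Y) (e' := V) (e'' := fp f (g i)) f (fp1 f (g i)) m).symm

/-- A sheaf of modules is quasi-coherent if locally its sections over affine schemes are compatible
with base change: take all sections as generators, and all relations between them. -/
theorem isQCoh_of_isBC {M : PreMod X} (hS : (toLoc M).IsSheaf)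
    (h : ∀ Y : Over X, ∃ R ∈ fppf X Y, ∀ (Z : Over X) (z : Z ⟶ Y), R z → IsAffine Z.left →
      ∀ (T : Over X) (t : T ⟶ Z), IsAffine T.left →
        IsBC t.left.appTop.hom ((toLoc M).res (e := Z) (e' := T) t)) : IsQCoh M := by
  refine ⟨isSheaf_toLoc.1 hS, fun Y => ?_⟩
  obtain ⟨R, hR, hRb⟩ := h Y
  obtain ⟨ι, Z, f, hZ, hf, hRf⟩ := exists_affine_cover hR
  refine ⟨Sieve.ofArrows Z f, hf.ofArrows_mem, ?_⟩
  rintro V _ ⟨_, v, _, ⟨i⟩, rfl⟩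
  have hbc := hRb _ _ (hRf i) (hZ i)
  let P := toLoc M
  let rs {V W : Over X} (k : V ⟶ W) : P.obj W →+ P.obj V := P.res (e := W) (e' := V) k
  have rr {U V W : Over X} (k : V ⟶ W) (l : U ⟶ V) (m : P.obj W) : rs l (rs k m) = rs (l ≫ k) m :=
    (P.res_comp (e := W) (e' := V) (e'' := U) k l m).symm
  have gg {U V W : Over X} (k : V ⟶ W) (l : U ⟶ V) (c : P.obj (Z i) →₀ Γ(W.left, ⊤)) :
      (c.mapRange k.left.appTop.hom (map_zero _)).mapRange l.left.appTop.hom (map_zero _) =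
        c.mapRange (l ≫ k).left.appTop.hom (map_zero _) := by
    ext m
    simp only [Finsupp.mapRange_apply, Over.comp_left, Scheme.Hom.comp_appTop]
    rfl
  refine hasPresentationOver_iff.2 ⟨P.obj (Z i),
    {c : P.obj (Z i) →₀ Γ((Z i).left, ⊤) // (c.sum fun m r => r • m) = 0},
    fun m => rs v m, fun c => c.1.mapRange v.left.appTop.hom (map_zero _), fun c => ?_,
    fun T t m => ?_, fun T t a ha => ?_⟩
  · refine (Finsupp.sum_mapRange_index (f := v.left.appTop.hom) (g := c.1)
      (h := fun m r => r • rs v m) (fun _ => zero_smul _ _)).trans ?_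
    refine Eq.trans ?_ ((congrArg (rs v) c.2).trans (map_zero (rs v)))
    rw [Finsupp.sum, Finsupp.sum, map_sum]
    exact Finset.sum_congr rfl fun m _ => (P.res_smul (e := Z i) (e' := V) v _ m).symm
  · obtain ⟨ι', W, w, hW, hw, -⟩ := exists_affine_cover ((fppf X).top_mem T)
    refine ⟨Sieve.ofArrows W w, hw.ofArrows_mem, ?_⟩
    rintro T' _ ⟨_, l, _, ⟨k⟩, rfl⟩
    have h1 := (hbc (W k) (w k ≫ t ≫ v) (hW k)).mem_span (rs (w k) m)
    have h2 := mem_span_image (σ := rs l) (f := l.left.appTop.hom)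
      (fun r m => P.res_smul (e := W k) (e' := T') l r m) h1
    have e1 : rs l (rs (w k) m) = rs (l ≫ w k) m := rr _ _ _
    rw [e1] at h2
    refine Submodule.span_mono ?_ h2
    rintro _ ⟨_, ⟨n, rfl⟩, rfl⟩
    refine ⟨n, (rr _ _ _).trans (Eq.trans ?_ (rr (w k ≫ t ≫ v) l n).symm)⟩
    simp only [Category.assoc]
  · obtain ⟨ι', W, w, hW, hw, -⟩ := exists_affine_cover ((fppf X).top_mem T)
    refine ⟨Sieve.ofArrows W w, hw.ofArrows_mem, ?_⟩
    rintro T' _ ⟨_, l, _, ⟨k⟩, rfl⟩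
    have h1 := (hbc (W k) (w k ≫ t ≫ v) (hW k)).relation
      (a.mapRange (w k).left.appTop.hom (map_zero _)) (by
        refine (Finsupp.sum_mapRange_index (f := (w k).left.appTop.hom) (g := a)
          (h := fun m r => r • rs (w k ≫ t ≫ v) m) (fun _ => zero_smul _ _)).trans ?_
        refine Eq.trans ?_ ((congrArg (rs (w k)) ha).trans (map_zero (rs (w k))))
        rw [Finsupp.sum, Finsupp.sum, map_sum]
        refine Finset.sum_congr rfl fun m _ => ?_
        refine Eq.trans ?_ (P.res_smul (e := T) (e' := W k) (w k) _ _).symm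
        refine congrArg (_ • ·) ?_
        refine Eq.trans ?_ (congrArg (rs (w k)) (rr v t m).symm)
        exact (rr _ _ _).symm)
    have h2 := mem_span_image (σ := Finsupp.mapRange.addMonoidHom l.left.appTop.hom.toAddMonoidHom)
      (f := l.left.appTop.hom) (fun r c => by
        ext m
        exact map_mul l.left.appTop.hom r (c m)) h1
    have e1 : Finsupp.mapRange.addMonoidHom l.left.appTop.hom.toAddMonoidHom
      (a.mapRange (w k).left.appTop.hom (map_zero _)) =
        a.mapRange (l ≫ w k).left.appTop.hom (map_zero _) := gg _ _ _
    rw [e1] at h2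
    refine Submodule.span_mono ?_ h2
    rintro _ ⟨_, ⟨c, rfl⟩, rfl⟩
    refine ⟨c, (gg _ _ _).trans (Eq.trans ?_ (gg (w k ≫ t ≫ v) l c.1).symm)⟩
    simp only [Category.assoc]

end Descent

/-! ### Assembling functors from their values on affine schemes -/

section Assembly

variable {R S R₁ R₂ R₃ R₁' R₂' R₃' : Type u} [CommRing R] [CommRing S] [CommRing R₁] [CommRing R₂]
  [CommRing R₃] [CommRing R₁'] [CommRing R₂'] [CommRing R₃']

/-- The semilinear map `m ↦ ψ (1 ⊗ m)` which corresponds to the linear map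
`ψ : S ⊗ M ⟶ N`. -/
def semilin (f : R →+* S) {M : ModuleCat.{u} R} {N : ModuleCat.{u} S}
    (ψ : (ModuleCat.extendScalars.{u, u, u} f).obj M ⟶ N) : M →+ N :=
  ((ModuleCat.extendRestrictScalarsAdj f).homEquiv M N ψ).hom.toAddMonoidHom

theorem semilin_smul (f : R →+* S) {M : ModuleCat.{u} R} {N : ModuleCat.{u} S}
    (ψ : (ModuleCat.extendScalars.{u, u, u} f).obj M ⟶ N) (r : R) (m : M) :
    semilin f ψ (r • m) = f r • semilin f ψ m :=
  map_smul ((ModuleCat.extendRestrictScalarsAdj f).homEquiv M N ψ).hom r m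

theorem semilin_injective (f : R →+* S) {M : ModuleCat.{u} R} {N : ModuleCat.{u} S}
    {ψ χ : (ModuleCat.extendScalars.{u, u, u} f).obj M ⟶ N}
    (h : ∀ m, semilin f ψ m = semilin f χ m) : ψ = χ := by
  apply ((ModuleCat.extendRestrictScalarsAdj f).homEquiv M N).injective
  ext m
  exact h m

theorem isBC_one_tmul (f : R →+* S) (M : ModuleCat.{u} R) :
    IsBC f (semilin f (𝟙 ((ModuleCat.extendScalars.{u, u, u} f).obj M))) := by
  refine ⟨semilin_smul f _, ?_⟩
  let : Algebra R S := f.toAlgebra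
  exact TensorProduct.isBaseChange R M S

theorem isBC_semilin (f : R →+* S) {M : ModuleCat.{u} R} {N : ModuleCat.{u} S}
    (ψ : (ModuleCat.extendScalars.{u, u, u} f).obj M ⟶ N) [IsIso ψ] : IsBC f (semilin f ψ) :=
  (isBC_one_tmul f M).comp (IsBC.of_bijective (f := RingHom.id S) Function.bijective_id
    (σ := ψ.hom.toAddMonoidHom) (fun r m => map_smul ψ.hom r m)
    (ConcreteCategory.bijective_of_isIso ψ))

theorem isIso_of_isBC (f : R →+* S) {M : ModuleCat.{u} R} {N : ModuleCat.{u} S}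
    (ψ : (ModuleCat.extendScalars.{u, u, u} f).obj M ⟶ N) (h : IsBC f (semilin f ψ)) :
    IsIso ψ := by
  obtain ⟨_, h⟩ := h
  let : Algebra R S := f.toAlgebra
  let : Module R N := Module.compHom N f
  have : IsScalarTower R S N := ⟨fun a b n => mul_smul (f a) b n⟩
  let e : (ModuleCat.extendScalars.{u, u, u} f).obj M ≅ N := LinearEquiv.toModuleIso h.equiv
  have : ψ = e.hom := semilin_injective f fun m => by
    refine Eq.trans ?_ (h.equiv_tmul 1 m).symm
    exact (one_smul S _).symm
  rw [this]
  infer_instance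

theorem semilin_canId (f : R →+* R) (hf : f = RingHom.id R) (M : ModuleCat.{u} R) (m : M) :
    semilin f ((canId f hf).hom.app M) m = m := by
  revert M m
  -- the proof `hf` is generalized separately, so that it stays syntactically the same
  suffices h : ∀ (h : RingHom.id R = f) (hf : f = RingHom.id R) (M : ModuleCat.{u} R) (m : M),
    semilin f ((canId f hf).hom.app M) m = m from h hf.symm hf
  intro h
  subst h
  intro hf M m
  have h : (canId (RingHom.id R) hf).hom.app M = (ModuleCat.extendScalarsId R).hom.app M := by
    simp only [canId, eqToIso_refl, Iso.refl_trans]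
  unfold semilin
  rw [h, ModuleCat.homEquiv_extendScalarsId]
  rfl

theorem canComp_one_tmul (f : R₁ →+* R₂) (g : R₂ →+* R₃) (k : R₁ →+* R₃) (hk : k = g.comp f)
    (M : ModuleCat.{u} R₁) (m : M) :
    (canComp f g k hk).hom.app M ((1 : R₃) ⊗ₜ[R₂, g] ((1 : R₂) ⊗ₜ[R₁, f] m :
      (ModuleCat.extendScalars.{u, u, u} f).obj M)) = (1 : R₃) ⊗ₜ[R₁, k] m := by
  revert M m
  suffices h : ∀ (h : g.comp f = k) (hk : k = g.comp f) (M : ModuleCat.{u} R₁) (m : M),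
    (canComp f g k hk).hom.app M ((1 : R₃) ⊗ₜ[R₂, g] ((1 : R₂) ⊗ₜ[R₁, f] m :
      (ModuleCat.extendScalars.{u, u, u} f).obj M)) = (1 : R₃) ⊗ₜ[R₁, k] m from h hk.symm hk
  intro h
  subst h
  intro hk M m
  have h : (canComp f g _ hk).hom.app M = (ModuleCat.extendScalarsComp f g).inv.app M := by
    simp only [canComp, eqToIso_refl, Iso.trans_refl, Iso.symm_hom]
  rw [h]
  refine (congrArg ((ModuleCat.extendScalarsComp f g).inv.app M)
    (ModuleCat.extendScalarsComp_hom_app_one_tmul f g M m).symm).trans ?_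
  exact ConcreteCategory.congr_hom (Iso.hom_inv_id ((ModuleCat.extendScalarsComp f g).app M)) _

/-- Maps out of `R₃ ⊗ (R₂ ⊗ M)` are determined by their values on the elements `1 ⊗ (1 ⊗ m)`. -/
theorem hom_ext_one_tmul (f : R₁ →+* R₂) (g : R₂ →+* R₃) {M : ModuleCat.{u} R₁}
    {N : ModuleCat.{u} R₃} {ψ χ : (ModuleCat.extendScalars.{u, u, u} g).obj
      ((ModuleCat.extendScalars.{u, u, u} f).obj M) ⟶ N}
    (h : ∀ m : M, ψ ((1 : R₃) ⊗ₜ[R₂, g] ((1 : R₂) ⊗ₜ[R₁, f] m :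
      (ModuleCat.extendScalars.{u, u, u} f).obj M)) = χ ((1 : R₃) ⊗ₜ[R₂, g]
        ((1 : R₂) ⊗ₜ[R₁, f] m : (ModuleCat.extendScalars.{u, u, u} f).obj M))) : ψ = χ := by
  apply ((ModuleCat.extendRestrictScalarsAdj g).homEquiv _ N).injective
  apply ((ModuleCat.extendRestrictScalarsAdj f).homEquiv M _).injective
  ext m
  exact h m

/-- The transition map `F₂(ρ) ∘ θ ∘ (1 ⊗ -) : F₁(M₁) ⟶ F₂(M₂)` given by a base change isomorphism
`θ` and a map `ρ : R₂' ⊗ M₁ ⟶ M₂`. -/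
def transMap {F₁ : ModuleCat.{u} R₁' ⥤ ModuleCat.{u} R₁} {F₂ : ModuleCat.{u} R₂' ⥤ ModuleCat.{u} R₂}
    {f : R₁ →+* R₂} {f' : R₁' →+* R₂'}
    (θ : F₁ ⋙ ModuleCat.extendScalars.{u, u, u} f ≅ ModuleCat.extendScalars.{u, u, u} f' ⋙ F₂)
    {M₁ : ModuleCat.{u} R₁'} {M₂ : ModuleCat.{u} R₂'}
    (ρ : (ModuleCat.extendScalars.{u, u, u} f').obj M₁ ⟶ M₂) : F₁.obj M₁ →+ F₂.obj M₂ :=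
  semilin f (θ.hom.app M₁ ≫ F₂.map ρ)

section

variable {F₁ : ModuleCat.{u} R₁' ⥤ ModuleCat.{u} R₁} {F₂ : ModuleCat.{u} R₂' ⥤ ModuleCat.{u} R₂}
    {F₃ : ModuleCat.{u} R₃' ⥤ ModuleCat.{u} R₃}
    {f : R₁ →+* R₂} {f' : R₁' →+* R₂'} {g : R₂ →+* R₃} {g' : R₂' →+* R₃'}
    {k : R₁ →+* R₃} {k' : R₁' →+* R₃'}
    {θf : F₁ ⋙ ModuleCat.extendScalars.{u, u, u} f ≅ ModuleCat.extendScalars.{u, u, u} f' ⋙ F₂}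
    {θg : F₂ ⋙ ModuleCat.extendScalars.{u, u, u} g ≅ ModuleCat.extendScalars.{u, u, u} g' ⋙ F₃}
    {θk : F₁ ⋙ ModuleCat.extendScalars.{u, u, u} k ≅ ModuleCat.extendScalars.{u, u, u} k' ⋙ F₃}
    {M₁ : ModuleCat.{u} R₁'} {M₂ : ModuleCat.{u} R₂'} {M₃ : ModuleCat.{u} R₃'}

theorem isBC_transMap (ρ : (ModuleCat.extendScalars.{u, u, u} f').obj M₁ ⟶ M₂) [IsIso ρ] :
    IsBC f (transMap θf ρ) := isBC_semilin f _

theorem transMap_nat (ρ : (ModuleCat.extendScalars.{u, u, u} f').obj M₁ ⟶ M₂)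
    {N₁ : ModuleCat.{u} R₁'} {N₂ : ModuleCat.{u} R₂'}
    (ρ' : (ModuleCat.extendScalars.{u, u, u} f').obj N₁ ⟶ N₂) (α : M₁ ⟶ N₁) (β : M₂ ⟶ N₂)
    (w : ρ ≫ β = (ModuleCat.extendScalars.{u, u, u} f').map α ≫ ρ') (m : F₁.obj M₁) :
    F₂.map β (transMap θf ρ m) = transMap θf ρ' (F₁.map α m) := by
  have h : (θf.hom.app M₁ ≫ F₂.map ρ) ≫ F₂.map β =
      (ModuleCat.extendScalars.{u, u, u} f).map (F₁.map α) ≫ θf.hom.app N₁ ≫ F₂.map ρ' := by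
    rw [Category.assoc, ← F₂.map_comp, w, F₂.map_comp]
    exact (θf.hom.naturality_assoc α _).symm
  exact ConcreteCategory.congr_hom h ((1 : R₂) ⊗ₜ[R₁, f] m)

/-- The cocycle condition for `θ` is the transitivity of the transition maps: both sides are
compared on the elements `1 ⊗ (1 ⊗ m)`. -/
theorem transMap_transMap {hk : k = g.comp f} {hk' : k' = g'.comp f'}
    (hθ : CocycleCompat F₁ F₂ F₃ f g k hk f' g' k' hk' θf θg θk)
    (ρf : (ModuleCat.extendScalars.{u, u, u} f').obj M₁ ⟶ M₂)
    (ρg : (ModuleCat.extendScalars.{u, u, u} g').obj M₂ ⟶ M₃)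
    (ρk : (ModuleCat.extendScalars.{u, u, u} k').obj M₁ ⟶ M₃)
    (hρ : ∀ m : M₁, semilin k' ρk m = semilin g' ρg (semilin f' ρf m)) (m : F₁.obj M₁) :
    transMap θk ρk m = transMap θg ρg (transMap θf ρf m) := by
  have w : (canComp f' g' k' hk').hom.app M₁ ≫ ρk =
      (ModuleCat.extendScalars.{u, u, u} g').map ρf ≫ ρg := by
    refine hom_ext_one_tmul f' g' fun x => ?_
    exact (congrArg ρk (canComp_one_tmul f' g' k' hk' M₁ x)).trans (hρ x)
  have w₂ : (ModuleCat.extendScalars.{u, u, u} g).map (F₂.map ρf) ≫ θg.hom.app M₂ =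
      θg.hom.app _ ≫ F₃.map ((ModuleCat.extendScalars.{u, u, u} g').map ρf) :=
    θg.hom.naturality ρf
  have h : (canComp f g k hk).hom.app (F₁.obj M₁) ≫ θk.hom.app M₁ ≫ F₃.map ρk =
      (ModuleCat.extendScalars.{u, u, u} g).map (θf.hom.app M₁ ≫ F₂.map ρf) ≫
        θg.hom.app M₂ ≫ F₃.map ρg := by
    rw [Functor.map_comp, Category.assoc, reassoc_of% w₂, ← F₃.map_comp, ← w, F₃.map_comp,
      ← Category.assoc, hθ M₁, Category.assoc, Category.assoc]
  let m' : (ModuleCat.extendScalars.{u, u, u} f).obj (F₁.obj M₁) := (1 : R₂) ⊗ₜ[R₁, f] m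
  refine Eq.trans ?_ (ConcreteCategory.congr_hom h ((1 : R₃) ⊗ₜ[R₂, g] m'))
  refine Eq.trans ?_ (ModuleCat.comp_apply _ _ _).symm
  exact congrArg (θk.hom.app M₁ ≫ F₃.map ρk) (canComp_one_tmul f g k hk (F₁.obj M₁) m).symm

theorem transMap_id {f : R₁ →+* R₁} {f' : R₁' →+* R₁'} {hf : f = RingHom.id R₁}
    {hf' : f' = RingHom.id R₁'}
    {θ : F₁ ⋙ ModuleCat.extendScalars.{u, u, u} f ≅ ModuleCat.extendScalars.{u, u, u} f' ⋙ F₁}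
    (hθ : UnitCompat F₁ f hf f' hf' θ) (ρ : (ModuleCat.extendScalars.{u, u, u} f').obj M₁ ⟶ M₁)
    (hρ : ∀ m : M₁, semilin f' ρ m = m) (m : F₁.obj M₁) : transMap θ ρ m = m := by
  have w : ρ = (canId f' hf').hom.app M₁ :=
    semilin_injective _ fun x => (hρ x).trans (semilin_canId f' hf' M₁ x).symm
  subst w
  exact (congrArg (fun ψ => semilin f ψ m) (hθ M₁)).trans (semilin_canId f hf (F₁.obj M₁) m)

end

variable {X : Scheme.{u}}

theorem LocMod.Cartesian.of_hom' {E : Type*} {π : E → Over X} {P Q : LocMod π}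
    (hP : Q.Cartesian) (α : Hom P Q) (h : ∀ e, Function.Bijective (α.app e)) : P.Cartesian := by
  let i (e : E) := LinearEquiv.ofBijective (α.app e) (h e)
  refine hP.of_hom ⟨fun e => (i e).symm.toLinearMap, fun {e e'} f m => ?_⟩
    fun e => (i e).symm.bijective
  apply (i e').injective
  refine ((i e').apply_symm_apply _).trans (Eq.trans ?_ (α.nat f _).symm)
  exact congrArg (Q.res f) ((i e).apply_symm_apply m).symm

/-- A morphism of presheaves of `O`-modules, considered as a family of linear maps. -/
def ofPre {M N : PreMod X} (f : M ⟶ N) : LocMod.Hom (toLoc M) (toLoc N) where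
  app W := (f.app (op W)).hom
  nat g m := PresheafOfModules.naturality_apply f (Quiver.Hom.op (V := Over X) g) m

/-- Composition of linear maps. -/
def LocMod.Hom.comp {E : Type*} {π : E → Over X} {P Q R : LocMod π} (α : Hom P Q) (β : Hom Q R) :
    Hom P R where
  app e := β.app e ∘ₗ α.app e
  nat f m := (congrArg (β.app _) (α.nat f m)).trans (β.nat f _)

/-- Functors with values in quasi-coherent modules are isomorphic if their sections over the members
of a dense family are, compatibly with restriction. -/
theorem exists_natIso {C : Type*} [Category C] {E : Type*} {π : E → Over X} (hπ : Dense π)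
    {Φ Ψ : C ⥤ QCoh X} (α : ∀ A : E, Φ ⋙ evAt (π A).hom ≅ Ψ ⋙ evAt (π A).hom)
    (h : ∀ (A B : E) (f : π B ⟶ π A) (c : C) (m : (Φ ⋙ evAt (π A).hom).obj c),
      (α B).hom.app c (resAt (Φ.obj c) f.left (π A).hom (π B).hom (Over.w f) m) =
        resAt (Ψ.obj c) f.left (π A).hom (π B).hom (Over.w f) ((α A).hom.app c m)) :
    ∃ φ : Φ ≅ Ψ, ∀ (A : E) (c : C), (evAt (π A).hom).map (φ.hom.app c) = (α A).hom.app c := by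
  have hs (M : QCoh X) : (toLoc M.obj).IsSheaf := isSheaf_toLoc.2 M.property.1
  have hβ (c : C) := LocMod.Hom.exists_extension (hs (Ψ.obj c)) hπ
    ((⟨fun A => ((α A).hom.app c).hom, fun {A B} f m => h A B f c m⟩ :
      LocMod.Hom ((toLoc (Φ.obj c).obj).comap π)
        ((toLoc (Ψ.obj c).obj).comap π)))
  choose β hβ using hβ
  have hb (c : C) := LocMod.Hom.bijective_of_dense (hs (Φ.obj c)) (hs (Ψ.obj c)) hπ (β c)
    (fun A => by
      have := ConcreteCategory.bijective_of_isIso ((α A).hom.app c)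
      convert! this using 1
      funext m
      exact hβ c A m)
  let φ (c : C) : Φ.obj c ⟶ Ψ.obj c := ⟨(β c).toPre⟩
  have hiso (c : C) : IsIso (φ c) := by
    have : IsIso ((IsQCoh (X := X)).ι.map (φ c)) := isIso_of_bijective _ (hb c)
    exact isIso_of_reflects_iso _ (IsQCoh (X := X)).ι
  refine ⟨NatIso.ofComponents (fun c => asIso (φ c)) ?_, fun A c => ?_⟩
  · intro c d a
    apply IsQCoh.hom_ext
    have key : LocMod.Hom.comp (β c) (ofPre (Ψ.map a).hom) =
        LocMod.Hom.comp (ofPre (Φ.map a).hom) (β d) := by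
      refine LocMod.Hom.ext_dense (hs (Ψ.obj d)) hπ fun A m => ?_
      refine (congrArg _ (hβ c A m)).trans (Eq.trans ?_ (hβ d A _).symm)
      exact (ConcreteCategory.congr_hom ((α A).hom.naturality a) m).symm
    exact (congrArg LocMod.Hom.toPre key).symm
  · ext m
    exact hβ c A m

/-- Functors `G A` for the affine schemes `A` over `X` whose values are related by natural
transition maps `σ` form a functor with values in quasi-coherent modules, provided that the maps `σ`
satisfy the cocycle condition and are base changes: the values `G A c` then form a sheaf of modules
on affine schemes by faithfully flat descent, and its extension is quasi-coherent. -/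
theorem exists_assembly {C : Type*} [Category C]
    (G : ∀ A : AffOver X, C ⥤ ModuleCat.{u} Γ(A.1.left, ⊤))
    (σ : ∀ {A B : AffOver X} (_ : B.1 ⟶ A.1) (c : C), (G A).obj c →+ (G B).obj c)
    (hσ : ∀ (A B : AffOver X) (f : B.1 ⟶ A.1) (c : C), IsBC f.left.appTop.hom (σ f c))
    (nat : ∀ (A B : AffOver X) (f : B.1 ⟶ A.1) (c d : C) (a : c ⟶ d) (m : (G A).obj c),
      (G B).map a (σ f c m) = σ f d ((G A).map a m))
    (id : ∀ (A : AffOver X) (c : C) (m : (G A).obj c), σ (𝟙 A.1) c m = m)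
    (comp : ∀ (A B D : AffOver X) (f : B.1 ⟶ A.1) (g : D.1 ⟶ B.1) (c : C) (m : (G A).obj c),
      σ (g ≫ f) c m = σ g c (σ f c m)) :
    ∃ (Φ : C ⥤ QCoh X) (e : ∀ A : AffOver X, Φ ⋙ evAt A.1.hom ≅ G A),
      ∀ (A B : AffOver X) (f : B.1 ⟶ A.1) (c : C) (m : (Φ ⋙ evAt A.1.hom).obj c),
        (e B).hom.app c ((toLoc (Φ.obj c).obj).res (e := A.1) (e' := B.1) f m) =
          σ f c ((e A).hom.app c m) := by
  let P (c : C) : LocMod (Subtype.val : AffOver X → Over X) :=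
    { obj := fun A => (G A).obj c
      ab := fun A => inferInstance
      mod := fun A => inferInstanceAs (Module Γ(A.1.left, ⊤) ((G A).obj c))
      res := fun f => σ f c
      res_smul := fun f r m => (hσ _ _ f c).smul r m
      res_id := fun m => id _ c m
      res_comp := fun f g m => comp _ _ _ f g c m }
  have hP (c : C) : (P c).Cartesian := fun A B f => hσ A B f c
  choose N hN γ hγ using fun c => LocMod.exists_extension (hP c).isSheaf (dense_aff X)
  have hq (c : C) : IsQCoh (N c) := by
    refine isQCoh_of_isBC (hN c) fun Y => ⟨⊤, (fppf X).top_mem Y, fun Z z _ hZ T t hT => ?_⟩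
    exact ((hP c).of_hom' (γ c) (hγ c)) ⟨Z, hZ⟩ ⟨T, hT⟩ t
  let iso (A : AffOver X) (c : C) := LinearEquiv.ofBijective ((γ c).app A) (hγ c A)
  have hiso (A B : AffOver X) (f : B.1 ⟶ A.1) (c : C) (m) :
    iso B c ((toLoc (N c)).res (e := A.1) (e' := B.1) f m) = σ f c (iso A c m) := (γ c).nat f m
  have hext (c d : C) (a : c ⟶ d) := LocMod.Hom.exists_extension (hN d) (dense_aff X)
    ((⟨fun A => (iso A d).symm.toLinearMap ∘ₗ ((G A).map a).hom ∘ₗ (iso A c).toLinearMap,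
      fun {A B} f m => by
        apply (iso B d).injective
        refine ((iso B d).apply_symm_apply _).trans (Eq.trans ?_ (hiso A B f d _).symm)
        refine (congrArg _ (hiso A B f c m)).trans ((nat A B f c d a _).trans (congrArg (σ f d) ?_))
        exact ((iso A d).apply_symm_apply _).symm⟩ :
      LocMod.Hom ((toLoc (N c)).comap Subtype.val) ((toLoc (N d)).comap Subtype.val)))
  choose β hβ using hext
  have hβ' (c d : C) (a : c ⟶ d) (A : AffOver X) (m) :
      iso A d ((β c d a).app A.1 m) = (G A).map a (iso A c m) := by
    rw [hβ]
    exact (iso A d).apply_symm_apply _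
  let Φ : C ⥤ QCoh X :=
    { obj := fun c => ⟨N c, hq c⟩
      map := fun {c d} a => ⟨(β c d a).toPre⟩
      map_id := fun c => by
        apply IsQCoh.hom_ext
        have key : β c c (𝟙 c) = ofPre (𝟙 (N c)) := by
          refine LocMod.Hom.ext_dense (hN c) (dense_aff X) fun A m => ?_
          apply (iso A c).injective
          exact (hβ' c c _ A m).trans
            (congrArg (fun φ : (G A).obj c ⟶ (G A).obj c => φ (iso A c m)) ((G A).map_id c))
        exact congrArg LocMod.Hom.toPre key
      map_comp := fun {c d e} a b => by
        apply IsQCoh.hom_ext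
        have key : β c e (a ≫ b) = (β c d a).comp (β d e b) := by
          refine LocMod.Hom.ext_dense (hN e) (dense_aff X) fun A m => ?_
          apply (iso A e).injective
          refine (hβ' c e _ A m).trans (Eq.trans ?_ (hβ' d e b A _).symm)
          refine Eq.trans ?_ (congrArg ((G A).map b) (hβ' c d a A m)).symm
          exact congrArg (fun φ : (G A).obj c ⟶ (G A).obj e => φ (iso A c m)) ((G A).map_comp a b)
        exact congrArg LocMod.Hom.toPre key }
  let ι (A : AffOver X) (c : C) : (Φ ⋙ evAt A.1.hom).obj c ≅ (G A).obj c :=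
    (iso A c).toModuleIso
  have hι (A : AffOver X) {c d : C} (a : c ⟶ d) :
      (Φ ⋙ evAt A.1.hom).map a ≫ (ι A d).hom = (ι A c).hom ≫ (G A).map a := by
    ext m
    exact hβ' c d a A m
  let e (A : AffOver X) : Φ ⋙ evAt A.1.hom ≅ G A := NatIso.ofComponents (ι A) (hι A)
  exact ⟨Φ, e, hiso⟩

end Assembly

section LocalAssembly

theorem semilin_rhoAt {Z Y X : Scheme.{u}} (M : QCoh X) (i : Z ⟶ Y) (f : Y ⟶ X) (f' : Z ⟶ X)
    (w : i ≫ f = f') (m : (evAt f).obj M) :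
    semilin i.appTop.hom (rhoAt M i f f' w) m = resAt M i f f' w m := one_smul _ _

theorem isIso_rhoAt {Z Y X : Scheme.{u}} (hZ : IsAffine Z) (hY : IsAffine Y) (M : QCoh X)
    (i : Z ⟶ Y) (f : Y ⟶ X) (f' : Z ⟶ X) (w : i ≫ f = f') : IsIso (rhoAt M i f f' w) := by
  refine isIso_of_isBC _ _ ?_
  let g : Over.mk f' ⟶ Over.mk f := Over.homMk i w
  have h : IsAffine (Over.mk f).left := hY
  have h' : IsAffine (Over.mk f').left := hZ
  have e : semilin i.appTop.hom (rhoAt M i f f' w) =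
      (toLoc M.obj).res (e := Over.mk f) (e' := Over.mk f') g :=
    AddMonoidHom.ext fun m => semilin_rhoAt M i f f' w m
  rw [e]
  exact isBC_of_isQCoh M.property g

theorem resAt_resAt {W Z Y X : Scheme.{u}} (M : QCoh X) (j : W ⟶ Z) (i : Z ⟶ Y) (k : W ⟶ Y)
    (hk : k = j ≫ i) (f : Y ⟶ X) (f' : Z ⟶ X) (f'' : W ⟶ X)
    (w : i ≫ f = f') (w' : j ≫ f' = f'') (w'' : k ≫ f = f'') (m : (evAt f).obj M) :
    resAt M k f f'' w'' m = resAt M j f' f'' w' (resAt M i f f' w m) := by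
  subst hk
  exact (toLoc M.obj).res_comp (e := Over.mk f) (e' := Over.mk f') (e'' := Over.mk f'')
    (Over.homMk i w : Over.mk f' ⟶ Over.mk f) (Over.homMk j w' : Over.mk f'' ⟶ Over.mk f') m

theorem resAt_id {Y X : Scheme.{u}} (M : QCoh X) (i : Y ⟶ Y) (hi : i = 𝟙 Y) (f : Y ⟶ X)
    (w : i ≫ f = f) (m : (evAt f).obj M) : resAt M i f f w m = m := by
  subst hi
  exact (toLoc M.obj).res_id (e := Over.mk f) m

theorem resAt_nat {Z Y X : Scheme.{u}} {M N : QCoh X} (a : M ⟶ N) (i : Z ⟶ Y) (f : Y ⟶ X)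
    (f' : Z ⟶ X) (w : i ≫ f = f') (m : (evAt f).obj M) :
    (evAt f').map a (resAt M i f f' w m) = resAt N i f f' w ((evAt f).map a m) :=
  PresheafOfModules.naturality_apply a.hom
    (Quiver.Hom.op (V := Over X) (Over.homMk i w : Over.mk f' ⟶ Over.mk f)) m

theorem rhoAt_nat {Z Y X : Scheme.{u}} {M N : QCoh X} (a : M ⟶ N) (i : Z ⟶ Y) (f : Y ⟶ X)
    (f' : Z ⟶ X) (w : i ≫ f = f') :
    rhoAt M i f f' w ≫ (evAt f').map a =
      (ModuleCat.extendScalars.{u, u, u} i.appTop.hom).map ((evAt f).map a) ≫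
        rhoAt N i f f' w := by
  refine semilin_injective _ fun m => ?_
  refine (congrArg ((evAt f').map a) (semilin_rhoAt M i f f' w m)).trans ?_
  exact (resAt_nat a i f f' w m).trans (semilin_rhoAt N i f f' w _).symm

/-- Local functors with base change isomorphisms assemble to a functor on quasi-coherent modules. -/
theorem exists_isAssembledFrom {T X : Scheme.{u}} (h : T ⟶ X) (hh : IsAffineHom h)
    (F : LocalFunctors h) (B : LocalBaseChange h F) :
    ∃ G : QCoh T ⥤ QCoh X, IsAssembledFrom h F B G := by
  have aff {U : Scheme.{u}} (x : U ⟶ X) (_ : IsAffine U) : IsAffine (pullback h x) :=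
    isAffine_of_isAffineHom (pullback.snd h x)
  obtain ⟨Φ, e, he⟩ := exists_assembly (X := X) (C := QCoh T)
    (fun A => evAt (pullback.fst h A.1.hom) ⋙ F A.1.hom A.2)
    (fun {A A'} f M => transMap (B.θ A'.2 A.2 A.1.hom A'.1.hom f.left (Over.w f))
      (rhoAt M (pullbackMap h _ _ f.left (Over.w f)) (pullback.fst h _) (pullback.fst h _)
        (pullbackMap_fst h _ _ f.left (Over.w f))))
    (fun A A' f M => by
      have := isIso_rhoAt (aff _ A'.2) (aff _ A.2) M (pullbackMap h _ _ f.left (Over.w f))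
        (pullback.fst h _) (pullback.fst h _) (pullbackMap_fst h _ _ f.left (Over.w f))
      exact isBC_transMap _)
    (fun A A' f M N a m => transMap_nat _ _ _ _ (rhoAt_nat a _ _ _ _) m)
    (fun A M m => by
      refine transMap_id (B.unit A.2 A.1.hom) _ (fun x => ?_) m
      refine (semilin_rhoAt M _ _ _ _ x).trans (resAt_id M _ ?_ _ _ x)
      exact pullbackMap_id h A.1.hom)
    (fun A A' A'' f g M m => by
      refine transMap_transMap (B.cocycle A''.2 A'.2 A.2 A.1.hom A'.1.hom A''.1.hom f.left g.left
        (Over.w f) (Over.w g) (Over.w (g ≫ f))) _ _ _ (fun x => ?_) m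
      refine (semilin_rhoAt M _ _ _ _ x).trans (Eq.trans ?_ (semilin_rhoAt M _ _ _ _ _).symm)
      refine Eq.trans ?_ (congrArg _ (semilin_rhoAt M _ _ _ _ _).symm)
      refine resAt_resAt M _ _ _ ?_ _ _ _ _ _ _ x
      exact pullbackMap_comp h _ _ _ _ _ _ _ _)
  refine ⟨Φ, fun {U} hU x => e ⟨Over.mk x, hU⟩, fun {V U} hV hU x y f w M => ?_⟩
  refine semilin_injective _ fun m => ?_
  refine Eq.trans ?_ (he ⟨Over.mk x, hU⟩ ⟨Over.mk y, hV⟩ (Over.homMk f w) M m)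
  exact congrArg ((e ⟨Over.mk y, hV⟩).hom.app M) (semilin_rhoAt (Φ.obj M) f x y w m)

end LocalAssembly

/-! ### Sections of quasi-coherent modules and maps covering a morphism of schemes -/

section Sections

variable {X X' X'' : Scheme.{u}}

/-- The sections of `M` over the `X`-scheme `p : W ⟶ X`. -/
abbrev Sec {X W : Scheme.{u}} (M : QCoh X) (p : W ⟶ X) : ModuleCat.{u} Γ(W, ⊤) := (evAt p).obj M

theorem resAt_smul {Z Y : Scheme.{u}} (M : QCoh X) (i : Z ⟶ Y) (f : Y ⟶ X)
    (f' : Z ⟶ X) (w : i ≫ f = f') (r : Γ(Y, ⊤)) (m : Sec M f) :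
    resAt M i f f' w (r • m) = i.appTop.hom r • resAt M i f f' w m :=
  (toLoc M.obj).res_smul (e := Over.mk f) (e' := Over.mk f')
    (Over.homMk i w : Over.mk f' ⟶ Over.mk f) r m

theorem resAt_add {Z Y : Scheme.{u}} (M : QCoh X) (i : Z ⟶ Y) (f : Y ⟶ X)
    (f' : Z ⟶ X) (w : i ≫ f = f') (m m' : Sec M f) :
    resAt M i f f' w (m + m') = resAt M i f f' w m + resAt M i f f' w m' :=
  map_add ((toLoc M.obj).res (e := Over.mk f) (e' := Over.mk f')
    (Over.homMk i w : Over.mk f' ⟶ Over.mk f)) m m'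

/-- The value of a linear map `φ : M' ⟶ g^* M` on sections over `p : W ⟶ X'`. The composite
`p ≫ g` is allowed to be given in any form `p'`. -/
def ap {g : X' ⟶ X} {M' : QCoh X'} {M : QCoh X} (φ : M' ⟶ (pull g).obj M) {W : Scheme.{u}}
    (p : W ⟶ X') (p' : W ⟶ X) (w : p ≫ g = p') : Sec M' p →ₗ[Γ(W, ⊤)] Sec M p' where
  toFun m := resAt M (𝟙 W) (p ≫ g) p' (by rw [Category.id_comp, w]) ((evAt p).map φ m)
  map_add' m m' := by
    exact (congrArg _ (map_add ((evAt p).map φ).hom m m')).trans (resAt_add _ _ _ _ _ _ _)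
  map_smul' r m := by
    refine (congrArg _ (map_smul ((evAt p).map φ).hom r m)).trans ?_
    refine (resAt_smul _ _ _ _ _ r _).trans ?_
    exact congrArg (· • _) (gamma_map_id W r)

theorem ap_rfl {g : X' ⟶ X} {M' : QCoh X'} {M : QCoh X} (φ : M' ⟶ (pull g).obj M)
    {W : Scheme.{u}} (p : W ⟶ X') (m : Sec M' p) : ap φ p (p ≫ g) rfl m = (evAt p).map φ m :=
  resAt_id M _ rfl _ _ _

theorem resAt_congr {Z Y : Scheme.{u}} (M : QCoh X) {i i' : Z ⟶ Y} (h : i = i') (f : Y ⟶ X)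
    (f' : Z ⟶ X) (w : i ≫ f = f') (m : Sec M f) :
    resAt M i f f' w m = resAt M i' f f' (h ▸ w) m := by
  subst h
  rfl

theorem ap_resAt {g : X' ⟶ X} {M' : QCoh X'} {M : QCoh X} (φ : M' ⟶ (pull g).obj M)
    {W V : Scheme.{u}} (i : V ⟶ W) (p : W ⟶ X') (p' : W ⟶ X) (w : p ≫ g = p') (q : V ⟶ X')
    (q' : V ⟶ X) (w' : q ≫ g = q') (h : i ≫ p = q) (h' : i ≫ p' = q') (m : Sec M' p) :
    ap φ q q' w' (resAt M' i p q h m) = resAt M i p' q' h' (ap φ p p' w m) := by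
  subst w w'
  rw [ap_rfl, ap_rfl]
  exact resAt_nat φ i p q h m

theorem ap_idMap {M : QCoh X} {W : Scheme.{u}} (p p' : W ⟶ X) (w : p ≫ 𝟙 X = p') (m : Sec M p) :
    ap (idMap M) p p' w m = resAt M (𝟙 W) p p' (by rw [← w]; simp) m := by
  subst w
  rw [ap_rfl]
  rfl

theorem ap_compMap {h : X'' ⟶ X'} {g : X' ⟶ X} {L : QCoh X''} {M : QCoh X'}
    {N : QCoh X} (ψ : L ⟶ (pull h).obj M) (φ : M ⟶ (pull g).obj N) {W : Scheme.{u}}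
    (p : W ⟶ X'') (p' : W ⟶ X') (p'' : W ⟶ X) (w : p ≫ h = p') (w' : p' ≫ g = p'')
    (w'' : p ≫ h ≫ g = p'') (m : Sec L p) :
    ap (compMap ψ φ) p p'' w'' m = ap φ p' p'' w' (ap ψ p p' w m) := by
  subst w w'
  rw [ap_rfl, ap_rfl]
  let x : Sec N ((p ≫ h) ≫ g) := (evAt (p ≫ h)).map φ ((evAt p).map ψ m)
  have e : ((evAt p).map (compMap ψ φ) m : Sec N (p ≫ h ≫ g)) =
    resAt N (𝟙 W) ((p ≫ h) ≫ g) (p ≫ h ≫ g) (by simp) x := rfl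
  refine (congrArg (resAt N (𝟙 W) (p ≫ h ≫ g) ((p ≫ h) ≫ g) (by simp)) e).trans ?_
  refine (resAt_resAt N (𝟙 W) (𝟙 W) (𝟙 W) (by simp) _ _ _ _ _ (by simp) x).symm.trans ?_
  exact resAt_id N _ rfl _ _ _

theorem ap_ext {g : X' ⟶ X} {M' : QCoh X'} {M : QCoh X} {φ ψ : M' ⟶ (pull g).obj M}
    (h : ∀ {W : Scheme.{u}} (p : W ⟶ X') (m : Sec M' p),
      ap φ p (p ≫ g) rfl m = ap ψ p (p ≫ g) rfl m) : φ = ψ := by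
  apply IsQCoh.hom_ext
  apply (PresheafOfModules.toPresheaf _).map_injective
  ext T m
  exact (ap_rfl φ T.unop.hom m).symm.trans ((h T.unop.hom m).trans (ap_rfl ψ T.unop.hom m))

/-- A linear map `M' ⟶ g^* M` from its values on sections. -/
theorem exists_ap (g : X' ⟶ X) (M' : QCoh X') (M : QCoh X)
    (v : ∀ {W : Scheme.{u}} (p : W ⟶ X'), Sec M' p →ₗ[Γ(W, ⊤)] Sec M (p ≫ g))
    (hv : ∀ {W V : Scheme.{u}} (i : V ⟶ W) (p : W ⟶ X') (m : Sec M' p),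
      v (i ≫ p) (resAt M' i p _ rfl m) =
        resAt M i (p ≫ g) _ (Category.assoc i p g).symm (v p m)) :
    ∃ φ : M' ⟶ (pull g).obj M, ∀ {W : Scheme.{u}} (p : W ⟶ X') (m : Sec M' p),
      ap φ p (p ≫ g) rfl m = v p m := by
  let α : LocMod.Hom (toLoc M'.obj) (toLoc ((pull g).obj M).obj) :=
    { app := fun T => v T.hom
      nat := fun {T T'} f m => by
        have hw : f.left ≫ T.hom = T'.hom := Over.w f
        have key : ∀ (q : T'.left ⟶ X') (hq : f.left ≫ T.hom = q),
            v q (resAt M' f.left T.hom q hq m) = resAt M f.left (T.hom ≫ g) (q ≫ g)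
              (by rw [← hq, Category.assoc]) (v T.hom m) := by
          rintro _ rfl
          exact hv f.left T.hom m
        exact key T'.hom hw }
  refine ⟨⟨α.toPre⟩, fun p m => ?_⟩
  rw [ap_rfl]
  rfl

theorem isIso_of_ap {g : X' ⟶ X} {M' : QCoh X'} {M : QCoh X} (φ : M' ⟶ (pull g).obj M)
    (h : ∀ {W : Scheme.{u}} (p : W ⟶ X'), Function.Bijective (ap φ p (p ≫ g) rfl)) : IsIso φ := by
  have : IsIso ((IsQCoh (X := X')).ι.map φ) := isIso_of_bijective _ fun T => by
    have := h T.hom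
    convert! this using 1
    funext m
    exact (ap_rfl φ T.hom m).symm
  exact isIso_of_reflects_iso _ (IsQCoh (X := X')).ι

theorem bijective_ap {g : X' ⟶ X} {M' : QCoh X'} {M : QCoh X} (φ : M' ⟶ (pull g).obj M) [IsIso φ]
    {W : Scheme.{u}} (p : W ⟶ X') (p' : W ⟶ X) (w : p ≫ g = p') :
    Function.Bijective (ap φ p p' w) := by
  subst w
  have := ConcreteCategory.bijective_of_isIso ((evAt p).map φ)
  convert! this using 1
  funext m
  exact ap_rfl φ p m

end Sections

/-! ### Gluing quasi-coherent modules along fppf coverings -/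

section Gluing

variable {ι : Type u} {Y : Scheme.{u}} {X : ι → Scheme.{u}}

/-- Families of flat morphisms of schemes, locally of finite presentation, that are
jointly surjective. -/
abbrev IsFppfCov (f : ∀ i, X i ⟶ Y) : Prop :=
  IsFppfCover (S := Y) (Y := Over.mk (𝟙 Y)) (X := fun i => Over.mk (f i))
    fun i => Over.homMk (f i) (Category.comp_id _)

variable {f : ∀ i, X i ⟶ Y}

/-- The `Y`-schemes over one of the schemes `X i`. -/
def famOver (f : ∀ i, X i ⟶ Y) (e : Σ i, Over (X i)) : Over Y := (Over.map (f e.1)).obj e.2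

theorem dense_famOver (hf : IsFppfCov f) : Dense (famOver f) := by
  intro W
  refine ⟨ι, fun i => ⟨i, Over.mk (pullback.snd W.hom (f i))⟩,
    fun i => Over.homMk (pullback.fst W.hom (f i)) pullback.condition, ?_⟩
  refine IsFppfCover.ofArrows_mem ⟨fun i => ?_, fun i => ?_, fun w => ?_⟩
  · have : Flat (f i) := hf.flat i
    exact inferInstanceAs (Flat (pullback.fst W.hom (f i)))
  · have : LocallyOfFinitePresentation (f i) := hf.lfp i
    exact inferInstanceAs (LocallyOfFinitePresentation (pullback.fst W.hom (f i)))
  · obtain ⟨i, z, hz⟩ := hf.surj (W.hom w)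
    obtain ⟨t, ht, -⟩ := Scheme.Pullback.exists_preimage_pullback (f := W.hom) (g := f i) w z hz.symm
    exact ⟨i, t, ht⟩

theorem isSheaf_qcoh {Y : Scheme.{u}} (M : QCoh Y) : (toLoc M.obj).IsSheaf :=
  isSheaf_toLoc.2 M.property.1

theorem glued_map_unique (hf : IsFppfCov f) {M N : QCoh Y} {β β' : M ⟶ N}
    (h : ∀ i {W : Scheme.{u}} (p : W ⟶ X i) (m : Sec M (p ≫ f i)),
      (evAt (p ≫ f i)).map β m = (evAt (p ≫ f i)).map β' m) : β = β' := by
  apply IsQCoh.hom_ext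
  have key : ofPre β.hom = ofPre β'.hom :=
    LocMod.Hom.ext_dense (isSheaf_qcoh N) (dense_famOver hf) fun e m => h e.1 e.2.hom m
  exact congrArg LocMod.Hom.toPre key

theorem exists_glued_map (hf : IsFppfCov f) {M N : QCoh Y}
    (v : ∀ i {W : Scheme.{u}} (p : W ⟶ X i), Sec M (p ≫ f i) →ₗ[Γ(W, ⊤)] Sec N (p ≫ f i))
    (hv : ∀ i j {W W' : Scheme.{u}} (k : W' ⟶ W) (p : W ⟶ X i) (p' : W' ⟶ X j)
      (w : k ≫ p ≫ f i = p' ≫ f j) (m : Sec M (p ≫ f i)),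
      v j p' (resAt M k _ _ w m) = resAt N k _ _ w (v i p m)) :
    ∃ β : M ⟶ N, ∀ i {W : Scheme.{u}} (p : W ⟶ X i) (m : Sec M (p ≫ f i)),
      (evAt (p ≫ f i)).map β m = v i p m := by
  obtain ⟨β, hβ⟩ := LocMod.Hom.exists_extension (M := toLoc M.obj) (isSheaf_qcoh N)
    (dense_famOver hf)
    ⟨fun e => v e.1 e.2.hom, fun {e e'} k m => hv e.1 e'.1 k.left e.2.hom e'.2.hom (Over.w k) m⟩
  exact ⟨⟨β.toPre⟩, fun i W p m => hβ ⟨i, Over.mk p⟩ m⟩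

/-- The restriction of sections as an additive map. -/
def resHom {Z Y X : Scheme.{u}} (M : QCoh X) (i : Z ⟶ Y) (f : Y ⟶ X) (f' : Z ⟶ X)
    (w : i ≫ f = f') : Sec M f →+ Sec M f' := AddMonoidHom.mk' (resAt M i f f' w) (resAt_add M i f f' w)

theorem isBC_resHom {Z Y X : Scheme.{u}} (hZ : IsAffine Z) (hY : IsAffine Y) (M : QCoh X)
    (i : Z ⟶ Y) (f : Y ⟶ X) (f' : Z ⟶ X) (w : i ≫ f = f') :
    IsBC i.appTop.hom (resHom M i f f' w) := by
  let g : Over.mk f' ⟶ Over.mk f := Over.homMk i w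
  have h : IsAffine (Over.mk f).left := hY
  have h' : IsAffine (Over.mk f').left := hZ
  exact isBC_of_isQCoh M.property g

theorem IsBC.of_conj {A B : Type u} [CommRing A] [CommRing B] {f : A →+* B} {M N M' N' : Type u}
    [AddCommGroup M] [Module A M] [AddCommGroup N] [Module B N] [AddCommGroup M'] [Module A M']
    [AddCommGroup N'] [Module B N'] {σ : M →+ N} {σ' : M' →+ N'} (h : IsBC f σ') (α : M →ₗ[A] M')
    (hα : Function.Bijective α) (β : N →ₗ[B] N') (hβ : Function.Bijective β)
    (w : ∀ m, β (σ m) = σ' (α m)) : IsBC f σ := by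
  have h1 : IsBC (RingHom.id A) α.toAddMonoidHom :=
    IsBC.of_bijective Function.bijective_id (fun r m => α.map_smul r m) hα
  let b := LinearEquiv.ofBijective β hβ
  have h2 : IsBC (RingHom.id B) b.symm.toLinearMap.toAddMonoidHom :=
    IsBC.of_bijective Function.bijective_id (fun r m => b.symm.map_smul r m) b.symm.bijective
  have h3 := (h1.comp h).comp h2
  have e : b.symm.toLinearMap.toAddMonoidHom.comp (σ'.comp α.toAddMonoidHom) = σ :=
    AddMonoidHom.ext fun m => (congrArg b.symm (w m).symm).trans (b.symm_apply_apply (σ m))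
  rw [e] at h3
  exact h3

theorem LocMod.isBC_of_hom {E : Type*} {π : E → Over Y} {P Q : LocMod π} (α : Hom P Q)
    (h : ∀ e, Function.Bijective (α.app e)) {e e' : E} (g : π e' ⟶ π e)
    (hQ : IsBC g.left.appTop.hom (Q.res g)) : IsBC g.left.appTop.hom (P.res g) :=
  hQ.of_conj (α.app e) (h e) (α.app e') (h e') fun m => α.nat g m

/-- Descent of quasi-coherent modules. The descent datum is given by isomorphisms `τ` between
the sections of the modules over schemes which lie over two members of the covering. -/
theorem exists_glued_module (hf : IsFppfCov f) (M : ∀ i, QCoh (X i))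
    (τ : ∀ i j {W : Scheme.{u}} (p : W ⟶ X i) (q : W ⟶ X j), p ≫ f i = q ≫ f j →
      (Sec (M i) p →ₗ[Γ(W, ⊤)] Sec (M j) q))
    (nat : ∀ i j {V W : Scheme.{u}} (k : V ⟶ W) (p : W ⟶ X i) (q : W ⟶ X j)
      (w : p ≫ f i = q ≫ f j) (m : Sec (M i) p),
      τ i j (k ≫ p) (k ≫ q) (by simp only [Category.assoc, w]) (resAt (M i) k p _ rfl m) =
        resAt (M j) k q _ rfl (τ i j p q w m))
    (id : ∀ i {W : Scheme.{u}} (p : W ⟶ X i) (m : Sec (M i) p), τ i i p p rfl m = m)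
    (cocycle : ∀ i j l {W : Scheme.{u}} (p : W ⟶ X i) (q : W ⟶ X j) (r : W ⟶ X l)
      (w : p ≫ f i = q ≫ f j) (w' : q ≫ f j = r ≫ f l) (m : Sec (M i) p),
      τ j l q r w' (τ i j p q w m) = τ i l p r (w.trans w') m) :
    ∃ (N : QCoh Y) (γ : ∀ i {W : Scheme.{u}} (p : W ⟶ X i),
        Sec N (p ≫ f i) →ₗ[Γ(W, ⊤)] Sec (M i) p),
      (∀ i {W : Scheme.{u}} (p : W ⟶ X i), Function.Bijective (γ i p)) ∧
      ∀ i j {V W : Scheme.{u}} (k : V ⟶ W) (p : W ⟶ X i) (p' : V ⟶ X i) (q : V ⟶ X j)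
        (h : k ≫ p = p') (w : p' ≫ f i = q ≫ f j) (m : Sec N (p ≫ f i)),
        γ j q (resAt N k _ _ (by rw [← w, ← h, Category.assoc]) m) =
          τ i j p' q w (resAt (M i) k p _ h (γ i p m)) := by
  have nat' (i j) {V W : Scheme.{u}} (k : V ⟶ W) (p : W ⟶ X i) (q : W ⟶ X j)
      (w : p ≫ f i = q ≫ f j) (p' : V ⟶ X i) (q' : V ⟶ X j) (h : k ≫ p = p') (h' : k ≫ q = q')
      (w' : p' ≫ f i = q' ≫ f j) (m : Sec (M i) p) :
      τ i j p' q' w' (resAt (M i) k p _ h m) = resAt (M j) k q _ h' (τ i j p q w m) := by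
    subst h h'
    exact nat i j k p q w m
  have bij (i j) {W : Scheme.{u}} (p : W ⟶ X i) (q : W ⟶ X j) (w : p ≫ f i = q ≫ f j) :
      Function.Bijective (τ i j p q w) :=
    Function.bijective_iff_has_inverse.2 ⟨τ j i q p w.symm,
      fun m => (cocycle i j i p q p w w.symm m).trans (id i p m),
      fun m => (cocycle j i j q p q w.symm w m).trans (id j q m)⟩
  have wk {e e' : Σ i, Over (X i)} (k : famOver f e' ⟶ famOver f e) :
      (k.left ≫ e.2.hom) ≫ f e.1 = e'.2.hom ≫ f e'.1 := (Category.assoc _ _ _).trans (Over.w k)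
  let P : LocMod (famOver f) :=
    { obj := fun e => Sec (M e.1) e.2.hom
      ab := fun e => inferInstance
      mod := fun e => inferInstanceAs (Module Γ(e.2.left, ⊤) (Sec (M e.1) e.2.hom))
      res := fun {e e'} k => (τ e.1 e'.1 (k.left ≫ e.2.hom) e'.2.hom (wk k)).toAddMonoidHom.comp
        (resHom (M e.1) k.left e.2.hom _ rfl)
      res_smul := fun {e e'} k r m =>
        (congrArg _ (resAt_smul (M e.1) k.left e.2.hom _ rfl r m)).trans
          (map_smul (τ e.1 e'.1 (k.left ≫ e.2.hom) e'.2.hom (wk k)) _ _)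
      res_id := fun {e} m => by
        have key : ∀ (k : e.2.left ⟶ e.2.left) (hk : k = 𝟙 _)
          (w : (k ≫ e.2.hom) ≫ f e.1 = e.2.hom ≫ f e.1),
            τ e.1 e.1 (k ≫ e.2.hom) e.2.hom w (resAt (M e.1) k e.2.hom _ rfl m) = m := by
          intro k hk w
          have h : k ≫ e.2.hom = e.2.hom := by rw [hk, Category.id_comp]
          refine (nat' e.1 e.1 k e.2.hom e.2.hom rfl _ _ rfl h _ m).trans ?_
          exact (resAt_id _ _ hk _ _ _).trans (id _ _ m)
        exact key _ rfl _
      res_comp := fun {e e' e''} k l m => by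
        have w₁ : l.left ≫ (k.left ≫ e.2.hom) = (l.left ≫ k.left) ≫ e.2.hom :=
          (Category.assoc _ _ _).symm
        have w₂ : ((l.left ≫ k.left) ≫ e.2.hom) ≫ f e.1 = (l.left ≫ e'.2.hom) ≫ f e'.1 := by
          exact (congrArg (· ≫ f e.1) w₁.symm).trans ((Category.assoc _ _ _).trans
            ((congrArg (l.left ≫ ·) (wk k)).trans (Category.assoc _ _ _).symm))
        refine Eq.trans ?_ (congrArg (τ e'.1 e''.1 (l.left ≫ e'.2.hom) e''.2.hom (wk l))
          (nat' e.1 e'.1 l.left _ _ (wk k) _ _ w₁ rfl w₂ (resAt (M e.1) k.left e.2.hom _ rfl m)))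
        refine Eq.trans ?_ (cocycle _ _ _ _ _ _ w₂ (wk l) _).symm
        refine congrArg (τ e.1 e''.1 _ e''.2.hom _) ?_
        exact resAt_resAt (M e.1) l.left k.left _ rfl _ _ _ _ _ _ m }
  have hres (i : ι) (T T' : Over (X i)) (k : T' ⟶ T) (m : Sec (M i) T.hom) :
      P.res (e := ⟨i, T⟩) (e' := ⟨i, T'⟩) ((Over.map (f i)).map k) m =
        (toLoc (M i).obj).res (e := T) (e' := T') k m := by
    have key : ∀ (q : T'.left ⟶ X i) (h : k.left ≫ T.hom = q)
        (w : (k.left ≫ T.hom) ≫ f i = q ≫ f i),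
        τ i i (k.left ≫ T.hom) q w (resAt (M i) k.left T.hom _ rfl m) =
          resAt (M i) k.left T.hom q h m := by
      rintro _ rfl _
      exact id _ _ _
    exact key _ (Over.w k) _
  have hP : P.IsSheaf := by
    rintro ⟨i, T⟩ R hR x hx
    let Φ := Over.map (f i)
    have hR' : R.functorPullback Φ ∈ fppf (X i) T :=
      Functor.cover_lift Φ (fppf (X i)) (fppf Y) hR
    obtain ⟨m, hm, hm'⟩ := isSheaf_qcoh (M i) T _ hR' (fun Z g hg => x ⟨i, Z⟩ (Φ.map g) hg) (by
      intro Z Z' g hg k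
      refine (hres i Z Z' k _).symm.trans ?_
      refine (hx ⟨i, Z⟩ ⟨i, Z'⟩ (Φ.map g) hg (Φ.map k)).trans ?_
      congr 1)
    refine ⟨m, ?_, fun n hn => hm' n fun Z g hg => (hres i T Z g n).symm.trans
      (hn ⟨i, Z⟩ (Φ.map g) hg)⟩
    rintro ⟨j, Z⟩ g hg
    let Z' : Over (X i) := Over.mk (g.left ≫ T.hom)
    let g' : Z' ⟶ T := Over.homMk g.left rfl
    let l : famOver f ⟨j, Z⟩ ⟶ Φ.obj Z' := Over.homMk (𝟙 _) ((Category.id_comp _).trans (wk g))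
    let l' : Φ.obj Z' ⟶ famOver f ⟨j, Z⟩ :=
      Over.homMk (𝟙 _) ((Category.id_comp _).trans (wk g).symm)
    have e : l' ≫ g = Φ.map g' := Over.OverMorphism.ext (Category.id_comp _)
    have e' : l ≫ Φ.map g' = g := Over.OverMorphism.ext (Category.id_comp _)
    have hg' : R (Φ.map g') := e ▸ R.downward_closed hg l'
    have h1 := (hres i T Z' g' m).trans (hm Z' g' hg')
    have h2 := hx ⟨i, Z'⟩ ⟨j, Z⟩ (Φ.map g') hg' l
    refine Eq.trans ?_ (h2.trans ?_)
    · refine (congrArg (fun k => P.res (e := ⟨i, T⟩) (e' := ⟨j, Z⟩) k m) e').symm.trans ?_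
      exact (P.res_comp (e := ⟨i, T⟩) (e' := ⟨i, Z'⟩) (e'' := ⟨j, Z⟩) (Φ.map g') l m).trans
        (congrArg (P.res (e := ⟨i, Z'⟩) (e' := ⟨j, Z⟩) l) h1)
    · congr 1
  obtain ⟨N, hN, c, hc⟩ := LocMod.exists_extension hP (dense_famOver hf)
  have hq : IsQCoh N := by
    have key (i : ι) {V W : Scheme.{u}} (hV : IsAffine V) (hW : IsAffine W) (p : W ⟶ X i)
        (t : V ⟶ W) (z : W ⟶ Y) (hz : p ≫ f i = z) (z' : V ⟶ Y) (hz' : (t ≫ p) ≫ f i = z')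
        (w : t ≫ z = z') :
        IsBC (Over.homMk t w : Over.mk z' ⟶ Over.mk z).left.appTop.hom
          ((toLoc N).res (e := Over.mk z) (e' := Over.mk z')
            (Over.homMk t w : Over.mk z' ⟶ Over.mk z)) := by
      subst hz hz'
      let k : Over.mk (t ≫ p) ⟶ Over.mk p := Over.homMk t rfl
      let e : Σ i, Over (X i) := ⟨i, Over.mk p⟩
      let e' : Σ i, Over (X i) := ⟨i, Over.mk (t ≫ p)⟩
      let k' : famOver f e' ⟶ famOver f e := (Over.map (f i)).map k
      have h1 : P.res (e := e) (e' := e') k' = resHom (M i) t p (t ≫ p) rfl :=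
        AddMonoidHom.ext fun m => hres i (Over.mk p) (Over.mk (t ≫ p)) k m
      refine LocMod.isBC_of_hom (e := e) (e' := e') c hc k' ?_
      rw [h1]
      exact isBC_resHom hV hW (M i) t p (t ≫ p) rfl
    refine isQCoh_of_isBC hN fun V => ?_
    obtain ⟨κ, e, g, hg⟩ := dense_famOver hf V
    refine ⟨_, hg, ?_⟩
    rintro Z _ ⟨_, l, _, ⟨a⟩, rfl⟩ hZ T t hT
    have h : (l.left ≫ (e a).2.hom) ≫ f (e a).1 = Z.hom := (Category.assoc _ _ _).trans (Over.w l)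
    refine key (e a).1 hT hZ (l.left ≫ (e a).2.hom) t.left Z.hom h T.hom ?_ (Over.w t)
    exact (Category.assoc _ _ _).trans ((congrArg (t.left ≫ ·) h).trans (Over.w t))
  refine ⟨⟨N, hq⟩, fun i {W} p => c.app ⟨i, Over.mk p⟩, fun i {W} p => hc _, ?_⟩
  intro i j V W k p p' q h w m
  subst h
  have w' : k ≫ p ≫ f i = q ≫ f j := by rw [← w, Category.assoc]
  exact c.nat (e := ⟨i, Over.mk p⟩) (e' := ⟨j, Over.mk q⟩)
    (Over.homMk k w' : famOver f ⟨j, Over.mk q⟩ ⟶ famOver f ⟨i, Over.mk p⟩) m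

end Gluing

section Descent

variable {ι : Type u} {Y : Scheme.{u}} {X : ι → Scheme.{u}} {f : ∀ i, X i ⟶ Y}

theorem ap_eq_resAt {X' X : Scheme.{u}} {g : X' ⟶ X} {M' : QCoh X'} {M : QCoh X}
    (φ : M' ⟶ (pull g).obj M) {W : Scheme.{u}} (p : W ⟶ X') (p' p'' : W ⟶ X) (w : p ≫ g = p')
    (w' : p ≫ g = p'') (m : Sec M' p) :
    ap φ p p'' w' m = resAt M (𝟙 W) p' p'' (by rw [← w, ← w', Category.id_comp])
      (ap φ p p' w m) := by
  subst w w'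
  exact (resAt_id M _ rfl _ _ _).symm

/-- Lifting of maps along isomorphisms `M' ≅ g^* M`. -/
theorem exists_ap_lift {X'' X' X : Scheme.{u}} {g : X' ⟶ X} {M' : QCoh X'} {M : QCoh X}
    (φ : M' ⟶ (pull g).obj M) [IsIso φ] (h : X'' ⟶ X') (k : X'' ⟶ X) (hk : h ≫ g = k)
    {L : QCoh X''} (ψ : L ⟶ (pull k).obj M) :
    ∃ χ : L ⟶ (pull h).obj M', (∀ {W : Scheme.{u}} (p : W ⟶ X'') (p' : W ⟶ X') (p'' : W ⟶ X)
      (w : p ≫ h = p') (w' : p' ≫ g = p'') (w'' : p ≫ k = p'') (m : Sec L p),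
        ap φ p' p'' w' (ap χ p p' w m) = ap ψ p p'' w'' m) ∧ (IsIso ψ → IsIso χ) := by
  let b {W : Scheme.{u}} (p : W ⟶ X') := LinearEquiv.ofBijective _ (bijective_ap φ p (p ≫ g) rfl)
  have hb {W : Scheme.{u}} (p : W ⟶ X') (m) : ap φ p _ rfl ((b p).symm m) = m :=
    (b p).apply_symm_apply m
  have wk {W : Scheme.{u}} (p : W ⟶ X'') : p ≫ k = (p ≫ h) ≫ g := by
    rw [Category.assoc, hk]
  obtain ⟨χ, hχ⟩ := exists_ap h L M'
    (fun p => (b (p ≫ h)).symm.toLinearMap ∘ₗ ap ψ p ((p ≫ h) ≫ g) (wk p)) (by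
      intro W V i p m
      apply (b _).injective
      refine (hb _ _).trans (Eq.trans ?_ (ap_resAt φ i (p ≫ h) ((p ≫ h) ≫ g) rfl ((i ≫ p) ≫ h)
        (((i ≫ p) ≫ h) ≫ g) rfl (by simp) (by simp) _).symm)
      refine (ap_resAt ψ i p ((p ≫ h) ≫ g) (wk p) _ _ _ rfl (by simp) m).trans ?_
      exact congrArg _ (hb _ _).symm)
  have key {W : Scheme.{u}} (p : W ⟶ X'') (p' : W ⟶ X') (p'' : W ⟶ X)
      (w : p ≫ h = p') (w' : p' ≫ g = p'') (w'' : p ≫ k = p'') (m : Sec L p) :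
        ap φ p' p'' w' (ap χ p p' w m) = ap ψ p p'' w'' m := by
    subst w w'
    rw [hχ]
    exact hb _ _
  refine ⟨χ, key, fun hψ => isIso_of_ap χ fun p => ?_⟩
  have h1 := bijective_ap ψ p ((p ≫ h) ≫ g) (wk p)
  have h2 := bijective_ap φ (p ≫ h) ((p ≫ h) ≫ g) rfl
  have h3 : ⇑(ap ψ p ((p ≫ h) ≫ g) (wk p)) =
      ⇑(ap φ (p ≫ h) ((p ≫ h) ≫ g) rfl) ∘ ⇑(ap χ p (p ≫ h) rfl) :=
    funext fun m => (key p _ _ rfl rfl (wk p) m).symm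
  rw [h3] at h1
  exact (Function.Bijective.of_comp_iff' h2 _).1 h1

/-- Gluing of linear maps `M ⟶ g^* N` along a covering. The restrictions of `M` to the
members of the covering are given by the modules `L i`. -/
theorem exists_descended_map (hf : IsFppfCov f) {Z : Scheme.{u}} (g : Y ⟶ Z) (f' : ∀ i, X i ⟶ Z)
    (hf' : ∀ i, f i ≫ g = f' i) {M : QCoh Y} {N : QCoh Z} {L : ∀ i, QCoh (X i)}
    (c : ∀ i, L i ⟶ (pull (f i)).obj M) (hc : ∀ i, IsIso (c i))
    (a : ∀ i, L i ⟶ (pull (f' i)).obj N)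
    (compat : ∀ i j {W : Scheme.{u}} (p : W ⟶ X i) (q : W ⟶ X j) (z : W ⟶ Y) (z' : W ⟶ Z)
      (w : p ≫ f i = z) (w' : q ≫ f j = z) (v : p ≫ f' i = z') (v' : q ≫ f' j = z')
      (m : Sec (L i) p) (n : Sec (L j) q),
      ap (c i) p z w m = ap (c j) q z w' n → ap (a i) p z' v m = ap (a j) q z' v' n) :
    ∃ β : M ⟶ (pull g).obj N, (∀ i {W : Scheme.{u}} (p : W ⟶ X i) (z : W ⟶ Y) (z' : W ⟶ Z)
      (w : p ≫ f i = z) (v : z ≫ g = z') (v' : p ≫ f' i = z') (m : Sec (L i) p),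
      ap β z z' v (ap (c i) p z w m) = ap (a i) p z' v' m) ∧
      ((∀ i, IsIso (a i)) → IsIso β) := by
  let b (i) {W : Scheme.{u}} (p : W ⟶ X i) :=
    LinearEquiv.ofBijective _ (bijective_ap (c i) p (p ≫ f i) rfl)
  have hb (i) {W : Scheme.{u}} (p : W ⟶ X i) (m) : ap (c i) p _ rfl ((b i p).symm m) = m :=
    (b i p).apply_symm_apply m
  have wk (i) {W : Scheme.{u}} (p : W ⟶ X i) : p ≫ f' i = (p ≫ f i) ≫ g := by
    rw [Category.assoc, hf']
  obtain ⟨β, hβ⟩ := exists_glued_map hf (M := M) (N := (pull g).obj N)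
    (fun i {W} p => (ap (a i) p ((p ≫ f i) ≫ g) (wk i p)) ∘ₗ (b i p).symm.toLinearMap) (by
      intro i j W W' k p p' w m
      let n := (b i p).symm m
      have e : k ≫ (p ≫ f i) ≫ g = (p' ≫ f j) ≫ g := by rw [← Category.assoc, w]
      refine (compat i j (k ≫ p) p' (p' ≫ f j) ((p' ≫ f j) ≫ g) (by rw [← w, Category.assoc]) rfl
        (by rw [Category.assoc, wk, e]) (wk j p') (resAt (L i) k p _ rfl n) _ ?_).symm.trans ?_
      · refine (ap_resAt (c i) k p (p ≫ f i) rfl _ _ _ _ w n).trans ?_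
        refine Eq.trans ?_ (hb j p' _).symm
        exact congrArg _ (hb i p m)
      · exact ap_resAt (a i) k p ((p ≫ f i) ≫ g) (wk i p) _ _ _ _ e n)
  have key (i) {W : Scheme.{u}} (p : W ⟶ X i) (z : W ⟶ Y) (z' : W ⟶ Z)
      (w : p ≫ f i = z) (v : z ≫ g = z') (v' : p ≫ f' i = z') (m : Sec (L i) p) :
      ap β z z' v (ap (c i) p z w m) = ap (a i) p z' v' m := by
    subst w v
    rw [ap_rfl, hβ]
    exact congrArg (ap (a i) p ((p ≫ f i) ≫ g) (wk i p)) ((b i p).symm_apply_apply m)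
  refine ⟨β, key, fun ha => ?_⟩
  have : IsIso ((IsQCoh (X := Y)).ι.map β) := isIso_of_bijective _
    (LocMod.Hom.bijective_of_dense (isSheaf_qcoh M) (isSheaf_qcoh ((pull g).obj N))
      (dense_famOver hf) (ofPre β.hom) fun e => by
        have h1 := bijective_ap (a e.1) e.2.hom ((e.2.hom ≫ f e.1) ≫ g) (wk _ _)
        have h3 : ⇑(ap (a e.1) e.2.hom ((e.2.hom ≫ f e.1) ≫ g) (wk _ _)) =
            ⇑(ap β (e.2.hom ≫ f e.1) ((e.2.hom ≫ f e.1) ≫ g) rfl) ∘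
              ⇑(ap (c e.1) e.2.hom (e.2.hom ≫ f e.1) rfl) :=
          funext fun m => (key e.1 e.2.hom _ _ rfl rfl (wk _ _) m).symm
        rw [h3] at h1
        have h4 := (Function.Bijective.of_comp_iff _
          (bijective_ap (c e.1) e.2.hom (e.2.hom ≫ f e.1) rfl)).1 h1
        convert! h4 using 1
        funext m
        exact (ap_rfl β (e.2.hom ≫ f e.1) m).symm)
  exact isIso_of_reflects_iso _ (IsQCoh (X := Y)).ι

theorem descended_map_unique (hf : IsFppfCov f) {Z : Scheme.{u}} {g : Y ⟶ Z}
    {M : QCoh Y} {N : QCoh Z} {β β' : M ⟶ (pull g).obj N}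
    (h : ∀ i {W : Scheme.{u}} (p : W ⟶ X i) (m : Sec M (p ≫ f i)),
      ap β (p ≫ f i) _ rfl m = ap β' (p ≫ f i) _ rfl m) : β = β' :=
  glued_map_unique hf fun i {_} p m =>
    (ap_rfl β _ m).symm.trans ((h i p m).trans (ap_rfl β' _ m))

/-- Descent of quasi-coherent modules, with the descent datum given by modules on the overlaps. -/
theorem exists_descended_module (hf : IsFppfCov f) (M : ∀ i, QCoh (X i)) {XX : ι → ι → Scheme.{u}}
    (a : ∀ i j, XX i j ⟶ X i) (b : ∀ i j, XX i j ⟶ X j)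
    (hp : ∀ i j, IsPullback (a i j) (b i j) (f i) (f j)) (MM : ∀ i j, QCoh (XX i j))
    (α : ∀ i j, MM i j ⟶ (pull (a i j)).obj (M i)) (β : ∀ i j, MM i j ⟶ (pull (b i j)).obj (M j))
    (hα : ∀ i j, IsIso (α i j)) (hβ : ∀ i j, IsIso (β i j))
    (cocycle : ∀ i j k {W : Scheme.{u}} (r : W ⟶ XX i j) (s : W ⟶ XX j k) (t : W ⟶ XX i k)
      (p : W ⟶ X i) (q : W ⟶ X j) (l : W ⟶ X k) (h₁ : r ≫ a i j = p) (h₂ : r ≫ b i j = q)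
      (h₃ : s ≫ a j k = q) (h₄ : s ≫ b j k = l) (h₅ : t ≫ a i k = p) (h₆ : t ≫ b i k = l)
      (m : Sec (MM i j) r) (n : Sec (MM j k) s) (o : Sec (MM i k) t),
      ap (β i j) r q h₂ m = ap (α j k) s q h₃ n → ap (α i j) r p h₁ m = ap (α i k) t p h₅ o →
        ap (β j k) s l h₄ n = ap (β i k) t l h₆ o) :
    ∃ (N : QCoh Y) (c : ∀ i, M i ⟶ (pull (f i)).obj N), (∀ i, IsIso (c i)) ∧
      ∀ i j {W : Scheme.{u}} (r : W ⟶ XX i j) (p : W ⟶ X i) (q : W ⟶ X j) (z : W ⟶ Y)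
        (h₁ : r ≫ a i j = p) (h₂ : r ≫ b i j = q) (w : p ≫ f i = z) (w' : q ≫ f j = z)
        (m : Sec (MM i j) r),
        ap (c i) p z w (ap (α i j) r p h₁ m) = ap (c j) q z w' (ap (β i j) r q h₂ m) := by
  let e (i j) {W : Scheme.{u}} (r : W ⟶ XX i j) (p : W ⟶ X i) (h : r ≫ a i j = p) :=
    LinearEquiv.ofBijective _ (bijective_ap (α i j) r p h)
  let τ (i j) {W : Scheme.{u}} (p : W ⟶ X i) (q : W ⟶ X j) (w : p ≫ f i = q ≫ f j) :
      Sec (M i) p →ₗ[Γ(W, ⊤)] Sec (M j) q :=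
    ap (β i j) ((hp i j).lift p q w) q ((hp i j).lift_snd p q w) ∘ₗ
      (e i j ((hp i j).lift p q w) p ((hp i j).lift_fst p q w)).symm.toLinearMap
  have hτ (i j) {W : Scheme.{u}} (r : W ⟶ XX i j) (p : W ⟶ X i) (q : W ⟶ X j)
      (w : p ≫ f i = q ≫ f j) (h₁ : r ≫ a i j = p) (h₂ : r ≫ b i j = q) (m : Sec (MM i j) r) :
      τ i j p q w (ap (α i j) r p h₁ m) = ap (β i j) r q h₂ m := by
    obtain rfl : r = (hp i j).lift p q w := (hp i j).hom_ext (by simp [h₁]) (by simp [h₂])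
    exact congrArg (ap (β i j) _ q _) ((e i j _ p _).symm_apply_apply m)
  have ex (i j) {W : Scheme.{u}} (p : W ⟶ X i) (q : W ⟶ X j) (w : p ≫ f i = q ≫ f j)
      (m : Sec (M i) p) : ∃ (r : W ⟶ XX i j) (h₁ : r ≫ a i j = p) (_ : r ≫ b i j = q)
        (n : Sec (MM i j) r), ap (α i j) r p h₁ n = m :=
    ⟨_, (hp i j).lift_fst p q w, (hp i j).lift_snd p q w,
      (bijective_ap (α i j) _ p ((hp i j).lift_fst p q w)).2 m⟩
  have hτ3 (i j l : ι) {W : Scheme.{u}} (p : W ⟶ X i) (q : W ⟶ X j) (r : W ⟶ X l)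
      (w : p ≫ f i = q ≫ f j) (w' : q ≫ f j = r ≫ f l) (m : Sec (M i) p) :
      τ j l q r w' (τ i j p q w m) = τ i l p r (w.trans w') m := by
    obtain ⟨r₁, h₁, h₂, n, rfl⟩ := ex i j p q w m
    rw [hτ i j r₁ p q w h₁ h₂]
    obtain ⟨r₂, h₃, h₄, n₂, e₂⟩ := ex j l q r w' (ap (β i j) r₁ q h₂ n)
    obtain ⟨r₃, h₅, h₆, n₃, e₃⟩ := ex i l p r (w.trans w') (ap (α i j) r₁ p h₁ n)
    rw [← e₂, ← e₃, hτ j l r₂ q r w' h₃ h₄, hτ i l r₃ p r _ h₅ h₆]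
    exact cocycle i j l r₁ r₂ r₃ p q r h₁ h₂ h₃ h₄ h₅ h₆ n n₂ n₃ e₂.symm e₃.symm
  have hτ2 (i j) {W : Scheme.{u}} (p : W ⟶ X i) (q : W ⟶ X j) (w : p ≫ f i = q ≫ f j) :
      Function.Injective (τ i j p q w) := by
    intro m m' h
    exact (e i j _ p _).symm.injective ((bijective_ap (β i j) _ q
      ((hp i j).lift_snd p q w)).1 h)
  have hτ1 (i : ι) {W : Scheme.{u}} (p : W ⟶ X i) (m : Sec (M i) p) : τ i i p p rfl m = m :=
    hτ2 i i p p rfl (hτ3 i i i p p p rfl rfl m)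
  obtain ⟨N, γ, hγ, hc⟩ := exists_glued_module hf M τ (by
    intro i j V _ k p q w m
    obtain ⟨r, h₁, h₂, n, rfl⟩ := ex i j p q w m
    rw [← ap_resAt (α i j) k r p h₁ (k ≫ r) (k ≫ p) (by rw [Category.assoc, h₁]) rfl rfl,
      hτ i j r p q w h₁ h₂, ← ap_resAt (β i j) k r q h₂ (k ≫ r) (k ≫ q)
        (by rw [Category.assoc, h₂]) rfl rfl]
    exact hτ _ _ _ _ _ _ _ _ _) hτ1 hτ3
  let g (i) {W : Scheme.{u}} (p : W ⟶ X i) := LinearEquiv.ofBijective _ (hγ i p)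
  have hg (i) {W : Scheme.{u}} (p : W ⟶ X i) (m) : γ i p ((g i p).symm m) = m :=
    (g i p).apply_symm_apply m
  have hex (i) := exists_ap (f i) (M i) N (fun p => (g i p).symm.toLinearMap) (by
    intro W V k p m
    apply (hγ i (k ≫ p)).1
    refine (hg _ _ _).trans (Eq.trans ?_ (hc i i k p (k ≫ p) (k ≫ p) rfl rfl _).symm)
    refine Eq.trans ?_ (hτ1 i _ _).symm
    exact congrArg _ (hg i p m).symm)
  choose c hc' using hex
  refine ⟨N, c, fun i => isIso_of_ap _ fun {W} p => ?_, ?_⟩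
  · have : ⇑(ap (c i) p (p ≫ f i) rfl) = ⇑(g i p).symm := funext fun m => hc' i p m
    rw [this]
    exact (g i p).symm.bijective
  · intro i j W r p q z h₁ h₂ w w' m
    subst w
    rw [hc', ap_eq_resAt (c j) q (q ≫ f j) (p ≫ f i) rfl w', hc']
    let x := (g i p).symm (ap (α i j) r p h₁ m)
    have h : (g j q).symm (ap (β i j) r q h₂ m) = resAt N (𝟙 W) (p ≫ f i) (q ≫ f j)
        (by rw [Category.id_comp, w']) x := by
      apply (hγ j q).1
      refine (hg _ _ _).trans (Eq.trans ?_ (hc i j (𝟙 W) p p q (Category.id_comp p) w'.symm x).symm)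
      rw [resAt_id _ _ rfl, hg i p]
      exact (hτ i j r p q _ h₁ h₂ m).symm
    refine Eq.trans ?_ (congrArg (resAt N _ _ _ _) h).symm
    refine Eq.trans ?_ (resAt_resAt N (𝟙 W) (𝟙 W) (𝟙 W) (by simp) (p ≫ f i) (q ≫ f j) (p ≫ f i)
      _ _ (by simp) x)
    exact (resAt_id N _ rfl _ _ x).symm

end Descent

/-! ### Fibered categories and stacks -/

section Fibered

variable {𝒳 : Type*} [Category 𝒳] {ℬ : Type*} [Category ℬ] (p : 𝒳 ⥤ ℬ)

theorem isHomLift_iff {a b : 𝒳} (f : p.obj a ⟶ p.obj b) (φ : a ⟶ b) :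
    p.IsHomLift f φ ↔ p.map φ = f := by
  constructor
  · intro h
    exact (IsHomLift.eq_of_isHomLift p f φ).symm
  · rintro rfl
    infer_instance

/-- The universal property of strongly cartesian morphisms, for morphisms between images. -/
theorem stronglyCartesian_iff {a b : 𝒳} (φ : a ⟶ b) :
    p.IsStronglyCartesian (p.map φ) φ ↔
      ∀ (a' : 𝒳) (g : p.obj a' ⟶ p.obj a) (φ' : a' ⟶ b), p.map φ' = g ≫ p.map φ →
        ∃! χ : a' ⟶ a, p.map χ = g ∧ χ ≫ φ = φ' := by
  constructor
  · intro h a' g φ' e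
    have : p.IsHomLift (g ≫ p.map φ) φ' := (isHomLift_iff p _ _).2 e
    obtain ⟨χ, ⟨h1, h2⟩, h3⟩ := h.universal_property' g φ'
    exact ⟨χ, ⟨(isHomLift_iff p _ _).1 h1, h2⟩, fun χ' h' =>
      h3 χ' ⟨(isHomLift_iff p _ _).2 h'.1, h'.2⟩⟩
  · intro h
    refine ⟨fun {a'} g φ' hφ' => ?_⟩
    obtain ⟨χ, ⟨h1, h2⟩, h3⟩ := h a' g φ' ((isHomLift_iff p _ _).1 hφ')
    exact ⟨χ, ⟨(isHomLift_iff p _ _).2 h1, h2⟩, fun χ' h' =>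
      h3 χ' ⟨(isHomLift_iff p _ _).1 h'.1, h'.2⟩⟩

variable {p}

theorem isStronglyCartesian_map {R T : ℬ} {f : R ⟶ T} {a b : 𝒳} {φ : a ⟶ b}
    (h : p.IsStronglyCartesian f φ) : p.IsStronglyCartesian (p.map φ) φ := by
  obtain rfl := IsHomLift.domain_eq p f φ
  obtain rfl := IsHomLift.codomain_eq p f φ
  obtain rfl := (isHomLift_iff p f φ).1 h.toIsHomLift
  exact h

theorem isStronglyCartesian_of_map {R T : ℬ} {f : R ⟶ T} {a b : 𝒳} {φ : a ⟶ b}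
    (hf : p.IsHomLift f φ) (h : p.IsStronglyCartesian (p.map φ) φ) : p.IsStronglyCartesian f φ := by
  obtain rfl := IsHomLift.domain_eq p f φ
  obtain rfl := IsHomLift.codomain_eq p f φ
  obtain rfl := (isHomLift_iff p f φ).1 hf
  exact h

theorem exists_cartesian_lift (hp : p.IsFibered) {b : 𝒳} {R : ℬ} (f : R ⟶ p.obj b) :
    ∃ (a : 𝒳) (φ : a ⟶ b) (e : p.obj a = R), p.map φ = eqToHom e ≫ f ∧
      p.IsStronglyCartesian (p.map φ) φ := by
  obtain ⟨a, φ, h⟩ := hp.exists_isCartesian' f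
  have := Functor.IsFibered.isStronglyCartesian_of_isCartesian p f φ
  refine ⟨a, φ, IsHomLift.domain_eq p f φ, ?_, isStronglyCartesian_map this⟩
  obtain rfl := IsHomLift.domain_eq p f φ
  obtain rfl := (isHomLift_iff p f φ).1 this.toIsHomLift
  simp

theorem isFibered_of (h : ∀ (b : 𝒳) (R : ℬ) (f : R ⟶ p.obj b),
    ∃ (a : 𝒳) (φ : a ⟶ b) (e : p.obj a = R), p.map φ = eqToHom e ≫ f ∧
      p.IsStronglyCartesian (p.map φ) φ) : p.IsFibered := by
  refine Functor.IsFibered.of_exists_isStronglyCartesian fun b R f => ?_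
  obtain ⟨a, φ, e, h1, h2⟩ := h b R f
  subst e
  refine ⟨a, φ, isStronglyCartesian_of_map ((isHomLift_iff p _ _).2 ?_) h2⟩
  simpa using h1

end Fibered

section StackNormalForm

variable {S : Scheme.{u}} {𝒳 : Type (u + 1)} [Category.{v} 𝒳] {p : 𝒳 ⥤ Over S}

theorem isPullback_of_eqToHom {X Y Z P : Over S} {f : X ⟶ Z} {g : Y ⟶ Z} {a : P ⟶ X} {b : P ⟶ Y}
    (h : ∃ e : P = pullback f g, a = eqToHom e ≫ pullback.fst f g ∧
      b = eqToHom e ≫ pullback.snd f g) : IsPullback a b f g := by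
  obtain ⟨rfl, rfl, rfl⟩ := h
  simpa using IsPullback.of_hasPullback f g

/-- It suffices to check the stack conditions for families of morphisms which are images of
morphisms of the fibered category. -/
theorem IsStack.of_map (hp : p.IsFibered)
    (glue_hom : ∀ {ι : Type u} {y y' : 𝒳} {x : ι → 𝒳} (c : ∀ i, x i ⟶ y) (a : ∀ i, x i ⟶ y')
      (e : p.obj y = p.obj y'), IsFppfCover (fun i => p.map (c i)) →
      (∀ i, p.IsStronglyCartesian (p.map (c i)) (c i)) →
      (∀ i, p.map (a i) = p.map (c i) ≫ eqToHom e) →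
      (∀ (i j : ι) (z : 𝒳) (s : z ⟶ x i) (t : z ⟶ x j), s ≫ c i = t ≫ c j →
        s ≫ a i = t ≫ a j) →
      ∃! b : y ⟶ y', p.map b = eqToHom e ∧ ∀ i, c i ≫ b = a i)
    (glue_obj : ∀ {ι : Type u} {Y : Over S} {x : ι → 𝒳} {xx : ι → ι → 𝒳}
      (f : ∀ i, p.obj (x i) ⟶ Y) (_ : IsFppfCover f)
      (a : ∀ i j, xx i j ⟶ x i) (b : ∀ i j, xx i j ⟶ x j),
      (∀ i j, p.IsStronglyCartesian (p.map (a i j)) (a i j)) →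
      (∀ i j, p.IsStronglyCartesian (p.map (b i j)) (b i j)) →
      (∀ i j, ∃ e : p.obj (xx i j) = pullback (f i) (f j),
        p.map (a i j) = eqToHom e ≫ pullback.fst (f i) (f j) ∧
        p.map (b i j) = eqToHom e ≫ pullback.snd (f i) (f j)) →
      (∀ (i j k : ι) (z : 𝒳) (r : z ⟶ xx i j) (s : z ⟶ xx j k) (t : z ⟶ xx i k),
        r ≫ b i j = s ≫ a j k → r ≫ a i j = t ≫ a i k →
        p.map (s ≫ b j k) = p.map (t ≫ b i k) → s ≫ b j k = t ≫ b i k) →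
      ∃ (y : 𝒳) (c : ∀ i, x i ⟶ y) (e : p.obj y = Y), (∀ i, p.map (c i) ≫ eqToHom e = f i) ∧
        (∀ i, p.IsStronglyCartesian (p.map (c i)) (c i)) ∧ ∀ i j, a i j ≫ c i = b i j ≫ c j) :
    IsStack p where
  fibered := hp
  glue_hom {ι Y X} f hf {y y' x} c a hy hy' hc ha compat := by
    subst hy
    obtain rfl : (fun i => p.obj (x i)) = X := funext fun i =>
      have := (hc i).toIsHomLift
      IsHomLift.domain_eq p (f i) (c i)
    obtain rfl : (fun i => p.map (c i)) = f := funext fun i =>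
      (isHomLift_iff p _ _).1 (hc i).toIsHomLift
    obtain ⟨b, ⟨h1, h2⟩, h3⟩ := glue_hom c a hy'.symm hf hc (fun i => by
      have := ha i
      have h := IsHomLift.fac' p (p.map (c i)) (a i)
      simpa using h) compat
    have key (b : y ⟶ y') : p.IsHomLift (𝟙 (p.obj y)) b ↔ p.map b = eqToHom hy'.symm := by
      constructor
      · intro h
        have := IsHomLift.fac' p (𝟙 (p.obj y)) b
        simpa using this
      · intro h
        exact IsHomLift.of_fac' p _ _ rfl hy' (by simp [h])
    exact ⟨b, ⟨(key b).2 h1, h2⟩, fun b' hb' => h3 b' ⟨(key b').1 hb'.1, hb'.2⟩⟩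
  glue_obj {ι Y X} f hf {x xx} a b ha hb cocycle := by
    by_cases hι : Nonempty ι
    swap
    · obtain ⟨y, c, e, -⟩ := glue_obj (x := x) (xx := xx)
        (fun i => (hι ⟨i⟩).elim) (Y := Y) ⟨fun i => (hι ⟨i⟩).elim, fun i => (hι ⟨i⟩).elim,
          fun y => (hι ⟨(hf.surj y).choose⟩).elim⟩ a b (fun i => (hι ⟨i⟩).elim)
          (fun i => (hι ⟨i⟩).elim) (fun i => (hι ⟨i⟩).elim) (fun i => (hι ⟨i⟩).elim)
      exact ⟨y, c, e, fun i => (hι ⟨i⟩).elim, fun i => (hι ⟨i⟩).elim⟩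
    obtain rfl : (fun i => p.obj (x i)) = X := funext fun i =>
      have := (ha i i).toIsHomLift
      IsHomLift.codomain_eq p (pullback.fst (f i) (f i)) (a i i)
    have h1 (i j) : p.obj (xx i j) = pullback (f i) (f j) :=
      have := (ha i j).toIsHomLift
      IsHomLift.domain_eq p (pullback.fst (f i) (f j)) (a i j)
    have ha' (i j) : p.map (a i j) = eqToHom (h1 i j) ≫ pullback.fst (f i) (f j) := by
      have := (ha i j).toIsHomLift
      have := IsHomLift.fac' p (pullback.fst (f i) (f j)) (a i j)
      simpa using this
    have hb' (i j) : p.map (b i j) = eqToHom (h1 i j) ≫ pullback.snd (f i) (f j) := by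
      have := (hb i j).toIsHomLift
      have := IsHomLift.fac' p (pullback.snd (f i) (f j)) (b i j)
      simpa using this
    obtain ⟨y, c, rfl, h2, h3, h4⟩ := glue_obj f hf a b
      (fun i j => isStronglyCartesian_map (ha i j)) (fun i j => isStronglyCartesian_map (hb i j))
      (fun i j => ⟨h1 i j, ha' i j, hb' i j⟩) cocycle
    refine ⟨y, c, rfl, fun i => isStronglyCartesian_of_map ((isHomLift_iff p _ _).2 ?_) (h3 i), h4⟩
    simpa using h2 i

theorem IsStack.glue_hom_map (hp : IsStack p) {ι : Type u} {y y' : 𝒳} {x : ι → 𝒳}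
    (c : ∀ i, x i ⟶ y) (a : ∀ i, x i ⟶ y') (e : p.obj y = p.obj y')
    (hf : IsFppfCover (fun i => p.map (c i)))
    (hc : ∀ i, p.IsStronglyCartesian (p.map (c i)) (c i))
    (ha : ∀ i, p.map (a i) = p.map (c i) ≫ eqToHom e)
    (compat : ∀ (i j : ι) (z : 𝒳) (s : z ⟶ x i) (t : z ⟶ x j), s ≫ c i = t ≫ c j →
        s ≫ a i = t ≫ a j) :
    ∃! b : y ⟶ y', p.map b = eqToHom e ∧ ∀ i, c i ≫ b = a i := by
  obtain ⟨b, ⟨h1, h2⟩, h3⟩ := hp.glue_hom _ hf c a rfl e.symm hc (fun i =>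
    IsHomLift.of_fac' p _ _ rfl e.symm (by simp [ha])) compat
  have key (b : y ⟶ y') : p.IsHomLift (𝟙 (p.obj y)) b ↔ p.map b = eqToHom e := by
    constructor
    · intro h
      have := IsHomLift.fac' p (𝟙 (p.obj y)) b
      simpa using this
    · intro h
      exact IsHomLift.of_fac' p _ _ rfl e.symm (by simp [h])
  exact ⟨b, ⟨(key b).1 h1, h2⟩, fun b' hb' => h3 b' ⟨(key b').2 hb'.1, hb'.2⟩⟩

theorem IsStack.glue_obj_map (hp : IsStack p) {ι : Type u} {Y : Over S} {x : ι → 𝒳}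
    {xx : ι → ι → 𝒳} (f : ∀ i, p.obj (x i) ⟶ Y) (hf : IsFppfCover f)
    (a : ∀ i j, xx i j ⟶ x i) (b : ∀ i j, xx i j ⟶ x j)
    (ha : ∀ i j, p.IsStronglyCartesian (p.map (a i j)) (a i j))
    (hb : ∀ i j, p.IsStronglyCartesian (p.map (b i j)) (b i j))
    (hab : ∀ i j, ∃ e : p.obj (xx i j) = pullback (f i) (f j),
      p.map (a i j) = eqToHom e ≫ pullback.fst (f i) (f j) ∧
      p.map (b i j) = eqToHom e ≫ pullback.snd (f i) (f j))
    (cocycle : ∀ (i j k : ι) (z : 𝒳) (r : z ⟶ xx i j) (s : z ⟶ xx j k) (t : z ⟶ xx i k),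
        r ≫ b i j = s ≫ a j k → r ≫ a i j = t ≫ a i k →
        p.map (s ≫ b j k) = p.map (t ≫ b i k) → s ≫ b j k = t ≫ b i k) :
    ∃ (y : 𝒳) (c : ∀ i, x i ⟶ y) (e : p.obj y = Y), (∀ i, p.map (c i) ≫ eqToHom e = f i) ∧
      (∀ i, p.IsStronglyCartesian (p.map (c i)) (c i)) ∧ ∀ i j, a i j ≫ c i = b i j ≫ c j := by
  obtain ⟨y, c, rfl, h1, h2⟩ := hp.glue_obj f hf a b
    (fun i j => by
      obtain ⟨e, h, -⟩ := hab i j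
      exact isStronglyCartesian_of_map (IsHomLift.of_fac p _ _ e rfl (by simp [h])) (ha i j))
    (fun i j => by
      obtain ⟨e, -, h⟩ := hab i j
      exact isStronglyCartesian_of_map (IsHomLift.of_fac p _ _ e rfl (by simp [h])) (hb i j))
    cocycle
  refine ⟨y, c, rfl, fun i => ?_, fun i => isStronglyCartesian_map (h1 i), h2⟩
  have := (isHomLift_iff p _ _).1 (h1 i).toIsHomLift
  simpa using this

end StackNormalForm

section QCohStack

variable {S : Scheme.{u}}

namespace QCohTot

theorem hom_ext {A B : QCohTot S} {a b : A ⟶ B} (h : a.base = b.base)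
    (h' : ∀ {W : Scheme.{u}} (p : W ⟶ A.base.left) (p' : W ⟶ B.base.left)
      (w : p ≫ a.base.left = p') (w' : p ≫ b.base.left = p') (m : Sec A.mod p),
      ap a.map p p' w m = ap b.map p p' w' m) : a = b := by
  obtain ⟨f, φ⟩ := a
  obtain ⟨g, ψ⟩ := b
  obtain rfl : f = g := h
  refine congrArg (Hom.mk f) (ap_ext fun p m => ?_)
  exact h' p _ rfl rfl m

theorem ap_comp {A B C : QCohTot S} (a : A ⟶ B) (b : B ⟶ C) {W : Scheme.{u}}
    (p : W ⟶ A.base.left) (p' : W ⟶ B.base.left) (p'' : W ⟶ C.base.left)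
    (w : p ≫ a.base.left = p') (w' : p' ≫ b.base.left = p'')
    (w'' : p ≫ (a ≫ b).base.left = p'') (m : Sec A.mod p) :
    ap (a ≫ b).map p p'' w'' m = ap b.map p' p'' w' (ap a.map p p' w m) :=
  ap_compMap a.map b.map p p' p'' w w' w'' m

theorem comp_base {A B C : QCohTot S} (a : A ⟶ B) (b : B ⟶ C) :
    (a ≫ b).base = a.base ≫ b.base := rfl

theorem ap_of_eq {A B : QCohTot S} {a b : A ⟶ B} (h : a = b) {W : Scheme.{u}}
    (p : W ⟶ A.base.left) (p' : W ⟶ B.base.left)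
    (w : p ≫ a.base.left = p') (w' : p ≫ b.base.left = p') (m : Sec A.mod p) :
    ap a.map p p' w m = ap b.map p p' w' m := by
  subst h
  rfl

theorem ap_id {A : QCohTot S} {W : Scheme.{u}} (p : W ⟶ A.base.left)
    (w : p ≫ (𝟙 A : A ⟶ A).base.left = p) (m : Sec A.mod p) : ap (𝟙 A : A ⟶ A).map p p w m = m :=
  (ap_idMap p p w m).trans (resAt_id _ _ rfl _ _ _)

/-- The pair `(W, g^* M)` with its canonical morphism to `(X, M)`. -/
def restr (B : QCohTot S) {W : Over S} (g : W ⟶ B.base) : QCohTot S := ⟨W, (pull g.left).obj B.mod⟩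

/-- The canonical morphism from the restriction. -/
def restrMap (B : QCohTot S) {W : Over S} (g : W ⟶ B.base) : B.restr g ⟶ B := ⟨g, 𝟙 _⟩

instance {B : QCohTot S} {W : Over S} (g : W ⟶ B.base) : IsIso (B.restrMap g).map :=
  inferInstanceAs (IsIso (𝟙 _))

theorem exists_lift {A B C : QCohTot S} (φ : A ⟶ B) [IsIso φ.map] (ψ : C ⟶ B)
    (g : C.base ⟶ A.base) (hg : g ≫ φ.base = ψ.base) :
    ∃! χ : C ⟶ A, χ.base = g ∧ χ ≫ φ = ψ := by
  obtain ⟨χ, hχ, -⟩ := exists_ap_lift φ.map g.left ψ.base.left (congrArg (·.left) hg) ψ.map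
  refine ⟨⟨g, χ⟩, ⟨rfl, hom_ext hg fun p p' w w' m => ?_⟩, ?_⟩
  · refine (ap_comp (A := C) (B := A) ⟨g, χ⟩ φ p _ p' rfl ?_ w m).trans (hχ _ _ _ rfl _ w' m)
    exact (Category.assoc _ _ _).trans w
  · rintro χ' ⟨h1, h2⟩
    refine hom_ext h1 fun p p' w w' m => ?_
    apply (bijective_ap φ.map p' _ rfl).1
    have e1 : p ≫ (χ' ≫ φ).base.left = p' ≫ φ.base.left := by
      rw [← w, Category.assoc]; rfl
    have e2 : p ≫ ψ.base.left = p' ≫ φ.base.left := by rw [← e1, h2]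
    refine (ap_comp χ' φ p p' _ w rfl e1 m).symm.trans ?_
    refine Eq.trans ?_ (hχ p p' _ w' rfl e2 m).symm
    subst h2
    rfl

/-- A morphism `(g, φ)` of `QCoh` is cartesian if and only if `φ` is an isomorphism: compare with
the canonical morphism from the restriction. -/
theorem stronglyCartesian_iff_isIso {A B : QCohTot S} (φ : A ⟶ B) :
    (proj S).IsStronglyCartesian ((proj S).map φ) φ ↔ IsIso φ.map := by
  rw [stronglyCartesian_iff]
  constructor
  · intro h
    have hinj : ∀ {C : QCohTot S} (χ χ' : C ⟶ A), χ.base = χ'.base → χ ≫ φ = χ' ≫ φ → χ = χ' := by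
      intro C χ χ' h1 h2
      obtain ⟨ξ, -, h3⟩ := h C χ'.base (χ' ≫ φ) rfl
      exact (h3 χ ⟨h1, h2⟩).trans (h3 χ' ⟨rfl, rfl⟩).symm
    obtain ⟨χ, ⟨h1, h2⟩, -⟩ := h (B.restr φ.base) (𝟙 _) (B.restrMap φ.base)
      (Category.id_comp _).symm
    obtain ⟨ρ, ⟨h3, h4⟩, -⟩ := exists_lift (B.restrMap φ.base) φ (𝟙 _) (Category.id_comp _)
    have h5 : ρ ≫ χ = 𝟙 A := by
      refine hinj _ _ ?_ (by rw [Category.assoc, h2, h4, Category.id_comp])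
      rw [comp_base]
      exact (congrArg₂ (· ≫ ·) h3 h1).trans (Category.id_comp _)
    have h1' : χ.base.left = 𝟙 _ := congrArg (·.left) h1
    have h3' : ρ.base.left = 𝟙 _ := congrArg (·.left) h3
    refine isIso_of_ap _ fun {W} p => ⟨fun m m' hm => ?_, fun n => ?_⟩
    · have e₁ : p ≫ ρ.base.left = p := (congrArg (p ≫ ·) h3').trans (Category.comp_id p)
      have e₂ : p ≫ χ.base.left = p := (congrArg (p ≫ ·) h1').trans (Category.comp_id p)
      have e₃ : p ≫ (ρ ≫ χ).base.left = p := by rw [h5]; exact Category.comp_id p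
      have e₄ : p ≫ (ρ ≫ B.restrMap φ.base).base.left = p ≫ φ.base.left := by rw [h4]
      have k1 (m : Sec A.mod p) : ap χ.map p p e₂ (ap ρ.map p p e₁ m) = m :=
        (ap_comp ρ χ p p p e₁ e₂ e₃ m).symm.trans
          ((ap_of_eq h5 p p e₃ (Category.comp_id p) m).trans (ap_id p _ m))
      have k2 (m : Sec A.mod p) : ap (B.restrMap φ.base).map p (p ≫ φ.base.left) rfl
          (ap ρ.map p p e₁ m) = ap φ.map p (p ≫ φ.base.left) rfl m :=
        (ap_comp ρ (B.restrMap φ.base) p p _ e₁ rfl e₄ m).symm.trans (ap_of_eq h4 p _ e₄ rfl m)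
      have k3 : ap ρ.map p p e₁ m = ap ρ.map p p e₁ m' :=
        (bijective_ap (B.restrMap φ.base).map p _ rfl).1 ((k2 m).trans (hm.trans (k2 m').symm))
      rw [← k1 m, ← k1 m', k3]
    · have e₂ : p ≫ χ.base.left = p := (congrArg (p ≫ ·) h1').trans (Category.comp_id p)
      have e₃ : p ≫ (χ ≫ φ).base.left = p ≫ φ.base.left := by rw [h2]; rfl
      obtain ⟨n', hn'⟩ := (bijective_ap (B.restrMap φ.base).map p (p ≫ φ.base.left) rfl).2 n
      refine ⟨ap χ.map p p e₂ n', ?_⟩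
      refine (ap_comp χ φ p p _ e₂ rfl e₃ n').symm.trans ?_
      exact (ap_of_eq h2 p _ e₃ rfl n').trans hn'
  · intro h C g ψ hψ
    exact exists_lift φ ψ g hψ.symm

theorem isFibered : (proj S).IsFibered :=
  isFibered_of fun B _ f => ⟨B.restr f, B.restrMap f, rfl, (Category.id_comp _).symm,
    (stronglyCartesian_iff_isIso _).2 (inferInstanceAs (IsIso (𝟙 _)))⟩

/-- Quasi-coherent modules form a stack. The gluing data of the stack condition are turned into
identities between sections by testing them on restrictions of the modules. -/
theorem isStack (S : Scheme.{u}) : IsStack (proj S) := by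
  refine IsStack.of_map isFibered ?_ ?_
  · intro ι y y' x c a e hf hc ha compat
    have hiso (i) : IsIso (c i).map := (stronglyCartesian_iff_isIso _).1 (hc i)
    obtain ⟨Y, M⟩ := y
    obtain ⟨Y', N⟩ := y'
    obtain rfl : Y = Y' := e
    have ha' (i) : (a i).base = (c i).base := (ha i).trans (Category.comp_id _)
    have hf' : IsFppfCov fun i => (c i).base.left := ⟨hf.flat, hf.lfp, hf.surj⟩
    obtain ⟨β, hβ, -⟩ := exists_descended_map hf' (𝟙 Y.left) (fun i => (a i).base.left)
      (fun i => by rw [ha']; exact Category.comp_id _) (fun i => (c i).map) hiso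
      (fun i => (a i).map) (by
        intro i j W p q z z' w w' v v' m n h
        -- the hypothesis on the `a i` is applied to the restriction of `M` to `W`
        let Z : Over S := Over.mk (z ≫ Y.hom)
        let k : Z ⟶ Y := Over.homMk z rfl
        have wp : p ≫ (x i).base.hom = z ≫ Y.hom := by
          rw [← w, Category.assoc]; exact congrArg (p ≫ ·) (Over.w (c i).base).symm
        have wq : q ≫ (x j).base.hom = z ≫ Y.hom := by
          rw [← w', Category.assoc]; exact congrArg (q ≫ ·) (Over.w (c j).base).symm
        let B : QCohTot S := ⟨Y, M⟩
        obtain ⟨s, ⟨hs, hs'⟩, -⟩ := exists_lift (c i) (B.restrMap k) (Over.homMk p wp)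
          (Over.OverMorphism.ext w)
        obtain ⟨t, ⟨ht, ht'⟩, -⟩ := exists_lift (c j) (B.restrMap k) (Over.homMk q wq)
          (Over.OverMorphism.ext w')
        have key := compat i j _ s t (hs'.trans ht'.symm)
        have es : s.base.left = p := congrArg (·.left) hs
        have et : t.base.left = q := congrArg (·.left) ht
        obtain ⟨l, hl⟩ := (bijective_ap (B.restrMap k).map (𝟙 W) z (Category.id_comp z)).2
          (ap (c i).map p z w m)
        have e₁ : 𝟙 W ≫ s.base.left = p := (Category.id_comp _).trans es
        have e₂ : 𝟙 W ≫ t.base.left = q := (Category.id_comp _).trans et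
        have e₃ : 𝟙 W ≫ (s ≫ c i).base.left = z := by rw [hs']; exact Category.id_comp _
        have e₄ : 𝟙 W ≫ (t ≫ c j).base.left = z := by rw [ht']; exact Category.id_comp _
        have e₅ : 𝟙 W ≫ (s ≫ a i).base.left = z' :=
          (Category.id_comp _).trans ((congrArg (· ≫ _) es).trans v)
        have e₆ : 𝟙 W ≫ (t ≫ a j).base.left = z' :=
          (Category.id_comp _).trans ((congrArg (· ≫ _) et).trans v')
        have hm : ap s.map (𝟙 W) p e₁ l = m := by
          apply (bijective_ap (c i).map p z w).1
          refine (ap_comp s (c i) (𝟙 W) p z e₁ w e₃ l).symm.trans (Eq.trans ?_ hl)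
          exact ap_of_eq hs' _ _ e₃ (Category.id_comp z) l
        have hn : ap t.map (𝟙 W) q e₂ l = n := by
          apply (bijective_ap (c j).map q z w').1
          refine (ap_comp t (c j) (𝟙 W) q z e₂ w' e₄ l).symm.trans (Eq.trans ?_ (hl.trans h))
          exact ap_of_eq ht' _ _ e₄ (Category.id_comp z) l
        rw [← hm, ← hn, ← ap_comp s (a i) (𝟙 W) p z' e₁ v e₅,
          ← ap_comp t (a j) (𝟙 W) q z' e₂ v' e₆]
        exact ap_of_eq key _ _ e₅ e₆ l)
    refine ⟨⟨𝟙 Y, β⟩, ⟨rfl, fun i => hom_ext ((Category.comp_id _).trans (ha' i).symm) ?_⟩, ?_⟩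
    · intro W p p' w w' m
      have e₁ : p ≫ (c i).base.left = p' := by rw [← ha']; exact w'
      refine (ap_comp (B := ⟨Y, M⟩) (C := ⟨Y, N⟩) (c i) ⟨𝟙 Y, β⟩ p p' p' e₁
        (Category.comp_id p') w m).trans ?_
      exact hβ i p p' p' e₁ (Category.comp_id p') w' m
    · rintro ⟨g, β'⟩ ⟨h1, h2⟩
      obtain rfl : g = 𝟙 Y := h1
      refine congrArg (Hom.mk (A := ⟨Y, M⟩) (B := ⟨Y, N⟩) (𝟙 Y))
        (descended_map_unique hf' fun i W p m => ?_)
      obtain ⟨n, rfl⟩ := (bijective_ap (c i).map p _ rfl).2 m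
      have e₁ : p ≫ (a i).base.left = (p ≫ (c i).base.left) ≫ (𝟙 Y : Y ⟶ Y).left := by
        rw [ha']; exact (Category.comp_id _).symm
      have e₂ : p ≫ (c i ≫ (⟨𝟙 Y, β'⟩ : (⟨Y, M⟩ : QCohTot S) ⟶ ⟨Y, N⟩)).base.left =
        (p ≫ (c i).base.left) ≫ (𝟙 Y : Y ⟶ Y).left := (Category.assoc _ _ _).symm
      refine Eq.trans ?_ (hβ i p _ _ rfl rfl e₁ n).symm
      refine Eq.trans ?_ (ap_of_eq (h2 i) p _ e₂ e₁ n)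
      exact (ap_comp (B := ⟨Y, M⟩) (C := ⟨Y, N⟩) (c i) ⟨𝟙 Y, β'⟩ p _ _ rfl rfl e₂ n).symm
  · intro ι Y x xx f hf a b ha hb hab cocycle
    have hp (i j) : IsPullback (a i j).base (b i j).base (f i) (f j) :=
      isPullback_of_eqToHom (hab i j)
    have hα (i j) : IsIso (a i j).map := (stronglyCartesian_iff_isIso _).1 (ha i j)
    have hβ (i j) : IsIso (b i j).map := (stronglyCartesian_iff_isIso _).1 (hb i j)
    have hf' : IsFppfCov fun i => (f i).left := ⟨hf.flat, hf.lfp, hf.surj⟩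
    obtain ⟨N, c, hc, h⟩ := exists_descended_module hf' (fun i => (x i).mod)
      (fun i j => (a i j).base.left) (fun i j => (b i j).base.left)
      (fun i j => (hp i j).map (Over.forget S)) (fun i j => (xx i j).mod)
      (fun i j => (a i j).map) (fun i j => (b i j).map) hα hβ (by
        intro i j k W r s t p q l h₁ h₂ h₃ h₄ h₅ h₆ m n o e e'
        -- the cocycle condition is applied to the restriction of the module on the overlap to `W`
        let Z : Over S := Over.mk (r ≫ (xx i j).base.hom)
        let κ : Z ⟶ (xx i j).base := Over.homMk r rfl
        have hs : s ≫ (xx j k).base.hom = Z.hom := by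
          rw [← Over.w (a j k).base, ← Category.assoc]
          refine (congrArg (· ≫ _) (h₃.trans h₂.symm)).trans ?_
          exact (Category.assoc _ _ _).trans (congrArg (r ≫ ·) (Over.w (b i j).base))
        have ht : t ≫ (xx i k).base.hom = Z.hom := by
          rw [← Over.w (a i k).base, ← Category.assoc]
          refine (congrArg (· ≫ _) (h₅.trans h₁.symm)).trans ?_
          exact (Category.assoc _ _ _).trans (congrArg (r ≫ ·) (Over.w (a i j).base))
        let ρ := (xx i j).restrMap κ
        obtain ⟨σ, ⟨hσ, hσ'⟩, -⟩ := exists_lift (a j k) (ρ ≫ b i j) (Over.homMk s hs)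
          (Over.OverMorphism.ext (h₃.trans h₂.symm))
        obtain ⟨τ, ⟨hτ, hτ'⟩, -⟩ := exists_lift (a i k) (ρ ≫ a i j) (Over.homMk t ht)
          (Over.OverMorphism.ext (h₅.trans h₁.symm))
        have es : σ.base.left = s := congrArg (·.left) hσ
        have et : τ.base.left = t := congrArg (·.left) hτ
        have key := cocycle i j k _ ρ σ τ hσ'.symm hτ'.symm
          (Over.OverMorphism.ext ((congrArg (· ≫ _) es).trans
            (h₄.trans (h₆.symm.trans (congrArg (· ≫ _) et.symm)))))
        obtain ⟨m, rfl⟩ := (bijective_ap ρ.map (𝟙 W) r (Category.id_comp r)).2 m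
        have e₁ : 𝟙 W ≫ σ.base.left = s := (Category.id_comp _).trans es
        have e₂ : 𝟙 W ≫ τ.base.left = t := (Category.id_comp _).trans et
        have e₃ : 𝟙 W ≫ (ρ ≫ b i j).base.left = q := (Category.id_comp _).trans h₂
        have e₃' : 𝟙 W ≫ (σ ≫ a j k).base.left = q := by rw [hσ']; exact e₃
        have e₄ : 𝟙 W ≫ (ρ ≫ a i j).base.left = p := (Category.id_comp _).trans h₁
        have e₄' : 𝟙 W ≫ (τ ≫ a i k).base.left = p := by rw [hτ']; exact e₄
        have e₅ : 𝟙 W ≫ (σ ≫ b j k).base.left = l :=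
          (Category.id_comp _).trans ((congrArg (· ≫ _) es).trans h₄)
        have e₆ : 𝟙 W ≫ (τ ≫ b i k).base.left = l :=
          (Category.id_comp _).trans ((congrArg (· ≫ _) et).trans h₆)
        have hn : ap σ.map (𝟙 W) s e₁ m = n := by
          apply (bijective_ap (a j k).map s q h₃).1
          refine (ap_comp σ (a j k) (𝟙 W) s q e₁ h₃ e₃' m).symm.trans (Eq.trans ?_ e)
          exact (ap_of_eq hσ' _ _ e₃' e₃ m).trans
            (ap_comp ρ (b i j) (𝟙 W) r q (Category.id_comp r) h₂ e₃ m)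
        have ho : ap τ.map (𝟙 W) t e₂ m = o := by
          apply (bijective_ap (a i k).map t p h₅).1
          refine (ap_comp τ (a i k) (𝟙 W) t p e₂ h₅ e₄' m).symm.trans (Eq.trans ?_ e')
          exact (ap_of_eq hτ' _ _ e₄' e₄ m).trans
            (ap_comp ρ (a i j) (𝟙 W) r p (Category.id_comp r) h₁ e₄ m)
        subst hn ho
        refine (ap_comp σ (b j k) (𝟙 W) s l e₁ h₄ e₅ m).symm.trans ?_
        refine Eq.trans ?_ (ap_comp τ (b i k) (𝟙 W) t l e₂ h₆ e₆ m)
        exact ap_of_eq key _ _ e₅ e₆ m)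
    let y : QCohTot S := ⟨Y, N⟩
    let c' (i) : x i ⟶ y := ⟨f i, c i⟩
    refine ⟨y, c', rfl, fun i => Category.comp_id _, fun i =>
      (stronglyCartesian_iff_isIso (c' i)).2 (hc i), fun i j => ?_⟩
    refine hom_ext (hp i j).w fun p p' w w' m => ?_
    have w₁ : (p ≫ (a i j).base.left) ≫ (f i).left = p' := (Category.assoc _ _ _).trans w
    have w₂ : (p ≫ (b i j).base.left) ≫ (f j).left = p' := (Category.assoc _ _ _).trans w'
    refine (ap_comp (a i j) (c' i) p _ p' rfl w₁ w m).trans ?_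
    refine Eq.trans ?_ (ap_comp (b i j) (c' j) p _ p' rfl w₂ w' m).symm
    exact h i j p _ _ p' rfl rfl w₁ w₂ m

end QCohTot

end QCohStack

section QCohIStack

variable {S : Scheme.{u}} {I : Subcat S}

theorem Subcat.comp_g {i j k : I.Cat} (a : i ⟶ j) (b : j ⟶ k) :
    (a ≫ b).val.g = a.val.g ≫ b.val.g := rfl

theorem AffMor.w {j h : AffMor S} (a : j ⟶ h) : a.g ≫ h.hom = j.hom ≫ a.f.left := a.isPullback.w

theorem Subcat.isFppfCov_total {ι : Type u} {y : I.Cat} {x : ι → I.Cat} (c : ∀ i, x i ⟶ y)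
    (hf : IsFppfCover fun i => (c i).val.f) : IsFppfCov fun i => (c i).val.g := by
  refine ⟨fun i => ?_, fun i => ?_, fun t => ?_⟩
  · have := hf.flat i
    exact MorphismProperty.of_isPullback (P := @Flat) (c i).val.isPullback.flip this
  · have := hf.lfp i
    exact MorphismProperty.of_isPullback (P := @LocallyOfFinitePresentation)
      (c i).val.isPullback.flip this
  · obtain ⟨i, z, hz⟩ := hf.surj (y.val.hom t)
    obtain ⟨w, h1, -⟩ := Scheme.exists_preimage_of_isPullback (c i).val.isPullback t z hz.symm
    exact ⟨i, w, h1⟩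

/-- A morphism `W ⟶ T'` to the source of an object `T' ⟶ T` of a fibered subcategory of affine
morphisms factors through the source of the base change along `W ⟶ T`. This base change has
morphisms to all cartesian morphisms for which this is possible. -/
theorem Subcat.exists_test (hI : I.proj.IsFibered) (B : I.Cat) {W : Scheme.{u}}
    (z : W ⟶ B.val.total) :
    ∃ (ζ : I.Cat) (m : ζ ⟶ B) (w : W ⟶ ζ.val.total), w ≫ m.val.g = z ∧
      IsIso (w ≫ ζ.val.hom) ∧ ∀ {A C : I.Cat} (φ : A ⟶ C), I.proj.IsStronglyCartesian (I.proj.map φ) φ →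
        ∀ (n : ζ ⟶ C) (p : W ⟶ A.val.total), p ≫ φ.val.g = w ≫ n.val.g →
          ∃ s : ζ ⟶ A, s ≫ φ = n ∧ w ≫ s.val.g = p := by
  let Z : Over S := Over.mk (z ≫ B.val.hom ≫ B.val.base.hom)
  let κ : Z ⟶ B.val.base := Over.homMk (z ≫ B.val.hom) (Category.assoc _ _ _)
  obtain ⟨ζ, m, e, h1, -⟩ := exists_cartesian_lift hI (b := B) κ
  let i : ζ.val.base ≅ Z := eqToIso e
  have hm : m.val.f.left = i.hom.left ≫ z ≫ B.val.hom := congrArg (·.left) h1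
  have hi : i.inv.left ≫ i.hom.left = 𝟙 W := congrArg (·.left) i.inv_hom_id
  have hi' : i.hom.left ≫ i.inv.left = 𝟙 _ := congrArg (·.left) i.hom_inv_id
  let w : W ⟶ ζ.val.total := m.val.isPullback.lift z i.inv.left
    (by
      rw [hm, reassoc_of% hi]
      exact (Category.id_comp _).symm)
  have hw : w ≫ m.val.g = z := m.val.isPullback.lift_fst _ _ _
  have hw' : w ≫ ζ.val.hom = i.inv.left := m.val.isPullback.lift_snd _ _ _
  refine ⟨ζ, m, w, hw, ?_, ?_⟩
  · rw [hw']
    exact ⟨i.hom.left, hi, hi'⟩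
  intro A C φ hφ n p hp
  have hp' : p ≫ A.val.hom ≫ φ.val.f.left = i.inv.left ≫ n.val.f.left := by
    rw [← AffMor.w, reassoc_of% hp, AffMor.w, reassoc_of% hw']
  let g : ζ.val.base ⟶ A.val.base := i.hom ≫ Over.homMk (p ≫ A.val.hom) (by
    rw [← Over.w φ.val.f, Category.assoc, reassoc_of% hp', Over.w, Over.w])
  obtain ⟨s, ⟨hs, hs'⟩, -⟩ := (stronglyCartesian_iff I.proj φ).1 hφ ζ g n (by
    refine Over.OverMorphism.ext ?_
    change n.val.f.left = (i.hom.left ≫ p ≫ A.val.hom) ≫ φ.val.f.left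
    rw [Category.assoc, Category.assoc, hp', reassoc_of% hi'])
  refine ⟨s, hs', ?_⟩
  apply φ.val.isPullback.hom_ext
  · rw [hp, Category.assoc, ← Subcat.comp_g, hs']
  · have : s.val.f.left = i.hom.left ≫ p ≫ A.val.hom := congrArg (·.left) hs
    rw [Category.assoc, AffMor.w, reassoc_of% hw', this, reassoc_of% hi]
    exact Category.id_comp _

namespace QCohI

theorem hom_ext {A B : QCohI I} {a b : A ⟶ B} (h : a.arr = b.arr)
    (h' : ∀ {W : Scheme.{u}} (p : W ⟶ A.arr.val.total) (p' : W ⟶ B.arr.val.total)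
      (w : p ≫ a.arr.val.g = p') (w' : p ≫ b.arr.val.g = p') (m : Sec A.mod p),
      ap a.map p p' w m = ap b.map p p' w' m) : a = b := by
  obtain ⟨f, φ, _⟩ := a
  obtain ⟨g, ψ, _⟩ := b
  obtain rfl : f = g := h
  obtain rfl : φ = ψ := ap_ext fun p m => h' p _ rfl rfl m
  rfl

theorem ap_comp {A B C : QCohI I} (a : A ⟶ B) (b : B ⟶ C) {W : Scheme.{u}}
    (p : W ⟶ A.arr.val.total) (p' : W ⟶ B.arr.val.total) (p'' : W ⟶ C.arr.val.total)
    (w : p ≫ a.arr.val.g = p') (w' : p' ≫ b.arr.val.g = p'')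
    (w'' : p ≫ (a ≫ b).arr.val.g = p'') (m : Sec A.mod p) :
    ap (a ≫ b).map p p'' w'' m = ap b.map p' p'' w' (ap a.map p p' w m) :=
  ap_compMap a.map b.map p p' p'' w w' w'' m

theorem ap_of_eq {A B : QCohI I} {a b : A ⟶ B} (h : a = b) {W : Scheme.{u}}
    (p : W ⟶ A.arr.val.total) (p' : W ⟶ B.arr.val.total)
    (w : p ≫ a.arr.val.g = p') (w' : p ≫ b.arr.val.g = p') (m : Sec A.mod p) :
    ap a.map p p' w m = ap b.map p p' w' m := by
  subst h
  rfl

/-- The restriction of the module along a morphism of `I`. -/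
def restr (B : QCohI I) {j : I.Cat} (g : j ⟶ B.arr) : QCohI I := ⟨j, (pull g.val.g).obj B.mod⟩

/-- The canonical morphism from the restriction. -/
def restrMap (B : QCohI I) {j : I.Cat} (g : j ⟶ B.arr) : B.restr g ⟶ B :=
  ⟨g, 𝟙 _, inferInstanceAs (IsIso (𝟙 _))⟩

theorem exists_lift {A B C : QCohI I} (φ : A ⟶ B) (ψ : C ⟶ B)
    (g : C.arr ⟶ A.arr) (hg : g ≫ φ.arr = ψ.arr) :
    ∃! χ : C ⟶ A, χ.arr = g ∧ χ ≫ φ = ψ := by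
  have := φ.isIso
  obtain ⟨χ, hχ, hi⟩ := exists_ap_lift φ.map g.val.g ψ.arr.val.g (congrArg (·.val.g) hg) ψ.map
  refine ⟨⟨g, χ, hi ψ.isIso⟩, ⟨rfl, hom_ext hg fun p p' w w' m => ?_⟩, ?_⟩
  · refine (ap_comp (A := C) (B := A) ⟨g, χ, hi ψ.isIso⟩ φ p _ p' rfl ?_ w m).trans
      (hχ _ _ _ rfl _ w' m)
    exact (Category.assoc _ _ _).trans w
  · rintro χ' ⟨h1, h2⟩
    refine hom_ext h1 fun p p' w w' m => ?_
    apply (bijective_ap φ.map p' _ rfl).1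
    have e1 : p ≫ (χ' ≫ φ).arr.val.g = p' ≫ φ.arr.val.g := by
      rw [← w, Category.assoc]; rfl
    have e2 : p ≫ ψ.arr.val.g = p' ≫ φ.arr.val.g := by rw [← e1, h2]
    refine (ap_comp χ' φ p p' _ w rfl e1 m).symm.trans ?_
    refine Eq.trans ?_ (hχ p p' _ w' rfl e2 m).symm
    exact ap_of_eq h2 _ _ e1 e2 m

/-- As the linear maps of morphisms of `QCohI I` are isomorphisms, only their underlying morphisms
of `I` matter. -/
theorem stronglyCartesian_iff_arr {A B : QCohI I} (φ : A ⟶ B) :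
    (proj I).IsStronglyCartesian ((proj I).map φ) φ ↔
      I.proj.IsStronglyCartesian (I.proj.map φ.arr) φ.arr := by
  rw [stronglyCartesian_iff, stronglyCartesian_iff]
  constructor
  · intro h j g φ' hφ'
    obtain ⟨χ, ⟨h1, h2⟩, h3⟩ := h (B.restr φ') g (B.restrMap φ') hφ'
    refine ⟨χ.arr, ⟨h1, congrArg (·.arr) h2⟩, fun χ₁ hχ₁ => ?_⟩
    obtain ⟨χ', ⟨h4, h5⟩, -⟩ := exists_lift φ (B.restrMap φ') χ₁ hχ₁.2
    rw [← h3 χ' ⟨(congrArg (fun k => I.proj.map k) h4).trans hχ₁.1, h5⟩]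
    exact h4.symm
  · intro h C g ψ hψ
    obtain ⟨χ₀, ⟨h1, h2⟩, h3⟩ := h C.arr g ψ.arr hψ
    obtain ⟨χ, ⟨h4, h5⟩, h6⟩ := exists_lift φ ψ χ₀ h2
    refine ⟨χ, ⟨(congrArg (fun k => I.proj.map k) h4).trans h1, h5⟩, fun χ' h => ?_⟩
    exact h6 χ' ⟨h3 _ ⟨h.1, congrArg (·.arr) h.2⟩, h.2⟩

theorem isFibered (hI : I.proj.IsFibered) : (proj I).IsFibered :=
  isFibered_of fun B _ f => by
    obtain ⟨j, φ, e, h1, h2⟩ := exists_cartesian_lift hI (b := B.arr) f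
    exact ⟨B.restr φ, B.restrMap φ, e, h1, (stronglyCartesian_iff_arr _).2 h2⟩

/-- Modules on the sources of the morphisms in a stack `I` form a stack: objects and morphisms of
`I` are glued first, and then modules and linear maps along the induced covering of the sources. -/
theorem isStack (hI : IsStack I.proj) : IsStack (proj I) := by
  refine IsStack.of_map (isFibered hI.fibered) ?_ ?_
  · intro ι y y' x c a e hf hc ha compat
    have hc' (i) := (stronglyCartesian_iff_arr _).1 (hc i)
    obtain ⟨b, ⟨hb, hb'⟩, hu⟩ := hI.glue_hom_map (fun i => (c i).arr) (fun i => (a i).arr) e hf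
      hc' ha (by
        intro i j z s t h
        obtain ⟨s', ⟨h1, h2⟩, -⟩ := exists_lift (c i) (y.restrMap (s ≫ (c i).arr)) s rfl
        obtain ⟨t', ⟨h3, h4⟩, -⟩ := exists_lift (c j) (y.restrMap (s ≫ (c i).arr)) t h.symm
        have := congrArg (·.arr) (compat i j _ s' t' (h2.trans h4.symm))
        exact (congrArg (· ≫ (a i).arr) h1).symm.trans
          (this.trans (congrArg (· ≫ (a j).arr) h3)))
    have hf' : IsFppfCov fun i => (c i).arr.val.g := Subcat.isFppfCov_total _ hf
    have hb'' (i) : (c i).arr.val.g ≫ b.val.g = (a i).arr.val.g := congrArg (·.val.g) (hb' i)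
    obtain ⟨β, hβ, hi⟩ := exists_descended_map hf' b.val.g (fun i => (a i).arr.val.g) hb''
      (fun i => (c i).map) (fun i => (c i).isIso) (fun i => (a i).map) (by
        intro i j W p q z z' w w' v v' m n h
        -- `W` need not be the source of an object of `I`, but maps to one to which `c i` and `c j`
        -- can be compared
        obtain ⟨ζ, μ, κ, hκ, -, ht⟩ := Subcat.exists_test hI.fibered y.arr z
        obtain ⟨s₀, hs₀, es⟩ := ht (c i).arr (hc' i) μ p (w.trans hκ.symm)
        obtain ⟨t₀, ht₀, et⟩ := ht (c j).arr (hc' j) μ q (w'.trans hκ.symm)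
        let ρ := y.restrMap μ
        obtain ⟨s, ⟨hs, hs'⟩, -⟩ := exists_lift (c i) ρ s₀ hs₀
        obtain ⟨t, ⟨ht, ht'⟩, -⟩ := exists_lift (c j) ρ t₀ ht₀
        have key := compat i j _ s t (hs'.trans ht'.symm)
        have := ρ.isIso
        have := (c i).isIso
        have := (c j).isIso
        obtain ⟨l, hl⟩ := (bijective_ap ρ.map κ z hκ).2 (ap (c i).map p z w m)
        have e₁ : κ ≫ s.arr.val.g = p := (congrArg (fun k => κ ≫ k.val.g) hs).trans es
        have e₂ : κ ≫ t.arr.val.g = q := (congrArg (fun k => κ ≫ k.val.g) ht).trans et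
        have e₃ : κ ≫ (s ≫ c i).arr.val.g = z := by rw [hs']; exact hκ
        have e₄ : κ ≫ (t ≫ c j).arr.val.g = z := by rw [ht']; exact hκ
        have e₅ : κ ≫ (s ≫ a i).arr.val.g = z' :=
          (Category.assoc _ _ _).symm.trans ((congrArg (· ≫ _) e₁).trans v)
        have e₆ : κ ≫ (t ≫ a j).arr.val.g = z' :=
          (Category.assoc _ _ _).symm.trans ((congrArg (· ≫ _) e₂).trans v')
        have hm : ap s.map κ p e₁ l = m := by
          apply (bijective_ap (c i).map p z w).1
          refine (ap_comp s (c i) κ p z e₁ w e₃ l).symm.trans (Eq.trans ?_ hl)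
          exact ap_of_eq hs' _ _ e₃ hκ l
        have hn : ap t.map κ q e₂ l = n := by
          apply (bijective_ap (c j).map q z w').1
          refine (ap_comp t (c j) κ q z e₂ w' e₄ l).symm.trans (Eq.trans ?_ (hl.trans h))
          exact ap_of_eq ht' _ _ e₄ hκ l
        subst hm hn
        refine (ap_comp s (a i) κ p z' e₁ v e₅ l).symm.trans ?_
        refine Eq.trans ?_ (ap_comp t (a j) κ q z' e₂ v' e₆ l)
        exact ap_of_eq key _ _ e₅ e₆ l)
    let b' : y ⟶ y' := ⟨b, β, hi fun i => (a i).isIso⟩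
    refine ⟨b', ⟨hb, fun i => hom_ext (hb' i) ?_⟩, ?_⟩
    · intro W p p' w w' m
      have e₁ : (p ≫ (c i).arr.val.g) ≫ b.val.g = p' := by
        rw [Category.assoc, hb'', w']
      exact (ap_comp (c i) b' p _ p' rfl e₁ w m).trans (hβ i p _ p' rfl e₁ w' m)
    · rintro ⟨g, β', hβ'⟩ ⟨h1, h2⟩
      obtain rfl : g = b := hu g ⟨h1, fun i => congrArg (·.arr) (h2 i)⟩
      have : β' = β := descended_map_unique hf' fun i W p m => by
        have := (c i).isIso
        obtain ⟨n, rfl⟩ := (bijective_ap (c i).map p _ rfl).2 m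
        have e₁ : p ≫ (a i).arr.val.g = (p ≫ (c i).arr.val.g) ≫ g.val.g := by
          rw [Category.assoc, hb'']
        have e₂ : p ≫ (c i ≫ (⟨g, β', hβ'⟩ : y ⟶ y')).arr.val.g =
          (p ≫ (c i).arr.val.g) ≫ g.val.g := (Category.assoc _ _ _).symm
        refine Eq.trans ?_ (hβ i p _ _ rfl rfl e₁ n).symm
        refine Eq.trans ?_ (ap_of_eq (h2 i) p _ e₂ e₁ n)
        exact (ap_comp (c i) (⟨g, β', hβ'⟩ : y ⟶ y') p _ _ rfl rfl e₂ n).symm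
      subst this
      rfl
  · intro ι Y x xx f hf a b ha hb hab cocycle
    have ha' (i j) := (stronglyCartesian_iff_arr _).1 (ha i j)
    have hb' (i j) := (stronglyCartesian_iff_arr _).1 (hb i j)
    obtain ⟨y₀, c₀, rfl, hcf, hc₀, hcw⟩ := hI.glue_obj_map (x := fun i => (x i).arr) f hf
      (fun i j => (a i j).arr) (fun i j => (b i j).arr) ha' hb' hab (by
        intro i j k z r s t e e' e''
        let ρ := (xx i j).restrMap r
        obtain ⟨s', ⟨h1, h2⟩, -⟩ := exists_lift (a j k) (ρ ≫ b i j) s e.symm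
        obtain ⟨t', ⟨h3, h4⟩, -⟩ := exists_lift (a i k) (ρ ≫ a i j) t e'.symm
        subst h1 h3
        exact congrArg (·.arr) (cocycle i j k _ ρ s' t' h2.symm h4.symm e''))
    obtain rfl : (fun i => (c₀ i).val.f) = f := funext fun i => by
      rw [← hcf]
      exact (Category.comp_id _).symm
    have hf' : IsFppfCov fun i => (c₀ i).val.g := Subcat.isFppfCov_total _ hf
    have hp₀ (i j) : IsPullback (a i j).arr.val.f (b i j).arr.val.f (c₀ i).val.f (c₀ j).val.f :=
      isPullback_of_eqToHom (hab i j)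
    have hp (i j) : IsPullback (a i j).arr.val.g (b i j).arr.val.g (c₀ i).val.g (c₀ j).val.g := by
      have h1 := (c₀ j).val.isPullback
      have h2 := (a i j).arr.val.isPullback.flip.paste_horiz ((hp₀ i j).map (Over.forget S)).flip
      have h3 : (xx i j).arr.val.hom ≫ (b i j).arr.val.f.left =
        (b i j).arr.val.g ≫ (x j).arr.val.hom := (AffMor.w _).symm
      have h4 : (x i).arr.val.hom ≫ (c₀ i).val.f.left = (c₀ i).val.g ≫ y₀.val.hom :=
        (AffMor.w _).symm
      refine (IsPullback.of_right (h₁₁ := (b i j).arr.val.g) (h₂₁ := (c₀ i).val.g) ?_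
        (congrArg (·.val.g) (hcw i j)).symm h1.flip).flip
      rw [← h3, ← h4]
      exact h2
    obtain ⟨N, c, hc, h⟩ := exists_descended_module hf' (fun i => (x i).mod)
      (fun i j => (a i j).arr.val.g) (fun i j => (b i j).arr.val.g) hp (fun i j => (xx i j).mod)
      (fun i j => (a i j).map) (fun i j => (b i j).map) (fun i j => (a i j).isIso)
      (fun i j => (b i j).isIso) (by
        intro i j k W r s t p q l h₁ h₂ h₃ h₄ h₅ h₆ m n o e e'
        obtain ⟨ζ, μ, κ, hκ, hi, ht⟩ := Subcat.exists_test hI.fibered (xx i j).arr r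
        let ρ := (xx i j).restrMap μ
        obtain ⟨s₀, hs₀, es⟩ := ht (a j k).arr (ha' j k) (μ ≫ (b i j).arr) s (by
          rw [h₃, Subcat.comp_g, reassoc_of% hκ, h₂])
        obtain ⟨t₀, ht₀, et⟩ := ht (a i k).arr (ha' i k) (μ ≫ (a i j).arr) t (by
          rw [h₅, Subcat.comp_g, reassoc_of% hκ, h₁])
        obtain ⟨σ, ⟨hσ, hσ'⟩, -⟩ := exists_lift (a j k) (ρ ≫ b i j) s₀ hs₀
        obtain ⟨τ, ⟨hτ, hτ'⟩, -⟩ := exists_lift (a i k) (ρ ≫ a i j) t₀ ht₀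
        have key := cocycle i j k _ ρ σ τ hσ'.symm hτ'.symm (by
          have h₀ : (s₀ ≫ (b j k).arr).val.f = (t₀ ≫ (b i k).arr).val.f := by
            refine Over.OverMorphism.ext ((cancel_epi (κ ≫ ζ.val.hom)).1 ?_)
            rw [Category.assoc, Category.assoc, ← AffMor.w, ← AffMor.w, Subcat.comp_g,
              Subcat.comp_g, Category.assoc, Category.assoc, reassoc_of% es, reassoc_of% et,
              reassoc_of% h₄, reassoc_of% h₆]
          exact (congrArg (fun k => I.proj.map (k ≫ (b j _).arr)) hσ).trans
            (h₀.trans (congrArg (fun k => I.proj.map (k ≫ (b i _).arr)) hτ.symm)))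
        have := ρ.isIso
        have := (a j k).isIso
        have := (a i k).isIso
        obtain ⟨m, rfl⟩ := (bijective_ap ρ.map κ r hκ).2 m
        have e₁ : κ ≫ σ.arr.val.g = s := (congrArg (fun k => κ ≫ k.val.g) hσ).trans es
        have e₂ : κ ≫ τ.arr.val.g = t := (congrArg (fun k => κ ≫ k.val.g) hτ).trans et
        have e₃ : κ ≫ (ρ ≫ b i j).arr.val.g = q :=
          (Category.assoc _ _ _).symm.trans ((congrArg (· ≫ _) hκ).trans h₂)
        have e₃' : κ ≫ (σ ≫ a j k).arr.val.g = q := by rw [hσ']; exact e₃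
        have e₄ : κ ≫ (ρ ≫ a i j).arr.val.g = p :=
          (Category.assoc _ _ _).symm.trans ((congrArg (· ≫ _) hκ).trans h₁)
        have e₄' : κ ≫ (τ ≫ a i k).arr.val.g = p := by rw [hτ']; exact e₄
        have e₅ : κ ≫ (σ ≫ b j k).arr.val.g = l :=
          (Category.assoc _ _ _).symm.trans ((congrArg (· ≫ _) e₁).trans h₄)
        have e₆ : κ ≫ (τ ≫ b i k).arr.val.g = l :=
          (Category.assoc _ _ _).symm.trans ((congrArg (· ≫ _) e₂).trans h₆)
        have hn : ap σ.map κ s e₁ m = n := by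
          apply (bijective_ap (a j k).map s q h₃).1
          refine (ap_comp σ (a j k) κ s q e₁ h₃ e₃' m).symm.trans (Eq.trans ?_ e)
          exact (ap_of_eq hσ' _ _ e₃' e₃ m).trans
            (ap_comp ρ (b i j) κ r q hκ h₂ e₃ m)
        have ho : ap τ.map κ t e₂ m = o := by
          apply (bijective_ap (a i k).map t p h₅).1
          refine (ap_comp τ (a i k) κ t p e₂ h₅ e₄' m).symm.trans (Eq.trans ?_ e')
          exact (ap_of_eq hτ' _ _ e₄' e₄ m).trans
            (ap_comp ρ (a i j) κ r p hκ h₁ e₄ m)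
        subst hn ho
        refine (ap_comp σ (b j k) κ s l e₁ h₄ e₅ m).symm.trans ?_
        refine Eq.trans ?_ (ap_comp τ (b i k) κ t l e₂ h₆ e₆ m)
        exact ap_of_eq key _ _ e₅ e₆ m)
    let y : QCohI I := ⟨y₀, N⟩
    let c' (i) : x i ⟶ y := ⟨c₀ i, c i, hc i⟩
    refine ⟨y, c', rfl, fun i => Category.comp_id _, fun i =>
      (stronglyCartesian_iff_arr (c' i)).2 (hc₀ i), fun i j => ?_⟩
    refine hom_ext (hcw i j) fun p p' w w' m => ?_
    have w₁ : (p ≫ (a i j).arr.val.g) ≫ (c₀ i).val.g = p' := (Category.assoc _ _ _).trans w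
    have w₂ : (p ≫ (b i j).arr.val.g) ≫ (c₀ j).val.g = p' := (Category.assoc _ _ _).trans w'
    refine (ap_comp (a i j) (c' i) p _ p' rfl w₁ w m).trans ?_
    refine Eq.trans ?_ (ap_comp (b i j) (c' j) p _ p' rfl w₂ w' m).symm
    exact h i j p _ _ p' rfl rfl w₁ w₂ m

end QCohI

end QCohIStack

/-! ### The functors and the morphism of stacks given by local functors -/

section Assembling

variable {S : Scheme.{u}}

theorem AffMor.exists_lift {h k k' : AffMor S} (m : k ⟶ h) (m' : k' ⟶ h)
    (t : k'.base.left ⟶ k.base.left) (w : t ≫ m.f.left = m'.f.left) :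
    ∃ n : k' ⟶ k, n ≫ m = m' ∧ n.f.left = t := by
  let f : k'.base ⟶ k.base := Over.homMk t (by rw [← Over.w m.f, reassoc_of% w, Over.w])
  have hf : f ≫ m.f = m'.f := Over.OverMorphism.ext w
  have e : m'.g ≫ h.hom = (k'.hom ≫ t) ≫ m.f.left := by rw [AffMor.w, Category.assoc, w]
  let g : k'.total ⟶ k.total := m.isPullback.lift m'.g (k'.hom ≫ t) e
  have hg : g ≫ m.g = m'.g := m.isPullback.lift_fst _ _ _
  have hg' : g ≫ k.hom = k'.hom ≫ t := m.isPullback.lift_snd _ _ _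
  refine ⟨⟨f, g, IsPullback.of_right ?_ hg' m.isPullback⟩, AffMor.Hom.ext hf hg, rfl⟩
  rw [hg]
  exact w ▸ m'.isPullback

theorem AffMor.hom_ext_left {h k k' : AffMor S} {n n' : k' ⟶ k} (m : k ⟶ h)
    (e : n ≫ m = n' ≫ m) (e' : n.f.left = n'.f.left) : n = n' := by
  refine AffMor.Hom.ext (Over.OverMorphism.ext e') (m.isPullback.hom_ext ?_ ?_)
  · exact congrArg (fun t : k' ⟶ h => t.g) e
  · rw [AffMor.w, AffMor.w, e']

variable {I : Subcat S}

theorem Subcat.Aff.isAffine_total (k : I.Aff) : IsAffine k.val.total :=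
  have := k.isAffine
  have := k.val.affine
  isAffine_of_isAffineHom k.val.hom

/-- All affine schemes over the target of an object of a fibered subcategory of affine morphisms
are, up to isomorphism, the target of a base change which belongs to the subcategory. -/
theorem Subcat.exists_aff (hI : I.proj.IsFibered) (h : I.Cat) {U : Scheme.{u}} (hU : IsAffine U)
    (x : U ⟶ h.val.base.left) :
    ∃ (k : I.Aff) (m : k.val ⟶ h.val) (i : k.val.base.left ≅ U), i.hom ≫ x = m.f.left := by
  obtain ⟨k, m, e, h1, -⟩ := exists_cartesian_lift hI (b := h)
    (Over.homMk x : Over.mk (x ≫ h.val.base.hom) ⟶ h.val.base)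
  let i : k.val.base.left ≅ U := (Over.forget S).mapIso (eqToIso e)
  exact ⟨⟨k, .of_isIso i.hom⟩, m.val, i, (congrArg (·.left) h1).symm⟩

/-- The base changes of an object `h` of a subcategory of affine morphisms with affine target,
as schemes over the target of `h`. -/
def affOver (h : I.Cat) (a : Σ k : I.Aff, (k.val ⟶ h.val)) : Over h.val.base.left :=
  Over.mk a.2.f.left

theorem dense_affOver (hI : I.proj.IsFibered) (h : I.Cat) : Dense (affOver h) := by
  intro W
  obtain ⟨ι, A, f, hf⟩ := dense_aff _ W
  choose k m i hi using fun a => Subcat.exists_aff hI h (A a).2 (A a).1.hom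
  let j (a : ι) : affOver h ⟨k a, m a⟩ ≅ (A a).1 := Over.isoMk (i a) (hi a)
  refine ⟨ι, fun a => ⟨k a, m a⟩, fun a => (j a).hom ≫ f a, (fppf _).superset_covering ?_ hf⟩
  rw [Sieve.ofArrows, Sieve.generate_le_iff]
  rintro _ _ ⟨a⟩
  exact ⟨_, (j a).inv, _, ⟨a⟩, (j a).inv_hom_id_assoc _⟩

section Trans

variable {F : I.Functors} (B : BaseChange I F)

/-- The restriction maps of the module given by local functors. -/
def trans {h : AffMor S} {k k' : I.Aff} (n : k'.val ⟶ k.val) (m : k.val ⟶ h) (m' : k'.val ⟶ h)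
    (w : n ≫ m = m') (M : QCoh h.total) :
    (F k).obj ((evAt m.g).obj M) →+ (F k').obj ((evAt m'.g).obj M) :=
  transMap (B.θ n) (rhoAt M n.g m.g m'.g (congrArg (fun t : k'.val ⟶ h => t.g) w))

variable {B} {h : AffMor S} {k k' k'' : I.Aff}

theorem isBC_trans (n : k'.val ⟶ k.val) (m : k.val ⟶ h) (m' : k'.val ⟶ h)
    (w : n ≫ m = m') (M : QCoh h.total) : IsBC n.f.left.appTop.hom (trans B n m m' w M) := by
  have := isIso_rhoAt k'.isAffine_total k.isAffine_total M n.g m.g m'.g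
    (congrArg (fun t : k'.val ⟶ h => t.g) w)
  exact isBC_transMap _

theorem trans_nat (n : k'.val ⟶ k.val) (m : k.val ⟶ h) (m' : k'.val ⟶ h)
    (w : n ≫ m = m') {M N : QCoh h.total} (a : M ⟶ N) (x : (F k).obj ((evAt m.g).obj M)) :
    (F k').map ((evAt m'.g).map a) (trans B n m m' w M x) =
      trans B n m m' w N ((F k).map ((evAt m.g).map a) x) :=
  transMap_nat _ _ _ _ (rhoAt_nat a _ _ _ _) x

theorem trans_id (n : k.val ⟶ k.val) (hn : n = 𝟙 _) (m : k.val ⟶ h)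
    (w : n ≫ m = m) (M : QCoh h.total) (x : (F k).obj ((evAt m.g).obj M)) :
    trans B n m m w M x = x := by
  subst hn
  refine transMap_id (B.unit k) _ (fun y => ?_) x
  exact (semilin_rhoAt M _ _ _ _ y).trans (resAt_id M _ rfl _ _ y)

theorem trans_trans (n : k'.val ⟶ k.val) (n' : k''.val ⟶ k'.val) (n'' : k''.val ⟶ k.val)
    (hn : n' ≫ n = n'') (m : k.val ⟶ h) (m' : k'.val ⟶ h) (m'' : k''.val ⟶ h)
    (w : n ≫ m = m') (w' : n' ≫ m' = m'') (w'' : n'' ≫ m = m'') (M : QCoh h.total)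
    (x : (F k).obj ((evAt m.g).obj M)) :
    trans B n'' m m'' w'' M x = trans B n' m' m'' w' M (trans B n m m' w M x) := by
  subst hn
  refine transMap_transMap (B.cocycle n' n) _ _ _ (fun y => ?_) x
  refine (semilin_rhoAt M _ _ _ _ y).trans (Eq.trans ?_ (semilin_rhoAt M _ _ _ _ _).symm)
  refine Eq.trans ?_ (congrArg _ (semilin_rhoAt M _ _ _ _ _).symm)
  exact resAt_resAt M _ _ _ rfl _ _ _ _ _ _ y

end Trans

theorem isBC_restrictScalars {R R' : Type u} [CommRing R] [CommRing R'] (f : R →+* R')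
    (hf : Function.Bijective f) (N : ModuleCat.{u} R') :
    IsBC (M := (ModuleCat.restrictScalars f).obj N) (N := N) f (AddMonoidHom.id N) :=
  IsBC.of_bijective hf (fun _ _ => rfl) Function.bijective_id

theorem isBC_restrictScalars' {R R' : Type u} [CommRing R] [CommRing R'] (f : R →+* R')
    (g : R' →+* R) (hf : Function.Bijective f) (hg : g.comp f = RingHom.id R)
    (N : ModuleCat.{u} R') :
    IsBC (M := N) (N := (ModuleCat.restrictScalars f).obj N) g (AddMonoidHom.id N) := by
  have h (x : R) : g (f x) = x := RingHom.congr_fun hg x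
  have h' (y : R') : f (g y) = y := by
    obtain ⟨x, rfl⟩ := hf.2 y
    rw [h]
  refine IsBC.of_bijective (Function.bijective_iff_has_inverse.2 ⟨f, h', h⟩) (fun r m => ?_)
    Function.bijective_id
  change r • m = f (g r) • m
  rw [h']

theorem bijective_appTop {X Y : Scheme.{u}} (i : X ≅ Y) : Function.Bijective i.hom.appTop.hom :=
  ConcreteCategory.bijective_of_isIso (Scheme.Γ.mapIso i.symm.op).inv

/-- The functors given by local functors on `QCoh(T')` for an object `T' ⟶ T` of `I`. -/
theorem exists_assembled_functor (hI : I.proj.IsFibered) {F : I.Functors} (B : BaseChange I F)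
    (h : I.Cat) : ∃ (Φ : QCoh h.val.total ⥤ QCoh h.val.base.left)
      (e : ∀ (k : I.Aff) (m : k.val ⟶ h.val), Φ ⋙ evAt m.f.left ≅ evAt m.g ⋙ F k),
      ∀ (k' k : I.Aff) (n : k'.val ⟶ k.val) (m : k.val ⟶ h.val) (m' : k'.val ⟶ h.val)
        (w : n ≫ m = m') (w' : n.f.left ≫ m.f.left = m'.f.left) (M : QCoh h.val.total)
        (x : (Φ ⋙ evAt m.f.left).obj M),
        (e k' m').hom.app M (resAt (Φ.obj M) n.f.left m.f.left m'.f.left w' x) =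
          trans B n m m' w M ((e k m).hom.app M x) := by
  choose k m i hi using fun A : AffOver h.val.base.left => Subcat.exists_aff hI h A.2 A.1.hom
  have hn (A A' : AffOver h.val.base.left) (f : A'.1 ⟶ A.1) := AffMor.exists_lift (m A) (m A')
    ((i A').hom ≫ f.left ≫ (i A).inv) (by
      rw [← hi A, ← hi A', Category.assoc, Category.assoc, Iso.inv_hom_id_assoc, Over.w f])
  choose n hn hn' using hn
  have happ (A : AffOver h.val.base.left) : Function.Bijective (i A).hom.appTop.hom :=
    bijective_appTop (i A)
  have hinv (A : AffOver h.val.base.left) :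
      (i A).inv.appTop.hom.comp (i A).hom.appTop.hom = RingHom.id _ := by
    rw [← appTop_comp, Iso.inv_hom_id, appTop_id]
  obtain ⟨Φ, ε, hε⟩ := exists_assembly (X := h.val.base.left) (C := QCoh h.val.total)
    (fun A => evAt (m A).g ⋙ F (k A) ⋙ ModuleCat.restrictScalars (i A).hom.appTop.hom)
    (fun {A A'} f M => trans B (n A A' f) (m A) (m A') (hn A A' f) M)
    (fun A A' f M => by
      have h1 := ((isBC_restrictScalars _ (happ A) ((F (k A)).obj ((evAt (m A).g).obj M))).comp
        (isBC_trans (B := B) (n A A' f) (m A) (m A') (hn A A' f) M)).comp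
        (isBC_restrictScalars' _ _ (happ A') (hinv A') ((F (k A')).obj ((evAt (m A').g).obj M)))
      have h2 : f.left.appTop.hom = (i A').inv.appTop.hom.comp
          ((n A A' f).f.left.appTop.hom.comp (i A).hom.appTop.hom) := by
        rw [← appTop_comp, ← appTop_comp, hn']
        simp
      rw [h2]
      exact h1)
    (fun A A' f M N a x => trans_nat _ _ _ _ a x)
    (fun A M x => trans_id _ (AffMor.hom_ext_left (m A)
      ((hn A A (𝟙 _)).trans (Category.id_comp _).symm) ((hn' A A (𝟙 _)).trans (by
        change (i A).hom ≫ 𝟙 _ ≫ (i A).inv = 𝟙 _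
        rw [Category.id_comp, Iso.hom_inv_id]))) _ _ _ x)
    (fun A A' A'' f g M x => trans_trans _ _ _ (AffMor.hom_ext_left (m A) (by
        rw [Category.assoc, hn, hn, hn]) (by
        change (n A' A'' g).f.left ≫ (n A A' f).f.left = _
        rw [hn', hn', hn']
        simp)) _ _ _ _ _ _ _ x)
  have hα (k' : I.Aff) (m' : k'.val ⟶ h.val) := AffMor.exists_lift
    (m ⟨Over.mk m'.f.left, k'.isAffine⟩) m' (i ⟨Over.mk m'.f.left, k'.isAffine⟩).inv (by
      rw [← hi, Iso.inv_hom_id_assoc]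
      rfl)
  choose l hl hl' using hα
  have hbij (k' : I.Aff) (m' : k'.val ⟶ h.val) (M : QCoh h.val.total) :
      Function.Bijective (trans B (l k' m') _ m' (hl k' m') M) := by
    refine (isBC_trans (B := B) (l k' m') _ m' (hl k' m') M).bijective ?_
    rw [hl']
    exact bijective_appTop (i _).symm
  let P (k' : I.Aff) (m' : k'.val ⟶ h.val) :
      QCoh h.val.total ⥤ ModuleCat.{u} Γ(k'.val.base.left, ⊤) :=
    evAt (m ⟨Over.mk m'.f.left, k'.isAffine⟩).g ⋙ F _ ⋙
      ModuleCat.restrictScalars (i ⟨Over.mk m'.f.left, k'.isAffine⟩).hom.appTop.hom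
  let ν (k' : I.Aff) (m' : k'.val ⟶ h.val) (M : QCoh h.val.total) :
      (P k' m').obj M →ₗ[Γ(k'.val.base.left, ⊤)] (evAt m'.g ⋙ F k').obj M :=
    { toFun := trans B (l k' m') _ m' (hl k' m') M
      map_add' := map_add (trans B (l k' m') _ m' (hl k' m') M)
      map_smul' := fun r x => by
        refine ((isBC_trans (B := B) (l k' m') _ m' (hl k' m') M).smul _ _).trans ?_
        refine congrArg (· • _) ?_
        rw [hl']
        exact RingHom.congr_fun (hinv ⟨Over.mk m'.f.left, k'.isAffine⟩) r }
  let e (k' : I.Aff) (m' : k'.val ⟶ h.val) : Φ ⋙ evAt m'.f.left ≅ evAt m'.g ⋙ F k' :=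
    ε ⟨Over.mk m'.f.left, k'.isAffine⟩ ≪≫ NatIso.ofComponents
      (fun M => (LinearEquiv.ofBijective (ν k' m' M) (hbij k' m' M)).toModuleIso) (by
        intro M N a
        ext x
        exact (trans_nat (B := B) (l k' m') (m ⟨Over.mk m'.f.left, k'.isAffine⟩) m' (hl k' m')
          a _).symm)
  refine ⟨Φ, e, fun k₂ k₁ n₁ m₁ m₂ w w' M x => ?_⟩
  let A₁ : AffOver h.val.base.left := ⟨Over.mk m₁.f.left, k₁.isAffine⟩
  let A₂ : AffOver h.val.base.left := ⟨Over.mk m₂.f.left, k₂.isAffine⟩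
  let f : A₂.1 ⟶ A₁.1 := Over.homMk n₁.f.left w'
  change trans B (l k₂ m₂) _ m₂ (hl k₂ m₂) M ((ε A₂).hom.app M _) =
    trans B n₁ m₁ m₂ w M (trans B (l k₁ m₁) _ m₁ (hl k₁ m₁) M ((ε A₁).hom.app M x))
  refine (congrArg _ (hε A₁ A₂ f M x)).trans ?_
  have w₁ : (l k₂ m₂ ≫ n A₁ A₂ f) ≫ m A₁ = m₂ := by rw [Category.assoc, hn, hl]
  refine (trans_trans _ _ _ rfl _ _ _ (hn A₁ A₂ f) (hl k₂ m₂) w₁ M _).symm.trans ?_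
  refine trans_trans _ _ _ (AffMor.hom_ext_left (m A₁) ?_ ?_) _ _ _ (hl k₁ m₁) w w₁ M _
  · rw [Category.assoc, hl, w, w₁]
  · change n₁.f.left ≫ (l k₁ m₁).f.left = (l k₂ m₂).f.left ≫ (n A₁ A₂ f).f.left
    rw [hl', hl', hn', Iso.inv_hom_id_assoc]
    rfl

end Assembling

section Assembled

variable {S : Scheme.{u}}

theorem ap_evAt_comp {X' X : Scheme.{u}} {g : X' ⟶ X} {M' L : QCoh X'} {M : QCoh X} (ψ : L ⟶ M')
    (φ : M' ⟶ (pull g).obj M) {W : Scheme.{u}} (p : W ⟶ X') (m : Sec L p) :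
    ap (ψ ≫ φ) p (p ≫ g) rfl m = (evAt p).map φ ((evAt p).map ψ m) :=
  ap_rfl _ _ _

/-- Morphisms of modules are determined by their values over a dense family. -/
theorem QCohTot.hom_ext_dense {A B : QCohTot S} {a b : A ⟶ B} (h : a.base = b.base)
    {E : Type*} {π : E → Over A.base.left} (hπ : Dense π)
    (h' : ∀ (e : E) (p' : (π e).left ⟶ B.base.left) (w : (π e).hom ≫ a.base.left = p')
      (w' : (π e).hom ≫ b.base.left = p') (m : Sec A.mod (π e).hom),
      ap a.map (π e).hom p' w m = ap b.map (π e).hom p' w' m) : a = b := by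
  obtain ⟨f, φ⟩ := a
  obtain ⟨g, ψ⟩ := b
  obtain rfl : f = g := h
  have key : ofPre φ.hom = ofPre ψ.hom :=
    LocMod.Hom.ext_dense (isSheaf_qcoh ((pull f.left).obj B.mod)) hπ fun e m =>
      (ap_rfl φ _ m).symm.trans ((h' e _ rfl rfl m).trans (ap_rfl ψ _ m))
  refine congrArg (Hom.mk f) ?_
  apply IsQCoh.hom_ext
  exact congrArg LocMod.Hom.toPre key

variable {I : Subcat S}

set_option maxHeartbeats 800000 in
/-- The functors `Φ h` are assembled from the local functors. Over the affine base changes `k` of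
`j`, both sides of `φ D : Φ j (g^* M) ≅ f^* (Φ h M)` are `F k (M(U'))`, and these identifications
are compatible with restriction. Functoriality is checked over the same dense family. -/
theorem assembles (hI : I.proj.IsFibered) (F : I.Functors) (B : BaseChange I F) :
    Assembles I F B := by
  choose Φ e he using exists_assembled_functor hI B
  have hφ (j h : I.Cat) (D : j.val ⟶ h.val) := exists_natIso (dense_affOver hI j)
    (Φ := pull D.g ⋙ Φ j) (Ψ := Φ h ⋙ pull D.f.left)
    (fun a => Functor.isoWhiskerLeft (pull D.g) (e j a.1 a.2) ≪≫
      (Iso.refl (evAt (a.2 ≫ D).g ⋙ F a.1)) ≪≫ (e h a.1 (a.2 ≫ D)).symm ≪≫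
      (Functor.isoWhiskerLeft (Φ h) (evPull a.2.f.left D.f.left)).symm) (by
      rintro ⟨k, m⟩ ⟨k', m'⟩ f M x
      obtain ⟨n, hw, hn⟩ := AffMor.exists_lift m m' f.left (Over.w f)
      have hw' : n ≫ (m ≫ D) = m' ≫ D := by rw [← Category.assoc, hw]
      have w₁ : n.f.left ≫ m.f.left = m'.f.left := congrArg (fun t : k'.val ⟶ j.val => t.f.left) hw
      have w₂ : n.f.left ≫ (m ≫ D).f.left = (m' ≫ D).f.left :=
        congrArg (fun t : k'.val ⟶ h.val => t.f.left) hw'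
      let y : (evAt (m ≫ D).g ⋙ F k).obj M := (e j k m).hom.app ((pull D.g).obj M) x
      have h1 := he j k' k n m m' hw w₁ ((pull D.g).obj M) x
      have h2 := he h k' k n (m ≫ D) (m' ≫ D) hw' w₂ M ((e h k (m ≫ D)).inv.app M y)
      have h3 : (e h k (m ≫ D)).hom.app M ((e h k (m ≫ D)).inv.app M y) = y :=
        ConcreteCategory.congr_hom ((e h k (m ≫ D)).inv_hom_id_app M) y
      have h4 (z : (evAt (m' ≫ D).g ⋙ F k').obj M) :
          (e h k' (m' ≫ D)).hom.app M ((e h k' (m' ≫ D)).inv.app M z) = z :=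
        ConcreteCategory.congr_hom ((e h k' (m' ≫ D)).inv_hom_id_app M) z
      apply (ConcreteCategory.bijective_of_isIso ((e h k' (m' ≫ D)).hom.app M)).1
      refine (h4 _).trans ?_
      refine (congrArg ((e j k' m').hom.app ((pull D.g).obj M))
        (resAt_congr ((Φ j).obj ((pull D.g).obj M)) hn.symm _ _ (Over.w f) x)).trans ?_
      refine h1.trans ?_
      refine Eq.trans ?_ (congrArg ((e h k' (m' ≫ D)).hom.app M)
        (resAt_congr ((pull D.f.left).obj ((Φ h).obj M)) hn _ _ w₁
          ((e h k (m ≫ D)).inv.app M y)))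
      exact ((h2.trans (congrArg _ h3)).symm))
  choose φ₀ hφ using hφ
  let φ {j h : I.Cat} (D : j.val ⟶ h.val) : pull D.g ⋙ Φ j ≅ Φ h ⋙ pull D.f.left := φ₀ j h D
  have hφ' (j h : I.Cat) (D : j.val ⟶ h.val) (k : I.Aff) (m : k.val ⟶ j.val)
      (M : QCoh h.val.total) :
      (evAt m.f.left).map ((φ D).hom.app M) ≫
          (evPull m.f.left D.f.left).hom.app ((Φ h).obj M) ≫ (e h k (m ≫ D)).hom.app M =
        (e j k m).hom.app ((pull D.g).obj M) ≫ (F k).map ((evPull m.g D.g).hom.app M) := by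
    ext x
    refine (congrArg ((e h k (m ≫ D)).hom.app M)
      (ConcreteCategory.congr_hom (hφ j h D ⟨k, m⟩ M) x)).trans ?_
    refine (ConcreteCategory.congr_hom ((e h k (m ≫ D)).inv_hom_id_app M) _).trans ?_
    exact (ConcreteCategory.congr_hom ((F k).map_id _) _).symm
  let ν := assembledPrefunctor Φ φ
  -- the morphisms in the image are determined by their values on affine base changes
  have key {A A' : QCohI I} (a : A ⟶ A') (k : I.Aff) (m : k.val ⟶ A.arr.val)
      (m' : k.val ⟶ A'.arr.val) (h : m ≫ a.arr.val = m')
      (w : m.f.left ≫ (ν.map a).base.left = m'.f.left) (w' : m.g ≫ a.arr.val.g = m'.g)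
      (x : Sec (ν.obj A).mod m.f.left) :
      (e A'.arr k m').hom.app A'.mod (ap (ν.map a).map m.f.left m'.f.left w x) =
        (F k).map (ModuleCat.ofHom (ap a.map m.g m'.g w')) ((e A.arr k m).hom.app A.mod x) := by
    subst h
    have h1 : ap (ν.map a).map m.f.left (m ≫ a.arr.val).f.left w x = _ :=
      ap_evAt_comp ((Φ A.arr).map a.map) ((φ a.arr.val).hom.app A'.mod) m.f.left x
    refine (congrArg _ h1).trans ?_
    have h2 := ConcreteCategory.congr_hom (hφ' A.arr A'.arr a.arr.val k m A'.mod)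
      ((evAt m.f.left).map ((Φ A.arr).map a.map) x)
    refine Eq.trans h2 ?_
    have h3 := ConcreteCategory.congr_hom ((e A.arr k m).hom.naturality a.map) x
    refine (congrArg ((F k).map ((evPull m.g a.arr.val.g).hom.app A'.mod)) h3).trans ?_
    have h4 : ModuleCat.ofHom (ap a.map m.g (m ≫ a.arr.val).g w') =
        (evAt m.g).map a.map ≫ (evPull m.g a.arr.val.g).hom.app A'.mod := by
      ext y
      exact ap_rfl a.map m.g y
    rw [h4, (F k).map_comp]
    rfl
  have inj (h : I.Cat) (k : I.Aff) (m : k.val ⟶ h.val) (M : QCoh h.val.total) :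
      Function.Injective ((e h k m).hom.app M) :=
    (ConcreteCategory.bijective_of_isIso ((e h k m).hom.app M)).1
  let N : QCohI I ⥤ QCohTot S :=
    { ν with
      map_id := fun A => by
        refine QCohTot.hom_ext_dense rfl (dense_affOver hI A.arr) ?_
        rintro ⟨k, m⟩ p' w w' x
        obtain rfl : m.f.left = p' := (Category.comp_id _).symm.trans w'
        apply inj A.arr k m A.mod
        refine (key (𝟙 A) k m m (Category.comp_id m) w (Category.comp_id m.g) x).trans ?_
        have h1 : ModuleCat.ofHom (ap (𝟙 A : A ⟶ A).map m.g m.g (Category.comp_id m.g)) = 𝟙 _ := by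
          ext y
          exact (ap_idMap m.g m.g (Category.comp_id m.g) y).trans (resAt_id _ _ rfl _ _ y)
        refine (congrArg (fun t => (F k).map t ((e A.arr k m).hom.app A.mod x)) h1).trans ?_
        rw [(F k).map_id]
        refine congrArg ((e A.arr k m).hom.app A.mod) ?_
        exact (QCohTot.ap_id (A := ν.obj A) m.f.left w' x).symm
      map_comp := fun {A A' A''} a b => by
        refine QCohTot.hom_ext_dense rfl (dense_affOver hI A.arr) ?_
        rintro ⟨k, m⟩ p' w w' x
        let m' := m ≫ a.arr.val
        let m'' := m' ≫ b.arr.val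
        obtain rfl : m''.f.left = p' := (Category.assoc _ _ _).trans w
        apply inj A''.arr k m'' A''.mod
        have w₁ : m.g ≫ (a ≫ b).arr.val.g = m''.g := (Category.assoc _ _ _).symm
        refine (key (a ≫ b) k m m'' (Category.assoc _ _ _).symm w w₁ x).trans ?_
        have h1 : ModuleCat.ofHom (ap (a ≫ b).map m.g m''.g w₁) =
            ModuleCat.ofHom (ap a.map m.g m'.g rfl) ≫ ModuleCat.ofHom (ap b.map m'.g m''.g rfl) := by
          ext y
          exact QCohI.ap_comp a b m.g m'.g m''.g rfl rfl w₁ y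
        refine (congrArg (fun t => (F k).map t ((e A.arr k m).hom.app A.mod x)) h1).trans ?_
        rw [(F k).map_comp]
        refine (congrArg ((F k).map _) (key a k m m' rfl rfl rfl x).symm).trans ?_
        refine (key b k m' m'' rfl rfl rfl _).symm.trans ?_
        refine congrArg ((e A''.arr k m'').hom.app A''.mod) ?_
        exact (QCohTot.ap_comp (ν.map a) (ν.map b) m.f.left m'.f.left m''.f.left rfl rfl w' x).symm }
  refine ⟨Φ, e, φ, N, ?_, hφ', rfl, rfl, ?_⟩
  · intro h k' k n m M
    refine semilin_injective _ fun x => ?_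
    refine Eq.trans ?_ (he h k' k n m _ rfl rfl M x)
    exact congrArg ((e h k' (n ≫ m)).hom.app M) (semilin_rhoAt ((Φ h).obj M) _ _ _ _ x)
  · intro A A' a
    have := a.isIso
    refine (QCohTot.stronglyCartesian_iff_isIso (N.map a)).2 ?_
    exact inferInstanceAs (IsIso ((Φ A.arr).map a.map ≫ (φ a.arr.val).hom.app A'.mod))

end Assembled

/-! ### Divided power algebras and base change -/

section DividedPower

open PowerSeries
open Finset.HasAntidiagonal (antidiagonal mem_antidiagonal)

variable {R M : Type u} [CommRing R] [AddCommGroup M] [Module R M]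

theorem dp_zero (m : M) : dp R 0 m = 1 := DividedPowerAlgebra.dp_zero

theorem dp_smul (n : ℕ) (r : R) (m : M) : dp R n (r • m) = r ^ n • dp R n m :=
  DividedPowerAlgebra.dp_smul

theorem dp_null (n : ℕ) : dp R n (0 : M) = if n = 0 then 1 else 0 := DividedPowerAlgebra.dp_null

theorem dp_mul (n k : ℕ) (m : M) : dp R n m * dp R k m = (n + k).choose n • dp R (n + k) m :=
  DividedPowerAlgebra.dp_mul

theorem dp_add (n : ℕ) (x y : M) :
    dp R n (x + y) = ∑ k ∈ antidiagonal n, dp R k.1 x * dp R k.2 y :=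
  DividedPowerAlgebra.dp_add

section Convolution

variable {D : Type*} [CommRing D]

/-- The sequences of divided powers of an element: `g_n g_k = (n + k choose n) g_{n + k}`. -/
def IsDP (g : D⟦X⟧) : Prop :=
  ∀ n k, coeff n g * coeff k g = (n + k).choose n • coeff (n + k) g

theorem isDP_one : IsDP (1 : D⟦X⟧) := by
  intro n k
  rcases n with _ | n
  · simp
  · rw [coeff_one, coeff_one (n + 1 + k), if_neg (by omega), if_neg (by omega)]
    simp

theorem IsDP.mul {g h : D⟦X⟧} (hg : IsDP g) (hh : IsDP h) : IsDP (g * h) := by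
  intro n k
  simp only [coeff_mul]
  rw [Finset.sum_mul_sum, Finset.smul_sum]
  have h1 : ∀ p ∈ antidiagonal (n + k), (n + k).choose n • (coeff p.1 g * coeff p.2 h) =
      ∑ i ∈ antidiagonal n, (p.1.choose i.1 * p.2.choose i.2) • (coeff p.1 g * coeff p.2 h) := by
    intro p hp
    rw [← Finset.sum_smul, ← Nat.add_choose_eq, mem_antidiagonal.1 hp]
  refine Eq.trans ?_ ((Finset.sum_congr rfl h1).trans Finset.sum_comm).symm
  refine Finset.sum_congr rfl fun i hi => ?_
  rw [mem_antidiagonal] at hi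
  refine Finset.sum_of_injOn (fun j => (i.1 + j.1, i.2 + j.2)) ?_ ?_ ?_ ?_
  · rintro ⟨a, b⟩ - ⟨a', b'⟩ - h
    simpa using h
  · rintro ⟨a, b⟩ h
    simp only [Finset.mem_coe,
      mem_antidiagonal] at h ⊢
    omega
  · rintro ⟨p, q⟩ hp hn
    rw [mem_antidiagonal] at hp
    rcases lt_or_ge p i.1 with h | h
    · simp [Nat.choose_eq_zero_of_lt h]
    rcases lt_or_ge q i.2 with h' | h'
    · simp [Nat.choose_eq_zero_of_lt h']
    refine (hn ⟨(p - i.1, q - i.2), ?_, ?_⟩).elim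
    · simp only [Finset.mem_coe,
        mem_antidiagonal] at hp ⊢
      omega
    · simp only [Prod.mk.injEq]
      omega
  · rintro ⟨a, b⟩ -
    have h2 := hg i.1 a
    have h3 := hh i.2 b
    calc coeff i.1 g * coeff i.2 h * (coeff a g * coeff b h)
        = (coeff i.1 g * coeff a g) * (coeff i.2 h * coeff b h) := by ring
      _ = _ := by
        rw [h2, h3, smul_mul_smul_comm]

end Convolution

variable {C D : Type u} [CommRing C] [Algebra R C] [CommRing D] [Algebra C D]

/-- The generating series `∑ c^n γ^n(m) T^n` of the divided powers of `c ⊗ m`, for a map from the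
divided power algebra to a `C`-algebra `D`. It turns sums into products. -/
def expTensor (i : Gam R M →+* D)
    (h : ∀ r, algebraMap C D (algebraMap R C r) = i (algebraMap R _ r)) :
    C ⊗[R] M →+ Additive D⟦X⟧ :=
  TensorProduct.liftAddHom
    { toFun := fun c =>
        { toFun := fun m => Additive.ofMul (mk fun n => algebraMap C D c ^ n * i (dp R n m))
          map_zero' := by
            refine congrArg Additive.ofMul (PowerSeries.ext fun n => ?_)
            rw [coeff_mk, dp_null, coeff_one]
            split_ifs with hn <;> simp [hn]
          map_add' := fun x y => by
            refine congrArg Additive.ofMul (PowerSeries.ext fun n => ?_)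
            rw [toMul_ofMul, toMul_ofMul, coeff_mk, coeff_mul, dp_add, map_sum, Finset.mul_sum]
            refine Finset.sum_congr rfl fun k hk => ?_
            rw [coeff_mk, coeff_mk, map_mul, ← mem_antidiagonal.1 hk, pow_add]
            ring }
      map_zero' := by
        refine AddMonoidHom.ext fun m => ?_
        refine congrArg Additive.ofMul (PowerSeries.ext fun n => ?_)
        rw [coeff_mk, map_zero, coeff_one]
        split_ifs with hn
        · rw [hn, dp_zero, map_one, pow_zero, one_mul]
        · rw [zero_pow hn, zero_mul]
      map_add' := fun c c' => by
        refine AddMonoidHom.ext fun m => ?_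
        refine congrArg Additive.ofMul (PowerSeries.ext fun n => ?_)
        change coeff n (mk _) = coeff n ((mk fun n => algebraMap C D c ^ n * i (dp R n m)) *
          mk fun n => algebraMap C D c' ^ n * i (dp R n m))
        rw [coeff_mk, coeff_mul, map_add, Commute.add_pow' (Commute.all _ _), Finset.sum_mul]
        refine Finset.sum_congr rfl fun k hk => ?_
        have e : i (dp R k.1 m) * i (dp R k.2 m) = n.choose k.1 • i (dp R n m) := by
          rw [← map_mul, dp_mul, map_nsmul, mem_antidiagonal.1 hk]
        rw [coeff_mk, coeff_mk, mul_mul_mul_comm, e, smul_mul_assoc, mul_smul_comm] }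
    (by
      intro r c m
      refine congrArg Additive.ofMul (PowerSeries.ext fun n => ?_)
      rw [coeff_mk, coeff_mk, dp_smul, Algebra.smul_def, Algebra.smul_def, map_mul, map_mul, h,
        mul_pow, map_pow, map_pow]
      ring)

variable (i : Gam R M →+* D) (h : ∀ r, algebraMap C D (algebraMap R C r) = i (algebraMap R _ r))

/-- The divided powers of an element of `C ⊗ M`. -/
def dpTensor (n : ℕ) (v : C ⊗[R] M) : D := coeff n (expTensor i h v).toMul

theorem dpTensor_tmul (n : ℕ) (c : C) (m : M) :
    dpTensor i h n (c ⊗ₜ m) = algebraMap C D c ^ n * i (dp R n m) :=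
  coeff_mk n fun n => algebraMap C D c ^ n * i (dp R n m)

theorem dpTensor_add (n : ℕ) (v w : C ⊗[R] M) :
    dpTensor i h n (v + w) = ∑ k ∈ antidiagonal n, dpTensor i h k.1 v * dpTensor i h k.2 w := by
  unfold dpTensor
  rw [map_add]
  exact coeff_mul _ _ _

theorem dpTensor_zero (v : C ⊗[R] M) : dpTensor i h 0 v = 1 := by
  induction v with
  | zero =>
    unfold dpTensor
    rw [map_zero]
    exact coeff_zero_one
  | tmul c m => rw [dpTensor_tmul, dp_zero, pow_zero, map_one, one_mul]
  | add v w hv hw => simp [dpTensor_add, hv, hw]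

theorem dpTensor_smul (n : ℕ) (c : C) (v : C ⊗[R] M) :
    dpTensor i h n (c • v) = c ^ n • dpTensor i h n v := by
  induction v generalizing n with
  | zero =>
    unfold dpTensor
    rw [smul_zero, map_zero]
    change coeff n 1 = c ^ n • coeff n 1
    rw [coeff_one]
    split_ifs with hn <;> simp [hn]
  | tmul c' m =>
    rw [TensorProduct.smul_tmul', dpTensor_tmul, dpTensor_tmul, smul_eq_mul, map_mul, mul_pow,
      Algebra.smul_def, map_pow, mul_assoc]
  | add v w hv hw =>
    rw [smul_add, dpTensor_add, dpTensor_add, Finset.smul_sum]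
    refine Finset.sum_congr rfl fun k hk => ?_
    rw [hv, hw, smul_mul_smul_comm, ← pow_add, mem_antidiagonal.1 hk]

theorem isDP_expTensor (v : C ⊗[R] M) : IsDP (expTensor i h v).toMul := by
  induction v with
  | zero => exact (congrArg (fun w => IsDP w.toMul) (expTensor i h).map_zero).mpr isDP_one
  | tmul c m =>
    intro n k
    change dpTensor i h n (c ⊗ₜ m) * dpTensor i h k (c ⊗ₜ m) =
      _ • dpTensor i h (n + k) (c ⊗ₜ m)
    rw [dpTensor_tmul, dpTensor_tmul, dpTensor_tmul, mul_mul_mul_comm, ← pow_add, ← map_mul,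
      dp_mul, map_nsmul, mul_smul_comm]
  | add v w hv hw =>
    exact (congrArg (fun w => IsDP w.toMul) ((expTensor i h).map_add v w)).mpr (hv.mul hw)

theorem dpTensor_sum {ι : Type*} [Fintype ι] [DecidableEq ι] (n : ℕ) (c : ι → C) (m : ι → M) :
    dpTensor i h n (∑ j, c j ⊗ₜ[R] m j) = ∑ a ∈ Finset.piAntidiag Finset.univ n,
      ∏ j, (algebraMap C D (c j) ^ a j * i (dp R (a j) (m j))) := by
  have e : (expTensor i h (∑ j, c j ⊗ₜ[R] m j)).toMul = ∏ j, (expTensor i h (c j ⊗ₜ[R] m j)).toMul := by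
    rw [map_sum, toMul_sum]
  refine (congrArg (coeff n) e).trans ?_
  rw [coeff_prod]
  refine Finset.sum_nbij' (fun l => ⇑l) (fun a => Finsupp.equivFunOnFinite.symm a) ?_ ?_ ?_ ?_ ?_
  · intro l hl
    simpa using hl
  · intro a ha
    simpa using ha
  · intro l _
    exact Finsupp.equivFunOnFinite.symm_apply_apply l
  · intro a _
    rfl
  · intro l _
    exact Finset.prod_congr rfl fun j _ => dpTensor_tmul i h _ _ _

/-- The homomorphism `Γ_C(C ⊗ M) ⟶ D`. -/
def gamTensor : Gam C (C ⊗[R] M) →ₐ[C] D :=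
  DividedPowerAlgebra.lift' (R := C) (M := C ⊗[R] M) (A := D)
    (f := fun nv => dpTensor i h nv.1 nv.2) (dpTensor_zero i h)
    (fun n c v => dpTensor_smul i h n c v) (fun n k v => isDP_expTensor i h v n k)
    (fun n v w => dpTensor_add i h n v w)

theorem gamTensor_dp (n : ℕ) (v : C ⊗[R] M) :
    gamTensor i h (dp C n v) = dpTensor i h n v :=
  DividedPowerAlgebra.lift'_apply_dp _ _ _ _ _ _

end DividedPower

section Grading

open Finset.HasAntidiagonal (antidiagonal mem_antidiagonal)

variable {R M : Type u} [CommRing R] [AddCommGroup M] [Module R M]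

/-- The homomorphism `Γ(M) ⟶ Γ(M)[T]`, `γ^n(m) ↦ γ^n(m) T^n`, which defines the grading. -/
def gamGrade : Gam R M →ₐ[R] Polynomial (Gam R M) :=
  DividedPowerAlgebra.lift' (R := R) (M := M) (A := Polynomial (Gam R M))
    (f := fun nm => Polynomial.monomial nm.1 (dp R nm.1 nm.2))
    (fun m => by
      change Polynomial.monomial 0 (dp R 0 m) = 1
      rw [dp_zero]
      rfl)
    (fun n r m => by
      change Polynomial.monomial n (dp R n (r • m)) = r ^ n • Polynomial.monomial n (dp R n m)
      rw [dp_smul, Polynomial.smul_monomial])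
    (fun n k m => by
      change Polynomial.monomial n (dp R n m) * Polynomial.monomial k (dp R k m) =
        _ • Polynomial.monomial (n + k) (dp R (n + k) m)
      rw [Polynomial.monomial_mul_monomial, dp_mul, Polynomial.smul_monomial])
    (fun n v w => by
      change Polynomial.monomial n (dp R n (v + w)) = ∑ k ∈ antidiagonal n,
        Polynomial.monomial k.1 (dp R k.1 v) * Polynomial.monomial k.2 (dp R k.2 w)
      rw [dp_add, map_sum]
      refine Finset.sum_congr rfl fun k hk => ?_
      rw [Polynomial.monomial_mul_monomial, mem_antidiagonal.1 hk])

theorem gamGrade_dp (n : ℕ) (m : M) :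
    gamGrade (dp R n m) = Polynomial.monomial n (dp R n m) :=
  DividedPowerAlgebra.lift'_apply_dp _ _ _ _ _ _

/-- The projection of `Γ(M)` to the part of degree `d`. -/
def gamCoeff (d : ℕ) : Gam R M →ₗ[R] Gam R M :=
  ((Polynomial.lcoeff (Gam R M) d).restrictScalars R) ∘ₗ gamGrade.toLinearMap

theorem gamCoeff_prod {ι : Type*} (s : Finset ι) (d : ℕ) (a : ι → ℕ) (m : ι → M) :
    gamCoeff d (∏ i ∈ s, dp R (a i) (m i)) =
      if ∑ i ∈ s, a i = d then ∏ i ∈ s, dp R (a i) (m i) else 0 := by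
  classical
  have h : gamGrade (∏ i ∈ s, dp R (a i) (m i)) =
      Polynomial.monomial (∑ i ∈ s, a i) (∏ i ∈ s, dp R (a i) (m i)) := by
    rw [map_prod]
    induction s using Finset.induction with
    | empty => rfl
    | insert j s hj ih =>
      rw [Finset.prod_insert hj, Finset.prod_insert hj, Finset.sum_insert hj, ih, gamGrade_dp,
        Polynomial.monomial_mul_monomial]
  refine (congrArg (fun p => Polynomial.coeff p d) h).trans ?_
  rw [Polynomial.coeff_monomial]

theorem prod_dp_mem {ι : Type*} (s : Finset ι) {d : ℕ} (a : ι → ℕ) (m : ι → M)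
    (h : ∑ i ∈ s, a i = d) : ∏ i ∈ s, dp R (a i) (m i) ∈ gammaPart R d M := by
  refine Submodule.subset_span ⟨s.card, fun i => a (s.equivFin.symm i),
    fun i => m (s.equivFin.symm i), ?_, ?_⟩
  · rw [← h, ← Finset.sum_coe_sort s, ← s.equivFin.symm.sum_comp]
  · rw [← Finset.prod_coe_sort s, ← s.equivFin.symm.prod_comp]

theorem gamCoeff_eq_self {d : ℕ} {x : Gam R M} (hx : x ∈ gammaPart R d M) : gamCoeff d x = x := by
  induction hx using Submodule.span_induction with
  | mem x hx =>
    obtain ⟨k, a, m, h, rfl⟩ := hx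
    rw [gamCoeff_prod, if_pos h]
  | zero => exact map_zero _
  | add x y _ _ hx hy => rw [map_add, hx, hy]
  | smul r x _ hx => rw [map_smul, hx]

/-- The part of degree `d` is spanned by the products of divided powers of elements of a
generating set. -/
theorem gammaPart_le_span {ι : Type u} {v : ι → M} (hv : Submodule.span R (Set.range v) = ⊤)
    (d : ℕ) : gammaPart R d M ≤ Submodule.span R {x | ∃ (k : ℕ) (a : Fin k → ℕ) (j : Fin k → ι),
      ∑ i, a i = d ∧ x = ∏ i, dp R (a i) (v (j i))} := by
  have key (x : Gam R M) : gamCoeff d x ∈ Submodule.span R {x | ∃ (k : ℕ) (a : Fin k → ℕ)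
      (j : Fin k → ι), ∑ i, a i = d ∧ x = ∏ i, dp R (a i) (v (j i))} := by
    have h : x ∈ Submodule.span R (Set.range fun n : ι →₀ ℕ => ∏ i ∈ n.support, dp R (n i) (v i)) := by
      have := DividedPowerAlgebra.submodule_span_prod_dp_eq_top hv
      exact (Submodule.ext_iff.1 this x).2 trivial
    induction h using Submodule.span_induction with
    | mem x hx =>
      obtain ⟨n, rfl⟩ := hx
      have := gamCoeff_prod (R := R) n.support d n v
      refine (congrArg (· ∈ _) this).mpr ?_
      split_ifs with hd
      · refine Submodule.subset_span ⟨n.support.card, fun i => n (n.support.equivFin.symm i),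
          fun i => n.support.equivFin.symm i, ?_, ?_⟩
        · rw [← hd, ← Finset.sum_coe_sort n.support, ← n.support.equivFin.symm.sum_comp]
        · rw [← Finset.prod_coe_sort n.support, ← n.support.equivFin.symm.prod_comp]
      · exact zero_mem _
    | zero => rw [map_zero]; exact zero_mem _
    | add x y _ _ hx hy => rw [map_add]; exact add_mem hx hy
    | smul r x _ hx => rw [map_smul]; exact Submodule.smul_mem _ _ hx
  intro x hx
  rw [← gamCoeff_eq_self hx]
  exact key x

theorem gamCoeff_mem (d : ℕ) (x : Gam R M) : gamCoeff d x ∈ gammaPart R d M := by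
  have h : x ∈ Submodule.span R (Set.range fun n : M →₀ ℕ => ∏ m ∈ n.support, dp R (n m) m) := by
    have := DividedPowerAlgebra.submodule_span_prod_dp_eq_top (R := R) (v := fun m : M => m)
      (Set.range_id (α := M) ▸ Submodule.span_univ)
    exact (Submodule.ext_iff.1 this x).2 trivial
  induction h using Submodule.span_induction with
  | mem x hx =>
    obtain ⟨n, rfl⟩ := hx
    have := gamCoeff_prod (R := R) n.support d n (fun m => m)
    refine (congrArg (· ∈ _) this).mpr ?_
    split_ifs with hd
    · exact prod_dp_mem _ _ _ hd
    · exact zero_mem _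
  | zero => rw [map_zero]; exact zero_mem _
  | add x y _ _ hx hy => rw [map_add]; exact add_mem hx hy
  | smul r x _ hx => rw [map_smul]; exact Submodule.smul_mem _ _ hx

end Grading

/-! ### The action of the divided powers of an algebra on those of a module -/

section Action

attribute [local instance] MvPolynomial.algebraMvPolynomial

variable {R M N : Type u} [CommRing R] [AddCommGroup M] [Module R M] [AddCommGroup N] [Module R N]

/-- The divided powers of `X_1 ⊗ m_1 + ⋯ + X_l ⊗ m_l` in the polynomial ring over `Γ(M)`. -/
def dpPoly (R : Type u) {M : Type u} [CommRing R] [AddCommGroup M] [Module R M] {l : ℕ} (n : ℕ)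
    (m : Fin l → M) : MvPolynomial (Fin l) (Gam R M) :=
  dpTensor (C := MvPolynomial (Fin l) R) (MvPolynomial.C : Gam R M →+* _)
    (fun r => by simp) n
    (∑ j, (MvPolynomial.X j : MvPolynomial (Fin l) R) ⊗ₜ[R] m j)

theorem dpPoly_eq {l : ℕ} (n : ℕ) (m : Fin l → M) :
    dpPoly R n m = ∑ a ∈ Finset.piAntidiag Finset.univ n,
      MvPolynomial.monomial (Finsupp.equivFunOnFinite.symm a) (∏ j, dp R (a j) (m j)) := by
  unfold dpPoly
  rw [dpTensor_sum]
  refine Finset.sum_congr rfl fun a _ => ?_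
  rw [MvPolynomial.monomial_eq, Finset.prod_mul_distrib, mul_comm, map_prod]
  congr 1
  rw [Finsupp.prod_fintype _ _ (fun _ => pow_zero _)]
  refine Finset.prod_congr rfl fun j _ => ?_
  simp

theorem coeff_dpPoly {l : ℕ} (m : Fin l → M) (a : Fin l → ℕ) {n : ℕ} (h : ∑ i, a i = n) :
    (dpPoly R n m).coeff (Finsupp.equivFunOnFinite.symm a) = ∏ j, dp R (a j) (m j) := by
  rw [dpPoly_eq, MvPolynomial.coeff_sum, Finset.sum_eq_single a]
  · rw [MvPolynomial.coeff_monomial, if_pos rfl]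
  · intro b _ hb
    rw [MvPolynomial.coeff_monomial, if_neg]
    exact fun e => hb (Finsupp.equivFunOnFinite.symm.injective e)
  · intro ha
    simp [h] at ha

/-- The homomorphism `Γ(N) ⟶ Γ(M)[X_1, …, X_l]` with `γ^n(x) ↦ γ^n(X_1 φ_1(x) + ⋯ + X_l φ_l(x))`. -/
def gamPoly {l : ℕ} (φ : Fin l → N →ₗ[R] M) : Gam R N →ₐ[R] MvPolynomial (Fin l) (Gam R M) :=
  DividedPowerAlgebra.lift' (R := R) (M := N) (A := MvPolynomial (Fin l) (Gam R M))
    (f := fun nx => dpPoly R nx.1 fun j => φ j nx.2)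
    (fun x => dpTensor_zero _ _ _)
    (fun n r x => by
      change dpPoly R n (fun j => φ j (r • x)) = r ^ n • dpPoly R n fun j => φ j x
      unfold dpPoly
      have e : ∑ j, (MvPolynomial.X j : MvPolynomial (Fin l) R) ⊗ₜ[R] φ j (r • x) =
          (MvPolynomial.C r : MvPolynomial (Fin l) R) •
            ∑ j, (MvPolynomial.X j : MvPolynomial (Fin l) R) ⊗ₜ[R] φ j x := by
        rw [Finset.smul_sum]
        refine Finset.sum_congr rfl fun j _ => ?_
        rw [map_smul, TensorProduct.tmul_smul, TensorProduct.smul_tmul', TensorProduct.smul_tmul',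
          MvPolynomial.smul_eq_C_mul, smul_eq_mul]
      rw [e, dpTensor_smul, ← map_pow]
      exact algebraMap_smul _ _ _)
    (fun n k x => isDP_expTensor _ _ _ n k)
    (fun n x y => by
      change dpPoly R n (fun j => φ j (x + y)) = _
      unfold dpPoly
      have e : ∑ j, (MvPolynomial.X j : MvPolynomial (Fin l) R) ⊗ₜ[R] φ j (x + y) =
          ∑ j, (MvPolynomial.X j : MvPolynomial (Fin l) R) ⊗ₜ[R] φ j x +
            ∑ j, (MvPolynomial.X j : MvPolynomial (Fin l) R) ⊗ₜ[R] φ j y := by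
        simp_rw [map_add, TensorProduct.tmul_add, Finset.sum_add_distrib]
      rw [e]
      exact dpTensor_add _ _ n _ _)

theorem gamPoly_dp {l : ℕ} (φ : Fin l → N →ₗ[R] M) (n : ℕ) (x : N) :
    gamPoly φ (dp R n x) = dpPoly R n fun j => φ j x :=
  DividedPowerAlgebra.lift'_apply_dp _ _ _ _ _ _

/-- Expanding the product of the generating polynomials gives a sum over matrices of exponents with
prescribed row sums `a` and column sums `b`, as in the definition of `gammaMul`. -/
theorem coeff_gamPoly {k l : ℕ} (φ : Fin l → N →ₗ[R] M) {d : ℕ} (a : Fin k → ℕ) (x : Fin k → N)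
    (b : Fin l → ℕ) (ha : ∑ i, a i = d) :
    (gamPoly φ (∏ i, dp R (a i) (x i))).coeff (Finsupp.equivFunOnFinite.symm b) =
      ∑ c : Fin k → Fin l → Fin (d + 1) with
        (∀ i, ∑ j, (c i j : ℕ) = a i) ∧ ∀ j, ∑ i, (c i j : ℕ) = b j,
        ∏ i, ∏ j, dp R (c i j : ℕ) (φ j (x i)) := by
  classical
  have e : gamPoly φ (∏ i, dp R (a i) (x i)) =
      ∑ c ∈ Fintype.piFinset fun i => Finset.piAntidiag (Finset.univ : Finset (Fin l)) (a i),
        MvPolynomial.monomial (∑ i, Finsupp.equivFunOnFinite.symm (c i))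
          (∏ i, ∏ j, dp R (c i j) (φ j (x i))) := by
    rw [map_prod]
    simp_rw [gamPoly_dp, dpPoly_eq]
    rw [Finset.prod_univ_sum]
    exact Finset.sum_congr rfl fun c _ => (MvPolynomial.monomial_sum_prod _ _ _).symm
  rw [e, MvPolynomial.coeff_sum]
  simp_rw [MvPolynomial.coeff_monomial]
  rw [← Finset.sum_filter]
  symm
  refine Finset.sum_nbij (fun c i j => (c i j : ℕ)) ?_ ?_ ?_ ?_
  · intro c hc
    simp only [Finset.mem_filter, Finset.mem_univ, true_and] at hc
    simp only [Finset.mem_filter, Fintype.mem_piFinset, Finset.mem_piAntidiag, Finset.mem_univ]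
    refine ⟨fun i => ⟨hc.1 i, fun _ _ => trivial⟩, ?_⟩
    ext j
    simpa using hc.2 j
  · intro c _ c' _ h
    ext i j
    exact congrFun (congrFun h i) j
  · intro c hc
    simp only [Finset.coe_filter, Set.mem_ofPred_eq, Fintype.mem_piFinset, Finset.mem_piAntidiag,
      Finset.mem_univ] at hc
    have hlt (i j) : c i j < d + 1 := by
      have h1 : c i j ≤ a i := by
        rw [← (hc.1 i).1]
        exact Finset.single_le_sum (fun _ _ => Nat.zero_le _) (Finset.mem_univ j)
      have h2 : a i ≤ d := by
        rw [← ha]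
        exact Finset.single_le_sum (fun _ _ => Nat.zero_le _) (Finset.mem_univ i)
      omega
    refine ⟨fun i j => ⟨c i j, hlt i j⟩, ?_, rfl⟩
    simp only [Finset.coe_filter, Set.mem_ofPred_eq, Finset.mem_univ, true_and]
    refine ⟨fun i => (hc.1 i).1, fun j => ?_⟩
    simpa using DFunLike.congr_fun hc.2 j
  · intro c _
    rfl

variable {A : Type u} [CommRing A] [Algebra R A] [Module A M] [IsScalarTower R A M]

theorem gammaMul_eq_left {k l d : ℕ} (a : Fin k → ℕ) (r : Fin k → A) (b : Fin l → ℕ)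
    (m : Fin l → M) (ha : ∑ i, a i = d) :
    gammaMul R d a r b m = (gamPoly (fun j => (LinearMap.toSpanSingleton A M (m j)).restrictScalars R)
      (∏ i, dp R (a i) (r i))).coeff (Finsupp.equivFunOnFinite.symm b) := by
  rw [coeff_gamPoly _ a r b ha]
  simp only [LinearMap.restrictScalars_apply, LinearMap.toSpanSingleton_apply]
  rfl

theorem gammaMul_eq_right {k l d : ℕ} (a : Fin k → ℕ) (r : Fin k → A) (b : Fin l → ℕ)
    (m : Fin l → M) (hb : ∑ i, b i = d) :
    gammaMul R d a r b m = (gamPoly (fun i => Algebra.lsmul R R M (r i))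
      (∏ j, dp R (b j) (m j))).coeff (Finsupp.equivFunOnFinite.symm a) := by
  rw [coeff_gamPoly _ b m a hb]
  unfold gammaMul
  refine Finset.sum_nbij' (fun c j i => c i j) (fun c i j => c j i) ?_ ?_ ?_ ?_ ?_
  · intro c hc
    simp only [Finset.mem_filter, Finset.mem_univ, true_and] at hc ⊢
    exact hc.symm
  · intro c hc
    simp only [Finset.mem_filter, Finset.mem_univ, true_and] at hc ⊢
    exact hc.symm
  · exact fun _ _ => rfl
  · exact fun _ _ => rfl
  · exact fun c _ => Finset.prod_comm

/-- The coefficient of `X^a` in `∏_t (∑_i s_{it} X_i)^{e_t}`. -/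
def substCoeff {k n : ℕ} (s : Fin k → Fin n → R) (a : Fin k → ℕ) (e : Fin n → ℕ) : R :=
  (∏ t, (∑ i, MvPolynomial.C (s i t) * MvPolynomial.X i : MvPolynomial (Fin k) R) ^ e t).coeff
    (Finsupp.equivFunOnFinite.symm a)

theorem prod_dp_sum {k n d : ℕ} (s : Fin k → Fin n → R) (y : Fin n → M) (a : Fin k → ℕ)
    (ha : ∑ i, a i = d) :
    ∏ i, dp R (a i) (∑ t, s i t • y t) = ∑ e ∈ Finset.piAntidiag Finset.univ d,
      substCoeff s a e • ∏ t, dp R (e t) (y t) := by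
  rw [← coeff_dpPoly _ a ha]
  unfold dpPoly
  have e : ∑ i, (MvPolynomial.X i : MvPolynomial (Fin k) R) ⊗ₜ[R] (∑ t, s i t • y t) =
      ∑ t, (∑ i, MvPolynomial.C (s i t) * MvPolynomial.X i : MvPolynomial (Fin k) R) ⊗ₜ[R] y t := by
    simp_rw [TensorProduct.tmul_sum, TensorProduct.sum_tmul]
    rw [Finset.sum_comm]
    refine Finset.sum_congr rfl fun t _ => Finset.sum_congr rfl fun i _ => ?_
    rw [TensorProduct.tmul_smul, TensorProduct.smul_tmul', MvPolynomial.smul_eq_C_mul]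
  rw [e, dpTensor_sum, MvPolynomial.coeff_sum]
  refine Finset.sum_congr rfl fun e _ => ?_
  rw [Finset.prod_mul_distrib, ← map_prod, mul_comm, MvPolynomial.coeff_C_mul, mul_comm]
  simp_rw [← map_pow]
  rw [← map_prod]
  change (MvPolynomial.map (algebraMap R (Gam R M)) _).coeff _ * _ = _
  rw [MvPolynomial.coeff_map, Algebra.smul_def]
  rfl

/-- Substitution of linear forms into a polynomial `Q`: as `substCoeff s a e` vanishes for `∑ e ≠ ∑
a`, only the homogeneous part of `Q` of degree `∑ a` contributes. -/
theorem coeff_aeval_subst {k n d : ℕ} (s : Fin k → Fin n → R) (a : Fin k → ℕ)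
    (ha : ∑ i, a i = d) (Q : MvPolynomial (Fin n) R) :
    (MvPolynomial.aeval (fun t => (∑ i, MvPolynomial.C (s i t) * MvPolynomial.X i :
      MvPolynomial (Fin k) R)) Q).coeff (Finsupp.equivFunOnFinite.symm a) =
      ∑ e ∈ Finset.piAntidiag Finset.univ d,
        substCoeff s a e * Q.coeff (Finsupp.equivFunOnFinite.symm e) := by
  classical
  let F : (Fin n →₀ ℕ) → R := fun e => substCoeff s a e * Q.coeff e
  have h0 (e : Fin n →₀ ℕ) (he : ∑ t, e t ≠ d) : substCoeff s a e = 0 := by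
    by_contra h
    have h1 : (∏ t, (∑ i, MvPolynomial.C (s i t) * MvPolynomial.X i :
        MvPolynomial (Fin k) R) ^ e t).IsHomogeneous (∑ t, e t) := by
      refine MvPolynomial.IsHomogeneous.prod _ _ _ fun t _ => ?_
      have := (MvPolynomial.IsHomogeneous.sum Finset.univ
        (fun i => (MvPolynomial.C (s i t) * MvPolynomial.X i : MvPolynomial (Fin k) R)) 1
        fun i _ => by
          simpa using (MvPolynomial.isHomogeneous_C (Fin k) (s i t)).mul
            (MvPolynomial.isHomogeneous_X R i)).pow (e t)
      simpa using this
    have h2 := h1 h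
    rw [← ha] at he
    refine he ?_
    rw [← h2, Finsupp.weight_apply, Finsupp.sum_fintype _ _ (fun _ => by simp)]
    simp
  have h1 : ∑ e ∈ Finset.piAntidiag Finset.univ d, F (Finsupp.equivFunOnFinite.symm e) =
      ∑ e ∈ (Finset.piAntidiag Finset.univ d).map Finsupp.equivFunOnFinite.symm.toEmbedding, F e :=
    (Finset.sum_map _ Finsupp.equivFunOnFinite.symm.toEmbedding F).symm
  have h2 : (MvPolynomial.aeval (fun t => (∑ i, MvPolynomial.C (s i t) * MvPolynomial.X i :
      MvPolynomial (Fin k) R)) Q).coeff (Finsupp.equivFunOnFinite.symm a) = ∑ e ∈ Q.support, F e := by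
    rw [MvPolynomial.aeval_def, MvPolynomial.eval₂_eq', MvPolynomial.coeff_sum]
    refine Finset.sum_congr rfl fun e _ => ?_
    rw [MvPolynomial.algebraMap_eq, MvPolynomial.coeff_C_mul, mul_comm]
    rfl
  refine h2.trans (Eq.trans ?_ h1.symm)
  rw [Finset.sum_subset (Finset.subset_union_left (s₂ :=
    (Finset.piAntidiag Finset.univ d).map Finsupp.equivFunOnFinite.symm.toEmbedding))]
  · symm
    refine Finset.sum_subset Finset.subset_union_right fun e _ he => ?_
    change _ * _ = _
    rw [h0 e, zero_mul]
    intro h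
    refine he (Finset.mem_map.2 ⟨e, ?_, Finsupp.equivFunOnFinite.symm_apply_apply e⟩)
    simp [h]
  · intro e _ he
    change _ * _ = _
    rw [MvPolynomial.notMem_support_iff.1 he, mul_zero]

end Action

/-! ### Norms of finite projective algebras -/

section Norm

variable {R : Type u} [CommRing R]

theorem det_one_add_comp_comm {n m : ℕ} (f : (Fin n → R) →ₗ[R] (Fin m → R))
    (g : (Fin m → R) →ₗ[R] (Fin n → R)) :
    LinearMap.det (LinearMap.id + g ∘ₗ f) = LinearMap.det (LinearMap.id + f ∘ₗ g) := by
  rw [← LinearMap.det_toMatrix', ← LinearMap.det_toMatrix', map_add, map_add,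
    LinearMap.toMatrix'_comp, LinearMap.toMatrix'_comp, LinearMap.toMatrix'_id,
    LinearMap.toMatrix'_id, Matrix.det_one_add_mul_comm]

/-- The determinant of an endomorphism of a finitely generated projective module may be computed
with any complement: if `q s = 1` then `s φ q + (1 - s q) = 1 + s (φ - 1) q`, and
`det (1 + x y) = det (1 + y x)`. -/
theorem projDet_eq {P : Type u} [AddCommGroup P] [Module R P] (φ : P →ₗ[R] P) {n : ℕ}
    (s : P →ₗ[R] (Fin n → R)) (q : (Fin n → R) →ₗ[R] P) (h : q ∘ₗ s = LinearMap.id) :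
    projDet φ = LinearMap.det (s ∘ₗ φ ∘ₗ q + (LinearMap.id - s ∘ₗ q)) := by
  have hex : ∃ (n : ℕ) (s : P →ₗ[R] (Fin n → R)) (q : (Fin n → R) →ₗ[R] P),
    q ∘ₗ s = LinearMap.id := ⟨n, s, q, h⟩
  have key {n' : ℕ} (s' : P →ₗ[R] (Fin n' → R)) (q' : (Fin n' → R) →ₗ[R] P)
      (h' : q' ∘ₗ s' = LinearMap.id) :
      LinearMap.det (s' ∘ₗ φ ∘ₗ q' + (LinearMap.id - s' ∘ₗ q')) =
        LinearMap.det (s ∘ₗ φ ∘ₗ q + (LinearMap.id - s ∘ₗ q)) := by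
    have hx (x : P) : q (s x) = x := LinearMap.congr_fun h x
    have hx' (x : P) : q' (s' x) = x := LinearMap.congr_fun h' x
    have e1 : s' ∘ₗ φ ∘ₗ q' + (LinearMap.id - s' ∘ₗ q') =
        LinearMap.id + (s' ∘ₗ q) ∘ₗ (s ∘ₗ (φ - LinearMap.id) ∘ₗ q') := by
      refine LinearMap.ext fun x => ?_
      simp only [LinearMap.add_apply, LinearMap.comp_apply, LinearMap.sub_apply,
        LinearMap.id_apply, hx, map_sub]
      abel
    have e2 : s ∘ₗ φ ∘ₗ q + (LinearMap.id - s ∘ₗ q) =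
        LinearMap.id + (s ∘ₗ (φ - LinearMap.id) ∘ₗ q') ∘ₗ (s' ∘ₗ q) := by
      refine LinearMap.ext fun x => ?_
      simp only [LinearMap.add_apply, LinearMap.comp_apply, LinearMap.sub_apply,
        LinearMap.id_apply, hx', map_sub]
      abel
    rw [e1, e2, det_one_add_comp_comm]
  unfold projDet
  rw [dif_pos hex]
  exact key _ _ hex.choose_spec.choose_spec.choose_spec

variable {A : Type u} [CommRing A] [Algebra R A]

/-- The norm of `∑ p_t ⊗ r_t ∈ C ⊗ A` for finitely generated projective `A` is a determinant whose
entries are linear in the `p_t`. -/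
theorem projNorm_sum {n : ℕ} (s : A →ₗ[R] (Fin n → R)) (q : (Fin n → R) →ₗ[R] A)
    (h : q ∘ₗ s = LinearMap.id) (C : Type u) [CommRing C] [Algebra R C] {k : ℕ} (p : Fin k → C)
    (r : Fin k → A) :
    projNorm C (∑ t, p t ⊗ₜ[R] r t) = Matrix.det (Matrix.of fun i j =>
      ∑ t, p t * algebraMap R C (s (r t * q (Pi.single j 1)) i) +
        algebraMap R C ((1 : Matrix (Fin n) (Fin n) R) i j - s (q (Pi.single j 1)) i)) := by
  let e : C ⊗[R] (Fin n → R) ≃ₗ[C] (Fin n → C) := TensorProduct.piScalarRight R C C (Fin n)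
  have he (c : C) (x : Fin n → R) (i : Fin n) : e (c ⊗ₜ x) i = c * algebraMap R C (x i) := by
    rw [mul_comm, ← Algebra.smul_def]
    rfl
  have hs (j : Fin n) : e.symm (Pi.single j 1) = 1 ⊗ₜ Pi.single j 1 := by
    rw [LinearEquiv.symm_apply_eq]
    ext i
    rw [he, one_mul, Pi.single_apply, Pi.single_apply]
    split_ifs <;> simp
  have hC : (q.baseChange C ∘ₗ e.symm.toLinearMap) ∘ₗ (e.toLinearMap ∘ₗ s.baseChange C) =
      LinearMap.id := by
    refine LinearMap.ext fun x => ?_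
    simp only [LinearMap.comp_apply, LinearEquiv.coe_coe, LinearEquiv.symm_apply_apply]
    rw [← LinearMap.comp_apply, ← LinearMap.baseChange_comp, h, LinearMap.baseChange_id]
  unfold projNorm
  rw [projDet_eq _ _ _ hC, ← LinearMap.det_toMatrix']
  congr 1
  ext i j
  rw [LinearMap.toMatrix'_apply]
  simp only [LinearMap.add_apply, LinearMap.sub_apply,
    LinearMap.comp_apply, LinearEquiv.coe_coe, hs, LinearMap.id_apply, LinearMap.baseChange_tmul,
    LinearMap.mulLeft_apply, Finset.sum_mul, Algebra.TensorProduct.tmul_mul_tmul, mul_one, map_sum,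
    Pi.add_apply, Pi.sub_apply, Finset.sum_apply, he, one_mul, Matrix.of_apply, map_sub]
  congr 2
  rw [Pi.single_apply, Matrix.one_apply]
  split_ifs <;> simp

/-- The coefficients of the norm transform under linear substitutions like products of divided
powers do, see `prod_dp_sum`. -/
theorem normCoeff_sum {n m : ℕ} (s : A →ₗ[R] (Fin n → R)) (q : (Fin n → R) →ₗ[R] A)
    (h : q ∘ₗ s = LinearMap.id) {k d : ℕ} (c : Fin k → Fin m → R) (y : Fin m → A) (a : Fin k → ℕ)
    (ha : ∑ i, a i = d) :
    normCoeff R a (fun i => ∑ t, c i t • y t) = ∑ e ∈ Finset.piAntidiag Finset.univ d,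
      substCoeff c a e * normCoeff R e y := by
  have e : ∑ i, (MvPolynomial.X i : MvPolynomial (Fin k) R) ⊗ₜ[R] (∑ t, c i t • y t) =
      ∑ t, (∑ i, MvPolynomial.C (c i t) * MvPolynomial.X i : MvPolynomial (Fin k) R) ⊗ₜ[R] y t := by
    simp_rw [TensorProduct.tmul_sum, TensorProduct.sum_tmul]
    rw [Finset.sum_comm]
    refine Finset.sum_congr rfl fun t _ => Finset.sum_congr rfl fun i _ => ?_
    rw [TensorProduct.tmul_smul, TensorProduct.smul_tmul', MvPolynomial.smul_eq_C_mul]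
  have h1 : projNorm (MvPolynomial (Fin k) R)
      (∑ t, (∑ i, MvPolynomial.C (c i t) * MvPolynomial.X i : MvPolynomial (Fin k) R) ⊗ₜ[R] y t) =
      MvPolynomial.aeval (fun t => (∑ i, MvPolynomial.C (c i t) * MvPolynomial.X i :
        MvPolynomial (Fin k) R)) (projNorm (MvPolynomial (Fin m) R)
          (∑ t, (MvPolynomial.X t : MvPolynomial (Fin m) R) ⊗ₜ[R] y t)) := by
    rw [projNorm_sum s q h, projNorm_sum s q h, AlgHom.map_det]
    congr 1
    ext1 i j
    simp only [Matrix.of_apply, AlgHom.mapMatrix_apply, Matrix.map_apply, map_add, map_sum, map_mul,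
      MvPolynomial.aeval_X, AlgHom.commutes]
  unfold normCoeff
  rw [e, h1, coeff_aeval_subst c a ha]

variable {S : Type u} [CommRing S] [Algebra R S] {B : Type u} [CommRing B] [Algebra S B]

/-- Norms commute with base change, as they are determinants of the same matrices. -/
theorem normCoeff_map {n : ℕ} (s : A →ₗ[R] (Fin n → R)) (q : (Fin n → R) →ₗ[R] A)
    (h : q ∘ₗ s = LinearMap.id) (s' : B →ₗ[S] (Fin n → S)) (q' : (Fin n → S) →ₗ[S] B)
    (h' : q' ∘ₗ s' = LinearMap.id) (g : A →+* B)
    (hs : ∀ x i, s' (g x) i = algebraMap R S (s x i))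
    (hq : ∀ j, q' (Pi.single j 1) = g (q (Pi.single j 1))) {k : ℕ} (a : Fin k → ℕ)
    (r : Fin k → A) :
    normCoeff S a (fun i => g (r i)) = algebraMap R S (normCoeff R a r) := by
  have e1 (t j i) : s' (g (r t) * q' (Pi.single j 1)) i =
      algebraMap R S (s (r t * q (Pi.single j 1)) i) := by rw [hq, ← map_mul, hs]
  have e2 (j i) : s' (q' (Pi.single j 1)) i = algebraMap R S (s (q (Pi.single j 1)) i) := by
    rw [hq, hs]
  unfold normCoeff
  rw [projNorm_sum s q h, projNorm_sum s' q' h', ← MvPolynomial.coeff_map, RingHom.map_det]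
  congr 2
  ext1 i j
  simp only [Matrix.of_apply, RingHom.mapMatrix_apply, Matrix.map_apply, map_add, map_sum, map_mul,
    MvPolynomial.map_X, MvPolynomial.algebraMap_eq, MvPolynomial.map_C, e1, e2, map_sub]
  congr 3
  rw [Matrix.one_apply, Matrix.one_apply]
  split_ifs <;> simp

/-- A retraction from a free module onto an algebra, after base change. -/
theorem exists_retraction_baseChange {n : ℕ} (s : A →ₗ[R] (Fin n → R)) (q : (Fin n → R) →ₗ[R] A)
    (h : q ∘ₗ s = LinearMap.id) [Module R B] [IsScalarTower R S B] (g : A →ₗ[R] B)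
    (hg : IsBaseChange S g) :
    ∃ (s' : B →ₗ[S] (Fin n → S)) (q' : (Fin n → S) →ₗ[S] B), q' ∘ₗ s' = LinearMap.id ∧
      (∀ x i, s' (g x) i = algebraMap R S (s x i)) ∧
        ∀ j, q' (Pi.single j 1) = g (q (Pi.single j 1)) := by
  let e : S ⊗[R] (Fin n → R) ≃ₗ[S] (Fin n → S) := TensorProduct.piScalarRight R S S (Fin n)
  have he (c : S) (x : Fin n → R) (i : Fin n) : e (c ⊗ₜ x) i = c * algebraMap R S (x i) := by
    rw [mul_comm, ← Algebra.smul_def]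
    rfl
  have hes (j : Fin n) : e.symm (Pi.single j 1) = 1 ⊗ₜ Pi.single j 1 := by
    rw [LinearEquiv.symm_apply_eq]
    ext i
    rw [he, one_mul, Pi.single_apply, Pi.single_apply]
    split_ifs <;> simp
  have hgs (x : A) : hg.equiv.symm (g x) = 1 ⊗ₜ x := by
    rw [LinearEquiv.symm_apply_eq, hg.equiv_tmul, one_smul]
  refine ⟨e.toLinearMap ∘ₗ s.baseChange S ∘ₗ hg.equiv.symm.toLinearMap,
    hg.equiv.toLinearMap ∘ₗ q.baseChange S ∘ₗ e.symm.toLinearMap, ?_, ?_, ?_⟩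
  · refine LinearMap.ext fun x => ?_
    simp only [LinearMap.comp_apply, LinearEquiv.coe_coe, LinearEquiv.symm_apply_apply]
    rw [← LinearMap.comp_apply (q.baseChange S), ← LinearMap.baseChange_comp, h,
      LinearMap.baseChange_id]
    exact hg.equiv.apply_symm_apply x
  · intro x i
    simp only [LinearMap.comp_apply, LinearEquiv.coe_coe, hgs, LinearMap.baseChange_tmul, he,
      one_mul]
  · intro j
    simp only [LinearMap.comp_apply, LinearEquiv.coe_coe, hes, LinearMap.baseChange_tmul,
      hg.equiv_tmul, one_smul]

/-- The relations defining the norm of a module `M` follow from the ones for generators of the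
algebra and of the module. -/
theorem normRel_le {M : Type u} [AddCommGroup M] [Module R M] [Module A M] [IsScalarTower R A M]
    {n : ℕ} (s : A →ₗ[R] (Fin n → R)) (q : (Fin n → R) →ₗ[R] A) (h : q ∘ₗ s = LinearMap.id)
    {ι : Type u} {v : ι → M} (hv : Submodule.span R (Set.range v) = ⊤) {d : ℕ}
    {K : Submodule R (Gam R M)}
    (H : ∀ (a : Fin n → ℕ) (l : ℕ) (b : Fin l → ℕ) (j : Fin l → ι), ∑ i, a i = d → ∑ i, b i = d →
      gammaMul R d a (fun t => q (Pi.single t 1)) b (fun i => v (j i)) -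
        normCoeff R a (fun t => q (Pi.single t 1)) • ∏ i, dp R (b i) (v (j i)) ∈ K) :
    normRel R A d M ≤ K := by
  -- first extend the relations from generators of the module to all elements
  have H1 (a : Fin n → ℕ) (ha : ∑ i, a i = d) (l : ℕ) (b : Fin l → ℕ) (m : Fin l → M)
      (hb : ∑ i, b i = d) : gammaMul R d a (fun t => q (Pi.single t 1)) b m -
        normCoeff R a (fun t => q (Pi.single t 1)) • ∏ i, dp R (b i) (m i) ∈ K := by
    let F : Gam R M →ₗ[R] Gam R M :=
      (MvPolynomial.lcoeff (Gam R M) (Finsupp.equivFunOnFinite.symm a)).restrictScalars R ∘ₗ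
        (gamPoly fun i => Algebra.lsmul R R M (q (Pi.single i 1))).toLinearMap -
        normCoeff R a (fun t => q (Pi.single t 1)) • LinearMap.id
    have hF (l : ℕ) (b : Fin l → ℕ) (m : Fin l → M) (hb : ∑ i, b i = d) :
        F (∏ i, dp R (b i) (m i)) = gammaMul R d a (fun t => q (Pi.single t 1)) b m -
          normCoeff R a (fun t => q (Pi.single t 1)) • ∏ i, dp R (b i) (m i) := by
      rw [gammaMul_eq_right a _ b m hb]
      rfl
    rw [← hF l b m hb]
    have hm : ∏ i, dp R (b i) (m i) ∈ gammaPart R d M := Submodule.subset_span ⟨l, b, m, hb, rfl⟩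
    refine (gammaPart_le_span hv d).trans (Submodule.span_le.2 ?_ : _ ≤ K.comap F) hm
    rintro _ ⟨l, b, j, hb, rfl⟩
    refine Submodule.mem_comap.2 ?_
    rw [hF l b _ hb]
    exact H a l b j ha hb
  refine Submodule.span_le.2 ?_
  rintro _ ⟨k, l, a, r, b, m, ha, hb, rfl⟩
  have hr : r = fun i => ∑ t, s (r i) t • q (Pi.single t 1) := by
    ext i
    conv_lhs => rw [← LinearMap.id_apply (R := R) (r i), ← h, LinearMap.comp_apply,
      LinearMap.pi_apply_eq_sum_univ q (s (r i))]
    refine Finset.sum_congr rfl fun t _ => ?_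
    congr 2
    ext t'
    rw [Pi.single_apply]
    simp [eq_comm]
  let G := (MvPolynomial.lcoeff (Gam R M) (Finsupp.equivFunOnFinite.symm b)).restrictScalars R ∘ₗ
    (gamPoly fun j => (LinearMap.toSpanSingleton A M (m j)).restrictScalars R).toLinearMap
  have e : gammaMul R d a r b m = ∑ e ∈ Finset.piAntidiag Finset.univ d,
      substCoeff (fun i => s (r i)) a e • gammaMul R d e (fun t => q (Pi.single t 1)) b m := by
    rw [gammaMul_eq_left a r b m ha]
    conv_lhs => rw [hr]
    rw [prod_dp_sum (fun i => s (r i)) _ a ha]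
    refine (map_sum G _ _).trans (Finset.sum_congr rfl fun e he => ?_)
    rw [gammaMul_eq_left e _ b m (by simpa using he)]
    exact map_smul G _ _
  have e' : normCoeff R a r = ∑ e ∈ Finset.piAntidiag Finset.univ d,
      substCoeff (fun i => s (r i)) a e * normCoeff R e fun t => q (Pi.single t 1) := by
    conv_lhs => rw [hr]
    exact normCoeff_sum s q h _ _ a ha
  rw [e, e', Finset.sum_smul, ← Finset.sum_sub_distrib]
  refine Submodule.sum_mem _ fun e he => ?_
  rw [mul_smul, ← smul_sub]
  exact Submodule.smul_mem _ _ (H1 e (by simpa using he) l b m hb)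

end Norm

/-! ### Base change of Ferrand's norm -/

section FerrandBaseChange

variable {R S A B : Type u} [CommRing R] [CommRing S] [CommRing A] [CommRing B] [Algebra R S]
variable {M M' : Type u} [AddCommGroup M] [AddCommGroup M'] [Module R M] [Module A M]
  [Module S M'] [Module B M']

theorem Gam.ringHom_ext {D : Type*} [CommRing D] {φ ψ : Gam R M →+* D}
    (h : ∀ r, φ (algebraMap R _ r) = ψ (algebraMap R _ r))
    (h' : ∀ n m, φ (dp R n m) = ψ (dp R n m)) : φ = ψ := by
  refine RingHom.ext fun x => ?_
  refine DividedPowerAlgebra.induction_on (P := fun x : DividedPowerAlgebra R M =>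
    φ (show Gam R M from x) = ψ (show Gam R M from x)) x h ?_ ?_
  · intro f g hf hg
    exact (map_add φ _ _).trans ((congrArg₂ _ hf hg).trans (map_add ψ _ _).symm)
  · intro f n m hf
    exact (map_mul φ _ _).trans ((congrArg₂ _ hf (h' n m)).trans (map_mul ψ _ _).symm)

/-- The homomorphism `Γ_R(M) ⟶ Γ_S(M')` defined by a semilinear map. -/
def gamSemi (u : M →+ M') (hu : ∀ (r : R) m, u (r • m) = algebraMap R S r • u m) :
    Gam R M →+* Gam S M' :=
  letI : Algebra R (Gam S M') := ((algebraMap S (Gam S M')).comp (algebraMap R S)).toAlgebra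
  (DividedPowerAlgebra.lift' (R := R) (M := M) (A := Gam S M')
    (f := fun nm => dp S nm.1 (u nm.2)) (fun m => dp_zero _)
    (fun n r m => by
      change dp S n (u (r • m)) = _
      rw [hu, dp_smul, Algebra.smul_def, Algebra.smul_def]
      exact congrArg (· * _) ((congrArg _ (map_pow (algebraMap R S) r n)).symm))
    (fun n k m => dp_mul n k (u m))
    (fun n x y => by
      change dp S n (u (x + y)) = _
      rw [map_add, dp_add])).toRingHom

variable (u : M →+ M') (hu : ∀ (r : R) m, u (r • m) = algebraMap R S r • u m)

theorem gamSemi_dp (n : ℕ) (m : M) : gamSemi u hu (dp R n m) = dp S n (u m) :=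
  letI : Algebra R (Gam S M') := ((algebraMap S (Gam S M')).comp (algebraMap R S)).toAlgebra
  DividedPowerAlgebra.lift'_apply_dp _ _ _ _ _ _

theorem gamSemi_algebraMap (r : R) :
    gamSemi u hu (algebraMap R _ r) = algebraMap S _ (algebraMap R S r) :=
  letI : Algebra R (Gam S M') := ((algebraMap S (Gam S M')).comp (algebraMap R S)).toAlgebra
  AlgHom.commutes (R := R) (A := DividedPowerAlgebra R M) _ r

theorem gamSemi_smul (r : R) (x : Gam R M) :
    gamSemi u hu (r • x) = algebraMap R S r • gamSemi u hu x := by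
  rw [Algebra.smul_def, Algebra.smul_def, map_mul, gamSemi_algebraMap]

theorem gamSemi_mem {d : ℕ} {x : Gam R M} (hx : x ∈ gammaPart R d M) :
    gamSemi u hu x ∈ gammaPart S d M' := by
  induction hx using Submodule.span_induction with
  | mem x hx =>
    obtain ⟨k, a, m, h, rfl⟩ := hx
    refine Submodule.subset_span ⟨k, a, fun i => u (m i), h, ?_⟩
    simp only [map_prod, gamSemi_dp]
  | zero => rw [map_zero]; exact zero_mem _
  | add x y _ _ hx hy => rw [map_add]; exact add_mem hx hy
  | smul r x _ hx => rw [gamSemi_smul]; exact Submodule.smul_mem _ _ hx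

theorem gamSemi_gammaMul (g : A →+* B) (hg : ∀ a m, u (a • m) = g a • u m) {k l d : ℕ}
    (a : Fin k → ℕ) (r : Fin k → A) (b : Fin l → ℕ) (m : Fin l → M) :
    gamSemi u hu (gammaMul R d a r b m) =
      gammaMul S d a (fun i => g (r i)) b (fun j => u (m j)) := by
  unfold gammaMul
  simp only [map_sum, map_prod, gamSemi_dp, hg]

theorem gammaMul_mem {k l d : ℕ} (a : Fin k → ℕ) (r : Fin k → A) (b : Fin l → ℕ)
    (m : Fin l → M) (ha : ∑ i, a i = d) : gammaMul R d a r b m ∈ gammaPart R d M := by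
  refine Submodule.sum_mem _ fun c hc => ?_
  rw [← Finset.prod_product']
  refine prod_dp_mem _ _ (fun x : Fin k × Fin l => r x.1 • m x.2) ?_
  rw [Finset.sum_product]
  exact (Finset.sum_congr rfl fun i _ => (Finset.mem_filter.1 hc).2.1 i).trans ha

variable [Algebra R A] [Algebra S B]

/-- The projection of `Γ(M)` to the norm of `M`, which vanishes on the parts of degree `≠ d`. -/
def toNorm (R A : Type u) [CommRing R] [CommRing A] [Algebra R A] (d : ℕ) (M : Type u)
    [AddCommGroup M] [Module R M] [Module A M] : Gam R M →ₗ[R] FerrandNorm R A d M :=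
  Submodule.mkQ _ ∘ₗ (gamCoeff d).codRestrict (gammaPart R d M) (gamCoeff_mem d)

theorem toNorm_coe {d : ℕ} (x : gammaPart R d M) :
    toNorm R A d M x = Submodule.Quotient.mk x :=
  congrArg Submodule.Quotient.mk (Subtype.ext (gamCoeff_eq_self x.2))

theorem toNorm_prod {d : ℕ} {ι : Type*} (s : Finset ι) (a : ι → ℕ) (m : ι → M) :
    toNorm R A d M (∏ i ∈ s, dp R (a i) (m i)) =
      open Classical in if h : ∑ i ∈ s, a i = d then
        Submodule.Quotient.mk ⟨∏ i ∈ s, dp R (a i) (m i), prod_dp_mem s a m h⟩ else 0 := by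
  split_ifs with h
  · exact toNorm_coe ⟨_, prod_dp_mem s a m h⟩
  · refine (congrArg Submodule.Quotient.mk (Subtype.ext ?_)).trans
      (Submodule.Quotient.mk_zero _)
    exact (gamCoeff_prod s d a m).trans (if_neg h)

theorem toNorm_eq_zero {d : ℕ} {x : Gam R M} (h : x ∈ gammaPart R d M)
    (hx : x ∈ normRel R A d M) : toNorm R A d M x = 0 :=
  (toNorm_coe ⟨x, h⟩).trans ((Submodule.Quotient.mk_eq_zero _).2 hx)

theorem exists_retraction [Module.Finite R A] [Module.Projective R A] :
    ∃ (n : ℕ) (s : A →ₗ[R] (Fin n → R)) (q : (Fin n → R) →ₗ[R] A), q ∘ₗ s = LinearMap.id := by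
  obtain ⟨n, q, s, _, _, h⟩ := Module.Finite.exists_comp_eq_id_of_projective R A
  exact ⟨n, s, q, h⟩

theorem exists_retractions [Module.Finite R A] [Module.Projective R A] {g : A →+* B}
    (hg : IsBC (algebraMap R S) g.toAddMonoidHom) :
    ∃ (n : ℕ) (s : A →ₗ[R] (Fin n → R)) (q : (Fin n → R) →ₗ[R] A) (s' : B →ₗ[S] (Fin n → S))
      (q' : (Fin n → S) →ₗ[S] B), q ∘ₗ s = LinearMap.id ∧ q' ∘ₗ s' = LinearMap.id ∧
      (∀ x i, s' (g x) i = algebraMap R S (s x i)) ∧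
        ∀ j, q' (Pi.single j 1) = g (q (Pi.single j 1)) := by
  obtain ⟨n, s, q, h⟩ := exists_retraction (R := R) (A := A)
  let : Module R B := Module.compHom B (algebraMap R S)
  have : IsScalarTower R S B := ⟨fun a b n => by
    rw [Algebra.smul_def a b, mul_smul]
    rfl⟩
  let g' : A →ₗ[R] B := { g.toAddMonoidHom with map_smul' := fun r a => hg.smul r a }
  obtain ⟨s', q', h'⟩ := exists_retraction_baseChange (S := S) s q h g' ((isBC_iff g').1 hg)
  exact ⟨n, s, q, s', q', h, h'⟩

variable {d : ℕ}

/-- The relations between generators of the norm are mapped to such relations, since norms of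
elements of the algebra commute with base change. -/
theorem gamSemi_normRel [Module.Finite R A] [Module.Projective R A] {g : A →+* B}
    (hg : IsBC (algebraMap R S) g.toAddMonoidHom) (hgu : ∀ a m, u (a • m) = g a • u m)
    {x : Gam R M} (hx : x ∈ normRel R A d M) : gamSemi u hu x ∈ normRel S B d M' := by
  obtain ⟨n, s, q, s', q', h, h', hs, hq⟩ := exists_retractions hg
  induction hx using Submodule.span_induction with
  | mem x hx =>
    obtain ⟨k, l, a, r, b, m, ha, hb, rfl⟩ := hx
    refine Submodule.subset_span ⟨k, l, a, fun i => g (r i), b, fun j => u (m j), ha, hb, ?_⟩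
    rw [map_sub, gamSemi_gammaMul u hu g hgu, gamSemi_smul, map_prod,
      normCoeff_map s q h s' q' h' g hs hq]
    simp only [gamSemi_dp]
  | zero => rw [map_zero]; exact zero_mem _
  | add x y _ _ hx hy => rw [map_add]; exact add_mem hx hy
  | smul r x _ hx => rw [gamSemi_smul]; exact Submodule.smul_mem _ _ hx

variable (hr : ∀ x ∈ normRel R A d M, gamSemi u hu x ∈ normRel S B d M')

/-- The semilinear map between the norms of modules defined by a semilinear map. -/
def normSemi : FerrandNorm R A d M →ₛₗ[algebraMap R S] FerrandNorm S B d M' :=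
  Submodule.liftQ _
    { toFun := fun x => toNorm S B d M' (gamSemi u hu x)
      map_add' := fun x y => by rw [Submodule.coe_add, map_add, map_add]
      map_smul' := fun r x => by rw [Submodule.coe_smul, gamSemi_smul, map_smul] }
    fun x hx => toNorm_eq_zero (gamSemi_mem u hu x.2) (hr x hx)

theorem normSemi_mk (x : gammaPart R d M) :
    normSemi u hu hr (Submodule.Quotient.mk x) = toNorm S B d M' (gamSemi u hu x) := rfl

theorem normSemi_ferrandMk {k : ℕ} (a : Fin k → ℕ) (m : Fin k → M) (ha : ∑ i, a i = d) :
    normSemi u hu hr (FerrandNorm.mk A a m ha) = FerrandNorm.mk B a (fun i => u (m i)) ha := by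
  refine Eq.trans ?_ (toNorm_coe ⟨∏ i, dp S (a i) (u (m i)), _⟩)
  refine congrArg (toNorm S B d M') ?_
  simp only [map_prod, gamSemi_dp]

theorem normSemi_toNorm {ι : Type*} (s : Finset ι) (a : ι → ℕ) (m : ι → M) :
    normSemi u hu hr (toNorm R A d M (∏ i ∈ s, dp R (a i) (m i))) =
      toNorm S B d M' (gamSemi u hu (∏ i ∈ s, dp R (a i) (m i))) := by
  rw [toNorm_prod]
  split_ifs with h
  · rfl
  · rw [map_zero, map_prod]
    simp only [gamSemi_dp]
    rw [toNorm_prod, dif_neg h]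

/-- The norm commutes with base change. The inverse of the base change map is induced by
`Γ_S(S ⊗ M) ⟶ S ⊗ Γ_R(M)`; that it respects the relations has to be checked on generators
only. -/
theorem isBC_normSemi [IsScalarTower R A M] [IsScalarTower S B M'] [Module.Finite R A]
    [Module.Projective R A] {g : A →+* B}
    (hg : IsBC (algebraMap R S) g.toAddMonoidHom) (hgu : ∀ a m, u (a • m) = g a • u m)
    (hb : IsBC (algebraMap R S) u) :
    IsBC (algebraMap R S) (normSemi u hu hr).toAddMonoidHom := by
  obtain ⟨n, s, q, s', q', h, h', hs, hq⟩ := exists_retractions hg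
  let : Module R M' := Module.compHom M' (algebraMap R S)
  have : IsScalarTower R S M' := ⟨fun a b n => by
    rw [Algebra.smul_def, mul_smul]
    rfl⟩
  let : Module R (FerrandNorm S B d M') := Module.compHom _ (algebraMap R S)
  have : IsScalarTower R S (FerrandNorm S B d M') := ⟨fun a b n => by
    rw [Algebra.smul_def, mul_smul]
    rfl⟩
  let u' : M →ₗ[R] M' := { u with map_smul' := fun r a => hb.smul r a }
  have hb' : IsBaseChange S u' := (isBC_iff u').1 hb
  let ν : FerrandNorm R A d M →ₗ[R] FerrandNorm S B d M' :=
    { (normSemi u hu hr).toAddMonoidHom with map_smul' := fun r x => (normSemi u hu hr).map_smulₛₗ r x }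
  refine (isBC_iff ν).2 ?_
  let ε : M' →ₗ[S] S ⊗[R] M := hb'.equiv.symm.toLinearMap
  have hε (m : M) : ε (u m) = 1 ⊗ₜ m := by
    refine (LinearEquiv.symm_apply_eq _).2 ?_
    rw [hb'.equiv_tmul, one_smul]
    rfl
  let i : Gam R M →+* S ⊗[R] Gam R M :=
    (Algebra.TensorProduct.includeRight : Gam R M →ₐ[R] S ⊗[R] Gam R M).toRingHom
  -- `Θ` inverts the base change map on the whole divided power algebra
  let Θ : Gam S M' →ₐ[S] S ⊗[R] Gam R M :=
    (gamTensor i fun r => by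
      rw [← IsScalarTower.algebraMap_apply]
      exact (AlgHom.commutes Algebra.TensorProduct.includeRight r).symm).comp (Gam.map ε)
  have hΘ (x : Gam R M) : Θ (gamSemi u hu x) = 1 ⊗ₜ x := by
    refine RingHom.congr_fun (Gam.ringHom_ext (φ := Θ.toRingHom.comp (gamSemi u hu)) (ψ := i)
      (fun r => ?_) fun n m => ?_) x
    · refine (congrArg Θ (gamSemi_algebraMap u hu r)).trans ((Θ.commutes _).trans ?_)
      rw [← IsScalarTower.algebraMap_apply]
      exact (AlgHom.commutes Algebra.TensorProduct.includeRight r).symm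
    · refine (congrArg Θ (gamSemi_dp u hu n m)).trans ?_
      change gamTensor i _ (Gam.map ε (dp S n (u m))) = _
      rw [Gam.map_dp, hε, gamTensor_dp, dpTensor_tmul, map_one, one_pow, one_mul]
  let χ : Gam S M' →ₗ[S] S ⊗[R] FerrandNorm R A d M :=
    (toNorm R A d M).baseChange S ∘ₗ Θ.toLinearMap
  have hχ (x : Gam R M) : χ (gamSemi u hu x) = 1 ⊗ₜ toNorm R A d M x :=
    (congrArg ((toNorm R A d M).baseChange S) (hΘ x)).trans (LinearMap.baseChange_tmul _ _ _)
  have hspan : Submodule.span S (Set.range u) = ⊤ := by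
    refine eq_top_iff.2 fun x _ => ?_
    exact hb'.inductionOn x (· ∈ Submodule.span S (Set.range u)) (zero_mem _)
      (fun m => Submodule.subset_span ⟨m, rfl⟩) (fun c _ h => Submodule.smul_mem _ c h)
      fun _ _ h h' => add_mem h h'
  -- on generators of `B` and `M'` which come from `A` and `M`, the relations come from relations
  have hK : normRel S B d M' ≤ LinearMap.ker χ := by
    refine normRel_le s' q' h' hspan fun a l b j ha hb => ?_
    have e : gammaMul S d a (fun t => q' (Pi.single t 1)) b (fun i => u (j i)) -
        normCoeff S a (fun t => q' (Pi.single t 1)) • ∏ i, dp S (b i) (u (j i)) =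
        gamSemi u hu (gammaMul R d a (fun t => q (Pi.single t 1)) b j -
          normCoeff R a (fun t => q (Pi.single t 1)) • ∏ i, dp R (b i) (j i)) := by
      rw [map_sub, gamSemi_gammaMul u hu g hgu, gamSemi_smul, map_prod,
        ← normCoeff_map s q h s' q' h' g hs hq]
      simp only [gamSemi_dp, hq]
    rw [LinearMap.mem_ker, e, hχ, toNorm_eq_zero, TensorProduct.tmul_zero]
    · exact sub_mem (gammaMul_mem a _ b j ha)
        (Submodule.smul_mem _ _ (Submodule.subset_span ⟨l, b, j, hb, rfl⟩))
    · exact Submodule.subset_span ⟨n, l, a, _, b, j, ha, hb, rfl⟩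
  let χ' : FerrandNorm S B d M' →ₗ[S] S ⊗[R] FerrandNorm R A d M :=
    Submodule.liftQ _ (χ ∘ₗ (gammaPart S d M').subtype) fun x hx => hK hx
  let ψ : S ⊗[R] FerrandNorm R A d M →ₗ[S] FerrandNorm S B d M' :=
    (TensorProduct.isBaseChange R (FerrandNorm R A d M) S).lift ν
  have hψ (x : FerrandNorm R A d M) : ψ (1 ⊗ₜ x) = ν x :=
    (TensorProduct.isBaseChange R (FerrandNorm R A d M) S).lift_eq ν x
  have h1 : ψ ∘ₗ χ = toNorm S B d M' := by
    refine LinearMap.ext_on (DividedPowerAlgebra.submodule_span_prod_dp_eq_top hspan) ?_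
    rintro _ ⟨a, rfl⟩
    have e : a.prod (fun m k => DividedPowerAlgebra.dp S k (u m)) =
        gamSemi u hu (∏ m ∈ a.support, dp R (a m) m) := by
      rw [map_prod]
      simp only [gamSemi_dp]
      rfl
    refine (congrArg (ψ ∘ₗ χ) e).trans (Eq.trans ?_ (congrArg (toNorm S B d M') e).symm)
    refine (congrArg ψ (hχ _)).trans ((hψ _).trans ?_)
    exact normSemi_toNorm u hu hr _ _ _
  refine IsBaseChange.of_equiv (LinearEquiv.ofLinearMap ψ χ' ?_ ?_) hψ
  · refine LinearMap.ext fun x => ?_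
    obtain ⟨x, rfl⟩ := Submodule.Quotient.mk_surjective _ x
    exact (LinearMap.congr_fun h1 x).trans (toNorm_coe x)
  · refine (TensorProduct.isBaseChange R (FerrandNorm R A d M) S).algHom_ext _ _ fun x => ?_
    obtain ⟨x, rfl⟩ := Submodule.Quotient.mk_surjective _ x
    refine (congrArg χ' (hψ _)).trans ?_
    refine (congrArg χ' (normSemi_mk u hu hr x)).trans ?_
    refine (congrArg χ' (toNorm_coe ⟨_, gamSemi_mem u hu x.2⟩)).trans ?_
    refine (hχ x).trans ?_
    rw [toNorm_coe]
    rfl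

end FerrandBaseChange

section FerrandFunctor

variable {R S A B : Type u} [CommRing R] [CommRing S] [CommRing A] [CommRing B] {d : ℕ}

theorem ferrandFunctor_map_mk (c : R →+* A) {M N : ModuleCat.{u} A} (φ : M ⟶ N) {k : ℕ}
    (a : Fin k → ℕ) (m : Fin k → M) (ha : ∑ i, a i = d) :
    (ferrandFunctor d c).map φ (ferrandMk c M a m ha) = ferrandMk c N a (fun i => φ (m i)) ha := by
  let : Algebra R A := c.toAlgebra
  let : Module R M := Module.compHom M c
  let : Module R N := Module.compHom N c
  let φ' : M →ₗ[R] N :=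
    { toFun := φ.hom
      map_add' := φ.hom.map_add
      map_smul' := fun r m => φ.hom.map_smul (c r) m }
  have e : Gam.map φ' (∏ i, dp R (a i) (m i)) = ∏ i, dp R (a i) (φ' (m i)) := by
    simp only [map_prod, Gam.map_dp]
  exact congrArg Submodule.Quotient.mk (Subtype.ext e)

theorem span_ferrandMk (c : R →+* A) (M : ModuleCat.{u} A) :
    Submodule.span R {x : (ferrandFunctor d c).obj M | ∃ (k : ℕ) (a : Fin k → ℕ) (m : Fin k → M)
      (ha : ∑ i, a i = d), x = ferrandMk c M a m ha} = ⊤ := by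
  let : Algebra R A := c.toAlgebra
  let : Module R M := Module.compHom M c
  rw [eq_top_iff]
  rintro x -
  obtain ⟨⟨x, hx⟩, rfl⟩ := Submodule.Quotient.mk_surjective _ x
  induction hx using Submodule.span_induction with
  | mem x hx =>
    obtain ⟨k, a, m, ha, rfl⟩ := hx
    exact Submodule.subset_span ⟨k, a, m, ha, rfl⟩
  | zero => exact zero_mem _
  | add x y _ _ hx hy => exact add_mem hx hy
  | smul r x _ hx => exact Submodule.smul_mem _ r hx

theorem ferrand_hom_ext (c : R →+* A) (f : R →+* S) {M : ModuleCat.{u} A} {N : ModuleCat.{u} S}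
    {ψ χ : (ModuleCat.extendScalars.{u, u, u} f).obj ((ferrandFunctor d c).obj M) ⟶ N}
    (h : ∀ (k : ℕ) (a : Fin k → ℕ) (m : Fin k → M) (ha : ∑ i, a i = d),
      ψ ((1 : S) ⊗ₜ[R, f] ferrandMk c M a m ha) = χ ((1 : S) ⊗ₜ[R, f] ferrandMk c M a m ha)) :
    ψ = χ := by
  apply ((ModuleCat.extendRestrictScalarsAdj f).homEquiv _ N).injective
  refine ModuleCat.hom_ext (LinearMap.ext_on (span_ferrandMk c M) ?_)
  rintro _ ⟨k, a, m, ha, rfl⟩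
  exact h k a m ha

theorem ferrand_hom_ext₂ {T : Type u} [CommRing T] (c : R →+* A) (f : R →+* S) (g : S →+* T)
    {M : ModuleCat.{u} A} {N : ModuleCat.{u} T}
    {ψ χ : (ModuleCat.extendScalars.{u, u, u} g).obj ((ModuleCat.extendScalars.{u, u, u} f).obj
      ((ferrandFunctor d c).obj M)) ⟶ N}
    (h : ∀ (k : ℕ) (a : Fin k → ℕ) (m : Fin k → M) (ha : ∑ i, a i = d),
      ψ ((1 : T) ⊗ₜ[S, g] ((1 : S) ⊗ₜ[R, f] ferrandMk c M a m ha :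
        (ModuleCat.extendScalars.{u, u, u} f).obj ((ferrandFunctor d c).obj M))) =
      χ ((1 : T) ⊗ₜ[S, g] ((1 : S) ⊗ₜ[R, f] ferrandMk c M a m ha :
        (ModuleCat.extendScalars.{u, u, u} f).obj ((ferrandFunctor d c).obj M)))) :
    ψ = χ := by
  apply ((ModuleCat.extendRestrictScalarsAdj g).homEquiv _ N).injective
  exact ferrand_hom_ext c f fun k a m ha => h k a m ha

/-- The base change map of the norm for a cocartesian square of rings, in which the base change of
`M` is given by the other extension of scalars. -/
theorem exists_ferrand_baseChange (d : ℕ) {f : R →+* S} {c : R →+* A} {c' : S →+* B} {e : A →+* B}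
    (hP : IsPushout (CommRingCat.ofHom f) (CommRingCat.ofHom c) (CommRingCat.ofHom c')
      (CommRingCat.ofHom e)) (hfin : c.Finite)
    (hproj : letI : Algebra R A := c.toAlgebra; Module.Projective R A) (M : ModuleCat.{u} A) :
    ∃ ψ : (ModuleCat.extendScalars.{u, u, u} f).obj ((ferrandFunctor d c).obj M) ⟶
        (ferrandFunctor d c').obj ((ModuleCat.extendScalars.{u, u, u} e).obj M), IsIso ψ ∧
      ∀ (k : ℕ) (a : Fin k → ℕ) (m : Fin k → M) (ha : ∑ i, a i = d),
        ψ ((1 : S) ⊗ₜ[R, f] ferrandMk c M a m ha) =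
          ferrandMk c' ((ModuleCat.extendScalars.{u, u, u} e).obj M) a
            (fun i => (1 : B) ⊗ₜ[A, e] m i) ha := by
  let M' := (ModuleCat.extendScalars.{u, u, u} e).obj M
  let : Algebra R S := f.toAlgebra
  let : Algebra R A := c.toAlgebra
  let : Algebra S B := c'.toAlgebra
  let : Module R M := Module.compHom M c
  let : Module S M' := Module.compHom M' c'
  have : IsScalarTower R A M := ⟨fun a b n => mul_smul (c a) b n⟩
  have : IsScalarTower S B M' := ⟨fun a b n => mul_smul (c' a) b n⟩
  have : Module.Finite R A := hfin
  have : Module.Projective R A := hproj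
  let u : M →+ M' := semilin e (𝟙 M')
  have hb : IsBC f u := IsBC.of_isPushout hP (isBC_one_tmul e M)
  have hg : IsBC f e.toAddMonoidHom := by
    refine IsBC.of_isPushout hP (M := A) (N := B) ?_
    let : Algebra A B := e.toAlgebra
    exact (isBC_iff (Algebra.linearMap A B)).2 (IsBaseChange.linearMap A B)
  have hgu (a : A) (m : M) : u (a • m) = e a • u m := semilin_smul e _ a m
  have hr (x : Gam R M) (hx : x ∈ normRel R A d M) : gamSemi u hb.1 x ∈ normRel S B d M' :=
    gamSemi_normRel u hb.1 hg hgu hx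
  have h := isBC_normSemi u hb.1 hr hg hgu hb
  let ψ : (ModuleCat.extendScalars.{u, u, u} f).obj ((ferrandFunctor d c).obj M) ⟶
      (ferrandFunctor d c').obj M' :=
    ((ModuleCat.extendRestrictScalarsAdj f).homEquiv _ _).symm (ModuleCat.ofHom
      (Y := (ModuleCat.restrictScalars f).obj ((ferrandFunctor d c').obj M'))
      { toFun := normSemi u hb.1 hr
        map_add' := (normSemi u hb.1 hr).map_add
        map_smul' := fun r x => (normSemi u hb.1 hr).map_smulₛₗ r x })
  have hψ (x : FerrandNorm R A d M) : ψ ((1 : S) ⊗ₜ[R, f] x) = normSemi u hb.1 hr x :=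
    one_smul S (normSemi u hb.1 hr x)
  refine ⟨ψ, ?_, ?_⟩
  · refine isIso_of_isBC f ψ ?_
    have e : semilin f ψ = (normSemi u hb.1 hr).toAddMonoidHom := AddMonoidHom.ext hψ
    rw [e]
    exact h
  · intro k a m ha
    exact (hψ _).trans (normSemi_ferrandMk u hb.1 hr a m ha)

end FerrandFunctor

section FerrandTheta

variable {R S A B : Type u} [CommRing R] [CommRing S] [CommRing A] [CommRing B]

/-- The base change maps of the norm are natural, as they are determined by their values on
generators. -/
theorem exists_ferrand_iso (d : ℕ) {f : R →+* S} {c : R →+* A} {c' : S →+* B} {e : A →+* B}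
    (hP : IsPushout (CommRingCat.ofHom f) (CommRingCat.ofHom c) (CommRingCat.ofHom c')
      (CommRingCat.ofHom e)) (hfin : c.Finite)
    (hproj : letI : Algebra R A := c.toAlgebra; Module.Projective R A) :
    ∃ θ : ferrandFunctor d c ⋙ ModuleCat.extendScalars.{u, u, u} f ≅
        ModuleCat.extendScalars.{u, u, u} e ⋙ ferrandFunctor d c',
      ∀ (M : ModuleCat.{u} A) (k : ℕ) (a : Fin k → ℕ) (m : Fin k → M) (ha : ∑ i, a i = d),
        θ.hom.app M ((1 : S) ⊗ₜ[R, f] ferrandMk c M a m ha) =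
          ferrandMk c' ((ModuleCat.extendScalars.{u, u, u} e).obj M) a
            (fun i => (1 : B) ⊗ₜ[A, e] m i) ha := by
  choose ψ hψ hmk using exists_ferrand_baseChange d hP hfin hproj
  have nat {M N : ModuleCat.{u} A} (φ : M ⟶ N) :
      (ModuleCat.extendScalars.{u, u, u} f).map ((ferrandFunctor d c).map φ) ≫ ψ N =
        ψ M ≫ (ferrandFunctor d c').map ((ModuleCat.extendScalars.{u, u, u} e).map φ) := by
    refine ferrand_hom_ext c f fun k a m ha => ?_
    have h1 : (ModuleCat.extendScalars.{u, u, u} f).map ((ferrandFunctor d c).map φ)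
        ((1 : S) ⊗ₜ[R, f] ferrandMk c M a m ha) =
        (1 : S) ⊗ₜ[R, f] ferrandMk c N a (fun i => φ (m i)) ha := by
      rw [← ferrandFunctor_map_mk c φ a m ha]
      rfl
    refine (congrArg (ψ N) h1).trans ((hmk N k a _ ha).trans ?_)
    refine Eq.trans ?_ (congrArg ((ferrandFunctor d c').map
      ((ModuleCat.extendScalars.{u, u, u} e).map φ)) (hmk M k a m ha)).symm
    refine Eq.trans ?_ (ferrandFunctor_map_mk c' ((ModuleCat.extendScalars.{u, u, u} e).map φ)
      a _ ha).symm
    exact congrArg (fun m => ferrandMk c' _ a m ha) (funext fun i => by rfl)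
  let τ : ferrandFunctor d c ⋙ ModuleCat.extendScalars.{u, u, u} f ⟶
      ModuleCat.extendScalars.{u, u, u} e ⋙ ferrandFunctor d c' :=
    { app := ψ
      naturality := fun M N φ => nat φ }
  have : IsIso τ := by
    have h (M : ModuleCat.{u} A) : IsIso (τ.app M) := hψ M
    exact NatIso.isIso_of_isIso_app τ
  exact ⟨asIso τ, hmk⟩

/-- The defining formula of the base change isomorphism of the norm, on the elements
`1 ⊗ γ^{a_1}(m_1) ⋯ γ^{a_k}(m_k)`. -/
def IsFerrandIso {d : ℕ} {f : R →+* S} {c : R →+* A} {c' : S →+* B} {e : A →+* B}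
    (θ : ferrandFunctor d c ⋙ ModuleCat.extendScalars.{u, u, u} f ≅
      ModuleCat.extendScalars.{u, u, u} e ⋙ ferrandFunctor d c') : Prop :=
  ∀ (M : ModuleCat.{u} A) (k : ℕ) (a : Fin k → ℕ) (m : Fin k → M) (ha : ∑ i, a i = d),
    θ.hom.app M ((1 : S) ⊗ₜ[R, f] ferrandMk c M a m ha) =
      ferrandMk c' ((ModuleCat.extendScalars.{u, u, u} e).obj M) a
        (fun i => (1 : B) ⊗ₜ[A, e] m i) ha

theorem IsFerrandIso.unitCompat {d : ℕ} {f : R →+* R} {c : R →+* A} {e : A →+* A}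
    {θ : ferrandFunctor d c ⋙ ModuleCat.extendScalars.{u, u, u} f ≅
      ModuleCat.extendScalars.{u, u, u} e ⋙ ferrandFunctor d c} (h : IsFerrandIso θ)
    (hf : f = RingHom.id R) (he : e = RingHom.id A) :
    UnitCompat (ferrandFunctor d c) f hf e he θ := by
  intro M
  refine ferrand_hom_ext c f fun k a m ha => ?_
  refine (congrArg ((ferrandFunctor d c).map ((canId e he).hom.app M)) (h M k a m ha)).trans ?_
  refine (ferrandFunctor_map_mk c ((canId e he).hom.app M) a _ ha).trans ?_
  refine Eq.trans ?_ (semilin_canId f hf _ (ferrandMk c M a m ha)).symm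
  exact congrArg (fun m => ferrandMk c M a m ha) (funext fun i => semilin_canId e he M (m i))

/-- The cocycle condition is checked on generators, where both sides are given by `m ↦ 1 ⊗ (1 ⊗ m)`.
-/
theorem IsFerrandIso.cocycleCompat {T D : Type u} [CommRing T] [CommRing D] {d : ℕ} {f : R →+* S}
    {c : R →+* A} {c' : S →+* B} {e : A →+* B} {g : S →+* T} {c'' : T →+* D} {e' : B →+* D}
    {k : R →+* T} {l : A →+* D}
    {θf : ferrandFunctor d c ⋙ ModuleCat.extendScalars.{u, u, u} f ≅
      ModuleCat.extendScalars.{u, u, u} e ⋙ ferrandFunctor d c'}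
    {θg : ferrandFunctor d c' ⋙ ModuleCat.extendScalars.{u, u, u} g ≅
      ModuleCat.extendScalars.{u, u, u} e' ⋙ ferrandFunctor d c''}
    {θk : ferrandFunctor d c ⋙ ModuleCat.extendScalars.{u, u, u} k ≅
      ModuleCat.extendScalars.{u, u, u} l ⋙ ferrandFunctor d c''}
    (hθf : IsFerrandIso θf) (hθg : IsFerrandIso θg) (hθk : IsFerrandIso θk)
    (hk : k = g.comp f) (hl : l = e'.comp e) :
    CocycleCompat (ferrandFunctor d c) (ferrandFunctor d c') (ferrandFunctor d c'')
      f g k hk e e' l hl θf θg θk := by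
  intro M
  refine ferrand_hom_ext₂ c f g fun n a m ha => ?_
  refine (congrArg (θk.hom.app M) (canComp_one_tmul f g k hk _ (ferrandMk c M a m ha))).trans ?_
  refine (hθk M n a m ha).trans ?_
  let F := θg.hom.app ((ModuleCat.extendScalars.{u, u, u} e).obj M) ≫
    (ferrandFunctor d c'').map ((canComp e e' l hl).hom.app M)
  refine Eq.trans ?_ (congrArg (fun x => F ((1 : T) ⊗ₜ[S, g] x)) (hθf M n a m ha)).symm
  refine Eq.trans ?_ (congrArg ((ferrandFunctor d c'').map ((canComp e e' l hl).hom.app M))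
    (hθg ((ModuleCat.extendScalars.{u, u, u} e).obj M) n a _ ha)).symm
  refine Eq.trans ?_ (ferrandFunctor_map_mk c'' ((canComp e e' l hl).hom.app M) a _ ha).symm
  exact congrArg (fun m => ferrandMk c'' _ a m ha)
    (funext fun i => (canComp_one_tmul e e' l hl M (m i)).symm)

end FerrandTheta

section

variable {S : Scheme.{u}}

/-- Fibre product squares of affine schemes are cocartesian squares of rings, and finite flat
algebras of finite presentation are projective. -/
theorem exists_ferrand_theta {d : ℕ} {k h : (flf S d).Aff} (D : k.val ⟶ h.val) :
    ∃ θ : ferrandFunctors S d h ⋙ ModuleCat.extendScalars.{u, u, u} D.f.left.appTop.hom ≅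
      ModuleCat.extendScalars.{u, u, u} D.g.appTop.hom ⋙ ferrandFunctors S d k,
      IsFerrandIso (c := h.val.hom.appTop.hom) (c' := k.val.hom.appTop.hom) θ := by
  obtain ⟨h1, h2, h3, _⟩ := h.mem
  have := h.isAffine
  have := k.isAffine
  have := h.isAffine_total
  have hfin := h.val.hom.finite_appTop
  refine exists_ferrand_iso d (isPushout_appTop_of_isPullback D.isPullback.flip) hfin ?_
  have hflat := h.val.hom.flat_appTop
  have hfp := h.val.hom.finitePresentation_appTop
  let : Algebra Γ(h.val.base.left, ⊤) Γ(h.val.total, ⊤) := h.val.hom.appTop.hom.toAlgebra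
  have : Module.Finite Γ(h.val.base.left, ⊤) Γ(h.val.total, ⊤) := hfin
  have : Module.Flat Γ(h.val.base.left, ⊤) Γ(h.val.total, ⊤) := hflat
  have : Algebra.FinitePresentation Γ(h.val.base.left, ⊤) Γ(h.val.total, ⊤) := hfp
  have := Module.FinitePresentation.of_finite_of_finitePresentation
    (R := Γ(h.val.base.left, ⊤)) (S := Γ(h.val.total, ⊤))
  exact Module.Flat.projective_of_finitePresentation

/-- The norm functors commute with base change. -/
theorem exists_ferrand_data (S : Scheme.{u}) (d : ℕ) :
    ∃ B : BaseChange (flf S d) (ferrandFunctors S d), IsFerrandBaseChange S d B := by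
  choose θ₀ hθ₀ using fun (k h : (flf S d).Aff) (D : k.val ⟶ h.val) => exists_ferrand_theta D
  refine ⟨⟨fun {k h} D => θ₀ k h D, fun h => (hθ₀ h h (𝟙 h.val)).unitCompat _ _,
    fun {l k h} E D => (hθ₀ k h D).cocycleCompat (hθ₀ l k E) (hθ₀ l h (E ≫ D)) _ _⟩, ?_⟩
  intro k h D M n a m ha s
  have e := hθ₀ k h D M n a m ha
  refine Eq.trans ?_ (congrArg (s • ·) e)
  refine Eq.trans ?_ (map_smul ((θ₀ k h D).hom.app M).hom s _)
  refine congrArg (fun t : Γ(k.val.base.left, ⊤) => (θ₀ k h D).hom.app M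
    (t ⊗ₜ[_, D.f.left.appTop.hom] ferrandMk h.val.hom.appTop.hom M a m ha :
      (ModuleCat.extendScalars.{u, u, u} D.f.left.appTop.hom).obj
        ((ferrandFunctors S d h).obj M))) ?_
  exact (mul_one s).symm

end

/-! ### Gluing morphisms along fppf coverings -/

section GlueMorphisms

variable {ι : Type u} {Y : Scheme.{u}} {X : ι → Scheme.{u}} {f : ∀ i, X i ⟶ Y}

theorem IsFppfCov.mk' (h1 : ∀ i, Flat (f i)) (h2 : ∀ i, LocallyOfFinitePresentation (f i))
    (h3 : ∀ y, ∃ i x, f i x = y) : IsFppfCov f := ⟨h1, h2, h3⟩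

/-- Coverings are stable under base change. -/
theorem IsFppfCov.of_isPullback (hf : IsFppfCov f) {Y' : Scheme.{u}} {X' : ι → Scheme.{u}}
    {y : Y' ⟶ Y} {f' : ∀ i, X' i ⟶ Y'} {x : ∀ i, X' i ⟶ X i}
    (h : ∀ i, IsPullback (f' i) (x i) y (f i)) : IsFppfCov f' := by
  refine .mk' (fun i => ?_) (fun i => ?_) fun t => ?_
  · have : Flat (f i) := hf.flat i
    exact MorphismProperty.of_isPullback (P := @Flat) (h i).flip this
  · have : LocallyOfFinitePresentation (f i) := hf.lfp i
    exact MorphismProperty.of_isPullback (P := @LocallyOfFinitePresentation) (h i).flip this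
  · obtain ⟨i, z, hz⟩ := hf.surj (y t)
    obtain ⟨w, h1, -⟩ := Scheme.exists_preimage_of_isPullback (h i) t z hz.symm
    exact ⟨i, w, h1⟩

/-- The fppf topology is subcanonical. -/
theorem IsFppfCov.existsUnique_desc (hf : IsFppfCov f) {Z : Scheme.{u}} (a : ∀ i, X i ⟶ Z)
    (compat : ∀ i j {W : Scheme.{u}} (p : W ⟶ X i) (q : W ⟶ X j), p ≫ f i = q ≫ f j →
      p ≫ a i = q ≫ a j) : ∃! b : Y ⟶ Z, ∀ i, f i ≫ b = a i := by
  have hm : Presieve.ofArrows X f ∈ Scheme.fppfPrecoverage Y := by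
    unfold Scheme.fppfPrecoverage
    rw [Scheme.ofArrows_mem_precoverage_iff]
    refine ⟨fun x => ?_, fun i => ⟨hf.flat i, hf.lfp i⟩⟩
    obtain ⟨i, z, hz⟩ := hf.surj x
    exact ⟨i, z, hz⟩
  have h := (GrothendieckTopology.Subcanonical.isSheaf_of_isRepresentable
    (J := Scheme.fppfTopology.{u}) (yoneda.obj Z)).isSheafFor _
    (Precoverage.generate_mem_toGrothendieck hm)
  rw [Presieve.isSheafFor_arrows_iff] at h
  exact h a fun i j W p q e => compat i j p q e

theorem IsFppfCov.hom_ext (hf : IsFppfCov f) {Z : Scheme.{u}} {b b' : Y ⟶ Z}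
    (h : ∀ i, f i ≫ b = f i ≫ b') : b = b' :=
  (hf.existsUnique_desc (fun i => f i ≫ b) fun i j W p q e => by
    rw [reassoc_of% e]).unique (fun _ => rfl) fun i => (h i).symm

/-- Functions can be glued along fppf coverings: they are morphisms to the affine line. -/
theorem IsFppfCov.existsUnique_section (hf : IsFppfCov f) (x : ∀ i, Γ(X i, ⊤))
    (compat : ∀ i j {W : Scheme.{u}} (p : W ⟶ X i) (q : W ⟶ X j), p ≫ f i = q ≫ f j →
      p.appTop.hom (x i) = q.appTop.hom (x j)) : ∃! m : Γ(Y, ⊤), ∀ i, (f i).appTop.hom m = x i := by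
  let L {W : Scheme.{u}} := AffineSpace.toSpecMvPolyIntEquiv PUnit.{u + 1} (X := W)
  let ev {W : Scheme.{u}} (a : W ⟶ _) : Γ(W, ⊤) := L a PUnit.unit
  have ev_comp {V W : Scheme.{u}} (p : V ⟶ W) (a : W ⟶ _) :
      ev (p ≫ a) = p.appTop.hom (ev a) := rfl
  have hev {W : Scheme.{u}} : Function.Bijective (ev (W := W)) :=
    ⟨fun a b h => L.injective (funext fun _ => h),
      fun m => ⟨L.symm fun _ => m, congrFun (L.apply_symm_apply _) _⟩⟩
  choose a ha using fun i => hev.2 (x i)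
  obtain ⟨b, hb, hu⟩ := hf.existsUnique_desc a fun i j W p q e => hev.1 (by
    rw [ev_comp, ev_comp, ha, ha]
    exact compat i j p q e)
  refine ⟨ev b, fun i => ?_, fun m hm => ?_⟩
  · rw [← ev_comp, hb, ha]
  · obtain ⟨b', rfl⟩ := hev.2 m
    rw [hu b' fun i => hev.1 (by rw [ev_comp, ha, ← hm i])]

/-- Whether a square is cartesian can be tested on an fppf covering. -/
theorem IsFppfCov.isPullback (hf : IsFppfCov f) {T T₀ Y₀ : Scheme.{u}} {q : T ⟶ Y} {c : T ⟶ T₀}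
    {q₀ : T₀ ⟶ Y₀} {v : Y ⟶ Y₀} (w : c ≫ q₀ = q ≫ v) {T' : ι → Scheme.{u}} {q' : ∀ i, T' i ⟶ X i}
    {g : ∀ i, T' i ⟶ T} (h : ∀ i, IsPullback (g i) (q' i) q (f i))
    (h' : ∀ i, IsPullback (g i ≫ c) (q' i) q₀ (f i ≫ v)) : IsPullback c q q₀ v := by
  let Z := pullback q₀ v
  let z : T ⟶ Z := pullback.lift c q w
  have hz : z ≫ pullback.fst _ _ = c := pullback.lift_fst _ _ _
  have hz' : z ≫ pullback.snd _ _ = q := pullback.lift_snd _ _ _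
  have hg (i) : IsPullback (g i ≫ z) (q' i) (pullback.snd q₀ v) (f i) := by
    refine IsPullback.of_right ?_ ?_ (IsPullback.of_hasPullback q₀ v)
    · rw [Category.assoc, hz]
      exact h' i
    · rw [Category.assoc, hz', (h i).w]
  have hcov := hf.of_isPullback hg
  obtain ⟨s, hs, -⟩ := hcov.existsUnique_desc g fun i j W p p' e => by
    have e1 := congrArg (· ≫ pullback.snd q₀ v) e
    simp only [Category.assoc, hz'] at e1
    let r : W ⟶ T' i := (h i).lift (p' ≫ g j) (p ≫ q' i) (by
      rw [Category.assoc, Category.assoc, ← e1, (h i).w])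
    have hr : r ≫ g i = p' ≫ g j := (h i).lift_fst _ _ _
    have hr' : r ≫ q' i = p ≫ q' i := (h i).lift_snd _ _ _
    have : r = p := (hg i).hom_ext (by rw [reassoc_of% hr, e]) hr'
    rw [← this, hr]
  have h1 : s ≫ z = 𝟙 _ := hcov.hom_ext fun i => by
    rw [← Category.assoc, hs i, Category.comp_id]
  have h2 : z ≫ s = 𝟙 _ := (hf.of_isPullback h).hom_ext fun i => by
    rw [← Category.assoc, hs i, Category.comp_id]
  have : IsIso z := ⟨s, h2, h1⟩
  exact IsPullback.of_iso_pullback ⟨w⟩ (asIso z) hz hz'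

end GlueMorphisms

/-- A commutative square of rings is cocartesian if and only if its horizontal maps are base
changes of modules along the vertical ones. -/
theorem isBC_iff_isPushout {A B C D : CommRingCat.{u}} {f : A ⟶ B} {c : A ⟶ C} {d : B ⟶ D}
    {e : C ⟶ D} (w : f ≫ d = c ≫ e) :
    (letI : Module A C := Module.compHom C c.hom
     letI : Module B D := Module.compHom D d.hom
     IsBC (M := C) (N := D) f.hom e.hom.toAddMonoidHom) ↔ IsPushout f c d e := by
  let : Algebra A B := f.hom.toAlgebra
  let : Algebra A C := c.hom.toAlgebra
  let : Algebra B D := d.hom.toAlgebra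
  let : Algebra C D := e.hom.toAlgebra
  let : Algebra A D := (f ≫ d).hom.toAlgebra
  have hw (x : A) : d.hom (f.hom x) = e.hom (c.hom x) :=
    RingHom.congr_fun (congrArg CommRingCat.Hom.hom w) x
  have : IsScalarTower A B D := IsScalarTower.of_algebraMap_eq fun x => rfl
  have : IsScalarTower A C D := IsScalarTower.of_algebraMap_eq hw
  refine Iff.trans ?_ (Algebra.isPushout_iff A B C D |>.symm.trans
    (CommRingCat.isPushout_iff_isPushout (R := A) (S := C) (R' := B) (S' := D)).symm)
  rw [← isBC_iff]
  exact Iff.rfl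

/-! ### Affine schemes over a covering that satisfy descent -/

/-- A descent datum for affine morphisms along a family of morphisms, in the form of a cartesian
functor on the schemes over the members of the family, with all morphisms over `Y`. -/
structure CartFam {ι : Type u} {Y : Scheme.{u}} {X : ι → Scheme.{u}} (f : ∀ i, X i ⟶ Y) where
  /-- the scheme over a scheme over some `X i` -/
  T : (Σ i, Over (X i)) → Scheme.{u}
  /-- the structure morphism -/
  q : ∀ e, T e ⟶ (famOver f e).left
  affine : ∀ e, IsAffineHom (q e)
  /-- the base change morphisms -/
  tr : ∀ {e e'}, (famOver f e' ⟶ famOver f e) → (T e' ⟶ T e)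
  isPullback : ∀ {e e'} (g : famOver f e' ⟶ famOver f e), IsPullback (tr g) (q e') (q e) g.left
  tr_id : ∀ e, tr (𝟙 (famOver f e)) = 𝟙 (T e)
  tr_comp : ∀ {e e' e''} (g : famOver f e' ⟶ famOver f e) (h : famOver f e'' ⟶ famOver f e'),
    tr (h ≫ g) = tr h ≫ tr g

namespace CartFam

variable {ι : Type u} {Y : Scheme.{u}} {X : ι → Scheme.{u}} {f : ∀ i, X i ⟶ Y} (𝒟 : CartFam f)

instance (e) : IsAffineHom (𝒟.q e) := 𝒟.affine e

theorem loc_w {e e'} (g : famOver f e' ⟶ famOver f e) :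
    g.left.appTop ≫ (𝒟.q e').appTop = (𝒟.q e).appTop ≫ (𝒟.tr g).appTop := by
  rw [← Scheme.Hom.comp_appTop, ← Scheme.Hom.comp_appTop, (𝒟.isPullback g).w]

/-- The functions on the schemes of the family. -/
def loc : LocMod (famOver f) where
  obj e := Γ(𝒟.T e, ⊤)
  ab _ := inferInstance
  mod e := Module.compHom _ (𝒟.q e).appTop.hom
  res g := (𝒟.tr g).appTop.hom.toAddMonoidHom
  res_smul {e e'} g r m := by
    change (𝒟.tr g).appTop.hom ((𝒟.q e).appTop.hom r * m) =
      (𝒟.q e').appTop.hom (g.left.appTop.hom r) * (𝒟.tr g).appTop.hom m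
    rw [map_mul]
    exact congrArg (· * _) (RingHom.congr_fun (congrArg CommRingCat.Hom.hom (𝒟.loc_w g)) r).symm
  res_id {e} m := by
    change (𝒟.tr _).appTop.hom m = m
    rw [𝒟.tr_id]
    rfl
  res_comp g h m := by
    change (𝒟.tr _).appTop.hom m = _
    rw [𝒟.tr_comp, Scheme.Hom.comp_appTop]
    rfl

theorem loc_isBC {e e'} (g : famOver f e' ⟶ famOver f e) (h : IsAffine (famOver f e).left)
    (h' : IsAffine (famOver f e').left) : IsBC g.left.appTop.hom (𝒟.loc.res g) := by
  have := isAffine_of_isAffineHom (𝒟.q e)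
  have := isAffine_of_isAffineHom (𝒟.q e')
  exact (isBC_iff_isPushout (𝒟.loc_w g)).2 (isPushout_appTop_of_isPullback (𝒟.isPullback g).flip)

end CartFam

section

variable {ι : Type u} {Y : Scheme.{u}} {X : ι → Scheme.{u}} {f : ∀ i, X i ⟶ Y}

/-- Quasi-coherence is local, and every scheme over `Y` is covered by members of the family. -/
theorem isQCoh_of_famOver (hf : IsFppfCov f) {P : LocMod (famOver f)} {N : PreMod Y}
    (hN : (toLoc N).IsSheaf) (c : LocMod.Hom ((toLoc N).comap (famOver f)) P)
    (hc : ∀ e, Function.Bijective (c.app e))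
    (hP : ∀ {e e' : Σ i, Over (X i)} (k : famOver f e' ⟶ famOver f e),
      IsAffine (famOver f e).left → IsAffine (famOver f e').left →
        IsBC k.left.appTop.hom (P.res k)) :
    IsQCoh N := by
  have key (i : ι) {V W : Scheme.{u}} (hV : IsAffine V) (hW : IsAffine W) (p : W ⟶ X i)
      (t : V ⟶ W) (z : W ⟶ Y) (hz : p ≫ f i = z) (z' : V ⟶ Y) (hz' : (t ≫ p) ≫ f i = z')
      (w : t ≫ z = z') :
      IsBC (Over.homMk t w : Over.mk z' ⟶ Over.mk z).left.appTop.hom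
        ((toLoc N).res (e := Over.mk z) (e' := Over.mk z')
          (Over.homMk t w : Over.mk z' ⟶ Over.mk z)) := by
    subst hz hz'
    let k : Over.mk (t ≫ p) ⟶ Over.mk p := Over.homMk t rfl
    exact LocMod.isBC_of_hom (e := ⟨i, Over.mk p⟩) (e' := ⟨i, Over.mk (t ≫ p)⟩) c hc
      ((Over.map (f i)).map k) (hP _ hW hV)
  refine isQCoh_of_isBC hN fun V => ?_
  obtain ⟨κ, e, g, hg⟩ := dense_famOver hf V
  refine ⟨_, hg, ?_⟩
  rintro Z _ ⟨_, l, _, ⟨a⟩, rfl⟩ hZ T t hT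
  have h : (l.left ≫ (e a).2.hom) ≫ f (e a).1 = Z.hom := (Category.assoc _ _ _).trans (Over.w l)
  refine key (e a).1 hT hZ (l.left ≫ (e a).2.hom) t.left Z.hom h T.hom ?_ (Over.w t)
  exact (Category.assoc _ _ _).trans ((congrArg (t.left ≫ ·) h).trans (Over.w t))

/-- Any scheme over the scheme of an object of the family belongs to the family. -/
def famOver.sub (e : Σ i, Over (X i)) {Z : Over Y} (g : Z ⟶ famOver f e) : Σ i, Over (X i) :=
  ⟨e.1, Over.mk ((g.left : Z.left ⟶ e.2.left) ≫ e.2.hom)⟩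

/-- The canonical morphism from the member of the family given by `famOver.sub`. -/
def famOver.subMap (e : Σ i, Over (X i)) {Z : Over Y} (g : Z ⟶ famOver f e) :
    famOver f (famOver.sub e g) ⟶ famOver f e :=
  (Over.map (f e.1)).map (Over.homMk g.left : Over.mk ((g.left : Z.left ⟶ e.2.left) ≫ e.2.hom) ⟶ e.2)

/-- The member of the family given by `famOver.sub` has the prescribed underlying scheme. -/
def famOver.subIso (e : Σ i, Over (X i)) {Z : Over Y} (g : Z ⟶ famOver f e) :
    famOver f (famOver.sub e g) ≅ Z :=
  Over.isoMk (Iso.refl Z.left) (by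
    refine (Category.id_comp _).trans ?_
    exact (Over.w g).symm.trans (Category.assoc _ _ _).symm)

theorem famOver.subIso_hom_comp (e : Σ i, Over (X i)) {Z : Over Y} (g : Z ⟶ famOver f e) :
    (famOver.subIso e g).hom ≫ g = famOver.subMap e g :=
  Over.OverMorphism.ext (Category.id_comp _)

end

namespace CartFam

variable {ι : Type u} {Y : Scheme.{u}} {X : ι → Scheme.{u}} {f : ∀ i, X i ⟶ Y} (𝒟 : CartFam f)

/-- The affine schemes over a covering form a covering. -/
theorem isFppfCov_tr {κ : Type u} {e : Σ i, Over (X i)} {d : κ → Σ i, Over (X i)}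
    {g : ∀ k, famOver f (d k) ⟶ famOver f e} (hg : IsFppfCover g) :
    IsFppfCov fun k => 𝒟.tr (g k) :=
  IsFppfCov.of_isPullback (f := fun k => (g k).left) (.mk' hg.flat hg.lfp hg.surj)
    fun k => 𝒟.isPullback (g k)

/-- The functions on the schemes of the family form a sheaf, since the schemes over a covering form
a covering, along which functions can be glued. -/
theorem loc_isSheaf : 𝒟.loc.IsSheaf := by
  intro e R hR x hx
  -- any covering sieve of an object of the family is refined by a covering by such objects
  have ref {e : Σ i, Over (X i)} {R : Sieve (famOver f e)} (hR : R ∈ fppf Y (famOver f e)) :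
      ∃ (κ : Type u) (d : κ → Σ i, Over (X i)) (g : ∀ k, famOver f (d k) ⟶ famOver f e),
        IsFppfCover g ∧ ∀ k, R (g k) := by
    obtain ⟨κ, Z, g, -, hg, hR⟩ := exists_affine_cover hR
    refine ⟨κ, fun k => famOver.sub e (g k), fun k => famOver.subMap e (g k),
      ⟨hg.flat, hg.lfp, hg.surj⟩, fun k => ?_⟩
    have := R.downward_closed (hR k) (famOver.subIso e (g k)).hom
    rwa [famOver.subIso_hom_comp] at this
  have hx' {d d' d'' : Σ i, Over (X i)} {s : famOver f d ⟶ famOver f e} (hs : R s)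
      {s' : famOver f d' ⟶ famOver f e} (hs' : R s') (a : famOver f d'' ⟶ famOver f d)
      (b : famOver f d'' ⟶ famOver f d') (w : a ≫ s = b ≫ s') :
      (𝒟.tr a).appTop.hom (x d s hs) = (𝒟.tr b).appTop.hom (x d' s' hs') := by
    refine (hx d d'' s hs a).trans (Eq.trans ?_ (hx d' d'' s' hs' b).symm)
    congr 1
  obtain ⟨κ, d, g, hg, hRg⟩ := ref hR
  have hc := 𝒟.isFppfCov_tr hg
  obtain ⟨m, hm, hu⟩ := hc.existsUnique_section (fun k => x (d k) (g k) (hRg k)) (by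
    intro k l W p p' w
    -- `W` maps to the scheme over the fibre product of the bases of `d k` and `d l`
    let c := famOver.sub (d k) (fp1 (g k) (g l))
    let a : famOver f c ⟶ famOver f (d k) := famOver.subMap (d k) (fp1 (g k) (g l))
    let b : famOver f c ⟶ famOver f (d l) := (famOver.subIso _ _).hom ≫ fp2 (g k) (g l)
    have hab : a ≫ g k = b ≫ g l := by
      rw [Category.assoc, ← fp_w, ← Category.assoc, famOver.subIso_hom_comp]
    have hb : b.left = pullback.snd (g k).left (g l).left := Category.id_comp _
    have w' : (p ≫ 𝒟.q (d k)) ≫ (g k).left = (p' ≫ 𝒟.q (d l)) ≫ (g l).left := by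
      rw [Category.assoc, Category.assoc, ← (𝒟.isPullback (g k)).w, ← (𝒟.isPullback (g l)).w,
        reassoc_of% w]
    let r : W ⟶ 𝒟.T c := (𝒟.isPullback a).lift p (pullback.lift _ _ w')
      (pullback.lift_fst _ _ w').symm
    have h1 : r ≫ 𝒟.tr a = p := (𝒟.isPullback a).lift_fst _ _ _
    have h2 : r ≫ 𝒟.q c = pullback.lift _ _ w' := (𝒟.isPullback a).lift_snd _ _ _
    have h3 : r ≫ 𝒟.tr b = p' := by
      apply (𝒟.isPullback (g l)).hom_ext
      · rw [Category.assoc, ← 𝒟.tr_comp, ← hab, 𝒟.tr_comp, reassoc_of% h1, w]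
      · rw [Category.assoc, (𝒟.isPullback b).w, reassoc_of% h2, hb]
        exact pullback.lift_snd _ _ w'
    rw [← h1, ← h3, Scheme.Hom.comp_appTop, Scheme.Hom.comp_appTop]
    exact congrArg r.appTop.hom (hx' (hRg k) (hRg l) a b hab))
  refine ⟨m, fun e' s hs => ?_, fun m' hm' => hu m' fun k => hm' _ _ (hRg k)⟩
  have hS : (Sieve.ofArrows _ g).pullback s ∈ fppf Y (famOver f e') :=
    (fppf Y).pullback_stable s hg.ofArrows_mem
  obtain ⟨κ', d', g', hg', hR'⟩ := ref hS
  refine ((𝒟.isFppfCov_tr hg').existsUnique_section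
    (fun k => (𝒟.tr (g' k)).appTop.hom (x e' s hs)) fun i j W p q w => ?_).unique
      (fun k => ?_) fun k => rfl
  · have := congrArg (fun t => t.appTop.hom (x e' s hs)) w
    simp only [Scheme.Hom.comp_appTop] at this
    exact this
  · obtain ⟨_, l, _, ⟨k'⟩, hl⟩ := hR' k
    refine Eq.trans ?_ (hx' (hRg k') hs l (g' k) hl)
    change (𝒟.tr (g' k)).appTop.hom ((𝒟.tr s).appTop.hom m) = _
    rw [← hm k']
    have h4 : 𝒟.tr (g' k) ≫ 𝒟.tr s = 𝒟.tr l ≫ 𝒟.tr (g k') := by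
      rw [← 𝒟.tr_comp, ← 𝒟.tr_comp, hl]
    have := congrArg (fun t => t.appTop.hom m) h4
    simp only [Scheme.Hom.comp_appTop] at this
    exact this

end CartFam

namespace CartFam

variable {ι : Type u} {Y : Scheme.{u}} {X : ι → Scheme.{u}} {f : ∀ i, X i ⟶ Y} (𝒟 : CartFam f)

/-- The ring of compatible families of functions on the schemes of the family over `W`. -/
def famRing (W : Over Y) : Subring (∀ (e) (_ : famOver f e ⟶ W), Γ(𝒟.T e, ⊤)) where
  carrier := {x | ∀ (e e') (g : famOver f e ⟶ W) (k : famOver f e' ⟶ famOver f e),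
    (𝒟.tr k).appTop.hom (x e g) = x e' (k ≫ g)}
  mul_mem' hx hy e e' g k := (map_mul _ _ _).trans (by rw [hx, hy]; rfl)
  one_mem' _ _ _ _ := map_one _
  add_mem' hx hy e e' g k := (map_add _ _ _).trans (by rw [hx, hy]; rfl)
  zero_mem' _ _ _ _ := map_zero _
  neg_mem' hx e e' g k := (map_neg _ _).trans (by rw [hx]; rfl)

variable [hs : ∀ W, Small.{u} (𝒟.loc.Fam W)]

instance (W : Over Y) : Small.{u} (𝒟.famRing W) := hs W

/-- The sections over `W` of the algebra obtained by descent. -/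
def alg (W : Over Y) : CommRingCat.{u} := .of (Shrink.{u} (𝒟.famRing W))

/-- Restriction of sections of the algebra to the members of the family. -/
def ev {W : Over Y} {e} (g : famOver f e ⟶ W) : 𝒟.alg W ⟶ Γ(𝒟.T e, ⊤) :=
  CommRingCat.ofHom (((Pi.evalRingHom _ g).comp (Pi.evalRingHom _ e)).comp
    ((𝒟.famRing W).subtype.comp (Shrink.ringEquiv (𝒟.famRing W)).toRingHom))

theorem ev_tr {W : Over Y} {e e'} (g : famOver f e ⟶ W) (k : famOver f e' ⟶ famOver f e) :
    𝒟.ev g ≫ (𝒟.tr k).appTop = 𝒟.ev (k ≫ g) :=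
  CommRingCat.hom_ext (RingHom.ext fun x => (Shrink.ringEquiv (𝒟.famRing W) x).2 e e' g k)

theorem alg_ext {W : Over Y} {x y : 𝒟.alg W}
    (h : ∀ e (g : famOver f e ⟶ W), (𝒟.ev g).hom x = (𝒟.ev g).hom y) : x = y :=
  (Shrink.ringEquiv (𝒟.famRing W)).injective
    (Subtype.ext (funext fun e => funext fun g => h e g))

theorem alg_hom_ext {W : Over Y} {R : CommRingCat.{u}} {φ ψ : R ⟶ 𝒟.alg W}
    (h : ∀ e (g : famOver f e ⟶ W), φ ≫ 𝒟.ev g = ψ ≫ 𝒟.ev g) : φ = ψ :=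
  CommRingCat.hom_ext (RingHom.ext fun x => 𝒟.alg_ext fun e g =>
    RingHom.congr_fun (congrArg CommRingCat.Hom.hom (h e g)) x)

theorem exists_alg_lift {W : Over Y} {R : CommRingCat.{u}}
    (φ : ∀ (e) (_ : famOver f e ⟶ W), R ⟶ Γ(𝒟.T e, ⊤))
    (h : ∀ (e e') (g : famOver f e ⟶ W) (k : famOver f e' ⟶ famOver f e),
      φ e g ≫ (𝒟.tr k).appTop = φ e' (k ≫ g)) :
    ∃ ψ : R ⟶ 𝒟.alg W, ∀ e (g : famOver f e ⟶ W), ψ ≫ 𝒟.ev g = φ e g := by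
  let Φ : R →+* 𝒟.famRing W := RingHom.codRestrict
    (RingHom.pi fun e => RingHom.pi fun g => (φ e g).hom) _
    fun x e e' g k => RingHom.congr_fun (congrArg CommRingCat.Hom.hom (h e e' g k)) x
  refine ⟨CommRingCat.ofHom ((Shrink.ringEquiv (𝒟.famRing W)).symm.toRingHom.comp Φ),
    fun e g => CommRingCat.hom_ext (RingHom.ext fun x => ?_)⟩
  exact congrArg (fun z : 𝒟.famRing W => z.1 e g)
    ((Shrink.ringEquiv (𝒟.famRing W)).apply_symm_apply (Φ x))

theorem exists_algMap {V W : Over Y} (k : V ⟶ W) : ∃ ψ : 𝒟.alg W ⟶ 𝒟.alg V,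
    ∀ e (g : famOver f e ⟶ V), ψ ≫ 𝒟.ev g = 𝒟.ev (g ≫ k) :=
  𝒟.exists_alg_lift (fun _ g => 𝒟.ev (g ≫ k)) fun e e' g l => by
    rw [ev_tr, Category.assoc]

/-- The restriction maps of the algebra. -/
def algMap {V W : Over Y} (k : V ⟶ W) : 𝒟.alg W ⟶ 𝒟.alg V := (𝒟.exists_algMap k).choose

theorem algMap_ev {V W : Over Y} (k : V ⟶ W) {e} (g : famOver f e ⟶ V) :
    𝒟.algMap k ≫ 𝒟.ev g = 𝒟.ev (g ≫ k) := (𝒟.exists_algMap k).choose_spec e g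

theorem algMap_id (W : Over Y) : 𝒟.algMap (𝟙 W) = 𝟙 _ :=
  𝒟.alg_hom_ext fun e g => by rw [algMap_ev, Category.comp_id, Category.id_comp]

theorem algMap_comp {U V W : Over Y} (k : V ⟶ W) (l : U ⟶ V) :
    𝒟.algMap (l ≫ k) = 𝒟.algMap k ≫ 𝒟.algMap l :=
  𝒟.alg_hom_ext fun e g => by
    rw [algMap_ev, Category.assoc, algMap_ev, algMap_ev, Category.assoc]

theorem exists_algStr (W : Over Y) : ∃ ψ : Γ(W.left, ⊤) ⟶ 𝒟.alg W,
    ∀ e (g : famOver f e ⟶ W), ψ ≫ 𝒟.ev g = g.left.appTop ≫ (𝒟.q e).appTop :=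
  𝒟.exists_alg_lift (fun e g => g.left.appTop ≫ (𝒟.q e).appTop) fun e e' g k => by
    rw [Category.assoc, ← loc_w, Over.comp_left, Scheme.Hom.comp_appTop, Category.assoc]

/-- The structure map of the algebra. -/
def algStr (W : Over Y) : Γ(W.left, ⊤) ⟶ 𝒟.alg W := (𝒟.exists_algStr W).choose

theorem algStr_ev {W : Over Y} {e} (g : famOver f e ⟶ W) :
    𝒟.algStr W ≫ 𝒟.ev g = g.left.appTop ≫ (𝒟.q e).appTop := (𝒟.exists_algStr W).choose_spec e g

theorem algMap_w {V W : Over Y} (k : V ⟶ W) :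
    k.left.appTop ≫ 𝒟.algStr V = 𝒟.algStr W ≫ 𝒟.algMap k :=
  𝒟.alg_hom_ext fun e g => by
    rw [Category.assoc, algStr_ev, Category.assoc, algMap_ev, algStr_ev, Over.comp_left,
      Scheme.Hom.comp_appTop, Category.assoc]

/-- The algebra is the extension of the structure sheaves of the family to a sheaf of modules. -/
theorem exists_toExt (W : Over Y) :
    letI : Module Γ(W.left, ⊤) (𝒟.alg W) := Module.compHom _ (𝒟.algStr W).hom
    ∃ φ : 𝒟.alg W →ₗ[Γ(W.left, ⊤)] 𝒟.loc.ext.obj W, Function.Bijective φ ∧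
      ∀ (x : 𝒟.alg W) (e) (g : famOver f e ⟶ W), 𝒟.loc.extVal (φ x) g = (𝒟.ev g).hom x := by
  let : Module Γ(W.left, ⊤) (𝒟.alg W) := Module.compHom _ (𝒟.algStr W).hom
  let E := Shrink.linearEquiv Γ(W.left, ⊤) (𝒟.loc.Fam W)
  let R := Shrink.ringEquiv (𝒟.famRing W)
  let φ (x : 𝒟.alg W) : 𝒟.loc.ext.obj W := E.symm ⟨(R x).1, (R x).2⟩
  have hφ (x : 𝒟.alg W) (e) (g : famOver f e ⟶ W) : 𝒟.loc.extVal (φ x) g = (𝒟.ev g).hom x :=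
    congrArg (fun z : 𝒟.loc.Fam W => z.1 e g) (E.apply_symm_apply _)
  refine ⟨{ toFun := φ, map_add' := fun x y => ?_, map_smul' := fun r x => ?_ }, ⟨?_, ?_⟩, hφ⟩
  · refine LocMod.extVal_inj fun e g => ?_
    rw [hφ, map_add, ← hφ, ← hφ]
    exact (congrArg (fun z : 𝒟.loc.Fam W => z.1 e g) (map_add E _ _)).symm
  · refine LocMod.extVal_inj fun e g => ?_
    rw [hφ]
    refine (map_mul (𝒟.ev g).hom _ x).trans (Eq.trans ?_
      (congrArg (fun z : 𝒟.loc.Fam W => z.1 e g) (map_smul E r (φ x))).symm)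
    refine congrArg₂ (· * ·) ?_ (hφ x e g).symm
    exact RingHom.congr_fun (congrArg CommRingCat.Hom.hom (𝒟.algStr_ev g)) r
  · intro x y h
    refine 𝒟.alg_ext fun e g => ?_
    rw [← hφ, ← hφ]
    exact congrArg (fun z => 𝒟.loc.extVal z g) h
  · intro y
    exact ⟨R.symm ⟨(E y).1, (E y).2⟩, LocMod.extVal_inj fun e g => (hφ _ _ _).trans
      (congrArg (fun z : 𝒟.famRing W => z.1 e g) (R.apply_symm_apply _))⟩

/-- The algebra is quasi-coherent. -/
theorem isPushout_algMap (hf : IsFppfCov f) {V W : Over Y} (k : V ⟶ W) [IsAffine V.left]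
    [IsAffine W.left] :
    IsPushout k.left.appTop (𝒟.algStr W) (𝒟.algStr V) (𝒟.algMap k) := by
  have hN := LocMod.ext_isSheaf 𝒟.loc_isSheaf
  obtain ⟨c, hc⟩ := LocMod.exists_ext_restrict 𝒟.loc
  have hq : IsQCoh 𝒟.loc.ext.toPre := isQCoh_of_famOver hf hN c hc fun k h h' => 𝒟.loc_isBC k h h'
  refine (isBC_iff_isPushout (𝒟.algMap_w k)).1 ?_
  obtain ⟨φ, hφ, hφ'⟩ := 𝒟.exists_toExt W
  obtain ⟨ψ, hψ, hψ'⟩ := 𝒟.exists_toExt V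
  let : Module Γ(W.left, ⊤) (𝒟.alg W) := Module.compHom _ (𝒟.algStr W).hom
  let : Module Γ(V.left, ⊤) (𝒟.alg V) := Module.compHom _ (𝒟.algStr V).hom
  refine IsBC.of_conj (isBC_of_isQCoh hq k) φ hφ ψ hψ fun m => ?_
  refine LocMod.extVal_inj (W := V) fun e g => ?_
  refine (hψ' _ e g).trans (Eq.trans ?_ (LocMod.extVal_res (V := V) (W := W) k (φ m) g).symm)
  rw [hφ', ← algMap_ev]
  rfl

/-- Over the members of the family, the algebra is the given one. -/
theorem isIso_ev (e : Σ i, Over (X i)) : IsIso (𝒟.ev (𝟙 (famOver f e))) := by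
  rw [ConcreteCategory.isIso_iff_bijective]
  refine ⟨fun x y h => 𝒟.alg_ext fun e' g => ?_, fun y => ?_⟩
  · have key (x) : (𝒟.ev g).hom x = (𝒟.tr g).appTop.hom ((𝒟.ev (𝟙 (famOver f e))).hom x) := by
      have := RingHom.congr_fun (congrArg CommRingCat.Hom.hom (𝒟.ev_tr (𝟙 (famOver f e)) g)) x
      rw [Category.comp_id] at this
      exact this.symm
    rw [key, key]
    exact congrArg _ h
  · obtain ⟨ψ, hψ⟩ := 𝒟.exists_alg_lift (W := famOver f e) (fun _ g => (𝒟.tr g).appTop)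
      fun e' e'' g k => by rw [𝒟.tr_comp, Scheme.Hom.comp_appTop]
    refine ⟨ψ.hom y, (RingHom.congr_fun (congrArg CommRingCat.Hom.hom (hψ e (𝟙 _))) y).trans ?_⟩
    rw [𝒟.tr_id]
    rfl

/-- As the algebra is quasi-coherent, its base changes to affine members of the family are the given
algebras. -/
theorem isPushout_ev (hf : IsFppfCov f) {W : Over Y} {e} (g : famOver f e ⟶ W)
    [IsAffine (famOver f e).left] [IsAffine W.left] :
    IsPushout g.left.appTop (𝒟.algStr W) (𝒟.q e).appTop (𝒟.ev g) := by
  have := 𝒟.isIso_ev e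
  refine IsPushout.of_iso (𝒟.isPushout_algMap hf g) (Iso.refl _) (Iso.refl _) (Iso.refl _)
    (asIso (𝒟.ev (𝟙 (famOver f e)))) (by simp) (by simp) ?_ ?_
  · exact (𝒟.algStr_ev (𝟙 (famOver f e))).trans (by simp)
  · exact (𝒟.algMap_ev g (𝟙 (famOver f e))).trans (by simp)

end CartFam

/-- The spectra of rings over the rings of functions of affine schemes `V` and `W` form a cartesian
square if the rings form a cocartesian one. -/
theorem isPullback_of_isPushout_appTop {V W : Scheme.{u}} [IsAffine V] [IsAffine W] {k : V ⟶ W}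
    {A B : CommRingCat.{u}} {a : Γ(W, ⊤) ⟶ A} {b : Γ(V, ⊤) ⟶ B} {c : A ⟶ B}
    (h : IsPushout k.appTop a b c) :
    IsPullback (Spec.map c) (Spec.map b ≫ V.isoSpec.inv) (Spec.map a ≫ W.isoSpec.inv) k :=
  (isPullback_SpecMap_of_isPushout _ _ _ _ h).flip.paste_vert
    (IsPullback.of_vert_isIso ⟨Scheme.isoSpec_inv_naturality k⟩)

namespace CartFam

variable {ι : Type u} {Y : Scheme.{u}} {X : ι → Scheme.{u}} {f : ∀ i, X i ⟶ Y} (𝒟 : CartFam f)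
variable [hs : ∀ W, Small.{u} (𝒟.loc.Fam W)]

/-- The structure morphism of the spectrum of the algebra over an affine scheme. -/
def rel (W : Over Y) [IsAffine W.left] : Spec (𝒟.alg W) ⟶ W.left :=
  Spec.map (𝒟.algStr W) ≫ W.left.isoSpec.inv

theorem isPullback_rel (hf : IsFppfCov f) {V W : Over Y} (k : V ⟶ W) [IsAffine V.left]
    [IsAffine W.left] :
    IsPullback (Spec.map (𝒟.algMap k)) (𝒟.rel V) (𝒟.rel W) k.left :=
  isPullback_of_isPushout_appTop (𝒟.isPushout_algMap hf k)

/-- The morphisms from the schemes of the family to the spectrum of the algebra. -/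
def toRel {W : Over Y} {e} (g : famOver f e ⟶ W) : 𝒟.T e ⟶ Spec (𝒟.alg W) :=
  (𝒟.T e).toSpecΓ ≫ Spec.map (𝒟.ev g)

theorem tr_toRel {W : Over Y} {e e'} (g : famOver f e ⟶ W) (k : famOver f e' ⟶ famOver f e) :
    𝒟.tr k ≫ 𝒟.toRel g = 𝒟.toRel (k ≫ g) := by
  rw [toRel, toRel, ← ev_tr, Spec.map_comp, Scheme.toSpecΓ_naturality_assoc]

theorem toRel_algMap {V W : Over Y} {e} (g : famOver f e ⟶ V) (k : V ⟶ W) :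
    𝒟.toRel g ≫ Spec.map (𝒟.algMap k) = 𝒟.toRel (g ≫ k) := by
  rw [toRel, toRel, Category.assoc, ← Spec.map_comp, algMap_ev]

/-- The affine schemes of the family are the base changes of the spectrum of the algebra. -/
theorem isPullback_toRel (hf : IsFppfCov f) {W : Over Y} {e} (g : famOver f e ⟶ W)
    [IsAffine (famOver f e).left] [IsAffine W.left] :
    IsPullback (𝒟.toRel g) (𝒟.q e) (𝒟.rel W) g.left := by
  have := isAffine_of_isAffineHom (𝒟.q e)
  refine (isPullback_of_isPushout_appTop (𝒟.isPushout_ev hf g)).of_iso (𝒟.T e).isoSpec.symm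
    (Iso.refl _) (Iso.refl _) (Iso.refl _) ?_ ?_ (by simp [rel]) (by simp)
  · rw [Iso.symm_hom, Iso.refl_hom, Category.comp_id, toRel]
    exact (Iso.inv_hom_id_assoc (𝒟.T e).isoSpec _).symm
  · rw [Iso.symm_hom, Iso.refl_hom, Category.comp_id]
    exact Scheme.isoSpec_inv_naturality (𝒟.q e)

/-- The morphism `σ` to the spectrum of the algebra over `W` is given by a morphism `z : Z ⟶ T e`
and a morphism `u : Z ⟶ W` over `Y`. -/
def IsRelLift {Z : Scheme.{u}} {e} (z : Z ⟶ 𝒟.T e) {W : Over Y} (u : Z ⟶ W.left)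
    (σ : Z ⟶ Spec (𝒟.alg W)) : Prop :=
  ∃ (e' : _) (k : famOver f e' ⟶ famOver f e) (g : famOver f e' ⟶ W) (m : Z ⟶ 𝒟.T e'),
    m ≫ 𝒟.tr k = z ∧ m ≫ 𝒟.q e' ≫ g.left = u ∧ m ≫ 𝒟.toRel g = σ

variable {𝒟}

/-- The morphism `σ` is constructed over the member of the family with underlying scheme `Z`, where
the descent datum gives a section. -/
theorem IsRelLift.exists {Z : Scheme.{u}} {e} (z : Z ⟶ 𝒟.T e) {W : Over Y} (u : Z ⟶ W.left)
    (h : z ≫ 𝒟.q e ≫ (famOver f e).hom = u ≫ W.hom) : ∃ σ, 𝒟.IsRelLift z u σ := by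
  let Z' : Over Y := Over.mk (u ≫ W.hom)
  let g : Z' ⟶ famOver f e := Over.homMk (z ≫ 𝒟.q e) ((Category.assoc _ _ _).trans h)
  let k := famOver.subMap e g
  let m : Z ⟶ 𝒟.T (famOver.sub e g) := (𝒟.isPullback k).lift z (𝟙 _) (Category.id_comp _).symm
  have hm : m ≫ 𝒟.q _ = 𝟙 _ := (𝒟.isPullback k).lift_snd _ _ _
  refine ⟨_, _, k, (famOver.subIso e g).hom ≫ Over.homMk u, m,
    (𝒟.isPullback k).lift_fst _ _ _, ?_, rfl⟩
  rw [reassoc_of% hm]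
  exact (Category.id_comp _).trans (Category.id_comp _)

theorem IsRelLift.unique {Z : Scheme.{u}} {e} {z : Z ⟶ 𝒟.T e} {W : Over Y} {u : Z ⟶ W.left}
    {σ σ' : Z ⟶ Spec (𝒟.alg W)} (h : 𝒟.IsRelLift z u σ) (h' : 𝒟.IsRelLift z u σ') : σ = σ' := by
  obtain ⟨d, k, g, m, h1, h2, rfl⟩ := h
  obtain ⟨d', k', g', m', h1', h2', rfl⟩ := h'
  have hz : m ≫ 𝒟.q d ≫ k.left = m' ≫ 𝒟.q d' ≫ k'.left := by
    rw [← (𝒟.isPullback k).w, ← (𝒟.isPullback k').w, reassoc_of% h1, reassoc_of% h1']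
  let Z' : Over Y := Over.mk (m ≫ 𝒟.q d ≫ (famOver f d).hom)
  let a : Z' ⟶ famOver f d := Over.homMk (m ≫ 𝒟.q d) (Category.assoc _ _ _)
  let b : Z' ⟶ famOver f d' := Over.homMk (m' ≫ 𝒟.q d') (by
    change _ = m ≫ 𝒟.q d ≫ (famOver f d).hom
    rw [← Over.w k, reassoc_of% hz, Over.w, Category.assoc])
  let a' := famOver.subMap d a
  let b' := (famOver.subIso d a).hom ≫ b
  let n : Z ⟶ 𝒟.T (famOver.sub d a) := (𝒟.isPullback a').lift m (𝟙 _) (Category.id_comp _).symm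
  have hn : n ≫ 𝒟.tr a' = m := (𝒟.isPullback a').lift_fst _ _ _
  have hn' : n ≫ 𝒟.q _ = 𝟙 _ := (𝒟.isPullback a').lift_snd _ _ _
  have hb : b'.left = m' ≫ 𝒟.q d' := Category.id_comp _
  have hab : a' ≫ k = b' ≫ k' := Over.OverMorphism.ext <|
    (Category.assoc m (𝒟.q d) k.left).trans <| hz.trans <|
      (Category.assoc m' (𝒟.q d') k'.left).symm.trans (congrArg (· ≫ k'.left) hb).symm
  have hab' : a' ≫ g = b' ≫ g' := Over.OverMorphism.ext <|
    (Category.assoc m (𝒟.q d) g.left).trans <| (h2.trans h2'.symm).trans <|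
      (Category.assoc m' (𝒟.q d') g'.left).symm.trans (congrArg (· ≫ g'.left) hb).symm
  have hn2 : n ≫ 𝒟.tr b' = m' := by
    apply (𝒟.isPullback k').hom_ext
    · rw [Category.assoc, ← 𝒟.tr_comp, ← hab, 𝒟.tr_comp, reassoc_of% hn, h1, h1']
    · rw [Category.assoc, (𝒟.isPullback b').w, reassoc_of% hn', hb]
      exact Category.id_comp _
  rw [← hn, ← hn2, Category.assoc, Category.assoc, tr_toRel, tr_toRel, hab']

theorem IsRelLift.comp {Z : Scheme.{u}} {e} {z : Z ⟶ 𝒟.T e} {W : Over Y} {u : Z ⟶ W.left}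
    {σ : Z ⟶ Spec (𝒟.alg W)} (h : 𝒟.IsRelLift z u σ) {Z' : Scheme.{u}} (y : Z' ⟶ Z) :
    𝒟.IsRelLift (y ≫ z) (y ≫ u) (y ≫ σ) := by
  obtain ⟨d, k, g, m, rfl, rfl, rfl⟩ := h
  exact ⟨d, k, g, y ≫ m, Category.assoc _ _ _, Category.assoc _ _ _, Category.assoc _ _ _⟩

theorem IsRelLift.map {Z : Scheme.{u}} {e} {z : Z ⟶ 𝒟.T e} {V : Over Y} {u : Z ⟶ V.left}
    {σ : Z ⟶ Spec (𝒟.alg V)} (h : 𝒟.IsRelLift z u σ) {W : Over Y} (l : V ⟶ W) :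
    𝒟.IsRelLift z (u ≫ l.left) (σ ≫ Spec.map (𝒟.algMap l)) := by
  obtain ⟨d, k, g, m, rfl, rfl, rfl⟩ := h
  refine ⟨d, k, g ≫ l, m, rfl, ?_, ?_⟩
  · rw [Over.comp_left, Category.assoc, Category.assoc]
  · rw [Category.assoc, toRel_algMap]

theorem IsRelLift.tr {Z : Scheme.{u}} {e} {z : Z ⟶ 𝒟.T e} {W : Over Y} {u : Z ⟶ W.left}
    {σ : Z ⟶ Spec (𝒟.alg W)} (h : 𝒟.IsRelLift z u σ) {e'} (l : famOver f e ⟶ famOver f e') :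
    𝒟.IsRelLift (z ≫ 𝒟.tr l) u σ := by
  obtain ⟨d, k, g, m, rfl, rfl, rfl⟩ := h
  exact ⟨d, k ≫ l, g, m, by rw [𝒟.tr_comp, Category.assoc], rfl, rfl⟩

theorem IsRelLift.toRel {W : Over Y} {e} (g : famOver f e ⟶ W) :
    𝒟.IsRelLift (𝟙 _) (𝒟.q e ≫ g.left) (𝒟.toRel g) :=
  ⟨e, 𝟙 _, g, 𝟙 _, by rw [𝒟.tr_id, Category.comp_id], Category.id_comp _, Category.id_comp _⟩

end CartFam

namespace CartFam

variable {ι : Type u} {Y : Scheme.{u}} {X : ι → Scheme.{u}} {f : ∀ i, X i ⟶ Y} (𝒟 : CartFam f)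
variable [hs : ∀ W, Small.{u} (𝒟.loc.Fam W)]

/-- An affine open subscheme of `Y` as an object over `Y`. -/
def affineOver (U : Y.directedAffineCover.I₀) : Over Y := Over.mk (Y.directedAffineCover.f U)

instance (U : Y.directedAffineCover.I₀) : IsAffine (affineOver U).left := U.2

/-- The inclusion of affine open subschemes of `Y` as a morphism over `Y`. -/
def affineOverMap {U V : Y.directedAffineCover.I₀} (h : U ⟶ V) : affineOver U ⟶ affineOver V :=
  Over.homMk (Y.directedAffineCover.trans h) (Y.directedAffineCover.trans_map h)

/-- The spectra of the algebra over the affine open subschemes of `Y`. -/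
def gluingData (hf : IsFppfCov f) : Y.directedAffineCover.RelativeGluingData where
  functor :=
    { obj := fun U => Spec (𝒟.alg (affineOver U))
      map := fun h => Spec.map (𝒟.algMap (affineOverMap h))
      map_id := fun U => by
        have : affineOverMap (𝟙 U) = 𝟙 _ :=
          Over.OverMorphism.ext (Y.directedAffineCover.trans_id U)
        rw [this, algMap_id, Spec.map_id]
      map_comp := fun g h => by
        have : affineOverMap (g ≫ h) = affineOverMap g ≫ affineOverMap h :=
          Over.OverMorphism.ext (Y.directedAffineCover.trans_comp g h)
        rw [this, algMap_comp, Spec.map_comp] }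
  natTrans :=
    { app := fun U => 𝒟.rel (affineOver U)
      naturality := fun U V h => (𝒟.isPullback_rel hf (affineOverMap h)).w }
  equifibered _ _ h := 𝒟.isPullback_rel hf (affineOverMap h)

/-- The inclusion of the spectra of the algebra into the scheme obtained by gluing them. -/
def glι (hf : IsFppfCov f) (U : Y.directedAffineCover.I₀) :
    Spec (𝒟.alg (affineOver U)) ⟶ (𝒟.gluingData hf).glued :=
  colimit.ι (𝒟.gluingData hf).functor U

theorem glι_w (hf : IsFppfCov f) {U V : Y.directedAffineCover.I₀} (h : U ⟶ V) :
    Spec.map (𝒟.algMap (affineOverMap h)) ≫ 𝒟.glι hf V = 𝒟.glι hf U :=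
  colimit.w (𝒟.gluingData hf).functor h

theorem isPullback_glι (hf : IsFppfCov f) (U : Y.directedAffineCover.I₀) :
    IsPullback (𝒟.glι hf U) (𝒟.rel (affineOver U)) (𝒟.gluingData hf).toBase (affineOver U).hom :=
  ((𝒟.gluingData hf).isPullback_natTrans_ι_toBase U).flip

/-- Over an affine open subscheme of `Y`, the glued scheme is the spectrum of the algebra. -/
theorem isAffineHom_toBase (hf : IsFppfCov f) : IsAffineHom (𝒟.gluingData hf).toBase := by
  refine isAffineHom_of_forall_exists_isAffineOpen _ fun y => ?_
  obtain ⟨U, x, hx⟩ : ∃ U x, (affineOver U).hom x = y := ⟨_, Y.directedAffineCover.covers y⟩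
  refine ⟨(Y.directedAffineCover.f U).opensRange, ⟨x, hx⟩, ?_, ?_⟩
  · have : IsAffine (Y.directedAffineCover.X U) := U.2
    exact isAffineOpen_opensRange _
  · rw [(𝒟.gluingData hf).toBase_preimage_eq_opensRange_ι U]
    have : IsAffine ((𝒟.gluingData hf).functor.obj U) :=
      inferInstanceAs (IsAffine (Spec (𝒟.alg (affineOver U))))
    exact isAffineOpen_opensRange _

/-- The morphisms from the schemes of the family to the scheme obtained by gluing. -/
theorem exists_toGlued (hf : IsFppfCov f) (e : Σ i, Over (X i)) :
    ∃ c : 𝒟.T e ⟶ (𝒟.gluingData hf).glued, ∀ {Z : Scheme.{u}} (z : Z ⟶ 𝒟.T e) (U)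
      (u : Z ⟶ (affineOver U).left) (σ), 𝒟.IsRelLift z u σ → z ≫ c = σ ≫ 𝒟.glι hf U := by
  let D := Y.directedAffineCover
  let v := 𝒟.q e ≫ (famOver f e).hom
  have ex (U : D.I₀) := IsRelLift.exists (𝒟 := 𝒟) (pullback.fst v (affineOver U).hom)
    (pullback.snd v (affineOver U).hom) pullback.condition
  choose s hs using ex
  have comp {U V : D.I₀} (h : U ⟶ V) (t : pullback v (affineOver U).hom ⟶
      pullback v (affineOver V).hom) (h1 : t ≫ pullback.fst _ _ = pullback.fst _ _)
      (h2 : t ≫ pullback.snd _ _ = pullback.snd _ _ ≫ (affineOverMap h).left) :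
      t ≫ s V ≫ 𝒟.glι hf V = s U ≫ 𝒟.glι hf U := by
    have := (hs V).comp t
    rw [h1, h2] at this
    rw [← glι_w 𝒟 hf h, ← Category.assoc, this.unique ((hs U).map (affineOverMap h)),
      Category.assoc]
  refine ⟨Scheme.OpenCover.glueMorphismsOfLocallyDirected (D.pullback₁ v) (fun U => s U ≫ 𝒟.glι hf U)
    fun {U V} h => comp h _ ?_ ?_, fun {Z} z U u σ h => ?_⟩
  · exact (pullback.lift_fst _ _ _).trans (Category.comp_id _)
  · exact pullback.lift_snd _ _ _
  · have hw : z ≫ v = u ≫ (affineOver U).hom := by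
      obtain ⟨d, k, g, m, rfl, rfl, rfl⟩ := h
      rw [Category.assoc, Category.assoc, Category.assoc, Over.w, (𝒟.isPullback k).w_assoc,
        Over.w]
    have hz : pullback.lift z u hw ≫ (D.pullback₁ v).f U = z := pullback.lift_fst _ _ _
    have hl := (hs U).comp (pullback.lift z u hw)
    rw [pullback.lift_fst, pullback.lift_snd] at hl
    rw [h.unique hl]
    refine (congrArg (· ≫ _) hz).symm.trans ((Category.assoc _ _ _).trans
      (Eq.trans ?_ (Category.assoc _ _ _).symm))
    exact congrArg (pullback.lift z u hw ≫ ·) (Scheme.OpenCover.map_glueMorphismsOfLocallyDirected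
      (D.pullback₁ v) (fun U => s U ≫ 𝒟.glι hf U) _ U)

theorem isFppfCover_affineOver :
    IsFppfCover fun U : Y.directedAffineCover.I₀ => (Over.homMk (affineOver U).hom :
      affineOver U ⟶ Over.mk (𝟙 Y)) where
  flat U := inferInstanceAs (Flat (Y.directedAffineCover.f U))
  lfp U := inferInstanceAs (LocallyOfFinitePresentation (Y.directedAffineCover.f U))
  surj y := ⟨_, Y.directedAffineCover.covers y⟩

end CartFam

/-- Affine schemes satisfy descent along fppf coverings: the quasi-coherent algebras of a descent
datum descend, and the spectra of the resulting algebra over the affine open subschemes of the base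
glue. -/
theorem CartFam.exists_descent {ι : Type u} {Y : Scheme.{u}} {X : ι → Scheme.{u}}
    {f : ∀ i, X i ⟶ Y} (hf : IsFppfCov f) (𝒟 : CartFam f) :
    ∃ (T₀ : Scheme.{u}) (q₀ : T₀ ⟶ Y) (c : ∀ e, 𝒟.T e ⟶ T₀), IsAffineHom q₀ ∧
      (∀ e, IsPullback (c e) (𝒟.q e) q₀ (famOver f e).hom) ∧
      ∀ {e e'} (k : famOver f e' ⟶ famOver f e), 𝒟.tr k ≫ c e = c e' := by
  have hs := LocMod.small_fam 𝒟.loc_isSheaf (dense_famOver hf)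
  choose c hc using 𝒟.exists_toGlued hf
  -- the affine open subschemes of `Y` give a covering of every object over `Y`
  have hS (W : Over Y) : ∃ (κ : Type u) (Z : κ → Over Y) (g : ∀ k, Z k ⟶ W),
      (∀ k, IsAffine (Z k).left) ∧ IsFppfCover g ∧ ∀ k, ∃ U, Nonempty (Z k ⟶ affineOver U) := by
    obtain ⟨κ, Z, g, h1, h2, h3⟩ := exists_affine_cover ((fppf Y).pullback_stable
      (Over.mkIdTerminal.from W) isFppfCover_affineOver.ofArrows_mem)
    refine ⟨κ, Z, g, h1, h2, fun k => ?_⟩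
    obtain ⟨_, l, _, ⟨U⟩, -⟩ := h3 k
    exact ⟨U, ⟨l⟩⟩
  have htr {e e'} (k : famOver f e' ⟶ famOver f e) : 𝒟.tr k ≫ c e = c e' := by
    obtain ⟨κ, Z, g, -, hg, hU⟩ := hS (famOver f e')
    refine (𝒟.isFppfCov_tr (d := fun k => famOver.sub e' (g k))
      (g := fun k => famOver.subMap e' (g k)) ⟨hg.flat, hg.lfp, hg.surj⟩).hom_ext fun j => ?_
    obtain ⟨U, ⟨l⟩⟩ := hU j
    obtain ⟨σ, hσ⟩ := IsRelLift.exists (𝒟 := 𝒟) (W := affineOver U)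
      (𝒟.tr (famOver.subMap e' (g j))) (𝒟.q _ ≫ l.left) (by
        have hl : l.left ≫ (affineOver U).hom = (famOver f (famOver.sub e' (g j))).hom :=
          (Over.w l).trans ((Category.id_comp _).symm.trans
            (Over.w (famOver.subIso e' (g j)).hom))
        rw [(𝒟.isPullback _).w_assoc, Over.w, ← hl]
        exact (Category.assoc _ _ _).symm)
    rw [hc _ _ _ _ _ hσ, ← Category.assoc, hc _ _ _ _ _ (hσ.tr k)]
  have key {e} {U} (g : famOver f e ⟶ affineOver U) (h : IsAffine (famOver f e).left) :
      IsPullback (c e) (𝒟.q e) (𝒟.gluingData hf).toBase (famOver f e).hom := by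
    have := (𝒟.isPullback_toRel hf g).paste_horiz (𝒟.isPullback_glι hf U)
    rwa [Over.w, ← hc _ _ _ _ _ (IsRelLift.toRel g), Category.id_comp] at this
  refine ⟨_, _, c, 𝒟.isAffineHom_toBase hf, fun e => ?_, htr⟩
  obtain ⟨κ, Z, g, hZ, hg, hU⟩ := hS (famOver f e)
  have hg' : IsFppfCov fun k => (famOver.subMap e (g k)).left := .mk' hg.flat hg.lfp hg.surj
  have h2 (k : κ) : IsPullback (𝒟.tr (famOver.subMap e (g k)) ≫ c e) (𝒟.q _)
      (𝒟.gluingData hf).toBase ((famOver.subMap e (g k)).left ≫ (famOver f e).hom) := by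
    obtain ⟨U, ⟨l⟩⟩ := hU k
    rw [htr, Over.w]
    exact key ((famOver.subIso e (g k)).hom ≫ l) (hZ k)
  refine hg'.isPullback ?_ (fun k => 𝒟.isPullback (famOver.subMap e (g k))) h2
  refine (𝒟.isFppfCov_tr (d := fun k => famOver.sub e (g k))
      (g := fun k => famOver.subMap e (g k)) ⟨hg.flat, hg.lfp, hg.surj⟩).hom_ext fun k => ?_
  refine (Category.assoc _ _ _).symm.trans ((h2 k).w.trans ?_)
  exact ((𝒟.isPullback (famOver.subMap e (g k))).w_assoc _).symm

/-! ### Finite locally free morphisms -/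

section

variable {ι : Type u} {Y : Scheme.{u}} {X : ι → Scheme.{u}} {f : ∀ i, X i ⟶ Y}

/-- Properties which descend along faithfully flat quasi-compact morphisms and are local on the
target can be checked on an fppf covering of the target. -/
theorem IsFppfCov.descends (P : MorphismProperty Scheme.{u})
    [P.DescendsAlong (@Surjective ⊓ @Flat ⊓ @QuasiCompact)] [IsZariskiLocalAtTarget P]
    [P.IsStableUnderBaseChange] (hf : IsFppfCov f) {T : Scheme.{u}} {q : T ⟶ Y}
    {T' : ι → Scheme.{u}} {q' : ∀ i, T' i ⟶ X i} {g : ∀ i, T' i ⟶ T}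
    (h : ∀ i, IsPullback (g i) (q' i) q (f i)) (hP : ∀ i, P (q' i)) : P q := by
  let F : ∐ X ⟶ Y := Sigma.desc f
  have hF (i) : Sigma.ι X i ≫ F = f i := Sigma.ι_desc _ _
  have h1 : Surjective F := ⟨fun y => by
    obtain ⟨i, x, hx⟩ := hf.surj y
    exact ⟨Sigma.ι X i x, (Scheme.Hom.comp_apply _ _ _).symm.trans
      ((congrArg (fun t : X i ⟶ Y => t x) (hF i)).trans hx)⟩⟩
  have hfl (i : ι) : Flat (f i) := hf.flat i
  have h2 : Flat F := inferInstanceAs (Flat (Limits.Sigma.desc f))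
  have : IsZariskiLocalAtSource @LocallyOfFinitePresentation.{u} :=
    HasRingHomProperty.instIsZariskiLocalAtSource (Q := RingHom.FinitePresentation)
  have h3 : LocallyOfFinitePresentation F :=
    IsZariskiLocalAtSource.sigmaDesc (P := @LocallyOfFinitePresentation) hf.lfp
  refine MorphismProperty.of_isPullback_of_descendsAlong
    (Q := @Surjective ⊓ @Flat ⊓ @LocallyOfFinitePresentation)
    (IsPullback.of_hasPullback F q) ⟨⟨h1, h2⟩, h3⟩ ?_
  refine (IsZariskiLocalAtTarget.iff_of_openCover (P := P) (sigmaOpenCover X)).2 fun i => ?_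
  change ι at i
  let s : pullback (pullback.fst F q) (Sigma.ι X i) ⟶ X i := pullback.snd _ _
  have h4 : IsPullback (pullback.fst (pullback.fst F q) (Sigma.ι X i) ≫ pullback.snd F q) s q
      (f i) := by
    rw [← hF]
    exact (IsPullback.of_hasPullback _ _).paste_horiz (IsPullback.of_hasPullback F q).flip
  have h5 : IsPullback ((h i).lift _ _ h4.w) s (q' i) (𝟙 (X i)) := by
    refine IsPullback.of_right ?_ ((h i).lift_snd _ _ _ |>.trans (Category.comp_id _).symm) (h i)
    rw [(h i).lift_fst, Category.id_comp]
    exact h4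
  exact P.of_isPullback h5 (hP i)

/-- Flatness descends along faithfully flat morphisms. -/
theorem descendsAlong_flat :
    MorphismProperty.DescendsAlong @Flat.{u} (@Surjective ⊓ @Flat ⊓ @QuasiCompact) := by
  refine HasRingHomProperty.descendsAlong_flat
    (RingHom.CodescendsAlong.mk _ RingHom.Flat.respectsIso ?_)
  intro R A B _ _ _ _ _ hA hB
  rw [RingHom.faithfullyFlat_algebraMap_iff] at hA
  rw [RingHom.flat_algebraMap_iff] at hB ⊢
  exact Module.Flat.of_flat_tensorProduct R B A

/-- Affine morphisms which are finite locally free of constant rank on an fppf covering are so. -/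
theorem IsFppfCov.finite_locally_free (hf : IsFppfCov f) {T : Scheme.{u}} {q : T ⟶ Y}
    (hq : IsAffineHom q) {T' : ι → Scheme.{u}} {q' : ∀ i, T' i ⟶ X i} {g : ∀ i, T' i ⟶ T}
    (h : ∀ i, IsPullback (g i) (q' i) q (f i)) {d : ℕ}
    (H : ∀ i, IsFinite (q' i) ∧ Flat (q' i) ∧ LocallyOfFinitePresentation (q' i) ∧
      ∀ t, (q' i).finrank t = d) :
    IsFinite q ∧ Flat q ∧ LocallyOfFinitePresentation q ∧ ∀ t, q.finrank t = d := by
  have := descendsAlong_flat.{u}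
  have : IsZariskiLocalAtTarget @Flat.{u} :=
    HasRingHomProperty.instIsZariskiLocalAtTarget (P := @Flat) (Q := RingHom.Flat)
  have : IsZariskiLocalAtTarget @LocallyOfFinitePresentation.{u} :=
    HasRingHomProperty.instIsZariskiLocalAtTarget (P := @LocallyOfFinitePresentation)
      (Q := RingHom.FinitePresentation)
  have h1 : UniversallyClosed q := hf.descends @UniversallyClosed h fun i =>
    have := (H i).1
    inferInstance
  have h2 : Flat q := hf.descends @Flat h fun i => (H i).2.1
  have h3 : LocallyOfFinitePresentation q :=
    hf.descends @LocallyOfFinitePresentation h fun i => (H i).2.2.1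
  -- a universally closed affine morphism is integral
  have h4 : IsIntegralHom q := IsIntegralHom.iff_universallyClosed_and_isAffineHom.2 ⟨h1, hq⟩
  have h5 : IsFinite q := (IsFinite.iff_isIntegralHom_and_locallyOfFiniteType ..).2
    ⟨h4, inferInstance⟩
  refine ⟨h5, h2, h3, fun t => ?_⟩
  obtain ⟨i, x, rfl⟩ := hf.surj t
  exact (Scheme.Hom.finrank_of_isPullback _ _ _ _ (h i) x).symm.trans ((H i).2.2.2 x)

end

section FlfStack

variable {S : Scheme.{u}} {d : ℕ}

theorem flf.exists_lift {h k k' : (flf S d).Cat} (m : k ⟶ h) (m' : k' ⟶ h)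
    (t : k'.val.base.left ⟶ k.val.base.left) (w : t ≫ m.val.f.left = m'.val.f.left) :
    ∃ n : k' ⟶ k, n ≫ m = m' ∧ n.val.f.left = t := by
  obtain ⟨n, h1, h2⟩ := AffMor.exists_lift m.val m'.val t w
  exact ⟨⟨n, trivial⟩, Subcat.Hom.ext h1, h2⟩

theorem flf.hom_ext {h k k' : (flf S d).Cat} {n n' : k' ⟶ k} (m : k ⟶ h) (e : n ≫ m = n' ≫ m)
    (e' : n.val.f.left = n'.val.f.left) : n = n' :=
  Subcat.Hom.ext (AffMor.hom_ext_left m.val (congrArg (·.val) e) e')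

/-- Fibre product squares of finite locally free morphisms are cartesian morphisms. -/
theorem flf.stronglyCartesian {k h : (flf S d).Cat} (a : k ⟶ h) :
    (flf S d).proj.IsStronglyCartesian ((flf S d).proj.map a) a := by
  refine (stronglyCartesian_iff _ a).2 fun k' g φ e => ?_
  obtain ⟨n, h1, h2⟩ := flf.exists_lift a φ g.left (congrArg (·.left) e).symm
  refine ⟨n, ⟨Over.OverMorphism.ext h2, h1⟩, fun n' hn => ?_⟩
  exact flf.hom_ext a (hn.2.trans h1.symm) ((congrArg (·.left) hn.1).trans h2.symm)

/-- The base change of a finite locally free morphism. -/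
def flf.pb (h : (flf S d).Cat) {B : Over S} (t : B ⟶ h.val.base) : (flf S d).Cat where
  val :=
    { base := B
      total := pullback h.val.hom t.left
      hom := pullback.snd _ _
      affine := MorphismProperty.of_isPullback (P := @IsAffineHom)
        (IsPullback.of_hasPullback _ _) h.val.affine }
  mem := by
    obtain ⟨h1, h2, h3, h4⟩ := h.mem
    have hp := IsPullback.of_hasPullback h.val.hom t.left
    exact ⟨MorphismProperty.of_isPullback (P := @IsFinite) hp h1,
      MorphismProperty.of_isPullback (P := @Flat) hp h2,
      MorphismProperty.of_isPullback (P := @LocallyOfFinitePresentation) hp h3,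
      fun x => (Scheme.Hom.finrank_pullback_snd _ _ x).trans (h4 _)⟩

/-- The fibre product square of the base change. -/
def flf.pbMap (h : (flf S d).Cat) {B : Over S} (t : B ⟶ h.val.base) : flf.pb h t ⟶ h :=
  ⟨⟨t, pullback.fst _ _, IsPullback.of_hasPullback _ _⟩, trivial⟩

theorem flf.isFibered : (flf S d).proj.IsFibered :=
  isFibered_of fun b _ f => ⟨flf.pb b f, flf.pbMap b f, rfl, (Category.id_comp _).symm,
    flf.stronglyCartesian _⟩

/-- Morphisms are glued on the sources, which form a covering again; whether the resulting square is
cartesian can be tested on the covering. -/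
theorem flf.glue_hom {ι : Type u} {y y' : (flf S d).Cat} {x : ι → (flf S d).Cat}
    (c : ∀ i, x i ⟶ y) (a : ∀ i, x i ⟶ y') (e : y.val.base = y'.val.base)
    (hf : IsFppfCover fun i => (c i).val.f)
    (ha : ∀ i, (a i).val.f = (c i).val.f ≫ eqToHom e)
    (compat : ∀ (i j : ι) (z : (flf S d).Cat) (s : z ⟶ x i) (t : z ⟶ x j), s ≫ c i = t ≫ c j →
      s ≫ a i = t ≫ a j) :
    ∃! b : y ⟶ y', b.val.f = eqToHom e ∧ ∀ i, c i ≫ b = a i := by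
  have hc : IsFppfCov fun i => (c i).val.g := Subcat.isFppfCov_total c hf
  obtain ⟨b, hb, hu⟩ := hc.existsUnique_desc (fun i => (a i).val.g) fun i j W p q w => by
    obtain ⟨ζ, m, v, hv, -, ht⟩ := Subcat.exists_test flf.isFibered y (p ≫ (c i).val.g)
    obtain ⟨s, h1, h2⟩ := ht (c i) (flf.stronglyCartesian _) m p hv.symm
    obtain ⟨t, h3, h4⟩ := ht (c j) (flf.stronglyCartesian _) m q (w.symm.trans hv.symm)
    have := congrArg (fun l : ζ ⟶ y' => l.val.g) (compat i j ζ s t (h1.trans h3.symm))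
    simp only [Subcat.comp_g] at this
    rw [← h2, ← h4, Category.assoc, Category.assoc, this]
  have hf' : IsFppfCov fun i => (c i).val.f.left := .mk' hf.flat hf.lfp hf.surj
  have ha' (i) : (a i).val.f.left = (c i).val.f.left ≫ (eqToHom e).left := congrArg (·.left) (ha i)
  have w : b ≫ y'.val.hom = y.val.hom ≫ (eqToHom e).left := by
    refine hc.hom_ext fun i => ?_
    rw [← Category.assoc, hb, AffMor.w, ha', ← Category.assoc, ← Category.assoc, AffMor.w]
  have hp : IsPullback b y.val.hom y'.val.hom (eqToHom e).left :=
    hf'.isPullback w (fun i => (c i).val.isPullback) fun i => by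
      rw [hb, ← ha']
      exact (a i).val.isPullback
  refine ⟨⟨⟨eqToHom e, b, hp⟩, trivial⟩, ⟨rfl, fun i => ?_⟩, fun b' hb' => ?_⟩
  · exact Subcat.Hom.ext (AffMor.Hom.ext (ha i).symm (hb i))
  · exact Subcat.Hom.ext (AffMor.Hom.ext hb'.1
      (hu _ fun i => congrArg (fun l : x i ⟶ y' => l.val.g) (hb'.2 i)))

/-- A descent datum of finite locally free morphisms for an fppf covering, on the fibre products
of the members of the covering. -/
structure FlfDescent {ι : Type u} (Y : Over S) (x : ι → (flf S d).Cat) (xx : ι → ι → (flf S d).Cat)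
    (f : ∀ i, (x i).val.base ⟶ Y) where
  /-- the first projections -/
  a : ∀ i j, xx i j ⟶ x i
  /-- the second projections -/
  b : ∀ i j, xx i j ⟶ x j
  isPullback : ∀ i j, IsPullback (a i j).val.f (b i j).val.f (f i) (f j)
  cocycle : ∀ (i j k : ι) (z : (flf S d).Cat) (r : z ⟶ xx i j) (s : z ⟶ xx j k) (t : z ⟶ xx i k),
    r ≫ b i j = s ≫ a j k → r ≫ a i j = t ≫ a i k →
    (s ≫ b j k).val.f = (t ≫ b i k).val.f → s ≫ b j k = t ≫ b i k

namespace FlfDescent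

variable {ι : Type u} {Y : Over S} {x : ι → (flf S d).Cat} {xx : ι → ι → (flf S d).Cat}
  {f : ∀ i, (x i).val.base ⟶ Y} (𝒟 : FlfDescent Y x xx f)

theorem isPullback_left (i j) : IsPullback (𝒟.a i j).val.f.left (𝒟.b i j).val.f.left
    (f i).left (f j).left := (𝒟.isPullback i j).map (Over.forget S)

theorem hom_ext {i j} {z : (flf S d).Cat} {r r' : z ⟶ xx i j} (h : r ≫ 𝒟.a i j = r' ≫ 𝒟.a i j)
    (h' : (r ≫ 𝒟.b i j).val.f.left = (r' ≫ 𝒟.b i j).val.f.left) : r = r' :=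
  flf.hom_ext (𝒟.a i j) h <| (𝒟.isPullback_left i j).hom_ext
    (congrArg (fun t : z ⟶ x i => t.val.f.left) h) h'

theorem exists_lift {i j} {z : (flf S d).Cat} (m : z ⟶ x i)
    (t : z.val.base.left ⟶ (x j).val.base.left) (w : m.val.f.left ≫ (f i).left = t ≫ (f j).left) :
    ∃ r : z ⟶ xx i j, r ≫ 𝒟.a i j = m ∧ (r ≫ 𝒟.b i j).val.f.left = t := by
  obtain ⟨r, h1, h2⟩ := flf.exists_lift (𝒟.a i j) m ((𝒟.isPullback_left i j).lift _ _ w)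
    ((𝒟.isPullback_left i j).lift_fst _ _ _)
  refine ⟨r, h1, ?_⟩
  have h3 := (𝒟.isPullback_left i j).lift_snd _ _ w
  rw [← h2] at h3
  exact h3

variable (x) in
/-- The base change of the members of the descent datum. -/
def obj (e : Σ i, Over (x i).val.base.left) : (flf S d).Cat :=
  flf.pb (x e.1) (B := Over.mk (e.2.hom ≫ (x e.1).val.base.hom)) (Over.homMk e.2.hom)

variable (x) in
/-- The projection from the base change. -/
def map (e : Σ i, Over (x i).val.base.left) : obj x e ⟶ x e.1 := flf.pbMap _ _

/-- A morphism between base changes which is compatible with the descent datum. -/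
def IsTrans {e e' : Σ i, Over (x i).val.base.left}
    (g : famOver (fun i => (f i).left) e' ⟶ famOver (fun i => (f i).left) e)
    (n : obj x e' ⟶ obj x e) : Prop :=
  n.val.f.left = g.left ∧ ∃ r : obj x e' ⟶ xx e'.1 e.1,
    r ≫ 𝒟.a _ _ = map x e' ∧ r ≫ 𝒟.b _ _ = n ≫ map x e

variable {𝒟} {e e' e'' : Σ i, Over (x i).val.base.left}

theorem IsTrans.unique {g : famOver (fun i => (f i).left) e' ⟶ famOver (fun i => (f i).left) e}
    {n n' : obj x e' ⟶ obj x e} (h : 𝒟.IsTrans g n) (h' : 𝒟.IsTrans g n') : n = n' := by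
  obtain ⟨h1, r, h2, h3⟩ := h
  obtain ⟨h1', r', h2', h3'⟩ := h'
  refine flf.hom_ext (map x e) ?_ (h1.trans h1'.symm)
  have h4 : (n ≫ map x e).val.f.left = (n' ≫ map x e).val.f.left :=
    congrArg (· ≫ (map x e).val.f.left) (h1.trans h1'.symm)
  rw [← h3, ← h3', 𝒟.hom_ext (h2.trans h2'.symm) (by rw [h3, h3', h4])]

/-- The cocycle condition of the descent datum makes the base changes functorial. -/
theorem IsTrans.comp {g : famOver (fun i => (f i).left) e' ⟶ famOver (fun i => (f i).left) e}
    {g' : famOver (fun i => (f i).left) e'' ⟶ famOver (fun i => (f i).left) e'}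
    {n : obj x e' ⟶ obj x e} {n' : obj x e'' ⟶ obj x e'} {n'' : obj x e'' ⟶ obj x e}
    (h : 𝒟.IsTrans g n) (h' : 𝒟.IsTrans g' n') (h'' : 𝒟.IsTrans (g' ≫ g) n'') : n'' = n' ≫ n := by
  obtain ⟨h1, r, h2, h3⟩ := h
  obtain ⟨h1', r', h2', h3'⟩ := h'
  obtain ⟨h1'', r'', h2'', h3''⟩ := h''
  have hb : n''.val.f.left = (n' ≫ n).val.f.left := by
    change _ = n'.val.f.left ≫ n.val.f.left
    rw [h1, h1', h1'']
    rfl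
  refine flf.hom_ext (map x e) ?_ hb
  have := 𝒟.cocycle _ _ _ _ r' (n' ≫ r) r'' (by rw [h3', Category.assoc, h2])
    (h2'.trans h2''.symm) (Over.OverMorphism.ext (by
      rw [Category.assoc, h3, h3'']
      exact (congrArg (· ≫ (map x e).val.f.left) hb).symm))
  rw [← h3'', ← this, Category.assoc, Category.assoc, h3]

variable (𝒟)

theorem exists_isTrans (g : famOver (fun i => (f i).left) e' ⟶ famOver (fun i => (f i).left) e) :
    ∃ n : obj x e' ⟶ obj x e, 𝒟.IsTrans g n := by
  obtain ⟨r, h1, h2⟩ := 𝒟.exists_lift (j := e.1) (map x e') (g.left ≫ e.2.hom)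
    ((Over.w g).symm.trans (Category.assoc _ _ _).symm)
  obtain ⟨n, h3, h4⟩ := flf.exists_lift (map x e) (r ≫ 𝒟.b _ _) g.left h2.symm
  exact ⟨n, h4, r, h1, h3.symm⟩

/-- The morphism between base changes given by the descent datum. -/
def tr (g : famOver (fun i => (f i).left) e' ⟶ famOver (fun i => (f i).left) e) :
    obj x e' ⟶ obj x e := (𝒟.exists_isTrans g).choose

theorem isTrans_tr (g : famOver (fun i => (f i).left) e' ⟶ famOver (fun i => (f i).left) e) :
    𝒟.IsTrans g (𝒟.tr g) := (𝒟.exists_isTrans g).choose_spec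

theorem tr_comp (g : famOver (fun i => (f i).left) e' ⟶ famOver (fun i => (f i).left) e)
    (g' : famOver (fun i => (f i).left) e'' ⟶ famOver (fun i => (f i).left) e') :
    𝒟.tr (g' ≫ g) = 𝒟.tr g' ≫ 𝒟.tr g :=
  (𝒟.isTrans_tr g).comp (𝒟.isTrans_tr g') (𝒟.isTrans_tr _)

/-- This holds as the left-hand side is idempotent and cartesian. -/
theorem tr_id : 𝒟.tr (𝟙 (famOver (fun i => (f i).left) e)) = 𝟙 _ := by
  refine flf.hom_ext (𝒟.tr (𝟙 _)) ?_ (𝒟.isTrans_tr _).1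
  rw [← tr_comp, Category.comp_id, Category.id_comp]

/-- For morphisms over the same member of the covering, the descent datum gives the canonical
morphisms between base changes. -/
theorem tr_map {i : ι} {W W' : Over (x i).val.base.left} (g : W' ⟶ W) :
    𝒟.tr (e := ⟨i, W⟩) (e' := ⟨i, W'⟩) ((Over.map (f i).left).map g) ≫ map x ⟨i, W⟩ =
      map x ⟨i, W'⟩ := by
  obtain ⟨n, h1, h2⟩ := flf.exists_lift (map x ⟨i, W⟩) (map x ⟨i, W'⟩) g.left (Over.w g)
  obtain ⟨-, r, h3, h4⟩ := 𝒟.isTrans_tr (𝟙 (famOver (fun i => (f i).left) ⟨i, W⟩))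
  rw [tr_id, Category.id_comp] at h4
  have : 𝒟.IsTrans (e := ⟨i, W⟩) (e' := ⟨i, W'⟩) ((Over.map (f i).left).map g) n :=
    ⟨h2, n ≫ r, by rw [Category.assoc, h3, h1], by rw [Category.assoc, h4]⟩
  rw [(𝒟.isTrans_tr _).unique this, h1]

/-- The descent datum on all schemes over the members of the covering. -/
def cartFam : CartFam fun i => (f i).left where
  T e := (obj x e).val.total
  q e := (obj x e).val.hom
  affine e := (obj x e).val.affine
  tr g := (𝒟.tr g).val.g
  isPullback g := (𝒟.isTrans_tr g).1 ▸ (𝒟.tr g).val.isPullback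
  tr_id e := congrArg (fun t : obj x e ⟶ obj x e => t.val.g) 𝒟.tr_id
  tr_comp {e _ e''} g h := congrArg (fun t : obj x e'' ⟶ obj x e => t.val.g) (𝒟.tr_comp g h)

/-- The affine morphism obtained from the associated cartesian family is finite locally free, as
this can be tested on the covering. -/
theorem exists_glue (hf : IsFppfCover f) : ∃ (y : (flf S d).Cat) (c : ∀ i, x i ⟶ y)
    (e : y.val.base = Y), (∀ i, (c i).val.f ≫ eqToHom e = f i) ∧
      ∀ i j, 𝒟.a i j ≫ c i = 𝒟.b i j ≫ c j := by
  have hf' : IsFppfCov fun i => (f i).left := .mk' hf.flat hf.lfp hf.surj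
  obtain ⟨T, q, c, hq, hc, htr⟩ := CartFam.exists_descent hf' 𝒟.cartFam
  let e (i : ι) : Σ i, Over (x i).val.base.left := ⟨i, Over.mk (𝟙 _)⟩
  have hu (i) := flf.exists_lift (map x (e i)) (𝟙 (x i)) (𝟙 _) (Category.id_comp _)
  choose v hv hv' using hu
  have hp (i) : IsPullback ((v i).val.g ≫ c (e i)) (x i).val.hom q (f i).left := by
    have h : (v i).val.f.left ≫ (famOver (fun i => (f i).left) (e i)).hom = (f i).left :=
      (congrArg (· ≫ _) (hv' i)).trans ((Category.id_comp _).trans (Category.id_comp _))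
    exact h ▸ (v i).val.isPullback.paste_horiz (hc (e i))
  let y : (flf S d).Cat := ⟨⟨Y, T, q, hq⟩, hf'.finite_locally_free hq hp fun i => (x i).mem⟩
  refine ⟨y, fun i => ⟨⟨f i, _, hp i⟩, trivial⟩, rfl, fun i => Category.comp_id _, fun i j => ?_⟩
  refine Subcat.Hom.ext (AffMor.Hom.ext (𝒟.isPullback i j).w ?_)
  -- compare over the fibre product, as a scheme over the `i`-th member of the covering
  let W : Σ i, Over (x i).val.base.left := ⟨i, Over.mk (𝒟.a i j).val.f.left⟩
  obtain ⟨w, hw, hw'⟩ := flf.exists_lift (map x W) (𝒟.a i j) (𝟙 _) (Category.id_comp _)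
  let g₁ : famOver (fun i => (f i).left) W ⟶ famOver (fun i => (f i).left) (e i) :=
    (Over.map (f i).left).map (Over.homMk (𝒟.a i j).val.f.left (Category.comp_id _))
  let g₂ : famOver (fun i => (f i).left) W ⟶ famOver (fun i => (f i).left) (e j) :=
    Over.homMk (𝒟.b i j).val.f.left
      ((congrArg _ (Category.id_comp _)).trans (𝒟.isPullback_left i j).w.symm)
  have h1 : w ≫ 𝒟.tr g₁ = 𝒟.a i j ≫ v i := by
    refine flf.hom_ext (map x (e i)) ?_ ?_
    · rw [Category.assoc, Category.assoc, 𝒟.tr_map, hv, hw, Category.comp_id]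
    · refine (congrArg₂ (· ≫ ·) hw' (𝒟.isTrans_tr g₁).1).trans ?_
      refine Eq.trans ?_ (congrArg (_ ≫ ·) (hv' i)).symm
      exact (Category.id_comp _).trans (Category.comp_id _).symm
  have h2 : w ≫ 𝒟.tr g₂ = 𝒟.b i j ≫ v j := by
    obtain ⟨h3, r, h4, h5⟩ := 𝒟.isTrans_tr g₂
    have hb : (w ≫ 𝒟.tr g₂).val.f.left = (𝒟.b i j ≫ v j).val.f.left := by
      refine (congrArg₂ (· ≫ ·) hw' h3).trans ?_
      refine Eq.trans ?_ (congrArg (_ ≫ ·) (hv' j)).symm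
      exact (Category.id_comp _).trans (Category.comp_id _).symm
    have hr : w ≫ r = 𝟙 _ := by
      refine 𝒟.hom_ext ?_ ?_
      · rw [Category.assoc, h4, hw, Category.id_comp]
      · rw [Category.assoc, h5, Category.id_comp, ← Category.assoc]
        refine (congrArg (· ≫ (map x (e j)).val.f.left) hb).trans ?_
        exact congrArg (fun t : xx i j ⟶ x j => t.val.f.left)
          ((Category.assoc _ _ _).trans ((congrArg (_ ≫ ·) (hv j)).trans (Category.comp_id _)))
    refine flf.hom_ext (map x (e j)) ?_ hb
    rw [Category.assoc, Category.assoc, ← h5, hv, reassoc_of% hr, Category.comp_id]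
  have h1' := congrArg (fun t : xx i j ⟶ obj x (e i) => t.val.g) h1
  have h2' := congrArg (fun t : xx i j ⟶ obj x (e j) => t.val.g) h2
  have h3 : (𝒟.tr g₁).val.g ≫ c (e i) = c W := htr g₁
  have h4 : (𝒟.tr g₂).val.g ≫ c (e j) = c W := htr g₂
  change (𝒟.a i j).val.g ≫ (v i).val.g ≫ c (e i) = (𝒟.b i j).val.g ≫ (v j).val.g ≫ c (e j)
  refine (Category.assoc _ _ _).symm.trans ((congrArg (· ≫ c (e i)) h1').symm.trans ?_)
  refine Eq.trans ?_ ((congrArg (· ≫ c (e j)) h2').trans (Category.assoc _ _ _))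
  refine (Category.assoc _ _ _).trans (Eq.trans ?_ (Category.assoc _ _ _).symm)
  exact congrArg (w.val.g ≫ ·) (h3.trans h4.symm)

end FlfDescent

/-- Finite locally free morphisms of constant rank form an fppf stack. -/
theorem isStack_flf : IsStack (flf S d).proj := by
  refine IsStack.of_map flf.isFibered (fun c a e hf _ ha compat => flf.glue_hom c a e hf ha compat)
    fun {ι Y x xx} f hf a b _ _ hab cocycle => ?_
  let 𝒟 : FlfDescent Y x xx f :=
    { a := a, b := b, isPullback := fun i j => isPullback_of_eqToHom (hab i j), cocycle := cocycle }
  obtain ⟨y, c, e, h1, h2⟩ := 𝒟.exists_glue hf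
  exact ⟨y, c, e, h1, fun i => flf.stronglyCartesian _, h2⟩

end FlfStack

end

end NormStack

theorem mainTheorem2 (S : AlgebraicGeometry.Scheme.{u}) :
    (∀ {T X : AlgebraicGeometry.Scheme.{u}} (h : T ⟶ X), AlgebraicGeometry.IsAffineHom h →
      ∀ (F : NormStack.LocalFunctors h) (B : NormStack.LocalBaseChange h F),
        ∃ G : NormStack.QCoh T ⥤ NormStack.QCoh X, NormStack.IsAssembledFrom h F B G) ∧
    NormStack.IsStack (NormStack.QCohTot.proj S) ∧
    (∀ I : NormStack.Subcat S, NormStack.IsStack I.proj →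
      NormStack.IsStack (NormStack.QCohI.proj I) ∧
      ∀ (F : I.Functors) (B : NormStack.BaseChange I F), NormStack.Assembles I F B) ∧
    (∀ d : ℕ, NormStack.IsStack (NormStack.flf S d).proj ∧
      ∃ B : NormStack.BaseChange (NormStack.flf S d) (NormStack.ferrandFunctors S d),
        NormStack.IsFerrandBaseChange S d B ∧
        NormStack.Assembles (NormStack.flf S d) (NormStack.ferrandFunctors S d) B) := by
  refine ⟨fun h hh F B => NormStack.exists_isAssembledFrom h hh F B, NormStack.QCohTot.isStack S,
    fun I hI => ⟨NormStack.QCohI.isStack hI, fun F B => NormStack.assembles hI.fibered F B⟩,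
    fun d => ?_⟩
  obtain ⟨B, hB⟩ := NormStack.exists_ferrand_data S d
  exact ⟨NormStack.isStack_flf, B, hB, NormStack.assembles NormStack.flf.isFibered _ B⟩
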